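/- Let $\mathbf k$ be a field of characteristic zero. All vector spaces are $\mathbb Z/2$-graded, "dg" means "with an odd differential of square zero", $|\cdot|$ denotes parity and $\Pi$ parity reversion; operads are symmetric, with operations of arities $n\ge 1$. A unital dg operad $\mathcal P$ is *admissible* if $\mathcal P(1)=\mathbf k\cdot\mathbf 1$ with $\mathbf 1\ne 0$ and every $\mathcal P(n)$ is finite-dimensional. For a dg vector space $V$, $\mathcal E(V)(n)=\operatorname{Hom}(V^{\otimes n},V)$ is its endomorphism operad; an $\mathcal O$-algebra structure on $V$ is a map of unital dg operads $\mathcal O\to\mathcal E(V)$. *Trees.* A reduced $n$-tree ($n\ge 2$) is a rooted tree with leaves labelled by $1,\dots,n$ in which every vertex has at least two incoming edges. $\mathcal P(T)=\bigotimes_v\mathcal P(\mathrm{In}(v))$ is the space of $\mathcal P$-decorations of $T$, and $\mu_T:\mathcal P(T)\to\mathcal P(n)$ is composition along the internal edges, with dual $\mu_T^*:\mathcal P(n)^*\to\mathcal P(T)^*$. *Cobar construction.* $\mathsf B\mathcal P$ is the free graded unital operad on the spaces $\Pi\mathcal P(n)^*$, $n\ge2$; write $\xi(x)$ for the generator given by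 $x\in\mathcal P(n)^*$. Its differential $d$ is the odd derivation given on generators by the differential of $\mathcal P^*$ and by the dual of the compositions $\mu_T$ along trees with two vertices: if $(e_b)$ are homogeneous bases of the spaces $\mathcal P(m)$, $(e_b^*)$ the dual bases and $\xi_b=\xi(e_b^*)$, then $$d\,\xi(x)=-(-1)^{|x|}\xi(x\circ d_{\mathcal P})+\sum_{S}\sum_{c,c'}(-1)^{|c|(1+|c'|)}\,x\big(\sigma_S(e_c\circ_1 e_{c'})\big)\,\sigma_S(\xi_c\circ_1\xi_{c'})$$ for homogeneous $x$, where $S$ runs over the subsets of $\{1,\dots,n\}$ with $2\le|S|\le n-1$, $c,c'$ run over the basis elements of arities $n-|S|+1$ and $|S|$, and $\sigma_S$ is any permutation taking $\{1,\dots,|S|\}$ onto $S$. *BV-resolution.* For a unital dg operad $\mathcal O$, $\mathsf{BV}\mathcal O$ is the unital operad freely generated over $\mathcal O$ by an odd operation $s$ and an even operation $t$ of arity $1$ subject to $s^2=0$, $t^2=t$, $st=ts=0$, with differential extending that of $\mathcal O$ and $ds=\mathbf 1-t$, $dt=0$. The suboperad $i:\mathsf{bv}\mathcal O\hookrightarrow\mathsf{BV}\mathcal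 O$ consists of the operations that do not change when $t$ is composed with the output or with an input; its unit is $t$. Let $p:\mathsf{bv}\mathcal O\to\mathcal O$ be the restriction of the map $\mathsf{BV}\mathcal O\to\mathcal O$ with $s\mapsto0$, $t\mapsto\mathbf 1$ that is the identity on $\mathcal O$. *Hodge decompositions.* A Hodge decomposition of $V$ is an odd operator $s$ and an even operator $t$ on $V$ with $s^2=0$, $t^2=t$, $dt=td$, $st=ts=0$, $ds+sd=\mathrm{id}-t$; it is canonical if $dt=0$. For an $\mathcal O$-algebra $V$ with a Hodge decomposition, let $Z_V:\mathsf{BV}\mathcal O\to\mathcal E(V)$ be the map of dg operads given by the action of $\mathcal O$ and the operators $s,t$. If the decomposition is canonical, then $H(V)=\ker d/\operatorname{im} d$, with zero differential, is identified with $\operatorname{im} t$ by $[z]\mapsto tz$, and $\varphi\mapsto\varphi\circ t^{\otimes n}$ defines an inclusion $\mathcal E(H(V))(n)\hookrightarrow\mathcal E(V)(n)$. *Minimal models.* Let $\kappa:\mathcal O\to\mathsf{bv}\mathcal O$ be a map of dg operads with $p\circ\kappa=\mathrm{id}$. The minimal model of an $\mathcal O$-algebra $V$ with a canonical Hodge decomposition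 is the $\mathcal O$-algebra structure $g$ on $H(V)$ whose composite with $\mathcal E(H(V))\hookrightarrow\mathcal E(V)$ is $Z_V\circ i\circ\kappa$. *The maps $\iota_T$.* For a reduced $n$-tree $T$, let $\iota_T:\mathcal P(T)^*\to\mathsf{BV}\mathsf B\mathcal P(n)$ be the linear map that takes the dual basis element of $\bigotimes_v e_{b(v)}$ to $(-1)^{q(q-1)/2}$ times the composition along $T$ in $\mathsf{BV}\mathsf B\mathcal P$ in which the vertex $v$ is decorated by $\xi_{b(v)}$, every internal edge is labelled by $s$, and all the leaves and the root are labelled by $t$; here $q$ is the number of vertices $v$ with $e_{b(v)}$ odd, and the vertices are read in both places in the same order, from the root to the leaves and from left to right in a planar representative of $T$, with the label $s$ of an internal edge standing immediately before the vertex above it. **Theorem.** Let $\mathcal P$ be an admissible dg operad. There is a map of dg operads $\kappa:\mathsf B\mathcal P\to\mathsf{bv}\mathsf B\mathcal P$ with $p\circ\kappa=\mathrm{id}$ such that for every $\mathsf B\mathcal P$-algebra $V$ and every canonical Hodge decomposition of $V$ there is a unique $\mathsf B\mathcal P$-algebra structure on $H(V)$ with the following two properties: it is the minimal model of $V$ (with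 respect to $\kappa$), and its structure maps $m_n:\Pi\mathcal P(n)^*\to\operatorname{Hom}(H(V)^{\otimes n},H(V))$, $n\ge2$, which are its values on the generators $\xi(x)$, are $$m_n=\sum_T Z_V\circ\iota_T\circ\mu_T^*,$$ where the sum is over the isomorphism classes of reduced $n$-trees $T$ and $\operatorname{Hom}(H(V)^{\otimes n},H(V))$ is regarded as a subspace of $\operatorname{Hom}(V^{\otimes n},V)$ by the above inclusion. -/

import Mathlib

universe u v w

noncomputable section

/-! ### Signs and parities -/

/-- The sign `(-1)^p` in `k`. -/
def sgn (k : Type u) [Field k] (p : ZMod 2) : k := if p = 0 then 1 else -1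

section
variable {k : Type u} [Field k]

theorem zmod2_cases (p : ZMod 2) : p = 0 ∨ p = 1 := by
  revert p; decide

@[simp] theorem sgn_zero : sgn k 0 = 1 := by simp [sgn]

@[simp] theorem sgn_one : sgn k 1 = -1 := by simp [sgn]

theorem sgn_add (p q : ZMod 2) : sgn k (p + q) = sgn k p * sgn k q := by
  have h : (1 : ZMod 2) + 1 = 0 := by decide
  rcases zmod2_cases p with rfl | rfl <;> rcases zmod2_cases q with rfl | rfl <;> simp [h]

theorem sgn_mul_self (p : ZMod 2) : sgn k p * sgn k p = 1 := by
  rcases zmod2_cases p with rfl | rfl <;> simp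

end

/-- A `ℤ/2`-graded vector space over a field of characteristic zero is encoded by its parity
involution `ε`; the part of parity `p` is `{x | ε x = (-1)^p x}`. -/
def HasParity {k : Type u} [Field k] {M : Type v} [AddCommGroup M] [Module k M]
    (ε : M →ₗ[k] M) (p : ZMod 2) (x : M) : Prop := ε x = sgn k p • x

/-- The homogeneous part of parity `p`. -/
def parityPart {k : Type u} [Field k] {M : Type v} [AddCommGroup M] [Module k M]
    (ε : M →ₗ[k] M) (p : ZMod 2) : Submodule k M where
  carrier := {x | HasParity ε p x}
  add_mem' := by intro a b ha hb; simp only [Set.mem_ofPred_eq, HasParity] at *; simp [ha, hb]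
  zero_mem' := by simp [HasParity]
  smul_mem' := by
    intro c x hx; simp only [Set.mem_ofPred_eq, HasParity] at *; rw [map_smul, hx, smul_comm]

/-- The projection of a graded space onto its part of parity `p`. -/
def parityProj {k : Type u} [Field k] {M : Type v} [AddCommGroup M] [Module k M]
    (ε : M →ₗ[k] M) (p : ZMod 2) : M →ₗ[k] M :=
  (2⁻¹ : k) • (LinearMap.id + sgn k p • ε)

section
variable {k : Type u} [Field k] [CharZero k] {M : Type v} [AddCommGroup M] [Module k M]
  (ε : M →ₗ[k] M)

theorem parityProj_hasParity (hε : ∀ x, ε (ε x) = x) (p : ZMod 2) (x : M) :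
    HasParity ε p (parityProj ε p x) := by
  have h : sgn k p • sgn k p • ε x = ε x := by rw [← mul_smul, sgn_mul_self, one_smul]
  simp only [HasParity, parityProj, LinearMap.smul_apply, LinearMap.add_apply, LinearMap.id_apply,
    map_smul, map_add, hε]
  rw [smul_comm (sgn k p) (2⁻¹ : k), smul_add (sgn k p), h, add_comm]

theorem parityProj_add (x : M) : parityProj ε 0 x + parityProj ε 1 x = x := by
  have h2 : (2⁻¹ : k) + 2⁻¹ = 1 := by norm_num
  simp only [parityProj, LinearMap.smul_apply, LinearMap.add_apply, LinearMap.id_apply, sgn_zero,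
    sgn_one, neg_smul, one_smul, LinearMap.neg_apply, smul_add, smul_neg]
  calc _ = ((2⁻¹ : k) + 2⁻¹) • x := by rw [add_smul]; abel
    _ = x := by rw [h2, one_smul]

theorem parityProj_of_hasParity {p : ZMod 2} {x : M} (hx : HasParity ε p x) (q : ZMod 2) :
    parityProj ε q x = if q = p then x else 0 := by
  have h2 : (2⁻¹ : k) * (1 + 1) = 1 := by norm_num
  have h3 : (1 : k) + -1 = 0 := by norm_num
  unfold HasParity at hx
  simp only [parityProj, LinearMap.smul_apply, LinearMap.add_apply, LinearMap.id_apply, hx]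
  have : (2⁻¹ : k) • (x + sgn k q • sgn k p • x) = (2⁻¹ * (1 + sgn k q * sgn k p)) • x := by
    rw [mul_smul, add_smul, one_smul, mul_smul]
  rw [this]
  rcases zmod2_cases p with rfl | rfl <;> rcases zmod2_cases q with rfl | rfl <;> simp [h2, h3]

/-- To prove an additive statement it suffices to treat homogeneous elements. -/
theorem parity_induction (hε : ∀ x, ε (ε x) = x) {Q : M → Prop}
    (hadd : ∀ x y, Q x → Q y → Q (x + y)) (h : ∀ p x, HasParity ε p x → Q x) (x : M) : Q x := by
  rw [← parityProj_add ε x]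
  exact hadd _ _ (h _ _ (parityProj_hasParity ε hε 0 x)) (h _ _ (parityProj_hasParity ε hε 1 x))

end

/-! ### Operads -/

section
variable {m n l : ℕ}

/-- In `x ∘_i y`, with `x` of arity `m + 1` and `y` of arity `n + 1`, the position of the input
`j ≠ i` of `x`. -/
def outerPos (h : m + n = l) (i j : Fin (m + 1)) : Fin (l + 1) :=
  ⟨if (j : ℕ) < i then j else j + n, by split <;> omega⟩

/-- In `x ∘_i y`, with `x` of arity `m + 1` and `y` of arity `n + 1`, the position of the input
`a` of `y`. -/
def innerPos (h : m + n = l) (i : Fin (m + 1)) (a : Fin (n + 1)) : Fin (l + 1) :=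
  ⟨i + a, by omega⟩

end

/-- A unital symmetric operad in `ℤ/2`-graded `k`-vector spaces, without operations of arity zero.
**`obj n` is the space of operations of arity `n + 1`**, so that the partial compositions `∘_i`
are maps `obj m ⊗ obj n → obj (m + n)`; inputs are numbered from `0`.  `par` is the parity
involution.  In `act σ x` the input `i` of `x` carries the label `σ i`. -/
structure GrOperad (k : Type u) [Field k] where
  obj : ℕ → Type w
  [grp : ∀ n, AddCommGroup (obj n)]
  [mod : ∀ n, Module k (obj n)]
  par : ∀ {n : ℕ}, obj n →ₗ[k] obj n
  act : ∀ {n : ℕ}, Equiv.Perm (Fin (n + 1)) → obj n →ₗ[k] obj n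
  comp : ∀ {m n l : ℕ}, m + n = l → Fin (m + 1) → obj m →ₗ[k] obj n →ₗ[k] obj l
  one : obj 0
  par_par : ∀ {n : ℕ} (x : obj n), par (par x) = x
  par_one : par one = one
  par_act : ∀ {n : ℕ} (σ : Equiv.Perm (Fin (n + 1))) (x : obj n), par (act σ x) = act σ (par x)
  par_comp : ∀ {m n l : ℕ} (h : m + n = l) (i : Fin (m + 1)) (x : obj m) (y : obj n),
    par (comp h i x y) = comp h i (par x) (par y)
  act_one : ∀ {n : ℕ} (x : obj n), act 1 x = x
  act_mul : ∀ {n : ℕ} (σ τ : Equiv.Perm (Fin (n + 1))) (x : obj n),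
    act (σ * τ) x = act σ (act τ x)
  one_comp : ∀ {n : ℕ} (x : obj n), comp (Nat.zero_add n) 0 one x = x
  comp_one : ∀ {n : ℕ} (i : Fin (n + 1)) (x : obj n), comp (Nat.add_zero n) i x one = x
  assoc : ∀ {m n r mn nr l : ℕ} (h₁ : m + n = mn) (h₂ : mn + r = l) (h₃ : n + r = nr)
    (h₄ : m + nr = l) (i : Fin (m + 1)) (j : Fin (n + 1)) (x : obj m) (y : obj n) (z : obj r),
    comp h₂ (innerPos h₁ i j) (comp h₁ i x y) z = comp h₄ i x (comp h₃ j y z)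
  parallel : ∀ {m n r mn mr l : ℕ} (h₁ : m + n = mn) (h₂ : mn + r = l) (h₃ : m + r = mr)
    (h₄ : mr + n = l) (i j : Fin (m + 1)) (_ : i ≠ j) (p q : ZMod 2)
    (x : obj m) (y : obj n) (z : obj r), HasParity par p y → HasParity par q z →
    comp h₂ (outerPos h₁ i j) (comp h₁ i x y) z
      = sgn k (p * q) • comp h₄ (outerPos h₃ j i) (comp h₃ j x z) y
  equivariant : ∀ {m n l : ℕ} (h : m + n = l) (i : Fin (m + 1)) (σ : Equiv.Perm (Fin (m + 1)))
    (τ : Equiv.Perm (Fin (n + 1))) (ρ : Equiv.Perm (Fin (l + 1))),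
    (∀ j, j ≠ i → ρ (outerPos h i j) = outerPos h (σ i) (σ j)) →
    (∀ a, ρ (innerPos h i a) = innerPos h (σ i) (τ a)) →
    ∀ (x : obj m) (y : obj n), comp h (σ i) (act σ x) (act τ y) = act ρ (comp h i x y)

attribute [instance] GrOperad.grp GrOperad.mod

/-- A graded operad with an odd derivation `d`. -/
structure DiffOperad (k : Type u) [Field k] extends GrOperad.{u, w} k where
  d : ∀ {n : ℕ}, obj n →ₗ[k] obj n
  par_d : ∀ {n : ℕ} (x : obj n), par (d x) = -d (par x)
  d_act : ∀ {n : ℕ} (σ : Equiv.Perm (Fin (n + 1))) (x : obj n), d (act σ x) = act σ (d x)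
  d_comp : ∀ {m n l : ℕ} (h : m + n = l) (i : Fin (m + 1)) (x : obj m) (y : obj n),
    d (comp h i x y) = comp h i (d x) y + comp h i (par x) (d y)

/-- A graded operad with an odd derivation `d` is a dg operad if `d ∘ d = 0`. -/
def DiffOperad.IsDG {k : Type u} [Field k] (O : DiffOperad.{u, w} k) : Prop :=
  ∀ {n : ℕ} (x : O.obj n), O.d (O.d x) = 0

/-- A dg operad is admissible if its operations of arity one are the multiples of the unit
(and the unit is nonzero), and all its components are finite-dimensional. -/
structure DiffOperad.Admissible {k : Type u} [Field k] (P : DiffOperad.{u, w} k) : Prop where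
  isDG : P.IsDG
  one_ne_zero : P.one ≠ 0
  span_one : ∀ x : P.obj 0, ∃ c : k, x = c • P.one
  finite : ∀ n, Module.Finite k (P.obj n)

/-- A map of (unital) dg operads. -/
structure OperadHom {k : Type u} [Field k] (A : DiffOperad.{u, v} k) (B : DiffOperad.{u, w} k) where
  app : ∀ {n : ℕ}, A.obj n →ₗ[k] B.obj n
  map_par : ∀ {n : ℕ} (x : A.obj n), app (A.par x) = B.par (app x)
  map_act : ∀ {n : ℕ} (σ : Equiv.Perm (Fin (n + 1))) (x : A.obj n),
    app (A.act σ x) = B.act σ (app x)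
  map_comp : ∀ {m n l : ℕ} (h : m + n = l) (i : Fin (m + 1)) (x : A.obj m) (y : A.obj n),
    app (A.comp h i x y) = B.comp h i (app x) (app y)
  map_one : app A.one = B.one
  map_d : ∀ {n : ℕ} (x : A.obj n), app (A.d x) = B.d (app x)
/-! ### Operads presented by generators and relations -/

/-- Formal operadic expressions in generators `G n` of arity `n + 1`. -/
inductive OpTerm (k : Type u) (G : ℕ → Type v) : ℕ → Type (max u v)
  | gen {n : ℕ} (g : G n) : OpTerm k G n
  | one : OpTerm k G 0
  | zero {n : ℕ} : OpTerm k G n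
  | add {n : ℕ} (a b : OpTerm k G n) : OpTerm k G n
  | smul {n : ℕ} (c : k) (a : OpTerm k G n) : OpTerm k G n
  | par {n : ℕ} (a : OpTerm k G n) : OpTerm k G n
  | act {n : ℕ} (σ : Equiv.Perm (Fin (n + 1))) (a : OpTerm k G n) : OpTerm k G n
  | comp {m n l : ℕ} (h : m + n = l) (i : Fin (m + 1)) (a : OpTerm k G m) (b : OpTerm k G n) :
      OpTerm k G l

/-- The smallest congruence on operadic expressions that contains the relations `R` and the laws
of a graded unital operad. -/
inductive OpRel (k : Type u) [Field k] {G : ℕ → Type v}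
    (R : ∀ n, OpTerm k G n → OpTerm k G n → Prop) : ∀ {n : ℕ}, OpTerm k G n → OpTerm k G n → Prop
  | of {n : ℕ} {a b : OpTerm k G n} (h : R n a b) : OpRel k R a b
  | refl {n : ℕ} (a : OpTerm k G n) : OpRel k R a a
  | symm {n : ℕ} {a b : OpTerm k G n} (h : OpRel k R a b) : OpRel k R b a
  | trans {n : ℕ} {a b c : OpTerm k G n} (h : OpRel k R a b) (h' : OpRel k R b c) : OpRel k R a c
  | congr_add {n : ℕ} {a a' b b' : OpTerm k G n} (h : OpRel k R a a') (h' : OpRel k R b b') :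
      OpRel k R (.add a b) (.add a' b')
  | congr_smul {n : ℕ} (c : k) {a a' : OpTerm k G n} (h : OpRel k R a a') :
      OpRel k R (.smul c a) (.smul c a')
  | congr_par {n : ℕ} {a a' : OpTerm k G n} (h : OpRel k R a a') :
      OpRel k R (.par a) (.par a')
  | congr_act {n : ℕ} (σ : Equiv.Perm (Fin (n + 1))) {a a' : OpTerm k G n} (h : OpRel k R a a') :
      OpRel k R (.act σ a) (.act σ a')
  | congr_comp {m n l : ℕ} (e : m + n = l) (i : Fin (m + 1)) {a a' : OpTerm k G m}
      {b b' : OpTerm k G n} (h : OpRel k R a a') (h' : OpRel k R b b') :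
      OpRel k R (.comp e i a b) (.comp e i a' b')
  | add_comm {n : ℕ} (a b : OpTerm k G n) : OpRel k R (.add a b) (.add b a)
  | add_assoc {n : ℕ} (a b c : OpTerm k G n) :
      OpRel k R (.add (.add a b) c) (.add a (.add b c))
  | zero_add {n : ℕ} (a : OpTerm k G n) : OpRel k R (.add .zero a) a
  | neg_add {n : ℕ} (a : OpTerm k G n) : OpRel k R (.add (.smul (-1) a) a) .zero
  | smul_add {n : ℕ} (c : k) (a b : OpTerm k G n) :
      OpRel k R (.smul c (.add a b)) (.add (.smul c a) (.smul c b))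
  | add_smul {n : ℕ} (c c' : k) (a : OpTerm k G n) :
      OpRel k R (.smul (c + c') a) (.add (.smul c a) (.smul c' a))
  | mul_smul {n : ℕ} (c c' : k) (a : OpTerm k G n) :
      OpRel k R (.smul (c * c') a) (.smul c (.smul c' a))
  | one_smul {n : ℕ} (a : OpTerm k G n) : OpRel k R (.smul 1 a) a
  | par_add {n : ℕ} (a b : OpTerm k G n) : OpRel k R (.par (.add a b)) (.add (.par a) (.par b))
  | par_smul {n : ℕ} (c : k) (a : OpTerm k G n) :
      OpRel k R (.par (.smul c a)) (.smul c (.par a))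
  | act_add {n : ℕ} (σ : Equiv.Perm (Fin (n + 1))) (a b : OpTerm k G n) :
      OpRel k R (.act σ (.add a b)) (.add (.act σ a) (.act σ b))
  | act_smul {n : ℕ} (σ : Equiv.Perm (Fin (n + 1))) (c : k) (a : OpTerm k G n) :
      OpRel k R (.act σ (.smul c a)) (.smul c (.act σ a))
  | comp_add {m n l : ℕ} (e : m + n = l) (i : Fin (m + 1)) (a : OpTerm k G m)
      (b b' : OpTerm k G n) :
      OpRel k R (.comp e i a (.add b b')) (.add (.comp e i a b) (.comp e i a b'))
  | comp_smul {m n l : ℕ} (e : m + n = l) (i : Fin (m + 1)) (c : k) (a : OpTerm k G m)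
      (b : OpTerm k G n) : OpRel k R (.comp e i a (.smul c b)) (.smul c (.comp e i a b))
  | add_comp {m n l : ℕ} (e : m + n = l) (i : Fin (m + 1)) (a a' : OpTerm k G m)
      (b : OpTerm k G n) :
      OpRel k R (.comp e i (.add a a') b) (.add (.comp e i a b) (.comp e i a' b))
  | smul_comp {m n l : ℕ} (e : m + n = l) (i : Fin (m + 1)) (c : k) (a : OpTerm k G m)
      (b : OpTerm k G n) : OpRel k R (.comp e i (.smul c a) b) (.smul c (.comp e i a b))
  | par_par {n : ℕ} (a : OpTerm k G n) : OpRel k R (.par (.par a)) a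
  | par_one : OpRel k R (.par .one) .one
  | par_act {n : ℕ} (σ : Equiv.Perm (Fin (n + 1))) (a : OpTerm k G n) :
      OpRel k R (.par (.act σ a)) (.act σ (.par a))
  | par_comp {m n l : ℕ} (e : m + n = l) (i : Fin (m + 1)) (a : OpTerm k G m)
      (b : OpTerm k G n) : OpRel k R (.par (.comp e i a b)) (.comp e i (.par a) (.par b))
  | act_one {n : ℕ} (a : OpTerm k G n) : OpRel k R (.act 1 a) a
  | act_mul {n : ℕ} (σ τ : Equiv.Perm (Fin (n + 1))) (a : OpTerm k G n) :
      OpRel k R (.act (σ * τ) a) (.act σ (.act τ a))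
  | one_comp {n : ℕ} (a : OpTerm k G n) : OpRel k R (.comp (Nat.zero_add n) 0 .one a) a
  | comp_one {n : ℕ} (i : Fin (n + 1)) (a : OpTerm k G n) :
      OpRel k R (.comp (Nat.add_zero n) i a .one) a
  | assoc {m n r mn nr l : ℕ} (h₁ : m + n = mn) (h₂ : mn + r = l) (h₃ : n + r = nr)
      (h₄ : m + nr = l) (i : Fin (m + 1)) (j : Fin (n + 1)) (a : OpTerm k G m)
      (b : OpTerm k G n) (c : OpTerm k G r) :
      OpRel k R (.comp h₂ (innerPos h₁ i j) (.comp h₁ i a b) c) (.comp h₄ i a (.comp h₃ j b c))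
  | parallel {m n r mn mr l : ℕ} (h₁ : m + n = mn) (h₂ : mn + r = l) (h₃ : m + r = mr)
      (h₄ : mr + n = l) (i j : Fin (m + 1)) (hij : i ≠ j) (p q : ZMod 2)
      (a : OpTerm k G m) (b : OpTerm k G n) (c : OpTerm k G r)
      (hb : OpRel k R (.par b) (.smul (sgn k p) b)) (hc : OpRel k R (.par c) (.smul (sgn k q) c)) :
      OpRel k R (.comp h₂ (outerPos h₁ i j) (.comp h₁ i a b) c)
        (.smul (sgn k (p * q)) (.comp h₄ (outerPos h₃ j i) (.comp h₃ j a c) b))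
  | equivariant {m n l : ℕ} (h : m + n = l) (i : Fin (m + 1)) (σ : Equiv.Perm (Fin (m + 1)))
      (τ : Equiv.Perm (Fin (n + 1))) (ρ : Equiv.Perm (Fin (l + 1)))
      (h₁ : ∀ j, j ≠ i → ρ (outerPos h i j) = outerPos h (σ i) (σ j))
      (h₂ : ∀ a, ρ (innerPos h i a) = innerPos h (σ i) (τ a))
      (a : OpTerm k G m) (b : OpTerm k G n) :
      OpRel k R (.comp h (σ i) (.act σ a) (.act τ b)) (.act ρ (.comp h i a b))

section
variable {k : Type u} [Field k] {G : ℕ → Type v}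
  (R : ∀ n, OpTerm k G n → OpTerm k G n → Prop)

/-- The operations of arity `n + 1` of the operad presented by `G` and `R`. -/
def Presented (n : ℕ) : Type (max u v) := Quot (fun a b : OpTerm k G n => OpRel k R a b)

namespace Presented

variable {R} {n : ℕ}

/-- The class of an expression. -/
def mk (a : OpTerm k G n) : Presented R n := Quot.mk _ a

theorem sound {a b : OpTerm k G n} (h : OpRel k R a b) : (mk a : Presented R n) = mk b :=
  Quot.sound h

theorem ind {Q : Presented R n → Prop} (h : ∀ a, Q (mk a)) (x : Presented R n) : Q x :=
  Quot.ind h x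

theorem exact {a b : OpTerm k G n} (h : (mk a : Presented R n) = mk b) : OpRel k R a b :=
  (Quot.eqvGen_exact h).rec (fun _ _ h => h) .refl (fun _ _ _ h => .symm h)
    (fun _ _ _ _ _ h h' => .trans h h')

instance : Zero (Presented R n) := ⟨mk .zero⟩
instance : Add (Presented R n) :=
  ⟨Quot.map₂ .add (fun _ _ _ h => .congr_add (.refl _) h) (fun _ _ _ h => .congr_add h (.refl _))⟩
instance : SMul k (Presented R n) :=
  ⟨fun c => Quot.map (.smul c) (fun _ _ h => .congr_smul c h)⟩
instance : Neg (Presented R n) := ⟨fun x => (-1 : k) • x⟩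

theorem mk_zero : (mk .zero : Presented R n) = 0 := rfl
theorem mk_add (a b : OpTerm k G n) : (mk (.add a b) : Presented R n) = mk a + mk b := rfl
theorem mk_smul (c : k) (a : OpTerm k G n) : (mk (.smul c a) : Presented R n) = c • mk a := rfl

instance : AddCommGroup (Presented R n) where
  add_assoc := by
    rintro ⟨a⟩ ⟨b⟩ ⟨c⟩; exact sound (.add_assoc a b c)
  zero_add := by rintro ⟨a⟩; exact sound (.zero_add a)
  add_zero := by
    rintro ⟨a⟩; exact sound (.trans (.add_comm _ _) (.zero_add a))
  neg_add_cancel := by rintro ⟨a⟩; exact sound (.neg_add a)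
  add_comm := by rintro ⟨a⟩ ⟨b⟩; exact sound (.add_comm a b)
  nsmul := nsmulRec
  zsmul := zsmulRec

instance : Module k (Presented R n) :=
  Module.ofMinimalAxioms
    (by rintro c ⟨a⟩ ⟨b⟩; exact sound (.smul_add c a b))
    (by rintro c c' ⟨a⟩; exact sound (.add_smul c c' a))
    (by rintro c c' ⟨a⟩; exact sound (.mul_smul c c' a))
    (by rintro ⟨a⟩; exact sound (.one_smul a))

/-- The parity involution. -/
def par : Presented R n →ₗ[k] Presented R n where
  toFun := Quot.map .par (fun _ _ h => .congr_par h)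
  map_add' := by rintro ⟨a⟩ ⟨b⟩; exact sound (.par_add a b)
  map_smul' := by rintro c ⟨a⟩; exact sound (.par_smul c a)

/-- The action of permutations. -/
def act (σ : Equiv.Perm (Fin (n + 1))) : Presented R n →ₗ[k] Presented R n where
  toFun := Quot.map (.act σ) (fun _ _ h => .congr_act σ h)
  map_add' := by rintro ⟨a⟩ ⟨b⟩; exact sound (.act_add σ a b)
  map_smul' := by rintro c ⟨a⟩; exact sound (.act_smul σ c a)

/-- The partial compositions. -/
def comp {m n l : ℕ} (h : m + n = l) (i : Fin (m + 1)) :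
    Presented R m →ₗ[k] Presented R n →ₗ[k] Presented R l :=
  LinearMap.mk₂ k
    (Quot.map₂ (.comp h i) (fun _ _ _ h' => .congr_comp h i (.refl _) h')
      (fun _ _ _ h' => .congr_comp h i h' (.refl _)))
    (by rintro ⟨a⟩ ⟨a'⟩ ⟨b⟩; exact sound (.add_comp h i a a' b))
    (by rintro c ⟨a⟩ ⟨b⟩; exact sound (.smul_comp h i c a b))
    (by rintro ⟨a⟩ ⟨b⟩ ⟨b'⟩; exact sound (.comp_add h i a b b'))
    (by rintro c ⟨a⟩ ⟨b⟩; exact sound (.comp_smul h i c a b))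

theorem mk_par (a : OpTerm k G n) : (mk (.par a) : Presented R n) = par (mk a) := rfl
theorem mk_act (σ : Equiv.Perm (Fin (n + 1))) (a : OpTerm k G n) :
    (mk (.act σ a) : Presented R n) = act σ (mk a) := rfl
theorem mk_comp {m n l : ℕ} (h : m + n = l) (i : Fin (m + 1)) (a : OpTerm k G m)
    (b : OpTerm k G n) : (mk (.comp h i a b) : Presented R l) = comp h i (mk a) (mk b) := rfl

theorem par_par (x : Presented R n) : par (par x) = x := by
  obtain ⟨a⟩ := x; exact sound (.par_par a)

theorem par_one : par (mk .one : Presented R 0) = mk .one := sound .par_one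

theorem par_act (σ : Equiv.Perm (Fin (n + 1))) (x : Presented R n) :
    par (act σ x) = act σ (par x) := by
  obtain ⟨a⟩ := x; exact sound (.par_act σ a)

theorem par_comp {m n l : ℕ} (h : m + n = l) (i : Fin (m + 1)) (x : Presented R m)
    (y : Presented R n) : par (comp h i x y) = comp h i (par x) (par y) := by
  obtain ⟨a⟩ := x; obtain ⟨b⟩ := y; exact sound (.par_comp h i a b)

theorem act_one (x : Presented R n) : act 1 x = x := by
  obtain ⟨a⟩ := x; exact sound (.act_one a)

theorem act_mul (σ τ : Equiv.Perm (Fin (n + 1))) (x : Presented R n) :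
    act (σ * τ) x = act σ (act τ x) := by
  obtain ⟨a⟩ := x; exact sound (.act_mul σ τ a)

theorem one_comp (x : Presented R n) : comp (Nat.zero_add n) 0 (mk .one) x = x := by
  obtain ⟨a⟩ := x; exact sound (.one_comp a)

theorem comp_one (i : Fin (n + 1)) (x : Presented R n) :
    comp (Nat.add_zero n) i x (mk .one) = x := by
  obtain ⟨a⟩ := x; exact sound (.comp_one i a)

theorem assoc {m n r mn nr l : ℕ} (h₁ : m + n = mn) (h₂ : mn + r = l) (h₃ : n + r = nr)
    (h₄ : m + nr = l) (i : Fin (m + 1)) (j : Fin (n + 1)) (x : Presented R m)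
    (y : Presented R n) (z : Presented R r) :
    comp h₂ (innerPos h₁ i j) (comp h₁ i x y) z = comp h₄ i x (comp h₃ j y z) := by
  obtain ⟨a⟩ := x; obtain ⟨b⟩ := y; obtain ⟨c⟩ := z
  exact sound (.assoc h₁ h₂ h₃ h₄ i j a b c)

theorem parallel {m n r mn mr l : ℕ} (h₁ : m + n = mn) (h₂ : mn + r = l) (h₃ : m + r = mr)
    (h₄ : mr + n = l) (i j : Fin (m + 1)) (hij : i ≠ j) (p q : ZMod 2)
    (x : Presented R m) (y : Presented R n) (z : Presented R r) (hy : par y = sgn k p • y)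
    (hz : par z = sgn k q • z) :
    comp h₂ (outerPos h₁ i j) (comp h₁ i x y) z
      = sgn k (p * q) • comp h₄ (outerPos h₃ j i) (comp h₃ j x z) y := by
  obtain ⟨a⟩ := x; obtain ⟨b⟩ := y; obtain ⟨c⟩ := z
  exact sound (.parallel h₁ h₂ h₃ h₄ i j hij p q a b c (exact hy) (exact hz))

theorem equivariant {m n l : ℕ} (h : m + n = l) (i : Fin (m + 1))
    (σ : Equiv.Perm (Fin (m + 1))) (τ : Equiv.Perm (Fin (n + 1))) (ρ : Equiv.Perm (Fin (l + 1)))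
    (h₁ : ∀ j, j ≠ i → ρ (outerPos h i j) = outerPos h (σ i) (σ j))
    (h₂ : ∀ a, ρ (innerPos h i a) = innerPos h (σ i) (τ a))
    (x : Presented R m) (y : Presented R n) :
    comp h (σ i) (act σ x) (act τ y) = act ρ (comp h i x y) := by
  obtain ⟨a⟩ := x; obtain ⟨b⟩ := y; exact sound (.equivariant h i σ τ ρ h₁ h₂ a b)

variable (R)

/-- The graded operad presented by the generators `G` and the relations `R`. -/
def operad : GrOperad.{u, max u v} k where
  obj := Presented R
  par := par
  act := act
  comp := comp
  one := mk .one
  par_par := par_par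
  par_one := par_one
  par_act := par_act
  par_comp := par_comp
  act_one := act_one
  act_mul := act_mul
  one_comp := one_comp
  comp_one := comp_one
  assoc := assoc
  parallel := parallel
  equivariant := equivariant

end Presented

/-! ### Maps out of a presented operad, and derivations -/

/-- The value of an expression in a graded operad in which the generators have been given
values. -/
def OpTerm.eval (T : GrOperad.{u, w} k) (φ : ∀ n : ℕ, G n → T.obj n) :
    ∀ {n : ℕ}, OpTerm k G n → T.obj n
  | _, .gen g => φ _ g
  | _, .one => T.one
  | _, .zero => 0
  | _, .add a b => a.eval T φ + b.eval T φ
  | _, .smul c a => c • a.eval T φ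
  | _, .par a => T.par (a.eval T φ)
  | _, .act σ a => T.act σ (a.eval T φ)
  | _, .comp h i a b => T.comp h i (a.eval T φ) (b.eval T φ)

theorem OpTerm.eval_eq {R : ∀ n, OpTerm k G n → OpTerm k G n → Prop} (T : GrOperad.{u, w} k)
    (φ : ∀ n : ℕ, G n → T.obj n)
    (hR : ∀ {n : ℕ} {a b : OpTerm k G n}, R n a b → a.eval T φ = b.eval T φ)
    {n : ℕ} {a b : OpTerm k G n} (h : OpRel k R a b) : a.eval T φ = b.eval T φ := by
  induction h with
  | of h => exact hR h
  | refl => rfl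
  | symm _ ih => exact ih.symm
  | trans _ _ ih ih' => exact ih.trans ih'
  | parallel h₁ h₂ h₃ h₄ i j hij p q a b c _ _ ihb ihc =>
      exact T.parallel h₁ h₂ h₃ h₄ i j hij p q _ _ _ ihb ihc
  | equivariant h i σ τ ρ h₁ h₂ a b => exact T.equivariant h i σ τ ρ h₁ h₂ _ _
  | _ => simp_all [OpTerm.eval, add_comm, add_left_comm, mul_smul, add_smul, T.par_par, T.par_one,
      T.par_act, T.par_comp, T.act_one, T.act_mul, T.one_comp, T.comp_one, T.assoc]

namespace Presented
variable {R}

/-- The map of graded operads out of a presented operad that is given on the generators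
by `φ`. -/
def lift (T : GrOperad.{u, w} k) (φ : ∀ n : ℕ, G n → T.obj n)
    (hR : ∀ {n : ℕ} {a b : OpTerm k G n}, R n a b → a.eval T φ = b.eval T φ) {n : ℕ} :
    Presented R n →ₗ[k] T.obj n where
  toFun := Quot.lift (fun a => a.eval T φ) (fun _ _ h => OpTerm.eval_eq T φ hR h)
  map_add' := by rintro ⟨a⟩ ⟨b⟩; rfl
  map_smul' := by rintro c ⟨a⟩; rfl

end Presented

/-- The derivation of a presented operad with prescribed values on the generators, evaluated on
an expression: the Leibniz rule. -/
def OpTerm.deriv (R : ∀ n, OpTerm k G n → OpTerm k G n → Prop)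
    (δ : ∀ n : ℕ, G n → Presented R n) : ∀ {n : ℕ}, OpTerm k G n → Presented R n
  | _, .gen g => δ _ g
  | _, .one => 0
  | _, .zero => 0
  | _, .add a b => a.deriv R δ + b.deriv R δ
  | _, .smul c a => c • a.deriv R δ
  | _, .par a => -Presented.par (a.deriv R δ)
  | _, .act σ a => Presented.act σ (a.deriv R δ)
  | _, .comp h i a b => Presented.comp h i (a.deriv R δ) (.mk b)
      + Presented.comp h i (.par (.mk a)) (b.deriv R δ)

theorem OpTerm.deriv_eq {R : ∀ n, OpTerm k G n → OpTerm k G n → Prop}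
    (δ : ∀ n : ℕ, G n → Presented R n)
    (hR : ∀ {n : ℕ} {a b : OpTerm k G n}, R n a b → a.deriv R δ = b.deriv R δ)
    {n : ℕ} {a b : OpTerm k G n} (h : OpRel k R a b) : a.deriv R δ = b.deriv R δ := by
  have key := fun {n : ℕ} {a b : OpTerm k G n} (h : OpRel k R a b) => Presented.sound h
  induction h with
  | of h => exact hR h
  | refl => rfl
  | symm _ ih => exact ih.symm
  | trans _ _ ih ih' => exact ih.trans ih'
  | congr_comp e i h h' ih ih' => simp [OpTerm.deriv, ih, ih', key h, key h']
  | parallel h₁ h₂ h₃ h₄ i j hij p q a b c hb hc ihb ihc =>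
      have kb := key hb
      have kc := key hc
      simp only [OpTerm.deriv, Presented.mk_smul, Presented.mk_par, Presented.mk_comp, map_add,
        LinearMap.add_apply, Presented.par_comp] at kb kc ihb ihc ⊢
      have ihb' : Presented.par (b.deriv R δ) = sgn k (p + 1) • b.deriv R δ := by
        rw [sgn_add, sgn_one, mul_neg_one, neg_smul, ← ihb, neg_neg]
      have ihc' : Presented.par (c.deriv R δ) = sgn k (q + 1) • c.deriv R δ := by
        rw [sgn_add, sgn_one, mul_neg_one, neg_smul, ← ihc, neg_neg]
      rw [Presented.parallel h₁ h₂ h₃ h₄ i j hij p q _ _ _ kb kc, Presented.parallel h₁ h₂ h₃ h₄ i j hij (p + 1) q _ _ _ ihb' kc,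
        kb, kc]
      simp only [map_smul, LinearMap.smul_apply]
      rw [Presented.parallel h₁ h₂ h₃ h₄ i j hij p (q + 1) _ _ _ kb ihc']
      simp only [smul_add, smul_smul, add_mul, mul_add, mul_one, one_mul, sgn_add]
      rw [add_assoc, add_assoc]
      congr 1
      rw [add_comm, mul_comm (sgn k p), mul_assoc, sgn_mul_self, mul_one]
  | equivariant h i σ τ ρ h₁ h₂ a b =>
      simp only [OpTerm.deriv, Presented.mk_act, Presented.par_act, map_add]
      rw [Presented.equivariant h i σ τ ρ h₁ h₂, Presented.equivariant h i σ τ ρ h₁ h₂]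
  | assoc h₁ h₂ h₃ h₄ i j a b c =>
      simp only [OpTerm.deriv, Presented.mk_comp, Presented.par_comp, map_add, LinearMap.add_apply, Presented.assoc h₁ h₂ h₃ h₄]
      abel
  | neg_add a => simp [OpTerm.deriv]
  | add_comm a b => simp [OpTerm.deriv, add_comm]
  | add_assoc a b c => simp [OpTerm.deriv, add_assoc]
  | congr_add h h' ih ih' => simp [OpTerm.deriv, ih, ih']
  | congr_smul c h ih => simp [OpTerm.deriv, ih]
  | congr_par h ih => simp [OpTerm.deriv, ih]
  | congr_act σ h ih => simp [OpTerm.deriv, ih]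
  | add_smul => simp [OpTerm.deriv, add_smul]
  | mul_smul => simp [OpTerm.deriv, mul_smul]
  | par_add => simp [OpTerm.deriv, add_comm]
  | comp_add => simp only [OpTerm.deriv, Presented.mk_add, map_add]; abel
  | add_comp =>
      simp only [OpTerm.deriv, Presented.mk_add, map_add, LinearMap.add_apply,
        Presented.mk_par]; abel
  | par_comp e i a b =>
      simp [OpTerm.deriv, Presented.mk_par, Presented.par_comp, add_comm]
  | smul_comp => simp [OpTerm.deriv, Presented.mk_smul]
  | comp_smul => simp [OpTerm.deriv, Presented.mk_smul]
  | par_par a => simp [OpTerm.deriv, Presented.par_par]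
  | par_act σ a => simp [OpTerm.deriv, Presented.par_act]
  | act_one a => simp [OpTerm.deriv, Presented.act_one]
  | act_mul σ τ a => simp [OpTerm.deriv, Presented.act_mul]
  | one_comp a => simp [OpTerm.deriv, Presented.par_one, Presented.one_comp]
  | comp_one i a => simp [OpTerm.deriv, Presented.comp_one]
  | _ => simp [OpTerm.deriv]

namespace Presented
variable {R}

/-- A presented operad with the derivation that has prescribed values on the generators. -/
def diffOperad (δ : ∀ n : ℕ, G n → Presented R n)
    (hR : ∀ {n : ℕ} {a b : OpTerm k G n}, R n a b → a.deriv R δ = b.deriv R δ) :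
    DiffOperad.{u, max u v} k where
  toGrOperad := operad R
  d := 
    { toFun := Quot.lift (fun a => a.deriv R δ) (fun _ _ h => OpTerm.deriv_eq δ hR h)
      map_add' := by rintro ⟨a⟩ ⟨b⟩; rfl
      map_smul' := by rintro c ⟨a⟩; rfl }
  par_d := by
    rintro n ⟨a⟩
    change par (a.deriv R δ) = - -par (a.deriv R δ)
    rw [neg_neg]
  d_act := by rintro n σ ⟨a⟩; rfl
  d_comp := by rintro m n l h i ⟨a⟩ ⟨b⟩; rfl

/-- The map of operads with derivation out of a presented operad that is given on the generators
by `φ`. -/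
def liftHom (δ : ∀ n : ℕ, G n → Presented R n)
    (hδ : ∀ {n : ℕ} {a b : OpTerm k G n}, R n a b → a.deriv R δ = b.deriv R δ)
    (T : DiffOperad.{u, w} k) (φ : ∀ n : ℕ, G n → T.obj n)
    (hR : ∀ {n : ℕ} {a b : OpTerm k G n}, R n a b →
      a.eval T.toGrOperad φ = b.eval T.toGrOperad φ)
    (hd : ∀ {n : ℕ} (g : G n), lift T.toGrOperad φ hR (δ n g) = T.d (φ n g)) :
    OperadHom (diffOperad δ hδ) T where
  app := lift T.toGrOperad φ hR
  map_par := by rintro n ⟨a⟩; rfl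
  map_act := by rintro n σ ⟨a⟩; rfl
  map_comp := by rintro m n l h i ⟨a⟩ ⟨b⟩; rfl
  map_one := rfl
  map_d := by
    have one : T.d T.one = 0 := by
      have := T.d_comp (Nat.zero_add 0) 0 T.one T.one
      rw [T.par_one, T.one_comp, T.one_comp, T.comp_one] at this
      simpa using this
    have par : ∀ {n : ℕ} (x : Presented R n), lift T.toGrOperad φ hR (par x)
        = T.par (lift T.toGrOperad φ hR x) := by rintro n ⟨a⟩; rfl
    have act : ∀ {n : ℕ} (σ : Equiv.Perm (Fin (n + 1))) (x : Presented R n),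
        lift T.toGrOperad φ hR (act σ x) = T.act σ (lift T.toGrOperad φ hR x) := by
      rintro n σ ⟨a⟩; rfl
    have comp : ∀ {m n l : ℕ} (h : m + n = l) (i : Fin (m + 1)) (x : Presented R m)
        (y : Presented R n), lift T.toGrOperad φ hR (comp h i x y)
        = T.comp h i (lift T.toGrOperad φ hR x) (lift T.toGrOperad φ hR y) := by
      rintro m n l h i ⟨a⟩ ⟨b⟩; rfl
    suffices H : ∀ {n : ℕ} (a : OpTerm k G n),
        lift T.toGrOperad φ hR (a.deriv R δ) = T.d (a.eval T.toGrOperad φ) by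
      rintro n ⟨a⟩; exact H a
    intro n a
    change lift T.toGrOperad φ hR (a.deriv R δ) = T.d (a.eval T.toGrOperad φ)
    have ev : ∀ {n : ℕ} (a : OpTerm k G n),
      lift T.toGrOperad φ hR (.mk a) = a.eval T.toGrOperad φ := fun _ => rfl
    induction a with
    | gen g => exact hd g
    | one => simp [OpTerm.deriv, OpTerm.eval, one]
    | zero => simp [OpTerm.deriv, OpTerm.eval]
    | add a b iha ihb => simp [OpTerm.deriv, OpTerm.eval, iha, ihb]
    | smul c a ih => simp [OpTerm.deriv, OpTerm.eval, ih]
    | par a ih => simp [OpTerm.deriv, OpTerm.eval, ih, par, T.par_d]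
    | act σ a ih => simp [OpTerm.deriv, OpTerm.eval, ih, act, T.d_act]
    | comp h i a b iha ihb =>
        simp [OpTerm.deriv, OpTerm.eval, iha, ihb, comp, par, ev, T.d_comp]

end Presented
end
/-! ### The BV-resolution -/

/-- Generators of the BV-resolution of `O`: the operations of `O` and two operations `s`, `t` of
arity one. -/
inductive BVGen {k : Type u} [Field k] (O : DiffOperad.{u, w} k) : ℕ → Type w
  | op {n : ℕ} (x : O.obj n) : BVGen O n
  | s : BVGen O 0
  | t : BVGen O 0

/-- Relations of the BV-resolution of `O`: those of `O`, and `s² = 0`, `t² = t`, `st = ts = 0`,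
where `s` is odd and `t` is even. -/
inductive BVRel {k : Type u} [Field k] (O : DiffOperad.{u, w} k) :
    ∀ n, OpTerm k (BVGen O) n → OpTerm k (BVGen O) n → Prop
  | op_add {n : ℕ} (x y : O.obj n) :
      BVRel O n (.gen (.op (x + y))) (.add (.gen (.op x)) (.gen (.op y)))
  | op_smul {n : ℕ} (c : k) (x : O.obj n) :
      BVRel O n (.gen (.op (c • x))) (.smul c (.gen (.op x)))
  | op_par {n : ℕ} (x : O.obj n) : BVRel O n (.gen (.op (O.par x))) (.par (.gen (.op x)))
  | op_act {n : ℕ} (σ : Equiv.Perm (Fin (n + 1))) (x : O.obj n) :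
      BVRel O n (.gen (.op (O.act σ x))) (.act σ (.gen (.op x)))
  | op_comp {m n l : ℕ} (h : m + n = l) (i : Fin (m + 1)) (x : O.obj m) (y : O.obj n) :
      BVRel O l (.gen (.op (O.comp h i x y))) (.comp h i (.gen (.op x)) (.gen (.op y)))
  | op_one : BVRel O 0 (.gen (.op O.one)) .one
  | par_s : BVRel O 0 (.par (.gen .s)) (.smul (-1) (.gen .s))
  | par_t : BVRel O 0 (.par (.gen .t)) (.gen .t)
  | s_s : BVRel O 0 (.comp (Nat.zero_add 0) 0 (.gen .s) (.gen .s)) .zero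
  | t_t : BVRel O 0 (.comp (Nat.zero_add 0) 0 (.gen .t) (.gen .t)) (.gen .t)
  | s_t : BVRel O 0 (.comp (Nat.zero_add 0) 0 (.gen .s) (.gen .t)) .zero
  | t_s : BVRel O 0 (.comp (Nat.zero_add 0) 0 (.gen .t) (.gen .s)) .zero

section
variable {k : Type u} [Field k] (O : DiffOperad.{u, w} k)

/-- The derivation of the BV-resolution on generators: it extends that of `O`, and `d s = 1 - t`,
`d t = 0`. -/
def bvDelta : ∀ n : ℕ, BVGen O n → Presented (BVRel O) n
  | _, .op x => .mk (.gen (.op (O.d x)))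
  | _, .s => .mk .one - .mk (.gen .t)
  | _, .t => 0

theorem DiffOperad.d_one {k : Type u} [Field k] (O : DiffOperad.{u, w} k) : O.d O.one = 0 := by
  have := O.d_comp (Nat.zero_add 0) 0 O.one O.one
  rw [O.par_one, O.one_comp, O.one_comp, O.comp_one] at this
  simpa using this

theorem bvDelta_rel {n : ℕ} {a b : OpTerm k (BVGen O) n} (h : BVRel O n a b) :
    a.deriv (BVRel O) (bvDelta O) = b.deriv (BVRel O) (bvDelta O) := by
  have key := fun {n : ℕ} {a b : OpTerm k (BVGen O) n} (h : BVRel O n a b) =>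
    Presented.sound (R := BVRel O) (.of h)
  have ks := key .par_s
  have kt := key .par_t
  rw [Presented.mk_par] at ks kt
  rw [Presented.mk_smul] at ks
  have hst := key .s_t
  have hts := key .t_s
  rw [Presented.mk_comp] at hst hts
  cases h with
  | op_add x y => simp only [OpTerm.deriv, bvDelta, map_add]; exact key (.op_add _ _)
  | op_smul c x => simp only [OpTerm.deriv, bvDelta, map_smul]; exact key (.op_smul _ _)
  | op_par x =>
      simp only [OpTerm.deriv, bvDelta]
      have h1 : O.d (O.par x) = (-1 : k) • O.par (O.d x) := by rw [O.par_d]; simp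
      have h2 := key (.op_smul (-1 : k) (O.par (O.d x)))
      rw [h1, h2, Presented.mk_smul, key (.op_par _), Presented.mk_par]; simp
  | op_act σ x => simp only [OpTerm.deriv, bvDelta, O.d_act]; exact key (.op_act _ _)
  | op_comp h i x y =>
      simp only [OpTerm.deriv, bvDelta, O.d_comp]
      rw [key (.op_add _ _), Presented.mk_add, key (.op_comp _ _ _ _), key (.op_comp _ _ _ _),
        Presented.mk_comp, Presented.mk_comp, key (.op_par _), Presented.mk_par]
  | op_one =>
      simp only [OpTerm.deriv, bvDelta, O.d_one]
      have h2 := key (.op_smul (0 : k) (0 : O.obj 0))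
      rw [zero_smul, Presented.mk_smul, zero_smul] at h2
      exact h2
  | par_s => simp [OpTerm.deriv, bvDelta, kt, Presented.par_one]
  | par_t => simp [OpTerm.deriv, bvDelta]
  | s_s =>
      simp [OpTerm.deriv, bvDelta, ks, map_sub, Presented.one_comp, hts, hst, Presented.mk_zero]
      exact sub_eq_zero.2 (Presented.comp_one (k := k) (R := BVRel O) 0 (.mk (.gen .s))).symm
  | t_t => simp [OpTerm.deriv, bvDelta]
  | s_t =>
      have htt := key .t_t
      rw [Presented.mk_comp] at htt
      simp [OpTerm.deriv, bvDelta, htt, map_sub, Presented.one_comp]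
  | t_s =>
      have htt := key .t_t
      rw [Presented.mk_comp] at htt
      have := Presented.comp_one (k := k) (R := BVRel O) 0 (.mk (.gen .t))
      simp [OpTerm.deriv, bvDelta, kt, htt, map_sub]
      exact sub_eq_zero.2 this

/-- The BV-resolution `O[s, t] / (s², t² - t, st, ts)` with `d s = 1 - t`, `d t = 0`. -/
def BV : DiffOperad.{u, max u w} k := Presented.diffOperad (bvDelta O) (bvDelta_rel O)

/-- The operation of `BV O` given by an operation of `O`. -/
def bvOp {n : ℕ} (x : O.obj n) : (BV O).obj n := Presented.mk (.gen (.op x))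

/-- The odd operation `s` of `BV O`. -/
def bvS : (BV O).obj 0 := Presented.mk (.gen .s)

/-- The even operation `t` of `BV O`. -/
def bvT : (BV O).obj 0 := Presented.mk (.gen .t)

theorem par_bvT : (BV O).par (bvT O) = bvT O := Presented.sound (.of .par_t)

theorem bvT_bvT : (BV O).comp (Nat.zero_add 0) 0 (bvT O) (bvT O) = bvT O :=
  Presented.sound (.of .t_t)

theorem d_bvT : (BV O).d (bvT O) = 0 := rfl

/-- The values in `O` of the generators of `BV O` under the augmentation. -/
def bvAugGen : ∀ n : ℕ, BVGen O n → O.obj n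
  | _, .op x => x
  | _, .s => 0
  | _, .t => O.one

theorem bvAugGen_rel {n : ℕ} {a b : OpTerm k (BVGen O) n} (h : BVRel O n a b) :
    a.eval O.toGrOperad (bvAugGen O) = b.eval O.toGrOperad (bvAugGen O) := by
  cases h <;> simp [OpTerm.eval, bvAugGen, O.par_one, O.one_comp]

/-- The augmentation `q : BV O → O`, `s ↦ 0`, `t ↦ 1`. -/
def bvAug : OperadHom (BV O) O :=
  Presented.liftHom (bvDelta O) (bvDelta_rel O) O (bvAugGen O) (bvAugGen_rel O) (by
    intro n g
    cases g with
    | op x => rfl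
    | s =>
        simp only [bvDelta, map_sub, bvAugGen, map_zero]
        exact sub_self O.one
    | t => simp only [bvDelta, map_zero, bvAugGen]; exact O.d_one.symm)

/-! ### The truncation by the idempotent `t` -/

/-- The operations of `BV O` that do not change when `t` is composed with the output or with one
of the inputs, that is, the image of `x ↦ t ∘ x ∘ (t, …, t)`. -/
def bvSub (n : ℕ) : Submodule k ((BV O).obj n) where
  carrier := {x | (BV O).comp (Nat.zero_add n) 0 (bvT O) x = x ∧
    ∀ i, (BV O).comp (Nat.add_zero n) i x (bvT O) = x}
  add_mem' := by
    rintro a b ⟨ha, ha'⟩ ⟨hb, hb'⟩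
    exact ⟨by rw [map_add, ha, hb], fun i => by
      rw [map_add, LinearMap.add_apply, ha' i, hb' i]⟩
  zero_mem' := ⟨by simp, fun i => by simp⟩
  smul_mem' := by
    rintro c a ⟨ha, ha'⟩
    exact ⟨by rw [map_smul, ha], fun i => by
      rw [map_smul, LinearMap.smul_apply, ha' i]⟩

variable {O}

theorem par_mem_bvSub {n : ℕ} {x : (BV O).obj n} (hx : x ∈ bvSub O n) :
    (BV O).par x ∈ bvSub O n := by
  constructor
  · have := congrArg (BV O).par hx.1
    rwa [(BV O).par_comp, par_bvT] at this
  · intro i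
    have := congrArg (BV O).par (hx.2 i)
    rwa [(BV O).par_comp, par_bvT] at this

theorem act_mem_bvSub {n : ℕ} (σ : Equiv.Perm (Fin (n + 1))) {x : (BV O).obj n}
    (hx : x ∈ bvSub O n) : (BV O).act σ x ∈ bvSub O n := by
  constructor
  · have := (BV O).equivariant (Nat.zero_add n) 0 1 σ σ
      (fun j hj => absurd (Subsingleton.elim (α := Fin 1) j 0) hj)
      (fun a => by
        have e : ∀ a : Fin (n + 1), innerPos (Nat.zero_add n) 0 a = a := fun a => by
          ext; simp [innerPos]
        rw [Equiv.Perm.one_apply, e, e]) (bvT O) x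
    rw [(BV O).act_one, hx.1] at this
    exact this
  · intro i
    have := (BV O).equivariant (Nat.add_zero n) (σ⁻¹ i) σ 1 σ
      (fun j hj => by
        have e : ∀ i j : Fin (n + 1), outerPos (Nat.add_zero n) i j = j := fun i j => by
          ext; simp [outerPos]
        rw [e, e])
      (fun a => by
        have e : ∀ (i : Fin (n + 1)) (a : Fin 1), innerPos (Nat.add_zero n) i a = i :=
          fun i a => by ext; simp [innerPos]
        rw [e, e]) x (bvT O)
    rw [(BV O).act_one, hx.2, ← Equiv.Perm.mul_apply, mul_inv_cancel, Equiv.Perm.one_apply] at this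
    exact this

theorem d_mem_bvSub {n : ℕ} {x : (BV O).obj n} (hx : x ∈ bvSub O n) :
    (BV O).d x ∈ bvSub O n := by
  constructor
  · have := congrArg (BV O).d hx.1
    rw [(BV O).d_comp, par_bvT, d_bvT] at this
    simpa using this
  · intro i
    have := congrArg (BV O).d (hx.2 i)
    rw [(BV O).d_comp, d_bvT] at this
    simpa using this

theorem bvT_mem_bvSub : bvT O ∈ bvSub O 0 :=
  ⟨bvT_bvT O, fun i => by rw [Subsingleton.elim (α := Fin 1) i 0]; exact bvT_bvT O⟩

theorem outerPos_or_innerPos {m n l : ℕ} (h : m + n = l) (i : Fin (m + 1)) (c : Fin (l + 1)) :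
    (∃ j, j ≠ i ∧ c = outerPos h i j) ∨ ∃ a, c = innerPos h i a := by
  rcases lt_or_ge (c : ℕ) i with h1 | h1
  · left
    refine ⟨⟨c, by omega⟩, fun e => by simp [← e] at h1, ?_⟩
    ext; simp [outerPos, h1]
  · rcases lt_or_ge (c : ℕ) (i + n + 1) with h2 | h2
    · right
      exact ⟨⟨c - i, by omega⟩, by ext; simp [innerPos]; omega⟩
    · left
      refine ⟨⟨c - n, by omega⟩, fun e => ?_, ?_⟩
      · have := congrArg Fin.val e; simp at this; omega
      · ext; simp [outerPos]; split <;> omega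

theorem comp_mem_bvSub [CharZero k] {m n l : ℕ} (h : m + n = l) (i : Fin (m + 1)) {x : (BV O).obj m}
    {y : (BV O).obj n} (hx : x ∈ bvSub O m) (hy : y ∈ bvSub O n) :
    (BV O).comp h i x y ∈ bvSub O l := by
  have hT : HasParity (BV O).par 0 (bvT O) := by simp [HasParity, par_bvT]
  constructor
  · have := (BV O).assoc (Nat.zero_add m) h h (Nat.zero_add l) 0 i (bvT O) x y
    rw [← this, hx.1]
    congr 1
    ext; simp [innerPos]
  · intro c
    rcases outerPos_or_innerPos h i c with ⟨j, hj, rfl⟩ | ⟨a, rfl⟩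
    · refine parity_induction (BV O).par (BV O).par_par
        (Q := fun y => (BV O).comp (Nat.add_zero l) (outerPos h i j) ((BV O).comp h i x y) (bvT O)
          = (BV O).comp h i x y) (fun a b ha hb => by
            rw [map_add, map_add, LinearMap.add_apply, ha, hb]) (fun p y hy => ?_) y
      rw [(BV O).parallel h (Nat.add_zero l) (Nat.add_zero m) h i j hj.symm p 0 x y (bvT O) hy hT,
        hx.2, mul_zero, sgn_zero, one_smul]
      have e : outerPos (Nat.add_zero m) j i = i := by ext; simp [outerPos]
      rw [e]
    · rw [(BV O).assoc h (Nat.add_zero l) (Nat.add_zero n) h i a x y (bvT O), hy.2]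

variable (O)

/-- The truncation `bv O` of `BV O` by the idempotent `t`: the suboperad with components `bvSub O n`
and unit `t`. -/
def bv [CharZero k] : DiffOperad.{u, max u w} k where
  obj := fun n => bvSub O n
  par := (BV O).par.restrict fun _ hx => par_mem_bvSub hx
  act := fun σ => ((BV O).act σ).restrict fun _ hx => act_mem_bvSub σ hx
  comp := fun h i => LinearMap.mk₂ k
    (fun x y => ⟨(BV O).comp h i x.1 y.1, comp_mem_bvSub h i x.2 y.2⟩)
    (fun x x' y => Subtype.ext (by simp)) (fun c x y => Subtype.ext (by simp))
    (fun x y y' => Subtype.ext (by simp)) (fun c x y => Subtype.ext (by simp))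
  one := ⟨bvT O, bvT_mem_bvSub⟩
  par_par := fun x => Subtype.ext ((BV O).par_par x.1)
  par_one := Subtype.ext (par_bvT O)
  par_act := fun σ x => Subtype.ext ((BV O).par_act σ x.1)
  par_comp := fun h i x y => Subtype.ext ((BV O).par_comp h i x.1 y.1)
  act_one := fun x => Subtype.ext ((BV O).act_one x.1)
  act_mul := fun σ τ x => Subtype.ext ((BV O).act_mul σ τ x.1)
  one_comp := fun x => Subtype.ext x.2.1
  comp_one := fun i x => Subtype.ext (x.2.2 i)
  assoc := fun h₁ h₂ h₃ h₄ i j x y z =>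
    Subtype.ext ((BV O).assoc h₁ h₂ h₃ h₄ i j x.1 y.1 z.1)
  parallel := fun h₁ h₂ h₃ h₄ i j hij p q x y z hy hz =>
    Subtype.ext ((BV O).parallel h₁ h₂ h₃ h₄ i j hij p q x.1 y.1 z.1
      (congrArg Subtype.val hy) (congrArg Subtype.val hz))
  equivariant := fun h i σ τ ρ h₁ h₂ x y =>
    Subtype.ext ((BV O).equivariant h i σ τ ρ h₁ h₂ x.1 y.1)
  d := (BV O).d.restrict fun _ hx => d_mem_bvSub hx
  par_d := fun x => Subtype.ext ((BV O).par_d x.1)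
  d_act := fun σ x => Subtype.ext ((BV O).d_act σ x.1)
  d_comp := fun h i x y => Subtype.ext ((BV O).d_comp h i x.1 y.1)

/-- The inclusion `i : bv O → BV O`, which is compatible with all operations except the unit. -/
def bvIncl [CharZero k] {n : ℕ} : (bv O).obj n →ₗ[k] (BV O).obj n := (bvSub O n).subtype

/-- The map `p = q ∘ i : bv O → O`. -/
def bvProj [CharZero k] {n : ℕ} : (bv O).obj n →ₗ[k] O.obj n := (bvAug O).app ∘ₗ bvIncl O

end
/-! ### The endomorphism operad -/

section
variable {m n l : ℕ} (h : m + n = l) (i : Fin (m + 1))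

theorem innerPos_injective {a b : Fin (n + 1)} (e : innerPos h i a = innerPos h i b) : a = b := by
  have := congrArg Fin.val e
  simp only [innerPos] at this
  ext; omega

theorem outerPos_injective {j j' : Fin (m + 1)} (hj : j ≠ i) (hj' : j' ≠ i)
    (e : outerPos h i j = outerPos h i j') : j = j' := by
  have e' := congrArg Fin.val e
  have h1 : (j : ℕ) ≠ i := fun e => hj (Fin.ext e)
  have h2 : (j' : ℕ) ≠ i := fun e => hj' (Fin.ext e)
  simp only [outerPos] at e'
  ext
  split_ifs at e' <;> omega

theorem outerPos_ne_innerPos {j : Fin (m + 1)} (hj : j ≠ i) (a : Fin (n + 1)) :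
    outerPos h i j ≠ innerPos h i a := by
  intro e
  have e' := congrArg Fin.val e
  have h1 : (j : ℕ) ≠ i := fun e => hj (Fin.ext e)
  simp only [outerPos, innerPos] at e'
  split_ifs at e' <;> omega

/-- The arguments of `f` in `f ∘_i g`, when the arguments of `f ∘_i g` are `v` and `g` takes the
value `w`. -/
def insVec {M : Type v} (v : Fin (l + 1) → M) (w : M) (j : Fin (m + 1)) : M :=
  if j = i then w else v (outerPos h i j)

theorem insVec_update_outer {M : Type v} (v : Fin (l + 1) → M) (w x : M) {j : Fin (m + 1)}
    (hj : j ≠ i) : insVec h i (Function.update v (outerPos h i j) x) w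
      = Function.update (insVec h i v w) j x := by
  funext j'
  by_cases e : j' = j
  · subst e; simp [insVec, hj]
  · rw [Function.update_of_ne e]
    by_cases e' : j' = i
    · simp [insVec, e']
    · simp only [insVec, e', if_false]
      exact Function.update_of_ne (fun e'' => e (outerPos_injective h i e' hj e'')) _ _

theorem insVec_update_inner {M : Type v} (v : Fin (l + 1) → M) (w w' x : M) (a : Fin (n + 1)) :
    insVec h i (Function.update v (innerPos h i a) x) w'
      = Function.update (insVec h i v w) i w' := by
  funext j'
  by_cases e : j' = i
  · subst e; simp [insVec]
  · rw [Function.update_of_ne e]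
    simp only [insVec, e, if_false]
    exact Function.update_of_ne (outerPos_ne_innerPos h i e a) _ _

/-- The inputs of `x ∘_i y` are the inputs of `x` other than `i` and the inputs of `y`. -/
theorem sum_outer_inner {A : Type v} [AddCommMonoid A] (F : Fin (l + 1) → A) :
    ∑ c, F c = (∑ j, if j = i then 0 else F (outerPos h i j)) + ∑ a, F (innerPos h i a) := by
  have hb : Function.Bijective (Sum.elim (fun j : {j : Fin (m + 1) // j ≠ i} => outerPos h i j.1)
      (fun a => innerPos h i a)) := by
    constructor
    · rintro (⟨j, hj⟩ | a) (⟨j', hj'⟩ | b) e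
      · exact congrArg Sum.inl (Subtype.ext (outerPos_injective h i hj hj' e))
      · exact absurd e (outerPos_ne_innerPos h i hj b)
      · exact absurd e.symm (outerPos_ne_innerPos h i hj' a)
      · exact congrArg Sum.inr (innerPos_injective h i e)
    · intro c
      rcases outerPos_or_innerPos h i c with ⟨j, hj, rfl⟩ | ⟨a, rfl⟩
      · exact ⟨.inl ⟨j, hj⟩, rfl⟩
      · exact ⟨.inr a, rfl⟩
  rw [← hb.sum_comp, Fintype.sum_sum_type]
  congr 1
  have := Finset.sum_subtype (p := fun j => j ≠ i) (F := inferInstance) (Finset.univ.filter fun j => j ≠ i)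
    (fun j => by simp) (fun j => F (outerPos h i j))
  simp only [Sum.elim_inl]
  refine (this.symm.trans ?_)
  rw [Finset.sum_filter]
  exact Finset.sum_congr rfl fun j _ => by by_cases e : j = i <;> simp [e]

variable {k : Type u} [Field k] {M : Type v} [AddCommGroup M] [Module k M]

/-- Insertion of `g` in the input `i` of `f`, without signs. -/
def insertMap (f : MultilinearMap k (fun _ : Fin (m + 1) => M) M)
    (g : MultilinearMap k (fun _ : Fin (n + 1) => M) M) :
    MultilinearMap k (fun _ : Fin (l + 1) => M) M :=
  MultilinearMap.mk' (fun v => f (insVec h i v (g fun a => v (innerPos h i a))))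
    (by
      intro v c x y
      rcases outerPos_or_innerPos h i c with ⟨j, hj, rfl⟩ | ⟨a, rfl⟩
      · have e : ∀ x, (fun a => Function.update v (outerPos h i j) x (innerPos h i a))
            = fun a => v (innerPos h i a) := fun x => funext fun a =>
          Function.update_of_ne (outerPos_ne_innerPos h i hj a).symm _ _
        simp only [e, insVec_update_outer h i _ _ _ hj, MultilinearMap.map_update_add]
      · have e : ∀ x, (fun b => Function.update v (innerPos h i a) x (innerPos h i b))
            = Function.update (fun b => v (innerPos h i b)) a x := fun x => funext fun b => by
          by_cases eb : b = a
          · subst eb; simp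
          · rw [Function.update_of_ne eb, Function.update_of_ne
              (fun e' => eb (innerPos_injective h i e'))]
        simp only [e, insVec_update_inner h i v (0 : M), MultilinearMap.map_update_add])
    (by
      intro v c r x
      rcases outerPos_or_innerPos h i c with ⟨j, hj, rfl⟩ | ⟨a, rfl⟩
      · have e : ∀ x, (fun a => Function.update v (outerPos h i j) x (innerPos h i a))
            = fun a => v (innerPos h i a) := fun x => funext fun a =>
          Function.update_of_ne (outerPos_ne_innerPos h i hj a).symm _ _
        simp only [e, insVec_update_outer h i _ _ _ hj, MultilinearMap.map_update_smul]
      · have e : ∀ x, (fun b => Function.update v (innerPos h i a) x (innerPos h i b))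
            = Function.update (fun b => v (innerPos h i b)) a x := fun x => funext fun b => by
          by_cases eb : b = a
          · subst eb; simp
          · rw [Function.update_of_ne eb, Function.update_of_ne
              (fun e' => eb (innerPos_injective h i e'))]
        simp only [e, insVec_update_inner h i v (0 : M), MultilinearMap.map_update_smul])

theorem insertMap_apply (f : MultilinearMap k (fun _ : Fin (m + 1) => M) M)
    (g : MultilinearMap k (fun _ : Fin (n + 1) => M) M) (v : Fin (l + 1) → M) :
    insertMap h i f g v = f (insVec h i v (g fun a => v (innerPos h i a))) := rfl

variable (ε : M →ₗ[k] M)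

/-- The parity involution on multilinear maps. -/
def endPar (N : ℕ) : MultilinearMap k (fun _ : Fin N => M) M →ₗ[k]
    MultilinearMap k (fun _ : Fin N => M) M where
  toFun f := (ε.compMultilinearMap f).compLinearMap fun _ => ε
  map_add' f g := by ext v; simp
  map_smul' c f := by ext v; simp

theorem endPar_apply (N : ℕ) (f : MultilinearMap k (fun _ : Fin N => M) M) (v : Fin N → M) :
    endPar ε N f v = ε (f fun j => ε (v j)) := rfl

/-- The partial composition of multilinear maps on a graded space, with the Koszul sign: the
component of `g` of parity `q` is moved past the arguments of `f` that precede it. -/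
def endComp : MultilinearMap k (fun _ : Fin (m + 1) => M) M →ₗ[k]
    MultilinearMap k (fun _ : Fin (n + 1) => M) M →ₗ[k]
    MultilinearMap k (fun _ : Fin (l + 1) => M) M :=
  LinearMap.mk₂ k
    (fun f g => insertMap h i f (parityProj (endPar ε (n + 1)) 0 g)
      + insertMap h i (f.compLinearMap fun j => if j < i then ε else LinearMap.id)
          (parityProj (endPar ε (n + 1)) 1 g))
    (fun f f' g => by
      ext v; simp only [MultilinearMap.add_apply, insertMap_apply,
        MultilinearMap.compLinearMap_apply]; abel)
    (fun c f g => by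
      ext v; simp only [MultilinearMap.add_apply, MultilinearMap.smul_apply, insertMap_apply,
        MultilinearMap.compLinearMap_apply, smul_add])
    (fun f g g' => by
      have e : ∀ (f : MultilinearMap k (fun _ : Fin (m + 1) => M) M)
          (g g' : MultilinearMap k (fun _ : Fin (n + 1) => M) M),
          insertMap h i f (g + g') = insertMap h i f g + insertMap h i f g' := by
        intro f g g'
        ext v
        simp only [MultilinearMap.add_apply, insertMap_apply]
        have := f.map_update_add (insVec h i v 0) i (g fun a => v (innerPos h i a))
          (g' fun a => v (innerPos h i a))
        have e' : ∀ w, Function.update (insVec h i v 0) i w = insVec h i v w := by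
          intro w; funext j; by_cases e : j = i
          · subst e; simp [insVec]
          · rw [Function.update_of_ne e]; simp [insVec, e]
        rwa [e', e', e'] at this
      rw [map_add, map_add, e, e]; abel)
    (fun c f g => by
      have e : ∀ (f : MultilinearMap k (fun _ : Fin (m + 1) => M) M)
          (g : MultilinearMap k (fun _ : Fin (n + 1) => M) M),
          insertMap h i f (c • g) = c • insertMap h i f g := by
        intro f g
        ext v
        simp only [MultilinearMap.smul_apply, insertMap_apply]
        have := f.map_update_smul (insVec h i v 0) i c (g fun a => v (innerPos h i a))
        have e' : ∀ w, Function.update (insVec h i v 0) i w = insVec h i v w := by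
          intro w; funext j; by_cases e : j = i
          · subst e; simp [insVec]
          · rw [Function.update_of_ne e]; simp [insVec, e]
        rwa [e', e'] at this
      rw [map_smul, map_smul, e, e, smul_add])

/-- The Koszul exponent of the permutation that takes `v_0 ⊗ ⋯ ⊗ v_n` to
`v_{σ 0} ⊗ ⋯ ⊗ v_{σ n}`, where `v_j` has parity `p j`. -/
def koszul {N : ℕ} (σ : Equiv.Perm (Fin N)) (p : Fin N → ZMod 2) : ZMod 2 :=
  ∑ a, ∑ b, if a < b ∧ σ b < σ a then p (σ a) * p (σ b) else 0

/-- The action of permutations on multilinear maps on a graded space: up to the Koszul sign,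
`(σ f)(v_0, …, v_n) = f(v_{σ 0}, …, v_{σ n})`. -/
def endAct {N : ℕ} (σ : Equiv.Perm (Fin N)) : MultilinearMap k (fun _ : Fin N => M) M →ₗ[k]
    MultilinearMap k (fun _ : Fin N => M) M where
  toFun f := ∑ p : Fin N → ZMod 2, sgn k (koszul σ p) •
    (f.domDomCongr σ).compLinearMap fun j => parityProj ε (p j)
  map_add' f g := by
    rw [← Finset.sum_add_distrib]; refine Finset.sum_congr rfl fun p _ => ?_
    ext v; simp
  map_smul' c f := by
    rw [Finset.smul_sum]; refine Finset.sum_congr rfl fun p _ => ?_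
    ext v; simp [mul_left_comm, smul_smul, mul_comm]

/-! Values on homogeneous arguments. -/

variable [CharZero k]

theorem multilinear_ext_parity (hε : ∀ x, ε (ε x) = x) {N : ℕ}
    {f g : MultilinearMap k (fun _ : Fin N => M) M}
    (H : ∀ (p : Fin N → ZMod 2) (v : Fin N → M), (∀ j, HasParity ε (p j) (v j)) → f v = g v) :
    f = g := by
  ext v
  have hv : v = fun j => ∑ q : ZMod 2, parityProj ε q (v j) := by
    funext j
    have : (Finset.univ : Finset (ZMod 2)) = {0, 1} := by decide
    rw [this, Finset.sum_pair (by decide), parityProj_add]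
  rw [hv, MultilinearMap.map_sum, MultilinearMap.map_sum]
  exact Finset.sum_congr rfl fun r _ => H r _ fun j => parityProj_hasParity ε hε _ _

theorem endAct_apply {N : ℕ} (σ : Equiv.Perm (Fin N)) (f : MultilinearMap k (fun _ : Fin N => M) M)
    {p : Fin N → ZMod 2} {v : Fin N → M} (hv : ∀ j, HasParity ε (p j) (v j)) :
    endAct ε σ f v = sgn k (koszul σ p) • f fun j => v (σ j) := by
  simp only [endAct, LinearMap.coe_mk, AddHom.coe_mk, MultilinearMap.sum_apply,
    MultilinearMap.smul_apply, MultilinearMap.compLinearMap_apply,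
    MultilinearMap.domDomCongr_apply]
  rw [Finset.sum_eq_single p]
  · congr 2; funext j; rw [parityProj_of_hasParity ε (hv _), if_pos rfl]
  · intro q _ hq
    obtain ⟨j, hj⟩ := Function.ne_iff.1 hq
    rw [f.map_coord_zero (σ.symm j), smul_zero]
    simp [parityProj_of_hasParity ε (hv j), hj]
  · simp

theorem HasParity.eps {p : ZMod 2} {x : M} (hx : HasParity ε p x) : ε x = sgn k p • x := hx

theorem sgn_sum {ι : Type*} (s : Finset ι) (p : ι → ZMod 2) :
    ∏ j ∈ s, sgn k (p j) = sgn k (∑ j ∈ s, p j) := by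
  classical
  induction s using Finset.induction_on with
  | empty => simp
  | insert a s ha ih => rw [Finset.prod_insert ha, Finset.sum_insert ha, sgn_add, ih]

theorem hasParity_apply {N : ℕ} {f : MultilinearMap k (fun _ : Fin N => M) M} {q : ZMod 2}
    (hf : HasParity (endPar ε N) q f) {p : Fin N → ZMod 2} {v : Fin N → M}
    (hv : ∀ j, HasParity ε (p j) (v j)) : HasParity ε (q + ∑ j, p j) (f v) := by
  have h1 := congrArg (fun F => F v) (show endPar ε N f = sgn k q • f from hf)
  simp only [endPar_apply, MultilinearMap.smul_apply] at h1
  have h2 : (fun j => ε (v j)) = fun j => sgn k (p j) • v j := funext fun j => hv j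
  rw [h2, MultilinearMap.map_smul_univ, map_smul, sgn_sum] at h1
  have h3 := congrArg (fun x => sgn k (∑ j, p j) • x) h1
  simp only [smul_smul, sgn_mul_self, one_smul] at h3
  rw [HasParity, h3, sgn_add, mul_comm]

/-- The sum of the parities of the arguments that precede position `t`. -/
def below {N : ℕ} (p : Fin N → ZMod 2) (t : ℕ) : ZMod 2 := ∑ c : Fin N, if (c : ℕ) < t then p c else 0

theorem endComp_apply (f : MultilinearMap k (fun _ : Fin (m + 1) => M) M)
    {g : MultilinearMap k (fun _ : Fin (n + 1) => M) M} {q : ZMod 2}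
    (hg : HasParity (endPar ε (n + 1)) q g) {p : Fin (l + 1) → ZMod 2} {v : Fin (l + 1) → M}
    (hv : ∀ j, HasParity ε (p j) (v j)) :
    endComp h i ε f g v = sgn k (q * below p i) •
      f (insVec h i v (g fun a => v (innerPos h i a))) := by
  simp only [endComp, LinearMap.mk₂_apply, parityProj_of_hasParity _ hg,
    MultilinearMap.add_apply, insertMap_apply]
  rcases zmod2_cases q with rfl | rfl
  · simp only [if_true, zero_mul, sgn_zero, one_smul, one_ne_zero, if_false,
      MultilinearMap.zero_apply]
    rw [(MultilinearMap.compLinearMap _ _).map_coord_zero i (by simp [insVec]), add_zero]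
  · simp only [if_true, one_mul, zero_ne_one, if_false, MultilinearMap.zero_apply]
    rw [f.map_coord_zero i (by simp [insVec]), zero_add, MultilinearMap.compLinearMap_apply]
    set w := insVec h i v (g fun a => v (innerPos h i a)) with hw
    have e : (fun j => (if j < i then ε else LinearMap.id) (w j))
        = fun j => sgn k (if j < i then p (outerPos h i j) else 0) • w j := by
      funext j
      by_cases hj : j < i
      · simp only [hj, if_true, hw, insVec, hj.ne, if_false]; exact hv _
      · simp [hj]
    rw [e, MultilinearMap.map_smul_univ, sgn_sum]
    congr 2
    rw [below, sum_outer_inner h i]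
    have e2 : ∀ a : Fin (n + 1), (if ((innerPos h i a : Fin (l + 1)) : ℕ) < i
        then p (innerPos h i a) else 0) = 0 := fun a => if_neg (by simp [innerPos])
    simp only [e2, Finset.sum_const_zero, add_zero]
    refine Finset.sum_congr rfl fun j _ => ?_
    by_cases hj : j = i
    · simp [hj]
    · have hj' : (j : ℕ) ≠ i := fun e => hj (Fin.ext e)
      have : ((outerPos h i j : Fin (l + 1)) : ℕ) < i ↔ j < i := by
        rw [Fin.lt_def]; simp only [outerPos]; split_ifs <;> omega
      simp [hj, this]


theorem zmod2_add_self (a : ZMod 2) : a + a = 0 := by revert a; decide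

theorem below_insVec (p : Fin (l + 1) → ZMod 2) (w : ZMod 2) (t t' : ℕ) (h1 : t ≤ i → t' = t)
    (h2 : (i : ℕ) < t → t' = t + n) :
    below (insVec h i p w) t
      = below p t' + if (i : ℕ) < t then w + ∑ a, p (innerPos h i a) else 0 := by
  have e1 : ∀ j : Fin (m + 1), (if j = i then 0 else
      if ((outerPos h i j : Fin (l + 1)) : ℕ) < t' then p (outerPos h i j) else 0)
      = if j = i then 0 else if (j : ℕ) < t then insVec h i p w j else 0 := by
    intro j
    by_cases hj : j = i
    · simp [hj]
    · have hj' : (j : ℕ) ≠ i := fun e => hj (Fin.ext e)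
      have : ((outerPos h i j : Fin (l + 1)) : ℕ) < t' ↔ (j : ℕ) < t := by
        simp only [outerPos]; split_ifs <;> omega
      simp only [hj, this, insVec, if_false]
  have e2 : ∀ a : Fin (n + 1), (if ((innerPos h i a : Fin (l + 1)) : ℕ) < t'
      then p (innerPos h i a) else 0) = if (i : ℕ) < t then p (innerPos h i a) else 0 := by
    intro a
    have : ((innerPos h i a : Fin (l + 1)) : ℕ) < t' ↔ (i : ℕ) < t := by
      simp only [innerPos]; omega
    simp only [this]
  have e3 : below (insVec h i p w) t = (∑ j : Fin (m + 1), if j = i then 0 else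
      if (j : ℕ) < t then insVec h i p w j else 0) + if (i : ℕ) < t then w else 0 := by
    have : (if (i : ℕ) < t then w else 0)
        = ∑ j : Fin (m + 1), if j = i then (if (i : ℕ) < t then w else 0) else 0 := by simp
    rw [this, ← Finset.sum_add_distrib, below]
    refine Finset.sum_congr rfl fun j _ => ?_
    by_cases hj : j = i
    · subst hj; simp [insVec]
    · simp [hj]
  rw [e3, below, sum_outer_inner h i]
  simp only [e1, e2]
  by_cases ht : (i : ℕ) < t
  · simp only [ht, if_true]
    rw [add_assoc, add_comm (∑ a, p (innerPos h i a)), add_assoc, zmod2_add_self, add_zero]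
  · simp [ht]

theorem hasParity_insVec {p : Fin (l + 1) → ZMod 2} {v : Fin (l + 1) → M}
    (hv : ∀ j, HasParity ε (p j) (v j)) {q : ZMod 2} {w : M} (hw : HasParity ε q w)
    (j : Fin (m + 1)) : HasParity ε (insVec h i p q j) (insVec h i v w j) := by
  by_cases hj : j = i
  · simpa [insVec, hj] using hw
  · simpa [insVec, hj] using hv _

theorem map_insVec_smul (f : MultilinearMap k (fun _ : Fin (m + 1) => M) M)
    (v : Fin (l + 1) → M) (c : k) (w : M) :
    f (insVec h i v (c • w)) = c • f (insVec h i v w) := by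
  have := f.map_update_smul (insVec h i v 0) i c w
  have e' : ∀ w, Function.update (insVec h i v 0) i w = insVec h i v w := by
    intro w; funext j; by_cases e : j = i
    · subst e; simp [insVec]
    · rw [Function.update_of_ne e]; simp [insVec, e]
  rwa [e', e'] at this

theorem koszul_mul {N : ℕ} (σ τ : Equiv.Perm (Fin N)) (p : Fin N → ZMod 2) :
    koszul (σ * τ) p = koszul σ p + koszul τ fun j => p (σ j) := by
  have h1 : koszul σ p = ∑ a, ∑ b, if τ a < τ b ∧ σ (τ b) < σ (τ a)
      then p (σ (τ a)) * p (σ (τ b)) else 0 := by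
    rw [koszul, ← Equiv.sum_comp τ]
    exact Finset.sum_congr rfl fun a _ => (Equiv.sum_comp τ _).symm
  have h2 : ∀ G : Fin N → Fin N → ZMod 2, (∀ a, G a a = 0) →
      ∑ a, ∑ b, G a b = ∑ a, ∑ b, if a < b then G a b + G b a else 0 := by
    intro G hG
    have : ∑ a, ∑ b, (if a < b then G b a else 0) = ∑ a, ∑ b, if b < a then G a b else 0 :=
      Finset.sum_comm
    have h3 : ∀ a b, (if a < b then G a b + G b a else 0)
        = (if a < b then G a b else 0) + if a < b then G b a else 0 := by
      intro a b; split_ifs <;> simp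
    simp only [h3, Finset.sum_add_distrib, this]
    rw [← Finset.sum_add_distrib]
    refine Finset.sum_congr rfl fun a _ => ?_
    rw [← Finset.sum_add_distrib]
    refine Finset.sum_congr rfl fun b _ => ?_
    rcases lt_trichotomy a b with h | h | h
    · simp [h, h.le, not_lt.2 h.le]
    · simp [h, hG]
    · simp [h, not_lt.2 h.le]
  rw [h1, h2 _ (by simp), koszul, koszul, ← Finset.sum_add_distrib]
  refine Finset.sum_congr rfl fun a _ => ?_
  rw [← Finset.sum_add_distrib]
  refine Finset.sum_congr rfl fun b _ => ?_
  have c1 : (if τ b < τ a ∧ σ (τ a) < σ (τ b) then p (σ (τ b)) * p (σ (τ a)) else 0)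
      = if τ b < τ a ∧ σ (τ a) < σ (τ b) then p (σ (τ a)) * p (σ (τ b)) else 0 := by
    rw [mul_comm]
  simp only [Equiv.Perm.mul_apply, c1]
  generalize p (σ (τ a)) * p (σ (τ b)) = P
  by_cases hab : a < b
  · have n1 : τ a ≠ τ b := fun e => hab.ne (τ.injective e)
    have n2 : σ (τ a) ≠ σ (τ b) := fun e => n1 (σ.injective e)
    rcases lt_or_gt_of_ne n1 with u1 | u1 <;> rcases lt_or_gt_of_ne n2 with u2 | u2 <;>
      simp [hab, u1, u2, not_lt.2 u1.le, not_lt.2 u2.le, zmod2_add_self]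
  · simp [hab]

theorem outer_lt_outer {j j' : Fin (m + 1)} (hj : j ≠ i) (hj' : j' ≠ i) :
    outerPos h i j < outerPos h i j' ↔ j < j' := by
  have h1 : (j : ℕ) ≠ i := fun e => hj (Fin.ext e)
  have h2 : (j' : ℕ) ≠ i := fun e => hj' (Fin.ext e)
  simp only [Fin.lt_def, outerPos]
  split_ifs <;> omega

theorem outer_lt_inner {j : Fin (m + 1)} (hj : j ≠ i) (a : Fin (n + 1)) :
    outerPos h i j < innerPos h i a ↔ j < i := by
  have h1 : (j : ℕ) ≠ i := fun e => hj (Fin.ext e)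
  simp only [Fin.lt_def, outerPos, innerPos]
  split_ifs <;> omega

theorem inner_lt_outer {j : Fin (m + 1)} (hj : j ≠ i) (a : Fin (n + 1)) :
    innerPos h i a < outerPos h i j ↔ i < j := by
  have h1 : (j : ℕ) ≠ i := fun e => hj (Fin.ext e)
  simp only [Fin.lt_def, outerPos, innerPos]
  split_ifs <;> omega

theorem inner_lt_inner (a b : Fin (n + 1)) :
    innerPos h i a < innerPos h i b ↔ a < b := by
  simp only [Fin.lt_def, innerPos]; omega

theorem koszul_block (σ : Equiv.Perm (Fin (m + 1))) (τ : Equiv.Perm (Fin (n + 1)))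
    (ρ : Equiv.Perm (Fin (l + 1)))
    (h₁ : ∀ j, j ≠ i → ρ (outerPos h i j) = outerPos h (σ i) (σ j))
    (h₂ : ∀ a, ρ (innerPos h i a) = innerPos h (σ i) (τ a)) (p : Fin (l + 1) → ZMod 2)
    (q : ZMod 2) :
    q * below p (σ i) + koszul σ (insVec h (σ i) p (q + ∑ a, p (innerPos h (σ i) a)))
      + koszul τ (fun a => p (innerPos h (σ i) a))
      = koszul ρ p + q * below (fun c => p (ρ c)) i := by
  set S := ∑ a, p (innerPos h (σ i) a) with hS
  set P : Fin (m + 1) → ZMod 2 := fun j => p (outerPos h (σ i) (σ j)) with hP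
  have hS' : ∑ a, p (innerPos h (σ i) (τ a)) = S :=
    Equiv.sum_comp τ fun a => p (innerPos h (σ i) a)
  -- the part of the exponent of `σ` that involves the input `i`
  set C : Fin (m + 1) → ZMod 2 := fun j => if j = i then 0 else
    if (j < i ∧ σ i < σ j) ∨ (i < j ∧ σ j < σ i) then P j else 0 with hC
  set A : ZMod 2 := ∑ j, ∑ j', if j = i then 0 else if j' = i then 0 else
    if j < j' ∧ σ j' < σ j then P j * P j' else 0 with hA
  have kσ : ∀ w, koszul σ (insVec h (σ i) p w) = A + (∑ j, C j) * w := by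
    intro w
    have e1 : ∀ j, insVec h (σ i) p w (σ j) = if j = i then w else P j := by
      intro j; simp [insVec, hP]
    have e2 : (∑ j, C j) * w = ∑ j, ∑ j', ((if j' = i then (if j = i then 0 else
        if j < i ∧ σ i < σ j then P j * w else 0) else 0) + (if j = i then (if j' = i then 0 else
        if i < j' ∧ σ j' < σ i then w * P j' else 0) else 0)) := by
      simp only [Finset.sum_add_distrib]
      rw [Finset.sum_comm (f := fun j j' => if j = i then (if j' = i then 0 else
        if i < j' ∧ σ j' < σ i then w * P j' else 0) else 0)]
      simp only [Finset.sum_ite_eq', Finset.mem_univ, if_true]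
      rw [← Finset.sum_add_distrib, Finset.sum_mul]
      refine Finset.sum_congr rfl fun j _ => ?_
      simp only [hC]
      by_cases hj : j = i
      · simp [hj]
      · rcases lt_or_gt_of_ne hj with u | u
        · simp [hj, u, not_lt.2 u.le]
        · simp [hj, u, not_lt.2 u.le, mul_comm]
    rw [e2, hA, ← Finset.sum_add_distrib, koszul]
    refine Finset.sum_congr rfl fun j _ => ?_
    rw [← Finset.sum_add_distrib]
    refine Finset.sum_congr rfl fun j' _ => ?_
    rw [e1, e1]
    by_cases hj : j = i <;> by_cases hj' : j' = i <;> simp [hj, hj']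
  have kρ : koszul ρ p = A + (∑ j, C j) * S + koszul τ (fun a => p (innerPos h (σ i) a)) := by
    rw [koszul, sum_outer_inner h i]
    simp only [sum_outer_inner h i]
    have t1 : ∀ j, (if j = i then (0 : ZMod 2) else
        (∑ j', if j' = i then 0 else if outerPos h i j < outerPos h i j' ∧
            ρ (outerPos h i j') < ρ (outerPos h i j)
          then p (ρ (outerPos h i j)) * p (ρ (outerPos h i j')) else 0)
        + ∑ a, if outerPos h i j < innerPos h i a ∧ ρ (innerPos h i a) < ρ (outerPos h i j)
          then p (ρ (outerPos h i j)) * p (ρ (innerPos h i a)) else 0)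
        = (∑ j', if j = i then 0 else if j' = i then 0 else
            if j < j' ∧ σ j' < σ j then P j * P j' else 0)
          + (if j = i then 0 else if j < i ∧ σ i < σ j then P j else 0) * S := by
      intro j
      by_cases hj : j = i
      · simp [hj]
      · have hj1 : σ j ≠ σ i := fun e => hj (σ.injective e)
        simp only [hj, if_false]
        congr 1
        · refine Finset.sum_congr rfl fun j' _ => ?_
          by_cases hj' : j' = i
          · simp [hj']
          · have hj1' : σ j' ≠ σ i := fun e => hj' (σ.injective e)
            simp only [hj', if_false, h₁ _ hj, h₁ _ hj', outer_lt_outer h i hj hj',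
              outer_lt_outer h _ hj1' hj1, hP]
        · simp only [h₁ _ hj, h₂, outer_lt_inner h i hj, inner_lt_outer h _ hj1]
          by_cases hc : j < i ∧ σ i < σ j
          · simp only [hc, if_true, and_self]
            rw [← Finset.mul_sum, hS']
          · simp [hc]
    have t2 : ∀ a, ((∑ j, if j = i then (0 : ZMod 2) else
          if innerPos h i a < outerPos h i j ∧ ρ (outerPos h i j) < ρ (innerPos h i a)
          then p (ρ (innerPos h i a)) * p (ρ (outerPos h i j)) else 0)
        + ∑ b, if innerPos h i a < innerPos h i b ∧ ρ (innerPos h i b) < ρ (innerPos h i a)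
          then p (ρ (innerPos h i a)) * p (ρ (innerPos h i b)) else 0)
        = (∑ j, (if j = i then 0 else if i < j ∧ σ j < σ i then P j else 0))
            * p (innerPos h (σ i) (τ a))
          + ∑ b, if a < b ∧ τ b < τ a
            then p (innerPos h (σ i) (τ a)) * p (innerPos h (σ i) (τ b)) else 0 := by
      intro a
      congr 1
      · rw [Finset.sum_mul]
        refine Finset.sum_congr rfl fun j _ => ?_
        by_cases hj : j = i
        · simp [hj]
        · have hj1 : σ j ≠ σ i := fun e => hj (σ.injective e)
          simp only [hj, if_false, h₁ _ hj, h₂, inner_lt_outer h i hj, outer_lt_inner h _ hj1, hP]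
          by_cases hc : i < j ∧ σ j < σ i
          · simp [hc, mul_comm]
          · simp [hc]
      · simp only [h₂, inner_lt_inner]
    simp only [t1, t2, Finset.sum_add_distrib]
    rw [← Finset.mul_sum, hS', ← Finset.sum_mul, koszul, hA]
    have t3 : ∑ j, C j = (∑ j, if j = i then 0 else if j < i ∧ σ i < σ j then P j else 0)
        + ∑ j, if j = i then 0 else if i < j ∧ σ j < σ i then P j else 0 := by
      rw [← Finset.sum_add_distrib]
      refine Finset.sum_congr rfl fun j _ => ?_
      simp only [hC]
      by_cases hj : j = i
      · simp [hj]
      · rcases lt_or_gt_of_ne hj with u | u <;> simp [hj, u, not_lt.2 u.le]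
    rw [t3]
    ring
  have b1 : below (fun c => p (ρ c)) i = ∑ j, if j = i then 0 else if j < i then P j else 0 := by
    rw [below, sum_outer_inner h i]
    have : ∀ a : Fin (n + 1), (if ((innerPos h i a : Fin (l + 1)) : ℕ) < i then
        p (ρ (innerPos h i a)) else 0) = 0 := fun a => if_neg (by simp [innerPos])
    simp only [this, Finset.sum_const_zero, add_zero]
    refine Finset.sum_congr rfl fun j _ => ?_
    by_cases hj : j = i
    · simp [hj]
    · have hj' : (j : ℕ) ≠ i := fun e => hj (Fin.ext e)
      have : ((outerPos h i j : Fin (l + 1)) : ℕ) < i ↔ j < i := by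
        rw [Fin.lt_def]; simp only [outerPos]; split_ifs <;> omega
      simp [hj, this, h₁ j hj, hP]
  have b2 : below p (σ i) = ∑ j, if j = i then 0 else if σ j < σ i then P j else 0 := by
    rw [below, sum_outer_inner h (σ i), ← Equiv.sum_comp σ]
    have : ∀ a : Fin (n + 1), (if ((innerPos h (σ i) a : Fin (l + 1)) : ℕ) < σ i then
        p (innerPos h (σ i) a) else 0) = 0 := fun a => if_neg (by simp [innerPos])
    simp only [this, Finset.sum_const_zero, add_zero]
    refine Finset.sum_congr rfl fun j _ => ?_
    by_cases hj : j = i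
    · simp [hj]
    · have hj1 : σ j ≠ σ i := fun e => hj (σ.injective e)
      have hj' : (σ j : ℕ) ≠ σ i := fun e => hj1 (Fin.ext e)
      have : ((outerPos h (σ i) (σ j) : Fin (l + 1)) : ℕ) < σ i ↔ σ j < σ i := by
        rw [Fin.lt_def]; simp only [outerPos]; split_ifs <;> omega
      simp [hj, this, hP]
  have b3 : below p (σ i) + ∑ j, C j = below (fun c => p (ρ c)) i := by
    rw [b1, b2, ← Finset.sum_add_distrib]
    refine Finset.sum_congr rfl fun j _ => ?_
    simp only [hC]
    by_cases hj : j = i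
    · simp [hj]
    · have hj1 : σ j ≠ σ i := fun e => hj (σ.injective e)
      rcases lt_or_gt_of_ne hj with u | u <;> rcases lt_or_gt_of_ne hj1 with u' | u' <;>
        simp [hj, u, u', not_lt.2 u.le, not_lt.2 u'.le, zmod2_add_self]
  rw [kσ, kρ, ← b3]
  ring

end
/-- The derivation `[δ, -]` of a graded operad, for an odd operation `δ` of arity one. -/
def GrOperad.bracket {k : Type u} [Field k] (T : GrOperad.{u, w} k) (δ : T.obj 0) {n : ℕ} :
    T.obj n →ₗ[k] T.obj n :=
  T.comp (Nat.zero_add n) 0 δ -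
    ∑ i : Fin (n + 1), (T.comp (Nat.add_zero n) i).flip δ ∘ₗ T.par

section
variable {k : Type u} [Field k] [CharZero k] (T : GrOperad.{u, w} k) (δ : T.obj 0)

theorem GrOperad.bracket_apply {n : ℕ} (x : T.obj n) : T.bracket δ x =
    T.comp (Nat.zero_add n) 0 δ x -
      ∑ i : Fin (n + 1), T.comp (Nat.add_zero n) i (T.par x) δ := by
  simp [GrOperad.bracket]

theorem innerPos_zero {n : ℕ} (a : Fin (n + 1)) : innerPos (Nat.zero_add n) 0 a = a := by
  ext; simp [innerPos]

theorem innerPos_self {n : ℕ} (i : Fin (n + 1)) (a : Fin 1) :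
    innerPos (Nat.add_zero n) i a = i := by
  ext; simp [innerPos]

theorem outerPos_self {n : ℕ} (i j : Fin (n + 1)) : outerPos (Nat.add_zero n) i j = j := by
  ext; simp [outerPos]

theorem GrOperad.bracket_par (hδ : T.par δ = -δ) {n : ℕ} (x : T.obj n) :
    T.par (T.bracket δ x) = -T.bracket δ (T.par x) := by
  simp only [GrOperad.bracket_apply, T.par_comp, hδ, map_sub, map_sum, map_neg,
    LinearMap.neg_apply, Finset.sum_neg_distrib]
  abel

theorem GrOperad.bracket_act {n : ℕ} (σ : Equiv.Perm (Fin (n + 1))) (x : T.obj n) :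
    T.bracket δ (T.act σ x) = T.act σ (T.bracket δ x) := by
  have h1 : T.comp (Nat.zero_add n) 0 δ (T.act σ x)
      = T.act σ (T.comp (Nat.zero_add n) 0 δ x) := by
    have := T.equivariant (Nat.zero_add n) 0 1 σ σ
      (fun j hj => absurd (Subsingleton.elim (α := Fin 1) j 0) hj)
      (fun a => by rw [Equiv.Perm.one_apply, innerPos_zero, innerPos_zero]) δ x
    rwa [T.act_one] at this
  have h2 : ∀ i, T.comp (Nat.add_zero n) (σ i) (T.act σ (T.par x)) δ
      = T.act σ (T.comp (Nat.add_zero n) i (T.par x) δ) := by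
    intro i
    have := T.equivariant (Nat.add_zero n) i σ 1 σ
      (fun j hj => by rw [outerPos_self, outerPos_self])
      (fun a => by rw [innerPos_self, innerPos_self]) (T.par x) δ
    rwa [T.act_one] at this
  rw [GrOperad.bracket_apply, GrOperad.bracket_apply, map_sub, map_sum, h1, T.par_act,
    ← Equiv.sum_comp σ]
  simp only [h2]

theorem GrOperad.bracket_comp (hδ : T.par δ = -δ) {m n l : ℕ} (h : m + n = l) (i : Fin (m + 1))
    (x : T.obj m) (y : T.obj n) : T.bracket δ (T.comp h i x y)
      = T.comp h i (T.bracket δ x) y + T.comp h i (T.par x) (T.bracket δ y) := by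
  have hδ' : HasParity T.par 1 δ := by simp [HasParity, hδ]
  have e0 : T.comp (Nat.zero_add l) 0 δ (T.comp h i x y)
      = T.comp h i (T.comp (Nat.zero_add m) 0 δ x) y := by
    have := T.assoc (Nat.zero_add m) h h (Nat.zero_add l) 0 i δ x y
    rwa [innerPos_zero, eq_comm] at this
  have e1 : ∀ a : Fin (n + 1),
      T.comp (Nat.add_zero l) (innerPos h i a) (T.comp h i (T.par x) (T.par y)) δ
      = T.comp h i (T.par x) (T.comp (Nat.add_zero n) a (T.par y) δ) := fun a =>
    T.assoc h (Nat.add_zero l) (Nat.add_zero n) h i a _ _ _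
  have e2 : T.comp h i (T.comp (Nat.add_zero m) i (T.par x) δ) y
      = T.comp h i (T.par x) (T.comp (Nat.zero_add n) 0 δ y) := by
    have := T.assoc (Nat.add_zero m) h (Nat.zero_add n) h i 0 (T.par x) δ y
    rwa [innerPos_self] at this
  have e3 : ∀ j : Fin (m + 1), j ≠ i →
      T.comp (Nat.add_zero l) (outerPos h i j) (T.comp h i (T.par x) (T.par y)) δ
      = T.comp h i (T.comp (Nat.add_zero m) j (T.par x) δ) y := by
    intro j hj
    refine parity_induction T.par T.par_par (Q := fun y =>
      T.comp (Nat.add_zero l) (outerPos h i j) (T.comp h i (T.par x) (T.par y)) δ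
        = T.comp h i (T.comp (Nat.add_zero m) j (T.par x) δ) y) (fun a b ha hb => by
          rw [map_add, map_add, map_add, LinearMap.add_apply, ha, hb, ← map_add])
      (fun p y hy => ?_) y
    have hy' : T.par y = sgn k p • y := hy
    have := T.parallel h (Nat.add_zero l) (Nat.add_zero m) h i j hj.symm p 1 (T.par x) y δ hy hδ'
    rw [outerPos_self] at this
    rw [hy', map_smul, map_smul, LinearMap.smul_apply, this, mul_one, smul_smul, sgn_mul_self,
      one_smul]
  have e4 : (∑ j, if j = i then 0 else
        T.comp (Nat.add_zero l) (outerPos h i j) (T.comp h i (T.par x) (T.par y)) δ)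
      = (∑ j, T.comp h i (T.comp (Nat.add_zero m) j (T.par x) δ) y)
        - T.comp h i (T.par x) (T.comp (Nat.zero_add n) 0 δ y) := by
    rw [eq_sub_iff_add_eq, ← e2]
    have : T.comp h i (T.comp (Nat.add_zero m) i (T.par x) δ) y = ∑ j, if j = i then
      T.comp h i (T.comp (Nat.add_zero m) i (T.par x) δ) y else 0 := by simp
    rw [this, ← Finset.sum_add_distrib]
    refine Finset.sum_congr rfl fun j _ => ?_
    by_cases hj : j = i
    · simp [hj]
    · simp [hj, e3 j hj]
  rw [GrOperad.bracket_apply, GrOperad.bracket_apply, GrOperad.bracket_apply, T.par_comp,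
    sum_outer_inner h i, e4]
  simp only [e0, e1, map_sub, map_sum, LinearMap.sub_apply, LinearMap.sum_apply]
  abel

end

/-- A dg vector space: a `ℤ/2`-graded vector space with an odd differential. -/
structure DGSpace (k : Type u) [Field k] where
  carrier : Type v
  [grp : AddCommGroup carrier]
  [mod : Module k carrier]
  par : carrier →ₗ[k] carrier
  d : carrier →ₗ[k] carrier
  par_par : ∀ x, par (par x) = x
  par_d : ∀ x, par (d x) = -d (par x)
  d_d : ∀ x, d (d x) = 0

attribute [instance] DGSpace.grp DGSpace.mod

section
variable {k : Type u} [Field k] [CharZero k]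

/-- A linear operator as an operation of arity one. -/
def endLin {M : Type v} [AddCommGroup M] [Module k M] :
    (M →ₗ[k] M) →ₗ[k] MultilinearMap k (fun _ : Fin 1 => M) M where
  toFun f := MultilinearMap.ofSubsingleton k M M (0 : Fin 1) f
  map_add' f g := by ext v; simp
  map_smul' c f := by ext v; simp

theorem endLin_apply {M : Type v} [AddCommGroup M] [Module k M] (f : M →ₗ[k] M)
    (v : Fin 1 → M) : endLin f v = f (v 0) := rfl

section
variable {M : Type v} [AddCommGroup M] [Module k M] (ε : M →ₗ[k] M)

theorem endPar_comp {m n l : ℕ} (hε : ∀ x, ε (ε x) = x) (h : m + n = l) (i : Fin (m + 1))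
    (f : MultilinearMap k (fun _ : Fin (m + 1) => M) M)
    (g : MultilinearMap k (fun _ : Fin (n + 1) => M) M) :
    endPar ε _ (endComp h i ε f g) = endComp h i ε (endPar ε _ f) (endPar ε _ g) := by
  have hP : ∀ x, endPar ε (n + 1) (endPar ε (n + 1) x) = x := fun x => by
    ext v; simp [endPar_apply, hε]
  refine parity_induction (endPar ε (n + 1)) hP
    (Q := fun g => endPar ε _ (endComp h i ε f g) = endComp h i ε (endPar ε _ f) (endPar ε _ g))
    (fun a b ha hb => by rw [map_add, map_add, map_add, ha, hb, ← map_add]) (fun q g hg => ?_) g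
  refine multilinear_ext_parity ε hε fun p v hv => ?_
  have hg' : HasParity (endPar ε (n + 1)) q (endPar ε (n + 1) g) := by
    have hg2 : endPar ε (n + 1) g = sgn k q • g := hg
    simp only [HasParity]; rw [hg2, map_smul, hg2]
  have hv' : ∀ j, HasParity ε (p j) (ε (v j)) := fun j => by
    have hv2 : ε (v j) = sgn k (p j) • v j := hv j
    simp only [HasParity]; rw [hv2, map_smul, hv2]
  rw [endPar_apply, endComp_apply h i ε f hg hv', endComp_apply h i ε _ hg' hv, map_smul,
    endPar_apply, endPar_apply]
  congr 3
  funext j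
  by_cases hj : j = i
  · simp [insVec, hj, hε]
  · simp [insVec, hj]

theorem endPar_act {N : ℕ} (hε : ∀ x, ε (ε x) = x) (σ : Equiv.Perm (Fin N))
    (f : MultilinearMap k (fun _ : Fin N => M) M) :
    endPar ε N (endAct ε σ f) = endAct ε σ (endPar ε N f) := by
  refine multilinear_ext_parity ε hε fun p v hv => ?_
  have hv' : ∀ j, HasParity ε (p j) (ε (v j)) := fun j => by
    have hv2 : ε (v j) = sgn k (p j) • v j := hv j
    simp only [HasParity]; rw [hv2, map_smul, hv2]
  rw [endPar_apply, endAct_apply ε σ f hv', endAct_apply ε σ _ hv, map_smul, endPar_apply]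

theorem HasParity.endPar_act {N : ℕ} (hε : ∀ x, ε (ε x) = x) (σ : Equiv.Perm (Fin N))
    {f : MultilinearMap k (fun _ : Fin N => M) M} {q : ZMod 2}
    (hf : HasParity (endPar ε N) q f) : HasParity (endPar ε N) q (endAct ε σ f) := by
  have hf2 : endPar ε N f = sgn k q • f := hf
  simp only [HasParity]; rw [_root_.endPar_act ε hε, hf2, map_smul]

theorem endPar_endPar (hε : ∀ x, ε (ε x) = x) {N : ℕ}
    (f : MultilinearMap k (fun _ : Fin N => M) M) : endPar ε N (endPar ε N f) = f := by
  ext v; simp [endPar_apply, hε]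

theorem HasParity.endComp {m n l : ℕ} (hε : ∀ x, ε (ε x) = x) (h : m + n = l) (i : Fin (m + 1))
    {f : MultilinearMap k (fun _ : Fin (m + 1) => M) M}
    {g : MultilinearMap k (fun _ : Fin (n + 1) => M) M} {p q : ZMod 2}
    (hf : HasParity (endPar ε _) p f) (hg : HasParity (endPar ε _) q g) :
    HasParity (endPar ε _) (p + q) (endComp h i ε f g) := by
  have hf2 : endPar ε _ f = sgn k p • f := hf
  have hg2 : endPar ε _ g = sgn k q • g := hg
  simp only [HasParity]
  rw [endPar_comp ε hε, hf2, hg2, map_smul, map_smul, LinearMap.smul_apply, smul_smul, sgn_add,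
    mul_comm]

theorem endAct_one {N : ℕ} (hε : ∀ x, ε (ε x) = x)
    (f : MultilinearMap k (fun _ : Fin N => M) M) : endAct ε 1 f = f := by
  refine multilinear_ext_parity ε hε fun p v hv => ?_
  rw [endAct_apply ε 1 f hv]
  have : koszul 1 p = 0 := by
    refine Finset.sum_eq_zero fun a _ => Finset.sum_eq_zero fun b _ => if_neg ?_
    rintro ⟨h1, h2⟩
    exact absurd h1 (not_lt.2 h2.le)
  simp [this]

theorem endAct_mul {N : ℕ} (hε : ∀ x, ε (ε x) = x) (σ τ : Equiv.Perm (Fin N))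
    (f : MultilinearMap k (fun _ : Fin N => M) M) :
    endAct ε (σ * τ) f = endAct ε σ (endAct ε τ f) := by
  refine multilinear_ext_parity ε hε fun p v hv => ?_
  rw [endAct_apply ε _ f hv, endAct_apply ε σ _ hv,
    endAct_apply ε τ f (p := fun j => p (σ j)) fun j => hv (σ j), koszul_mul, sgn_add, smul_smul]
  rfl

theorem end_one_comp {n : ℕ} (hε : ∀ x, ε (ε x) = x)
    (f : MultilinearMap k (fun _ : Fin (n + 1) => M) M) :
    endComp (Nat.zero_add n) 0 ε (endLin LinearMap.id) f = f := by
  refine parity_induction (endPar ε (n + 1)) (endPar_endPar ε hε)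
    (Q := fun f => endComp (Nat.zero_add n) 0 ε (endLin LinearMap.id) f = f)
    (fun a b ha hb => by rw [map_add, ha, hb]) (fun q f hf => ?_) f
  refine multilinear_ext_parity ε hε fun p v hv => ?_
  rw [endComp_apply _ _ ε _ hf hv, endLin_apply]
  simp [below, insVec, innerPos_zero]

theorem end_comp_one {n : ℕ} (hε : ∀ x, ε (ε x) = x) (i : Fin (n + 1))
    (f : MultilinearMap k (fun _ : Fin (n + 1) => M) M) :
    endComp (Nat.add_zero n) i ε f (endLin LinearMap.id) = f := by
  have h1 : HasParity (endPar ε 1) 0 (endLin (LinearMap.id : M →ₗ[k] M)) := by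
    simp only [HasParity, sgn_zero, one_smul]; ext v; simp [endPar_apply, endLin_apply, hε]
  refine multilinear_ext_parity ε hε fun p v hv => ?_
  rw [endComp_apply _ _ ε _ h1 hv, endLin_apply, zero_mul, sgn_zero, one_smul]
  congr 1
  funext j
  by_cases hj : j = i
  · simp [insVec, hj, innerPos_self]
  · simp [insVec, hj, outerPos_self]

theorem end_assoc (hε : ∀ x, ε (ε x) = x) {m n r mn nr l : ℕ} (h₁ : m + n = mn)
    (h₂ : mn + r = l) (h₃ : n + r = nr) (h₄ : m + nr = l) (i : Fin (m + 1)) (j : Fin (n + 1))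
    (x : MultilinearMap k (fun _ : Fin (m + 1) => M) M)
    (y : MultilinearMap k (fun _ : Fin (n + 1) => M) M)
    (z : MultilinearMap k (fun _ : Fin (r + 1) => M) M) :
    endComp h₂ (innerPos h₁ i j) ε (endComp h₁ i ε x y) z
      = endComp h₄ i ε x (endComp h₃ j ε y z) := by
  refine parity_induction (endPar ε (n + 1)) (endPar_endPar ε hε)
    (Q := fun y => endComp h₂ (innerPos h₁ i j) ε (endComp h₁ i ε x y) z
      = endComp h₄ i ε x (endComp h₃ j ε y z))
    (fun a b ha hb => by simp only [map_add, LinearMap.add_apply, ha, hb]) (fun q y hy => ?_) y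
  refine parity_induction (endPar ε (r + 1)) (endPar_endPar ε hε)
    (Q := fun z => endComp h₂ (innerPos h₁ i j) ε (endComp h₁ i ε x y) z
      = endComp h₄ i ε x (endComp h₃ j ε y z))
    (fun a b ha hb => by simp only [map_add, ha, hb]) (fun s z hz => ?_) z
  refine multilinear_ext_parity ε hε fun p v hv => ?_
  have hzv := hasParity_apply ε hz (p := fun a => p (innerPos h₂ (innerPos h₁ i j) a))
    (v := fun a => v (innerPos h₂ (innerPos h₁ i j) a)) (fun a => hv _)
  rw [endComp_apply h₂ _ ε _ hz hv, endComp_apply h₁ i ε x hy (hasParity_insVec _ _ ε hv hzv),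
    endComp_apply h₄ i ε x (hy.endComp ε hε h₃ j hz) hv,
    endComp_apply h₃ j ε y hz (p := fun a => p (innerPos h₄ i a)) (fun a => hv _),
    map_insVec_smul, smul_smul, smul_smul, ← sgn_add, ← sgn_add]
  have p1 : ∀ b, innerPos h₂ (innerPos h₁ i j) b = innerPos h₄ i (innerPos h₃ j b) := fun b => by
    ext; simp only [innerPos]; omega
  have p2 : ∀ a, a ≠ j → outerPos h₂ (innerPos h₁ i j) (innerPos h₁ i a)
      = innerPos h₄ i (outerPos h₃ j a) := fun a ha => by
    have ha' : (a : ℕ) ≠ j := fun e => ha (Fin.ext e)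
    ext; simp only [innerPos, outerPos]
    have : (i : ℕ) + a < i + j ↔ (a : ℕ) < j := by omega
    simp only [this]
    split_ifs <;> omega
  have p3 : ∀ a, a ≠ i → outerPos h₂ (innerPos h₁ i j) (outerPos h₁ i a)
      = outerPos h₄ i a := fun a ha => by
    have ha' : (a : ℕ) ≠ i := fun e => ha (Fin.ext e)
    ext; simp only [innerPos, outerPos]; split_ifs <;> omega
  congr 1
  · congr 1
    rw [below_insVec h₂ _ p _ (i : ℕ) (i : ℕ) (fun _ => rfl)
      (fun hlt => absurd hlt (by simp [innerPos]))]
    have e1 := below_insVec h₂ (innerPos h₁ i j) p 0 (innerPos h₁ i j : Fin (mn + 1))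
      (innerPos h₁ i j : Fin (mn + 1)) (fun _ => rfl) (fun hlt => absurd hlt (lt_irrefl _))
    have e2 : below p (innerPos h₁ i j : Fin (mn + 1))
        = below p i + below (fun a => p (innerPos h₄ i a)) j := by
      have s1 : ∀ a : Fin (nr + 1), ((innerPos h₄ i a : Fin (l + 1)) : ℕ)
          < (innerPos h₁ i j : Fin (mn + 1)) ↔ (a : ℕ) < j := fun a => by
        simp only [innerPos]; omega
      have s2 : ∀ a : Fin (nr + 1), ¬((innerPos h₄ i a : Fin (l + 1)) : ℕ) < i := fun a => by
        simp only [innerPos]; omega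
      have s3 : ∀ a : Fin (m + 1), a ≠ i → (((outerPos h₄ i a : Fin (l + 1)) : ℕ)
          < (innerPos h₁ i j : Fin (mn + 1)) ↔ ((outerPos h₄ i a : Fin (l + 1)) : ℕ) < i) :=
        fun a ha => by
          have ha' : (a : ℕ) ≠ i := fun e => ha (Fin.ext e)
          simp only [innerPos, outerPos]; split_ifs <;> omega
      simp only [below, sum_outer_inner h₄ i, s1, s2, if_false, Finset.sum_const_zero, add_zero]
      congr 1
      refine Finset.sum_congr rfl fun a _ => ?_
      by_cases ha : a = i
      · simp [ha]
      · simp [ha, s3 a ha]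
    have s4 : ¬((innerPos h₁ i j : Fin (mn + 1)) : ℕ) < i := by simp [innerPos]
    rw [e2, if_neg s4]
    ring
  · congr 1
    funext a
    by_cases ha : a = i
    · simp only [insVec, ha, if_true]
      congr 1
      funext b
      by_cases hb : b = j
      · simp only [insVec, hb, if_true, p1]
      · have : innerPos h₁ i b ≠ innerPos h₁ i j := fun e => hb (innerPos_injective h₁ i e)
        simp only [insVec, this, hb, if_false, p2 b hb]
    · have : outerPos h₁ i a ≠ innerPos h₁ i j := outerPos_ne_innerPos h₁ i ha j
      simp only [insVec, ha, this, if_false, p3 a ha]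

theorem end_parallel (hε : ∀ x, ε (ε x) = x) {m n r mn mr l : ℕ} (h₁ : m + n = mn)
    (h₂ : mn + r = l) (h₃ : m + r = mr) (h₄ : mr + n = l) (i j : Fin (m + 1)) (hij : i ≠ j)
    (q s : ZMod 2) (x : MultilinearMap k (fun _ : Fin (m + 1) => M) M)
    (y : MultilinearMap k (fun _ : Fin (n + 1) => M) M)
    (z : MultilinearMap k (fun _ : Fin (r + 1) => M) M) (hy : HasParity (endPar ε _) q y)
    (hz : HasParity (endPar ε _) s z) :
    endComp h₂ (outerPos h₁ i j) ε (endComp h₁ i ε x y) z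
      = sgn k (q * s) • endComp h₄ (outerPos h₃ j i) ε (endComp h₃ j ε x z) y := by
  refine multilinear_ext_parity ε hε fun p v hv => ?_
  have hij' : (i : ℕ) ≠ j := fun e => hij (Fin.ext e)
  have hzv := hasParity_apply ε hz (p := fun a => p (innerPos h₂ (outerPos h₁ i j) a))
    (v := fun a => v (innerPos h₂ (outerPos h₁ i j) a)) (fun a => hv _)
  have hyv := hasParity_apply ε hy (p := fun a => p (innerPos h₄ (outerPos h₃ j i) a))
    (v := fun a => v (innerPos h₄ (outerPos h₃ j i) a)) (fun a => hv _)
  rw [MultilinearMap.smul_apply, endComp_apply h₂ _ ε _ hz hv,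
    endComp_apply h₁ i ε x hy (hasParity_insVec _ _ ε hv hzv),
    endComp_apply h₄ _ ε _ hy hv,
    endComp_apply h₃ j ε x hz (hasParity_insVec _ _ ε hv hyv), smul_smul, smul_smul, smul_smul,
    ← sgn_add, ← sgn_add, ← sgn_add]
  have p1 : ∀ a, outerPos h₂ (outerPos h₁ i j) (innerPos h₁ i a)
      = innerPos h₄ (outerPos h₃ j i) a := fun a => by
    ext; simp only [innerPos, outerPos]; split_ifs <;> omega
  have p2 : ∀ a, outerPos h₄ (outerPos h₃ j i) (innerPos h₃ j a)
      = innerPos h₂ (outerPos h₁ i j) a := fun a => by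
    ext; simp only [innerPos, outerPos]; split_ifs <;> omega
  have p3 : ∀ a, a ≠ i → a ≠ j → outerPos h₂ (outerPos h₁ i j) (outerPos h₁ i a)
      = outerPos h₄ (outerPos h₃ j i) (outerPos h₃ j a) := fun a ha hb => by
    have ha' : (a : ℕ) ≠ i := fun e => ha (Fin.ext e)
    have hb' : (a : ℕ) ≠ j := fun e => hb (Fin.ext e)
    ext; simp only [outerPos]; split_ifs <;> omega
  congr 1
  · congr 1
    have e1 := below_insVec h₂ (outerPos h₁ i j) p
      (s + ∑ a, p (innerPos h₂ (outerPos h₁ i j) a)) (i : ℕ)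
      ((outerPos h₃ j i : Fin (mr + 1)) : ℕ)
      (by simp only [outerPos]; split_ifs <;> omega) (by simp only [outerPos]; split_ifs <;> omega)
    have e2 := below_insVec h₄ (outerPos h₃ j i) p
      (q + ∑ a, p (innerPos h₄ (outerPos h₃ j i) a)) (j : ℕ)
      ((outerPos h₁ i j : Fin (mn + 1)) : ℕ)
      (by simp only [outerPos]; split_ifs <;> omega) (by simp only [outerPos]; split_ifs <;> omega)
    have e3 : ∀ a b : ZMod 2, a + b + b = a := by decide
    rw [e1, e2, e3, e3]
    rcases lt_or_gt_of_ne hij' with u | u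
    · have c1 : ¬((outerPos h₁ i j : Fin (mn + 1)) : ℕ) < i := by
        simp only [outerPos]; split_ifs <;> omega
      have c2 : ((outerPos h₃ j i : Fin (mr + 1)) : ℕ) < j := by
        simp only [outerPos]; split_ifs <;> omega
      rw [if_neg c1, if_pos c2]
      have := zmod2_add_self (q * s)
      linear_combination (-1 : ZMod 2) * this
    · have c1 : ((outerPos h₁ i j : Fin (mn + 1)) : ℕ) < i := by
        simp only [outerPos]; split_ifs <;> omega
      have c2 : ¬((outerPos h₃ j i : Fin (mr + 1)) : ℕ) < j := by
        simp only [outerPos]; split_ifs <;> omega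
      rw [if_pos c1, if_neg c2]
      ring
  · congr 1
    funext a
    by_cases ha : a = i
    · have n1 : outerPos h₃ j i = outerPos h₃ j a := by rw [ha]
      have n2 : a ≠ j := fun e => hij (ha.symm.trans e)
      have n3 : ∀ b, innerPos h₁ i b ≠ outerPos h₁ i j := fun b =>
        (outerPos_ne_innerPos h₁ i hij.symm b).symm
      subst ha
      simp only [insVec, if_true, n2, if_false, n3, p1]
    · by_cases hb : a = j
      · have n3 : ∀ b, innerPos h₃ j b ≠ outerPos h₃ j i := fun b =>
          (outerPos_ne_innerPos h₃ j hij b).symm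
        subst hb
        simp only [insVec, if_true, ha, if_false, n3, p2]
      · have n1 : outerPos h₁ i a ≠ outerPos h₁ i j := fun e =>
          hb (outerPos_injective h₁ i ha hij.symm e)
        have n2 : outerPos h₃ j a ≠ outerPos h₃ j i := fun e =>
          ha (outerPos_injective h₃ j hb hij e)
        simp only [insVec, ha, hb, if_false, n1, n2, p3 a ha hb]

theorem end_equivariant (hε : ∀ x, ε (ε x) = x) {m n l : ℕ} (h : m + n = l) (i : Fin (m + 1))
    (σ : Equiv.Perm (Fin (m + 1))) (τ : Equiv.Perm (Fin (n + 1))) (ρ : Equiv.Perm (Fin (l + 1)))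
    (h₁ : ∀ j, j ≠ i → ρ (outerPos h i j) = outerPos h (σ i) (σ j))
    (h₂ : ∀ a, ρ (innerPos h i a) = innerPos h (σ i) (τ a))
    (x : MultilinearMap k (fun _ : Fin (m + 1) => M) M)
    (y : MultilinearMap k (fun _ : Fin (n + 1) => M) M) :
    endComp h (σ i) ε (endAct ε σ x) (endAct ε τ y) = endAct ε ρ (endComp h i ε x y) := by
  refine parity_induction (endPar ε (n + 1)) (endPar_endPar ε hε)
    (Q := fun y => endComp h (σ i) ε (endAct ε σ x) (endAct ε τ y)
      = endAct ε ρ (endComp h i ε x y))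
    (fun a b ha hb => by simp only [map_add, ha, hb]) (fun q y hy => ?_) y
  refine multilinear_ext_parity ε hε fun p v hv => ?_
  have hτ := hy.endPar_act ε hε τ
  have hyv := hasParity_apply ε hτ (p := fun a => p (innerPos h (σ i) a))
    (v := fun a => v (innerPos h (σ i) a)) (fun a => hv _)
  rw [endComp_apply h _ ε _ hτ hv, endAct_apply ε σ x (hasParity_insVec _ _ ε hv hyv),
    endAct_apply ε ρ _ hv,
    endComp_apply h i ε x hy (p := fun c => p (ρ c)) (v := fun c => v (ρ c)) (fun c => hv _),
    endAct_apply ε τ y (p := fun a => p (innerPos h (σ i) a)) (fun a => hv _)]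
  have e : ∀ (c : k) (w : M), (fun j => insVec h (σ i) v (c • w) (σ j))
      = insVec h i (fun b => v (ρ b)) (c • w) := by
    intro c w
    funext j
    by_cases hj : j = i
    · simp [insVec, hj]
    · simp [insVec, hj, h₁ j hj]
  rw [e, map_insVec_smul, smul_smul, smul_smul, smul_smul, ← sgn_add, ← sgn_add, ← sgn_add,
    ← koszul_block h i σ τ ρ h₁ h₂ p q]
  simp only [h₂]

end

variable (V : DGSpace.{u, v} k)

/-- The graded endomorphism operad of `V`, with components `Hom(V^{⊗(n+1)}, V)`. -/
def endGr : GrOperad.{u, v} k where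
  obj := fun n => MultilinearMap k (fun _ : Fin (n + 1) => V.carrier) V.carrier
  par := endPar V.par _
  act := endAct V.par
  comp := fun h i => endComp h i V.par
  one := endLin LinearMap.id
  par_par := endPar_endPar V.par V.par_par
  par_one := by ext v; simp [endPar_apply, endLin_apply, V.par_par]
  par_act := endPar_act V.par V.par_par
  par_comp := endPar_comp V.par V.par_par
  act_one := endAct_one V.par V.par_par
  act_mul := endAct_mul V.par V.par_par
  one_comp := end_one_comp V.par V.par_par
  comp_one := end_comp_one V.par V.par_par
  assoc := end_assoc V.par V.par_par
  parallel := end_parallel V.par V.par_par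
  equivariant := end_equivariant V.par V.par_par

theorem par_endLin_d : endPar V.par 1 (endLin V.d) = -endLin V.d := by
  ext v; simp [endPar_apply, endLin_apply, V.par_d, V.par_par]

/-- The endomorphism operad `E(V)` of a dg vector space, with the differential
`d(f) = d ∘ f - (-1)^|f| ∑ f ∘ (1, …, d, …, 1)`. -/
def endOperad : DiffOperad.{u, v} k where
  toGrOperad := endGr V
  d := (endGr V).bracket (endLin V.d)
  par_d := (endGr V).bracket_par (endLin V.d) (par_endLin_d V)
  d_act := (endGr V).bracket_act (endLin V.d)
  d_comp := (endGr V).bracket_comp (endLin V.d) (par_endLin_d V)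

end
/-! ### Homology and Hodge decompositions -/

section
variable {k : Type u} [Field k] [CharZero k] (V : DGSpace.{u, v} k)

/-- The homology `ker d / im d`, a graded vector space with zero differential. -/
def homology : DGSpace.{u, v} k where
  carrier := LinearMap.ker V.d ⧸ (LinearMap.range V.d).submoduleOf (LinearMap.ker V.d)
  par := Submodule.mapQ _ _ (V.par.restrict (p := LinearMap.ker V.d) (q := LinearMap.ker V.d)
      fun x hx => by
        rw [LinearMap.mem_ker] at hx ⊢
        rw [← neg_neg (V.d (V.par x)), ← V.par_d, hx, map_zero, neg_zero])
    (by
      rintro ⟨x, hx⟩ ⟨y, hy⟩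
      refine ⟨-V.par y, ?_⟩
      have hy' : V.d y = x := hy
      change V.d (-V.par y) = V.par x
      rw [map_neg, ← V.par_d, hy'])
  d := 0
  par_par := by
    intro x
    obtain ⟨x, rfl⟩ := Submodule.Quotient.mk_surjective _ x
    rw [Submodule.mapQ_apply, Submodule.mapQ_apply]
    exact congrArg _ (Subtype.ext (V.par_par x.1))
  par_d := by simp
  d_d := by simp

/-- A Hodge decomposition of a dg vector space. -/
structure Hodge where
  s : V.carrier →ₗ[k] V.carrier
  t : V.carrier →ₗ[k] V.carrier
  par_s : ∀ x, V.par (s x) = -s (V.par x)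
  par_t : ∀ x, V.par (t x) = t (V.par x)
  s_s : ∀ x, s (s x) = 0
  t_t : ∀ x, t (t x) = t x
  d_t : ∀ x, V.d (t x) = t (V.d x)
  s_t : ∀ x, s (t x) = 0
  t_s : ∀ x, t (s x) = 0
  d_s : ∀ x, V.d (s x) + s (V.d x) = x - t x

variable {V}

/-- A Hodge decomposition is canonical if `d t = 0`. -/
def Hodge.IsCanonical (H : Hodge V) : Prop := ∀ x, V.d (H.t x) = 0

/-- For a canonical Hodge decomposition, the projector `t` as a map `V → H(V)`: it takes `v` to
the class of `t v`. -/
def Hodge.toHomology (H : Hodge V) (hc : H.IsCanonical) :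
    V.carrier →ₗ[k] (homology V).carrier :=
  Submodule.mkQ _ ∘ₗ LinearMap.codRestrict (LinearMap.ker V.d) H.t hc

/-- For a canonical Hodge decomposition, the embedding `H(V) → V` with image `im t`: it takes the
class of `z` to `t z`. -/
def Hodge.ofHomology (H : Hodge V) (hc : H.IsCanonical) :
    (homology V).carrier →ₗ[k] V.carrier :=
  Submodule.liftQ _ (H.t ∘ₗ (LinearMap.ker V.d).subtype) (by
    rintro ⟨x, hx⟩ ⟨y, hy⟩
    have hy' : V.d y = x := hy
    change H.t x = 0
    rw [← hy', ← H.d_t, hc])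

/-- `H(V) → V → H(V)` is the identity. -/
theorem Hodge.toHomology_ofHomology (H : Hodge V) (hc : H.IsCanonical)
    (x : (homology V).carrier) : H.toHomology hc (H.ofHomology hc x) = x := by
  obtain ⟨⟨x, hx⟩, rfl⟩ := Submodule.Quotient.mk_surjective _ x
  refine (Submodule.Quotient.eq _).2 ⟨-H.s x, ?_⟩
  have h1 := H.d_s x
  have hx' : V.d x = 0 := hx
  rw [hx', map_zero, add_zero] at h1
  change V.d (-H.s x) = H.t (H.t x) - x
  rw [map_neg, h1, H.t_t]; abel

/-- `V → H(V) → V` is `t`. -/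
theorem Hodge.ofHomology_toHomology (H : Hodge V) (hc : H.IsCanonical) (x : V.carrier) :
    H.ofHomology hc (H.toHomology hc x) = H.t x := H.t_t x

/-- The inclusion `E(H(V)) → E(V)` determined by the projector of a canonical Hodge
decomposition. -/
def Hodge.inclEnd (H : Hodge V) (hc : H.IsCanonical) {n : ℕ} :
    (endOperad (homology V)).obj n →ₗ[k] (endOperad V).obj n where
  toFun φ := ((H.ofHomology hc).compMultilinearMap φ).compLinearMap fun _ => H.toHomology hc
  map_add' f g := by
    refine MultilinearMap.ext fun v => ?_
    exact map_add (H.ofHomology hc) _ _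
  map_smul' c f := by
    refine MultilinearMap.ext fun v => ?_
    exact map_smul (H.ofHomology hc) _ _

theorem endComp_endLin {M : Type v} [AddCommGroup M] [Module k M] (ε a b : M →ₗ[k] M)
    (hε : ∀ x, ε (ε x) = x) :
    endComp (Nat.zero_add 0) 0 ε (endLin a) (endLin b) = endLin (a ∘ₗ b) := by
  refine parity_induction (endPar ε 1) (endPar_endPar ε hε)
    (Q := fun g => ∀ v, endComp (Nat.zero_add 0) 0 ε (endLin a) g v = a (g v))
    (fun x y hx hy v => by simp [hx, hy]) (fun q g hg => ?_) (endLin b) |> fun h => by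
      ext v; rw [h]; rfl
  suffices h : endComp (Nat.zero_add 0) 0 ε (endLin a) g = a.compMultilinearMap g by
    intro v; rw [h]; rfl
  refine multilinear_ext_parity ε hε fun p v hv => ?_
  rw [endComp_apply _ _ ε _ hg hv, endLin_apply]
  simp [below, insVec, innerPos_zero]

/-- The values of the generators of `BV O` in `E(V)`, for an `O`-algebra `V` with a Hodge
decomposition. -/
def hodgeGen {O : DiffOperad.{u, w} k} (f : OperadHom O (endOperad V)) (H : Hodge V) :
    ∀ n : ℕ, BVGen O n → (endOperad V).obj n
  | _, .op x => f.app x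
  | _, .s => endLin H.s
  | _, .t => endLin H.t

theorem hodgeGen_rel {O : DiffOperad.{u, w} k} (f : OperadHom O (endOperad V)) (H : Hodge V)
    {n : ℕ} {a b : OpTerm k (BVGen O) n} (h : BVRel O n a b) :
    a.eval (endOperad V).toGrOperad (hodgeGen f H)
      = b.eval (endOperad V).toGrOperad (hodgeGen f H) := by
  have key := fun a b : V.carrier →ₗ[k] V.carrier => endComp_endLin V.par a b V.par_par
  cases h with
  | op_add x y => exact map_add f.app x y
  | op_smul c x => exact map_smul f.app c x
  | op_par x => exact f.map_par x
  | op_act σ x => exact f.map_act σ x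
  | op_comp h i x y => exact f.map_comp h i x y
  | op_one => exact f.map_one
  | par_s =>
      refine MultilinearMap.ext fun v => ?_
      change V.par (H.s (V.par (v 0))) = (-1 : k) • H.s (v 0)
      rw [H.par_s, V.par_par]; simp
  | par_t =>
      refine MultilinearMap.ext fun v => ?_
      change V.par (H.t (V.par (v 0))) = H.t (v 0)
      rw [H.par_t, V.par_par]
  | s_s =>
      refine (key H.s H.s).trans (MultilinearMap.ext fun v => H.s_s _)
  | t_t => refine (key H.t H.t).trans (MultilinearMap.ext fun v => H.t_t _)
  | s_t => refine (key H.s H.t).trans (MultilinearMap.ext fun v => H.s_t _)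
  | t_s => refine (key H.t H.s).trans (MultilinearMap.ext fun v => H.t_s _)

/-- The action of `BV O` on an `O`-algebra `V` with a Hodge decomposition: its value on a decorated
tree is the amplitude of the tree. -/
def hodgeMap {O : DiffOperad.{u, w} k} (f : OperadHom O (endOperad V)) (H : Hodge V) :
    OperadHom (BV O) (endOperad V) :=
  Presented.liftHom (bvDelta O) (bvDelta_rel O) (endOperad V) (hodgeGen f H) (hodgeGen_rel f H) (by
    have key := fun a b : V.carrier →ₗ[k] V.carrier => endComp_endLin V.par a b V.par_par
    have br : ∀ a : V.carrier →ₗ[k] V.carrier, (endOperad V).d (endLin a)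
        = endLin (V.d ∘ₗ a - (V.par ∘ₗ a ∘ₗ V.par) ∘ₗ V.d) := by
      intro a
      refine ((endGr V).bracket_apply (endLin V.d) (endLin a)).trans ?_
      rw [Fin.sum_univ_one, map_sub, ← key, ← key]
      rfl
    intro n g
    cases g with
    | op x => exact f.map_d x
    | s =>
        refine Eq.trans ?_ (br H.s).symm
        refine (map_sub _ _ _).trans (MultilinearMap.ext fun v => ?_)
        change v 0 - H.t (v 0) = V.d (H.s (v 0)) - V.par (H.s (V.par (V.d (v 0))))
        rw [H.par_s, V.par_par, sub_neg_eq_add, H.d_s]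
    | t =>
        refine Eq.trans ?_ (br H.t).symm
        refine MultilinearMap.ext fun v => ?_
        change (0 : V.carrier) = V.d (H.t (v 0)) - V.par (H.t (V.par (V.d (v 0))))
        rw [H.par_t, V.par_par, H.d_t, sub_self])

end
/-! ### Homogeneous bases -/

section
variable {k : Type u} [Field k] [CharZero k] {M : Type v} [AddCommGroup M] [Module k M]
  (ε : M →ₗ[k] M)

/-- The index set of a homogeneous basis of a graded space; the first entry is the parity. -/
abbrev HIdx : Type := (p : ZMod 2) × Fin (Module.finrank k (parityPart ε p))

variable [Module.Finite k M]

/-- The elements of a homogeneous basis. -/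
def hVec (b : HIdx ε) : M := (Module.finBasis k (parityPart ε b.1) b.2 : M)

/-- The elements of the dual basis. -/
def hCov (hε : ∀ x, ε (ε x) = x) (b : HIdx ε) : Module.Dual k M :=
  (Module.finBasis k (parityPart ε b.1)).coord b.2 ∘ₗ
    LinearMap.codRestrict (parityPart ε b.1) (parityProj ε b.1) (parityProj_hasParity ε hε b.1)

theorem eps_hVec (b : HIdx ε) : ε (hVec ε b) = sgn k b.1 • hVec ε b :=
  (Module.finBasis k (parityPart ε b.1) b.2).2

theorem hCov_eps (hε : ∀ x, ε (ε x) = x) (b : HIdx ε) :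
    hCov ε hε b ∘ₗ ε = sgn k b.1 • hCov ε hε b := by
  ext x
  simp only [hCov, LinearMap.comp_apply, LinearMap.smul_apply]
  rw [← map_smul, ← map_smul]
  congr 1
  refine Subtype.ext ?_
  rw [map_smul]
  change parityProj ε b.1 (ε x) = sgn k b.1 • parityProj ε b.1 x
  have h1 : HasParity ε b.1 (parityProj ε b.1 x) := parityProj_hasParity ε hε b.1 x
  rw [← h1.eps ε]
  simp [parityProj]

theorem sum_hCov_smul_hVec (hε : ∀ x, ε (ε x) = x) (p : ZMod 2) (x : M) :
    ∑ i, hCov ε hε ⟨p, i⟩ x • hVec ε ⟨p, i⟩ = parityProj ε p x := by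
  have := congrArg (parityPart ε p).subtype ((Module.finBasis k (parityPart ε p)).sum_repr
    ⟨parityProj ε p x, parityProj_hasParity ε hε p x⟩)
  rw [map_sum] at this
  exact this

theorem hCov_parityProj (hε : ∀ x, ε (ε x) = x) (b : HIdx ε) (x : M) :
    hCov ε hε b (parityProj ε b.1 x) = hCov ε hε b x := by
  simp only [hCov, LinearMap.comp_apply]
  congr 1
  refine Subtype.ext ?_
  change parityProj ε b.1 (parityProj ε b.1 x) = parityProj ε b.1 x
  rw [parityProj_of_hasParity ε (parityProj_hasParity ε hε b.1 x), if_pos rfl]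

/-- The two bases are dual to each other. -/
theorem hCov_hVec (hε : ∀ x, ε (ε x) = x) (p : ZMod 2)
    (i j : Fin (Module.finrank k (parityPart ε p))) :
    hCov ε hε ⟨p, i⟩ (hVec ε ⟨p, j⟩) = if j = i then 1 else 0 := by
  have h : LinearMap.codRestrict (parityPart ε p) (parityProj ε p) (parityProj_hasParity ε hε p)
      (hVec ε ⟨p, j⟩) = Module.finBasis k (parityPart ε p) j := by
    refine Subtype.ext ?_
    change parityProj ε p (hVec ε ⟨p, j⟩) = hVec ε ⟨p, j⟩
    rw [parityProj_of_hasParity ε (show HasParity ε p _ from eps_hVec ε ⟨p, j⟩), if_pos rfl]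
  simp only [hCov, LinearMap.comp_apply]
  rw [h]
  simp [Finsupp.single_apply]

/-- The canonical element of a graded space tensored with its dual is invariant. -/
theorem sum_hVec_hCov (hε : ∀ x, ε (ε x) = x) (p : ZMod 2) (f g : M →ₗ[k] M)
    (hf : ∀ x, ε (f x) = f (ε x)) (hfg : ∀ x, f (g x) = x)
    {Z : Type*} [AddCommGroup Z] [Module k Z] (B : M →ₗ[k] Module.Dual k M →ₗ[k] Z) :
    ∑ i, B (f (hVec ε ⟨p, i⟩)) (hCov ε hε ⟨p, i⟩ ∘ₗ g)
      = ∑ i, B (hVec ε ⟨p, i⟩) (hCov ε hε ⟨p, i⟩) := by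
  have h1 : ∀ i, f (hVec ε ⟨p, i⟩)
      = ∑ j, hCov ε hε ⟨p, j⟩ (f (hVec ε ⟨p, i⟩)) • hVec ε ⟨p, j⟩ := by
    intro i
    have : HasParity ε p (f (hVec ε ⟨p, i⟩)) := by
      simp only [HasParity]; rw [hf, eps_hVec, map_smul]
    rw [sum_hCov_smul_hVec, parityProj_of_hasParity ε this, if_pos rfl]
  have h2 : ∀ j, hCov ε hε ⟨p, j⟩
      = ∑ i, hCov ε hε ⟨p, j⟩ (f (hVec ε ⟨p, i⟩)) • (hCov ε hε ⟨p, i⟩ ∘ₗ g) := by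
    intro j
    ext x
    simp only [LinearMap.sum_apply, LinearMap.smul_apply, LinearMap.comp_apply, smul_eq_mul]
    have h3 := congrArg (fun y => hCov ε hε ⟨p, j⟩ (f y)) (sum_hCov_smul_hVec ε hε p (g x))
    simp only [map_sum, map_smul, smul_eq_mul] at h3
    have h4 : f (parityProj ε p (g x)) = parityProj ε p x := by
      simp only [parityProj, LinearMap.smul_apply, LinearMap.add_apply, LinearMap.id_apply,
        map_smul, map_add]
      rw [← hf, hfg]
    rw [h4, hCov_parityProj ε hε ⟨p, j⟩] at h3
    rw [← h3]
    exact Finset.sum_congr rfl fun i _ => mul_comm _ _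
  calc _ = ∑ i, ∑ j, hCov ε hε ⟨p, j⟩ (f (hVec ε ⟨p, i⟩)) •
        B (hVec ε ⟨p, j⟩) (hCov ε hε ⟨p, i⟩ ∘ₗ g) := by
        refine Finset.sum_congr rfl fun i _ => ?_
        conv_lhs => rw [h1 i]
        simp only [map_sum, map_smul, LinearMap.sum_apply, LinearMap.smul_apply]
    _ = _ := by
        rw [Finset.sum_comm]
        refine Finset.sum_congr rfl fun j _ => ?_
        conv_rhs => rw [h2 j]
        simp only [map_sum, map_smul]

end

/-! ### The cobar construction -/

section
variable {k : Type u} [Field k] [CharZero k] (P : DiffOperad.{u, w} k)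

/-- Generators of the cobar construction: for every functional `x` on the operations of an arity
greater than one, the operation `ξ(x)` of that arity. -/
inductive CobarGen : ℕ → Type (max u w)
  | xi {n : ℕ} (x : Module.Dual k (P.obj (n + 1))) : CobarGen (n + 1)

/-- Relations of the cobar construction as a graded operad: it is free on the symmetric sequence
`Π P̄^*`, that is, `ξ` is linear, reverses parity, and is equivariant. -/
inductive CobarRel : ∀ n, OpTerm k (CobarGen P) n → OpTerm k (CobarGen P) n → Prop
  | add {n : ℕ} (x y : Module.Dual k (P.obj (n + 1))) :
      CobarRel (n + 1) (.gen (.xi (x + y))) (.add (.gen (.xi x)) (.gen (.xi y)))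
  | smul {n : ℕ} (c : k) (x : Module.Dual k (P.obj (n + 1))) :
      CobarRel (n + 1) (.gen (.xi (c • x))) (.smul c (.gen (.xi x)))
  | par {n : ℕ} (x : Module.Dual k (P.obj (n + 1))) :
      CobarRel (n + 1) (.par (.gen (.xi x))) (.smul (-1) (.gen (.xi (x ∘ₗ P.par))))
  | act {n : ℕ} (σ : Equiv.Perm (Fin (n + 1 + 1))) (x : Module.Dual k (P.obj (n + 1))) :
      CobarRel (n + 1) (.act σ (.gen (.xi x))) (.gen (.xi (x ∘ₗ P.act σ⁻¹)))

/-- The operation `ξ(x)` of the free operad on `Π P̄^*`. -/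
def cobarXi {n : ℕ} : Module.Dual k (P.obj (n + 1)) →ₗ[k] Presented (CobarRel P) (n + 1) where
  toFun x := .mk (.gen (.xi x))
  map_add' x y := Presented.sound (.of (.add x y))
  map_smul' c x := Presented.sound (.of (.smul c x))

theorem par_cobarXi {n : ℕ} (x : Module.Dual k (P.obj (n + 1))) :
    Presented.par (cobarXi P x) = -cobarXi P (x ∘ₗ P.par) := by
  have h : Presented.par (cobarXi P x) = (-1 : k) • cobarXi P (x ∘ₗ P.par) :=
    Presented.sound (.of (.par x))
  rw [h, neg_smul, one_smul]

theorem act_cobarXi {n : ℕ} (σ : Equiv.Perm (Fin (n + 1 + 1)))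
    (x : Module.Dual k (P.obj (n + 1))) :
    Presented.act σ (cobarXi P x) = cobarXi P (x ∘ₗ P.act σ⁻¹) :=
  Presented.sound (.of (.act σ x))

variable {P} (hP : P.Admissible)

/-- The index set of a homogeneous basis of `P` in arity `n + 1`. -/
abbrev DiffOperad.Idx (P : DiffOperad.{u, w} k) (n : ℕ) : Type := HIdx (P.par (n := n))

/-- The elements `e_b` of a homogeneous basis of `P`. -/
def basisVec {n : ℕ} (b : P.Idx n) : P.obj n :=
  haveI := hP.finite n
  hVec P.par b

/-- The elements of the dual basis. -/
def basisCov {n : ℕ} (b : P.Idx n) : Module.Dual k (P.obj n) :=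
  haveI := hP.finite n
  hCov P.par P.par_par b

theorem par_basisVec {n : ℕ} (b : P.Idx n) :
    P.par (basisVec hP b) = sgn k b.1 • basisVec hP b :=
  haveI := hP.finite n
  eps_hVec P.par b

theorem basisCov_par {n : ℕ} (b : P.Idx n) :
    basisCov hP b ∘ₗ P.par = sgn k b.1 • basisCov hP b :=
  haveI := hP.finite n
  hCov_eps P.par P.par_par b

theorem sum_basis (F : ZMod 2 → k) {n : ℕ} (σ : Equiv.Perm (Fin (n + 1)))
    {Z : Type*} [AddCommGroup Z] [Module k Z]
    (B : P.obj n →ₗ[k] Module.Dual k (P.obj n) →ₗ[k] Z) :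
    ∑ b : P.Idx n, F b.1 • B (P.act σ (basisVec hP b)) (basisCov hP b ∘ₗ P.act σ⁻¹)
      = ∑ b : P.Idx n, F b.1 • B (basisVec hP b) (basisCov hP b) := by
  haveI := hP.finite n
  refine (Fintype.sum_sigma _).trans (Eq.trans ?_ (Fintype.sum_sigma _).symm)
  refine Finset.sum_congr rfl fun p _ => ?_
  have key := sum_hVec_hCov P.par P.par_par p (P.act σ) (P.act σ⁻¹) (P.par_act σ)
    (fun x => by rw [← P.act_mul, mul_inv_cancel, P.act_one]) B
  exact Finset.smul_sum.symm.trans ((congrArg (F p • ·) key).trans Finset.smul_sum)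

/-- The contribution to the cobar differential of `ξ(x)` of the trees with two vertices, an upper
vertex whose inputs are `σ 0, …, σ (b + 1)` and a lower vertex to which the other inputs are
attached: the element dual to the composition in `P` along the internal edge. -/
def cobarQuad {a b N : ℕ} (h : a + 1 + (b + 1) = N) (σ : Equiv.Perm (Fin (N + 1)))
    (x : Module.Dual k (P.obj N)) : Presented (CobarRel P) N :=
  ∑ c : P.Idx (a + 1), ∑ c' : P.Idx (b + 1),
    (sgn k (c.1 * (1 + c'.1)) * x (P.act σ (P.comp h 0 (basisVec hP c) (basisVec hP c')))) •
      Presented.act σ (Presented.comp h 0 (cobarXi P (basisCov hP c)) (cobarXi P (basisCov hP c')))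

/-- A permutation that takes `0, …, j - 1` to the elements of `S`. -/
def permOf {N : ℕ} (S : Finset (Fin N)) (j : ℕ) : Equiv.Perm (Fin N) :=
  open Classical in
  if h : ∃ σ : Equiv.Perm (Fin N), ∀ i, σ i ∈ S ↔ (i : ℕ) < j then h.choose else 1

/-- The differential of `ξ(x)` in the cobar construction: the sum of `ξ(d^* x)`, where `d^*` is the
differential of the dual, and of the contributions of all reduced trees with two vertices, where
`S` is the set of the inputs attached to the upper vertex. -/
def cobarD {n : ℕ} (x : Module.Dual k (P.obj (n + 1))) : Presented (CobarRel P) (n + 1) :=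
  cobarXi P (x ∘ₗ P.d ∘ₗ P.par) +
    ∑ a : Fin n, ∑ S ∈ Finset.powersetCard (n - 1 - a + 1 + 1) Finset.univ,
      cobarQuad hP (a := a) (b := n - 1 - a) (by omega) (permOf S (n - 1 - a + 1 + 1)) x

theorem permOf_spec {N j : ℕ} {S : Finset (Fin N)} (hS : S.card = j) (i : Fin N) :
    permOf S j i ∈ S ↔ (i : ℕ) < j := by
  classical
  have hj : j ≤ N := by
    rw [← hS]; simpa using Finset.card_le_univ S
  have h : ∃ σ : Equiv.Perm (Fin N), ∀ i, σ i ∈ S ↔ (i : ℕ) < j := by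
    have c1 : Fintype.card {i : Fin N // (i : ℕ) < j} = Fintype.card {i // i ∈ S} := by
      rw [Fintype.card_coe, hS, Fintype.card_subtype]
      have : (Finset.univ.filter fun i : Fin N => (i : ℕ) < j)
          = (Finset.univ : Finset (Fin j)).map (Fin.castLEEmb hj) := by
        ext i
        simp only [Finset.mem_filter, Finset.mem_univ, true_and, Finset.mem_map]
        exact ⟨fun h => ⟨⟨i, h⟩, rfl⟩, by rintro ⟨a, rfl⟩; exact a.2⟩
      rw [this]; simp
    have e1 := Fintype.equivOfCardEq c1
    refine ⟨e1.extendSubtype, fun i => ?_⟩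
    by_cases hi : (i : ℕ) < j
    · exact iff_of_true (e1.extendSubtype_mem i hi) hi
    · exact iff_of_false (e1.extendSubtype_not_mem i hi) hi
  have e : permOf S j = h.choose := dif_pos h
  rw [e]
  exact h.choose_spec i

theorem cobarQuad_block {a b N : ℕ} (h : a + 1 + (b + 1) = N) (σ ρ : Equiv.Perm (Fin (N + 1)))
    (σ' : Equiv.Perm (Fin (a + 1 + 1))) (τ : Equiv.Perm (Fin (b + 1 + 1))) (hσ : σ' 0 = 0)
    (h₁ : ∀ j, j ≠ 0 → ρ (outerPos h 0 j) = outerPos h 0 (σ' j))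
    (h₂ : ∀ a, ρ (innerPos h 0 a) = innerPos h 0 (τ a)) (x : Module.Dual k (P.obj N)) :
    cobarQuad hP h (σ * ρ) x = cobarQuad hP h σ x := by
  have E := fun (y : P.obj (a + 1)) (z : P.obj (b + 1)) =>
    P.equivariant h 0 σ' τ ρ (by rwa [hσ]) (by rwa [hσ]) y z
  have E' := fun (y : Presented (CobarRel P) (a + 1)) (z : Presented (CobarRel P) (b + 1)) =>
    Presented.equivariant h 0 σ' τ ρ (by rwa [hσ]) (by rwa [hσ]) y z
  rw [hσ] at E E'
  unfold cobarQuad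
  let B : P.obj (a + 1) →ₗ[k] Module.Dual k (P.obj (a + 1)) →ₗ[k] P.obj (b + 1) →ₗ[k]
      Module.Dual k (P.obj (b + 1)) →ₗ[k] Presented (CobarRel P) N :=
    LinearMap.mk₂ k (fun y y' => LinearMap.mk₂ k (fun z z' => x (P.act σ (P.comp h 0 y z)) •
        Presented.act σ (Presented.comp h 0 (cobarXi P y') (cobarXi P z')))
        (fun z₁ z₂ z' => by simp [add_smul]) (fun c z z' => by simp [mul_smul])
        (fun z z₁ z₂ => by simp) (fun c z z' => by simp [smul_comm c]))
      (fun y₁ y₂ y' => by ext; simp [add_smul]) (fun c z z' => by ext; simp [mul_smul])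
      (fun z z₁ z₂ => by ext; simp) (fun c z z' => by ext; simp [smul_comm c])
  have step : ∀ (c : P.Idx (a + 1)) (c' : P.Idx (b + 1)),
      (sgn k (c.1 * (1 + c'.1)) * x (P.act (σ * ρ)
        (P.comp h 0 (basisVec hP c) (basisVec hP c')))) • Presented.act (σ * ρ)
          (Presented.comp h 0 (cobarXi P (basisCov hP c)) (cobarXi P (basisCov hP c')))
      = sgn k (c.1 * (1 + c'.1)) • B (P.act σ' (basisVec hP c)) (basisCov hP c ∘ₗ P.act σ'⁻¹)
          (P.act τ (basisVec hP c')) (basisCov hP c' ∘ₗ P.act τ⁻¹) := by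
    intro c c'
    rw [P.act_mul, Presented.act_mul, ← E, ← E', act_cobarXi, act_cobarXi, mul_smul]
    rfl
  have step' : ∀ (c : P.Idx (a + 1)) (c' : P.Idx (b + 1)),
      (sgn k (c.1 * (1 + c'.1)) * x (P.act σ
        (P.comp h 0 (basisVec hP c) (basisVec hP c')))) • Presented.act σ
          (Presented.comp h 0 (cobarXi P (basisCov hP c)) (cobarXi P (basisCov hP c')))
      = sgn k (c.1 * (1 + c'.1)) • B (basisVec hP c) (basisCov hP c)
          (basisVec hP c') (basisCov hP c') := by
    intro c c'
    rw [mul_smul]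
    rfl
  simp only [step, step']
  have s1 : ∀ c : P.Idx (a + 1), ∑ c' : P.Idx (b + 1), sgn k (c.1 * (1 + c'.1)) •
      B (P.act σ' (basisVec hP c)) (basisCov hP c ∘ₗ P.act σ'⁻¹)
          (P.act τ (basisVec hP c')) (basisCov hP c' ∘ₗ P.act τ⁻¹)
      = ∑ c' : P.Idx (b + 1), sgn k (c.1 * (1 + c'.1)) •
      B (P.act σ' (basisVec hP c)) (basisCov hP c ∘ₗ P.act σ'⁻¹)
          (basisVec hP c') (basisCov hP c') := fun c =>
    sum_basis hP (fun q => sgn k (c.1 * (1 + q))) τ _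
  simp only [s1]
  rw [Finset.sum_comm]
  conv_rhs => rw [Finset.sum_comm]
  refine Finset.sum_congr rfl fun c' _ => ?_
  exact sum_basis hP (fun q => sgn k (q * (1 + c'.1))) σ'
    ((B.compr₂ (LinearMap.applyₗ (basisVec hP c'))).compr₂ (LinearMap.applyₗ (basisCov hP c')))

end
section
variable {k : Type u} [Field k] [CharZero k] {P : DiffOperad.{u, w} k} (hP : P.Admissible)

/-- The contribution of a tree with two vertices depends only on the set of the inputs attached to
the upper vertex. -/
theorem cobarQuad_eq {a b N : ℕ} (h : a + 1 + (b + 1) = N) (σ₁ σ₂ : Equiv.Perm (Fin (N + 1)))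
    (S : Finset (Fin (N + 1))) (h₁ : ∀ i, σ₁ i ∈ S ↔ (i : ℕ) < b + 1 + 1)
    (h₂ : ∀ i, σ₂ i ∈ S ↔ (i : ℕ) < b + 1 + 1) (x : Module.Dual k (P.obj N)) :
    cobarQuad hP h σ₂ x = cobarQuad hP h σ₁ x := by
  obtain ⟨ρ, rfl⟩ : ∃ ρ, σ₂ = σ₁ * ρ := ⟨σ₁⁻¹ * σ₂, by simp⟩
  have hρ : ∀ i, (ρ i : ℕ) < b + 1 + 1 ↔ (i : ℕ) < b + 1 + 1 := fun i => by
    rw [← h₂ i, ← h₁ (ρ i)]; rfl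
  have vin : ∀ i : Fin (b + 1 + 1), ((innerPos h 0 i : Fin (N + 1)) : ℕ) = i := fun i => by
    simp [innerPos]
  have vout : ∀ j : Fin (a + 1 + 1), j ≠ 0 → ((outerPos h 0 j : Fin (N + 1)) : ℕ)
      = j + (b + 1) := fun j _ => by simp [outerPos]
  have hout : ∀ j : Fin (a + 1 + 1), j ≠ 0 →
      b + 1 + 1 ≤ ((ρ (outerPos h 0 j) : Fin (N + 1)) : ℕ) := fun j hj => by
    rw [← not_lt, hρ, vout j hj]
    have : (j : ℕ) ≠ 0 := fun e => hj (Fin.ext e)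
    omega
  let f : Fin (b + 1 + 1) → Fin (b + 1 + 1) := fun i =>
    ⟨ρ (innerPos h 0 i), (hρ _).2 (by rw [vin]; exact i.2)⟩
  have hf : Function.Injective f := fun i j e => by
    have e0 := congrArg Fin.val e
    have e1 : ρ (innerPos h 0 i) = ρ (innerPos h 0 j) := Fin.ext e0
    exact innerPos_injective h 0 (ρ.injective e1)
  let g : Fin (a + 1 + 1) → Fin (a + 1 + 1) := fun j => if j = 0 then 0 else
    ⟨(ρ (outerPos h 0 j) : ℕ) - (b + 1), by have := (ρ (outerPos h 0 j)).2; omega⟩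
  have hg : Function.Injective g := fun i j e => by
    by_cases hi : i = 0 <;> by_cases hj : j = 0
    · rw [hi, hj]
    · have := congrArg Fin.val e
      simp only [g, hi, hj, if_true, if_false] at this
      have h3 := hout j hj
      simp at this; omega
    · have := congrArg Fin.val e
      simp only [g, hi, hj, if_true, if_false] at this
      have h3 := hout i hi
      simp at this; omega
    · have := congrArg Fin.val e
      simp only [g, hi, hj, if_false] at this
      have h3 := hout i hi
      have h4 := hout j hj
      refine outerPos_injective h 0 hi hj (ρ.injective (Fin.ext ?_))
      omega
  refine cobarQuad_block hP h σ₁ ρ (Equiv.ofBijective g (Finite.injective_iff_bijective.1 hg))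
    (Equiv.ofBijective f (Finite.injective_iff_bijective.1 hf)) (show g 0 = 0 from if_pos rfl) ?_ ?_ x
  · intro j hj
    have hgj : g j ≠ 0 := fun e => hj (hg (e.trans (if_pos rfl).symm))
    refine Fin.ext ?_
    change _ = ((outerPos h 0 (g j) : Fin (N + 1)) : ℕ)
    rw [vout _ hgj]
    simp only [g, hj, if_false]
    have := hout j hj
    omega
  · intro i
    refine Fin.ext ?_
    change _ = ((innerPos h 0 (f i) : Fin (N + 1)) : ℕ)
    rw [vin]

theorem cobarQuad_act {a b N : ℕ} (h : a + 1 + (b + 1) = N) (σ ρ : Equiv.Perm (Fin (N + 1)))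
    (x : Module.Dual k (P.obj N)) :
    cobarQuad hP h σ (x ∘ₗ P.act ρ⁻¹) = Presented.act ρ (cobarQuad hP h (ρ⁻¹ * σ) x) := by
  simp only [cobarQuad, map_sum, map_smul, P.act_mul, Presented.act_mul, LinearMap.comp_apply]
  refine Finset.sum_congr rfl fun c _ => Finset.sum_congr rfl fun c' _ => ?_
  rw [← Presented.act_mul ρ, mul_inv_cancel, Presented.act_one]

theorem cobarQuad_par {a b N : ℕ} (h : a + 1 + (b + 1) = N) (σ : Equiv.Perm (Fin (N + 1)))
    (x : Module.Dual k (P.obj N)) :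
    cobarQuad hP h σ (x ∘ₗ P.par) = Presented.par (cobarQuad hP h σ x) := by
  simp only [cobarQuad, map_sum, map_smul, LinearMap.comp_apply]
  refine Finset.sum_congr rfl fun c _ => Finset.sum_congr rfl fun c' _ => ?_
  rw [P.par_act, P.par_comp, par_basisVec, par_basisVec, Presented.par_act, Presented.par_comp,
    par_cobarXi, par_cobarXi, basisCov_par, basisCov_par]
  simp only [map_smul, map_neg, LinearMap.smul_apply, LinearMap.neg_apply, neg_neg, smul_neg,
    smul_smul, smul_eq_mul]
  congr 1
  ring

/-- The values of the cobar differential on the generators. -/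
def cobarDelta : ∀ n : ℕ, CobarGen P n → Presented (CobarRel P) n
  | _, .xi x => cobarD hP x

theorem cobarQuad_add {a b N : ℕ} (h : a + 1 + (b + 1) = N) (σ : Equiv.Perm (Fin (N + 1)))
    (x y : Module.Dual k (P.obj N)) :
    cobarQuad hP h σ (x + y) = cobarQuad hP h σ x + cobarQuad hP h σ y := by
  simp only [cobarQuad, LinearMap.add_apply, mul_add, add_smul, Finset.sum_add_distrib]

theorem cobarQuad_smul {a b N : ℕ} (h : a + 1 + (b + 1) = N) (σ : Equiv.Perm (Fin (N + 1)))
    (r : k) (x : Module.Dual k (P.obj N)) :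
    cobarQuad hP h σ (r • x) = r • cobarQuad hP h σ x := by
  simp only [cobarQuad, LinearMap.smul_apply, Finset.smul_sum, smul_smul, smul_eq_mul]
  refine Finset.sum_congr rfl fun c _ => Finset.sum_congr rfl fun c' _ => ?_
  congr 1
  ring

theorem sum_powersetCard_perm {N : ℕ} {Z : Type*} [AddCommMonoid Z] (σ : Equiv.Perm (Fin N))
    (j : ℕ) (F G : Finset (Fin N) → Z)
    (h : ∀ S : Finset (Fin N), S.card = j → F (S.map σ.toEmbedding) = G S) :
    ∑ S ∈ Finset.powersetCard j Finset.univ, F S = ∑ S ∈ Finset.powersetCard j Finset.univ, G S := by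
  refine (Finset.sum_nbij' (fun S => S.map σ.toEmbedding) (fun S => S.map σ⁻¹.toEmbedding)
    ?_ ?_ ?_ ?_ ?_).symm
  · intro S hS
    rw [Finset.mem_powersetCard] at hS ⊢
    exact ⟨Finset.subset_univ _, by rw [Finset.card_map]; exact hS.2⟩
  · intro S hS
    rw [Finset.mem_powersetCard] at hS ⊢
    exact ⟨Finset.subset_univ _, by rw [Finset.card_map]; exact hS.2⟩
  · intro S _
    ext i
    simp only [Finset.mem_map_equiv]
    rw [show Equiv.symm σ⁻¹ = σ from rfl, Equiv.symm_apply_apply]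
  · intro S _
    ext i
    simp only [Finset.mem_map_equiv]
    rw [show Equiv.symm σ⁻¹ = σ from rfl, Equiv.apply_symm_apply]
  · intro S hS
    rw [Finset.mem_powersetCard] at hS
    exact (h S hS.2).symm

theorem sum_cobarQuad_act {a b N : ℕ} (h : a + 1 + (b + 1) = N) (σ : Equiv.Perm (Fin (N + 1)))
    (x : Module.Dual k (P.obj N)) :
    ∑ S ∈ Finset.powersetCard (b + 1 + 1) Finset.univ,
        cobarQuad hP h (permOf S (b + 1 + 1)) (x ∘ₗ P.act σ⁻¹)
      = Presented.act σ (∑ S ∈ Finset.powersetCard (b + 1 + 1) Finset.univ,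
        cobarQuad hP h (permOf S (b + 1 + 1)) x) := by
  rw [map_sum]
  refine sum_powersetCard_perm σ _ _ _ fun S hS => ?_
  rw [cobarQuad_act]
  congr 1
  refine cobarQuad_eq hP h _ _ S (permOf_spec hS) (fun i => ?_) x
  rw [← permOf_spec (S := S.map σ.toEmbedding) (by rw [Finset.card_map]; exact hS) i]
  simp [Finset.mem_map_equiv]

theorem cobarDelta_rel {n : ℕ} {s t : OpTerm k (CobarGen P) n} (h : CobarRel P n s t) :
    s.deriv (CobarRel P) (cobarDelta hP) = t.deriv (CobarRel P) (cobarDelta hP) := by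
  cases h with
  | add x y =>
      simp only [OpTerm.deriv, cobarDelta, cobarD, cobarQuad_add, Finset.sum_add_distrib,
        LinearMap.add_comp, map_add]
      abel
  | smul c x =>
      simp only [OpTerm.deriv, cobarDelta, cobarD, cobarQuad_smul, LinearMap.smul_comp, map_smul,
        smul_add, Finset.smul_sum]
  | par x =>
      have e1 : (x ∘ₗ P.par) ∘ₗ P.d ∘ₗ P.par = -(x ∘ₗ P.d ∘ₗ P.par) ∘ₗ P.par := by
        ext y; simp [P.par_d]
      simp only [OpTerm.deriv, cobarDelta, cobarD, map_add, map_sum, cobarQuad_par, par_cobarXi,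
        e1, neg_smul, one_smul, map_neg, LinearMap.neg_comp]
  | act σ x =>
      have e1 : (x ∘ₗ P.act σ⁻¹) ∘ₗ P.d ∘ₗ P.par = (x ∘ₗ P.d ∘ₗ P.par) ∘ₗ P.act σ⁻¹ := by
        ext y; simp [P.par_act, P.d_act]
      simp only [OpTerm.deriv, cobarDelta, cobarD]
      rw [map_add, map_sum, act_cobarXi, e1]
      refine congrArg₂ (· + ·) rfl (Finset.sum_congr rfl fun a _ => ?_)
      exact (sum_cobarQuad_act hP _ σ x).symm

/-- The cobar construction `B P` of an admissible dg operad. -/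
def Cobar : DiffOperad.{u, max u w} k := Presented.diffOperad (cobarDelta hP) (cobarDelta_rel hP)

/-- The generators of `B P`. -/
def Cobar.xi {n : ℕ} : Module.Dual k (P.obj (n + 1)) →ₗ[k] (Cobar hP).obj (n + 1) := cobarXi P

end
/-! ### Reduced trees -/

/-- Planar forests of `r` reduced rooted trees, listed from left to right, with `r + b` leaves
altogether.  A tree is either a single leaf, or a root vertex with `m + 2` incoming edges and a
forest `C` of `m + 2` trees above it. -/
inductive Forest : ℕ → ℕ → Type
  | nil : Forest 0 0
  | leaf {r b : ℕ} (F : Forest r b) : Forest (r + 1) b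
  | node {m a r b c : ℕ} (h : m + 1 + a + b = c) (C : Forest (m + 2) a) (F : Forest r b) :
      Forest (r + 1) c

/-- A planar representative of a reduced tree with at least one vertex and with leaves labelled by
`Fin (n + 1)`: the root vertex has `m + 2` incoming edges, with the forest `children` above it, and
`label p` is the label of the `p`-th leaf from the left. -/
structure PlanarTree (n : ℕ) where
  m : ℕ
  a : ℕ
  h : m + 1 + a = n
  children : Forest (m + 2) a
  label : Equiv.Perm (Fin (n + 1))

/-- The labels of the leaves in the positions `pos, …, pos + len - 1`. -/
def leafBlock {N : ℕ} (label : Equiv.Perm (Fin N)) (pos len : ℕ) : Finset (Fin N) :=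
  Finset.univ.filter fun i => pos ≤ (label.symm i : ℕ) ∧ (label.symm i : ℕ) < pos + len

/-- The sets of leaves above the vertices of a forest whose leaves are in the positions from
`pos` on. -/
def Forest.clusters {N : ℕ} (label : Equiv.Perm (Fin N)) :
    ∀ {r b : ℕ}, Forest r b → ℕ → Finset (Finset (Fin N))
  | _, _, .nil, _ => ∅
  | _, _, .leaf F, pos => F.clusters label (pos + 1)
  | _, _, .node (m := m) (a := a) _ C F, pos =>
      insert (leafBlock label pos (m + 2 + a))
        (C.clusters label pos ∪ F.clusters label (pos + (m + 2 + a)))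

/-- The sets of leaves above the vertices of a labelled tree.  Two reduced labelled trees are
isomorphic if and only if they have the same such sets. -/
def PlanarTree.clusters {n : ℕ} (T : PlanarTree n) : Finset (Finset (Fin (n + 1))) :=
  insert Finset.univ (T.children.clusters T.label 0)

/-- Isomorphism classes of reduced trees with leaves labelled by `Fin (n + 1)` and at least one
vertex, each given by the sets of leaves above its vertices. -/
def RTree (n : ℕ) : Type :=
  {H : Finset (Finset (Fin (n + 1))) // ∃ T : PlanarTree n, T.clusters = H}

instance (n : ℕ) : Fintype (RTree n) := by
  classical exact Subtype.fintype _

/-- A planar representative of a reduced tree. -/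
def RTree.planar {n : ℕ} (T : RTree n) : PlanarTree n := T.2.choose

/-! ### Decorations and contractions of trees -/

section
variable (ι : ℕ → Type)

/-- Decorations of a forest: every vertex with `m + 1` incoming edges gets an element of `ι m`. -/
def Forest.Dec : ∀ {r b : ℕ}, Forest r b → Type
  | _, _, .nil => Unit
  | _, _, .leaf F => F.Dec
  | _, _, .node (m := m) _ C F => ι (m + 1) × C.Dec × F.Dec

/-- The finitely many decorations of a forest. -/
@[reducible]
def Forest.decFintype [∀ m, Fintype (ι m)] : ∀ {r b : ℕ} (F : Forest r b), Fintype (F.Dec ι)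
  | _, _, .nil => inferInstanceAs (Fintype Unit)
  | _, _, .leaf F => F.decFintype
  | _, _, .node (m := m) _ C F =>
      letI := C.decFintype
      letI := F.decFintype
      inferInstanceAs (Fintype (ι (m + 1) × C.Dec ι × F.Dec ι))

/-- Decorations of a tree. -/
def PlanarTree.Dec {n : ℕ} (T : PlanarTree n) : Type := ι (T.m + 1) × T.children.Dec ι

instance [∀ m, Fintype (ι m)] {n : ℕ} (T : PlanarTree n) : Fintype (T.Dec ι) :=
  letI := T.children.decFintype ι
  inferInstanceAs (Fintype (ι (T.m + 1) × T.children.Dec ι))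

variable {ι}

/-- The sum of a quantity over the vertices of a decorated forest. -/
def Forest.count (p : ∀ m, ι m → ℕ) : ∀ {r b : ℕ} (F : Forest r b), F.Dec ι → ℕ
  | _, _, .nil, _ => 0
  | _, _, .leaf F, D => F.count p D
  | _, _, .node _ C F, D => p _ D.1 + C.count p D.2.1 + F.count p D.2.2

/-- The sum of a quantity over the vertices of a decorated tree. -/
def PlanarTree.count (p : ∀ m, ι m → ℕ) {n : ℕ} (T : PlanarTree n) (D : T.Dec ι) : ℕ :=
  p _ D.1 + T.children.count p D.2

variable {k : Type u} [Field k] (Q : GrOperad.{u, w} k) (φ : ∀ m, ι m → Q.obj m) (e l : Q.obj 0)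

/-- Composition along a decorated forest that is grafted on the inputs `pos, pos + 1, …` of `x`:
the vertices are read from the root to the leaves and from left to right, a vertex with
decoration `g` contributes `φ g`, an internal edge contributes `e`, and a leaf contributes `l`. -/
def Forest.contract : ∀ {r b : ℕ} (F : Forest r b), F.Dec ι → ∀ {m n : ℕ} (pos : ℕ),
    m + b = n → pos + r = m + 1 → Q.obj m → Q.obj n
  | _, _, .nil, _, _, _, _, h, _, x => h ▸ x
  | _, _, .leaf F, D, m, _, pos, h, hp, x =>
      F.contract D (pos + 1) h (by omega) (Q.comp (Nat.add_zero m) ⟨pos, by omega⟩ x l)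
  | _, _, .node (m := m') (a := a) h' C F, D, m, _, pos, h, hp, x =>
      F.contract D.2.2 (m := m + (m' + 1 + a)) (pos + (m' + 1 + a) + 1) (by omega) (by omega)
        (Q.comp (n := m' + 1 + a) rfl ⟨pos, by omega⟩ x
          (Q.comp (Nat.zero_add _) 0 e
            (C.contract D.2.1 0 rfl (Nat.zero_add _) (φ (m' + 1) D.1))))

/-- Composition along a decorated tree: a vertex with decoration `g` contributes `φ g`, an internal
edge contributes `e`, and the extremities (the leaves and the root) contribute `l`. -/
def PlanarTree.contract {n : ℕ} (T : PlanarTree n) (D : T.Dec ι) : Q.obj n :=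
  Q.act T.label (Q.comp (Nat.zero_add n) 0 l
    (T.children.contract Q φ e l D.2 0 T.h (Nat.zero_add _) (φ (T.m + 1) D.1)))

end

section
variable {k : Type u} [Field k] [CharZero k] {P : DiffOperad.{u, w} k} (hP : P.Admissible)

/-- A linear functional on the space `P(T)` of `P`-decorations of the tree `T`, given by its values
on the decorations `⊗_v e_{D v}` by elements of the homogeneous basis; in the tensor product the
vertices are read from the root to the leaves and from left to right. -/
abbrev TreeDual (P : DiffOperad.{u, w} k) {n : ℕ} (T : PlanarTree n) : Type u :=
  T.Dec P.Idx → k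

/-- The dual `μ_T^* : P(n)^* → P(T)^*` of the composition `μ_T` in `P` along the internal edges
of `T`. -/
def muDual {n : ℕ} (T : PlanarTree n) : Module.Dual k (P.obj n) →ₗ[k] TreeDual P T where
  toFun x D := x (T.contract P.toGrOperad (fun _ => basisVec hP) P.one P.one D)
  map_add' _ _ := rfl
  map_smul' _ _ := rfl

/-- The value in `B P` of a vertex decoration: the generator `ξ(e_b^*)`. -/
def vertexXi : ∀ n, P.Idx n → (Cobar hP).obj n
  | 0, _ => 0
  | _ + 1, b => Cobar.xi hP (basisCov hP b)

/-- The inclusion `ι_T` of `P(T)^*` in the space of `B P`-decorations of the tree `T_BV`, that is,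
of the tree `T` with internal edges labelled by `s` and extremities labelled by `t`: the dual basis
element of `⊗_v e_{D v}` goes to `(-1)^{q(q-1)/2} ⊗_v ξ(e_{D v}^*)`, where `q` is the number of
vertices with an odd decoration. -/
def iotaTree {n : ℕ} (T : PlanarTree n) : TreeDual P T →ₗ[k] (BV (Cobar hP)).obj n where
  toFun α := ∑ D, α D • sgn k ((T.count (fun _ b => ZMod.val b.1) D).choose 2 : ℕ) •
    T.contract (BV (Cobar hP)).toGrOperad (fun n b => bvOp (Cobar hP) (vertexXi hP n b))
      (bvS (Cobar hP)) (bvT (Cobar hP)) D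
  map_add' α β := by simp only [Pi.add_apply, add_smul, Finset.sum_add_distrib]
  map_smul' c α := by
    simp only [Pi.smul_apply, smul_eq_mul, mul_smul, Finset.smul_sum, RingHom.id_apply]

end

section
variable {k : Type u} [Field k] [CharZero k] {O : DiffOperad.{u, w} k} {V : DGSpace.{u, v} k}

/-- Given a right inverse `κ` of `bv O → O`, the minimal model of the `O`-algebra `V` with a
canonical Hodge decomposition is the `O`-algebra structure `g` on `H(V)` that corresponds, under
`E(H(V)) ⊆ E(V)`, to the composition `O → bv O → BV O → E(V)`. -/
def IsMinimalModel (κ : OperadHom O (bv O)) (f : OperadHom O (endOperad V)) (H : Hodge V)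
    (hc : H.IsCanonical) (g : OperadHom O (endOperad (homology V))) : Prop :=
  ∀ (n : ℕ) (x : O.obj n), H.inclEnd hc (g.app x) = (hodgeMap f H).app (bvIncl O (κ.app x))

end

end

-- All signs are absorbed by working in the Hadamard product `hadamardD B P`, with components B(n) ⊗
-- P(n). For a map f from the cobar construction to B, the canonical elements α_n = Σ_c f(ξ_c) ⊗ e_c
-- form an odd family of symmetric operations, and compatibility of f with the differentials on
-- generators is the Maurer–Cartan equation dα = α ⋆ α. Here ⋆ is `GrOperad.star`, the sum of the
-- insertions of one operation into another over all sets of inputs (`d_famOf_iff`,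
-- `d_famOf_genMap`). The Koszul sign of the Hadamard product is the sign in the cobar differential
-- (`contr_insSum`); accumulated along a tree, it is the sign (-1)^{q(q-1)/2} in the definition of
-- ι_T (`Forest.glue_hadamard`). What remains is a statement without signs: if α is a Maurer–Cartan
-- family and s, t behave like a canonical Hodge decomposition, then the sum over all trees with
-- vertices α, internal edges s and extremities t is again Maurer–Cartan.
--
-- Let g_j be the sum over the trees with j internal edges, with nothing at the extremities. Marking
-- an internal edge and cutting there gives (j+1) g_{j+1} = Σ_{a+b=j} g_a ⋆ (s g_b)
-- (`treeSum_succ`), so the generating function G(τ) = Σ τ^j g_j solves G' = G ⋆ sG with G(0) = α.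
-- On symmetric families ⋆ satisfies the graded pre-Lie identity (`GrOperad.star_preLie`). Together
-- with ds = 1 - t it implies that dG and G ⋆ G - τ G ⋆ (1-t)G solve the same linear differential
-- equation with the same initial value, hence coincide (`preLie_flow`). At τ = 1 this is dG = G ⋆
-- tG (`d_treeTotal`). Truncation, that is composition with t at the root and at all leaves,
-- commutes with d, turns G ⋆ tG into the ⋆-square of the truncation of G (`GrOperad.truncFam_star`)
-- and puts t at the extremities (`PlanarTree.trunc_value`). This is the Maurer–Cartan equation
-- `d_extTotal`. Besides parities, only t² = t, ds = 1 - t and dt = 0 enter.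
--
-- The recursion requires cutting and grafting of isomorphism classes of trees. A class is given by
-- its clusters, the sets of leaves above the vertices. Cutting at a vertex splits the set of
-- clusters in a recoverable way (`graftSets_injective`), so a composition along a tree depends on
-- the clusters only (`PlanarTree.value_eq_of_clusters_eq`), and pairs of a tree and an internal
-- edge correspond to pairs of trees to be grafted (`treeSum_isGraft`).
--
-- For B the BV-resolution of the cobar construction, contracting the resulting family with
-- functionals on P gives κ on generators, with values invariant under t. The augmentation sends (s,
-- t) to (0, 1), which kills every tree with an internal edge, so p ∘ κ = id (`bvProj_kappa`).
-- Finally `Hodge.inclEnd` identifies the operations on H(V) with the operations on V that are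
-- invariant under t; it respects all structure, with the unit going to t, so Z_V ∘ i ∘ κ factors
-- through it in exactly one way.

universe u'

noncomputable section

/-! ### Block permutations -/

section
variable {m n l : ℕ}

/-- The inputs of `x ∘_i y` are the inputs of `x` other than `i` and the inputs of `y`. -/
def blockEquiv (h : m + n = l) (i : Fin (m + 1)) :
    {j : Fin (m + 1) // j ≠ i} ⊕ Fin (n + 1) ≃ Fin (l + 1) :=
  Equiv.ofBijective (Sum.elim (fun j => outerPos h i j.1) (fun a => innerPos h i a)) (by
    constructor
    · rintro (⟨j, hj⟩ | a) (⟨j', hj'⟩ | b) e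
      · exact congrArg Sum.inl (Subtype.ext (outerPos_injective h i hj hj' e))
      · exact absurd e (outerPos_ne_innerPos h i hj b)
      · exact absurd e.symm (outerPos_ne_innerPos h i hj' a)
      · exact congrArg Sum.inr (innerPos_injective h i e)
    · intro c
      rcases outerPos_or_innerPos h i c with ⟨j, hj, rfl⟩ | ⟨a, rfl⟩
      · exact ⟨.inl ⟨j, hj⟩, rfl⟩
      · exact ⟨.inr a, rfl⟩)

/-- Supplies the permutation `ρ` that the equivariance axiom takes as data: `σ` and `τ` act on the
two summands of `blockEquiv`. -/
theorem exists_blockPerm (h : m + n = l) (i : Fin (m + 1)) (σ : Equiv.Perm (Fin (m + 1)))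
    (τ : Equiv.Perm (Fin (n + 1))) : ∃ ρ : Equiv.Perm (Fin (l + 1)),
      (∀ j, j ≠ i → ρ (outerPos h i j) = outerPos h (σ i) (σ j)) ∧
      ∀ a, ρ (innerPos h i a) = innerPos h (σ i) (τ a) := by
  refine ⟨(blockEquiv h i).symm.trans ((Equiv.sumCongr
    (σ.subtypeEquiv (q := fun j => j ≠ σ i) fun j => σ.injective.ne_iff.symm) τ).trans
      (blockEquiv h (σ i))), fun j hj => ?_, fun a => ?_⟩
  · have : outerPos h i j = blockEquiv h i (.inl ⟨j, hj⟩) := rfl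
    rw [this]; simp only [Equiv.trans_apply, Equiv.symm_apply_apply]; rfl
  · have : innerPos h i a = blockEquiv h i (.inr a) := rfl
    rw [this]; simp only [Equiv.trans_apply, Equiv.symm_apply_apply]; rfl

/-- Converse of `exists_blockPerm`, used to cut trees. An injection of the inner block into a block
of the same size is bijective, so the outer inputs have to go to outer inputs, and `ρ` splits into
its actions on the two factors. -/
theorem exists_perms_of_block (h : m + n = l) (i i' : Fin (m + 1)) (ρ : Equiv.Perm (Fin (l + 1)))
    (hρ : ∀ a, ∃ b, ρ (innerPos h i a) = innerPos h i' b) :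
    ∃ (σ : Equiv.Perm (Fin (m + 1))) (τ : Equiv.Perm (Fin (n + 1))), σ i = i' ∧
      (∀ j, j ≠ i → ρ (outerPos h i j) = outerPos h i' (σ j)) ∧
      ∀ a, ρ (innerPos h i a) = innerPos h i' (τ a) := by
  choose f hf using hρ
  have finj : Function.Injective f := fun a b e =>
    innerPos_injective h i (ρ.injective (by rw [hf, hf, e]))
  have fbij := Finite.injective_iff_bijective.1 finj
  have hout : ∀ j : Fin (m + 1), ∃ j', (j = i → j' = i') ∧
      (j ≠ i → j' ≠ i' ∧ ρ (outerPos h i j) = outerPos h i' j') := by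
    intro j
    by_cases hj : j = i
    · exact ⟨i', fun _ => rfl, fun e => absurd hj e⟩
    · rcases outerPos_or_innerPos h i' (ρ (outerPos h i j)) with ⟨j', hj', e⟩ | ⟨a, e⟩
      · exact ⟨j', fun e => absurd e hj, fun _ => ⟨hj', e⟩⟩
      -- Every position in the target block is already the image of an inner position, so an outer
      -- one cannot land there.
      · obtain ⟨b, rfl⟩ := fbij.2 a
        rw [← hf] at e
        exact absurd (ρ.injective e) (outerPos_ne_innerPos h i hj b)
  choose g hg1 hg2 using hout
  have ginj : Function.Injective g := by
    intro j j' e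
    by_cases hj : j = i <;> by_cases hj' : j' = i
    · rw [hj, hj']
    · exact absurd (e.symm.trans (hg1 j hj)) (hg2 j' hj').1
    · exact absurd (e.trans (hg1 j' hj')) (hg2 j hj).1
    · refine outerPos_injective h i hj hj' (ρ.injective ?_)
      rw [(hg2 j hj).2, (hg2 j' hj').2, e]
  exact ⟨Equiv.ofBijective g (Finite.injective_iff_bijective.1 ginj), Equiv.ofBijective f fbij,
    hg1 i rfl, fun j hj => (hg2 j hj).2, hf⟩

theorem innerPos_zero_iff (h : m + n = l) (c : Fin (l + 1)) :
    (∃ a : Fin (n + 1), c = innerPos h 0 a) ↔ (c : ℕ) < n + 1 := by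
  constructor
  · rintro ⟨a, rfl⟩; simp only [innerPos, Fin.val_zero]; omega
  · intro hc; exact ⟨⟨c, hc⟩, by ext; simp [innerPos]⟩

end

/-! ### Symmetric operations, symmetrization and insertion sums -/

namespace GrOperad
variable {k : Type u} [Field k] (Q : GrOperad.{u, w} k)

theorem comp_act {m n l : ℕ} (h : m + n = l) (i : Fin (m + 1)) (σ : Equiv.Perm (Fin (m + 1)))
    (τ : Equiv.Perm (Fin (n + 1))) (x : Q.obj m) (y : Q.obj n) :
    ∃ ρ, Q.comp h (σ i) (Q.act σ x) (Q.act τ y) = Q.act ρ (Q.comp h i x y) := by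
  obtain ⟨ρ, h1, h2⟩ := exists_blockPerm h i σ τ
  exact ⟨ρ, Q.equivariant h i σ τ ρ h1 h2 x y⟩

/-- An operation is symmetric if permutations of the inputs do not change it. -/
def IsSymm {n : ℕ} (x : Q.obj n) : Prop := ∀ σ, Q.act σ x = x

/-- Symmetrization. -/
def sym {n : ℕ} : Q.obj n →ₗ[k] Q.obj n := ∑ σ, Q.act σ

theorem sym_apply {n : ℕ} (x : Q.obj n) : Q.sym x = ∑ σ, Q.act σ x := by
  simp [sym]

theorem sym_act {n : ℕ} (σ : Equiv.Perm (Fin (n + 1))) (x : Q.obj n) :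
    Q.sym (Q.act σ x) = Q.sym x := by
  rw [sym_apply, sym_apply, ← Equiv.sum_comp (Equiv.mulRight σ) fun τ => Q.act τ x]
  exact Finset.sum_congr rfl fun τ _ => (Q.act_mul τ σ x).symm

theorem isSymm_sym {n : ℕ} (x : Q.obj n) : Q.IsSymm (Q.sym x) := by
  intro σ
  rw [sym_apply, map_sum, ← Equiv.sum_comp (Equiv.mulLeft σ) fun τ => Q.act τ x]
  exact Finset.sum_congr rfl fun τ _ => (Q.act_mul σ τ x).symm

variable {Q} in
theorem IsSymm.sym_eq {n : ℕ} {x : Q.obj n} (hx : Q.IsSymm x) :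
    Q.sym x = ((n + 1).factorial : k) • x := by
  rw [sym_apply, Finset.sum_congr rfl fun σ _ => hx σ]
  simp [Fintype.card_perm, ← Nat.cast_smul_eq_nsmul k]

/-- Two permutations with the same set `S` of labels on the inputs of `y` differ by a block
permutation, which symmetric `x` and `y` absorb. Hence the arbitrary choice in `permOf` does not
matter for symmetric operations. -/
theorem IsSymm.act_comp_eq {Q : GrOperad.{u, w} k} {m n l : ℕ} (h : m + n = l) {x : Q.obj m}
    {y : Q.obj n} (hx : Q.IsSymm x) (hy : Q.IsSymm y) {σ₁ σ₂ : Equiv.Perm (Fin (l + 1))}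
    {S : Finset (Fin (l + 1))} (h₁ : ∀ i, σ₁ i ∈ S ↔ (i : ℕ) < n + 1)
    (h₂ : ∀ i, σ₂ i ∈ S ↔ (i : ℕ) < n + 1) :
    Q.act σ₂ (Q.comp h 0 x y) = Q.act σ₁ (Q.comp h 0 x y) := by
  obtain ⟨ρ, rfl⟩ : ∃ ρ, σ₂ = σ₁ * ρ := ⟨σ₁⁻¹ * σ₂, by simp⟩
  have hρ : ∀ i, (ρ i : ℕ) < n + 1 ↔ (i : ℕ) < n + 1 := fun i => by
    rw [← h₂ i, ← h₁ (ρ i)]; rfl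
  obtain ⟨σ, τ, e0, e1, e2⟩ := exists_perms_of_block h 0 0 ρ fun a =>
    (innerPos_zero_iff h _).2 ((hρ _).2 ((innerPos_zero_iff h _).1 ⟨a, rfl⟩))
  have := Q.equivariant h 0 σ τ ρ (by rwa [e0]) (by rwa [e0]) x y
  rw [Q.act_mul, ← this, e0, hx, hy]

/-- The sum of the compositions `x ∘_S y` over the sets `S` of inputs that may be attached to
`y`. -/
def insSum {m n l : ℕ} (h : m + n = l) : Q.obj m →ₗ[k] Q.obj n →ₗ[k] Q.obj l :=
  ∑ S ∈ Finset.powersetCard (n + 1) Finset.univ,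
    (Q.comp h 0).compr₂ (Q.act (permOf S (n + 1)))

theorem insSum_apply {m n l : ℕ} (h : m + n = l) (x : Q.obj m) (y : Q.obj n) :
    Q.insSum h x y = ∑ S ∈ Finset.powersetCard (n + 1) Finset.univ,
      Q.act (permOf S (n + 1)) (Q.comp h 0 x y) := by
  simp [insSum, LinearMap.sum_apply]

variable {Q} in
-- A relabelling permutes the sets `S`, and each term depends on `S` only.
theorem IsSymm.insSum {m n l : ℕ} (h : m + n = l) {x : Q.obj m} {y : Q.obj n} (hx : Q.IsSymm x)
    (hy : Q.IsSymm y) : Q.IsSymm (Q.insSum h x y) := by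
  intro σ
  rw [insSum_apply, map_sum]
  refine (sum_powersetCard_perm σ _ _ _ fun S hS => ?_).symm
  rw [← Q.act_mul]
  refine hx.act_comp_eq h hy (S := S.map σ.toEmbedding) (fun i => ?_)
    (permOf_spec (by rw [Finset.card_map]; exact hS))
  simp [permOf_spec hS]

/-- The sum of the partial compositions. -/
def plComp {m n l : ℕ} (h : m + n = l) : Q.obj m →ₗ[k] Q.obj n →ₗ[k] Q.obj l :=
  ∑ i, Q.comp h i

theorem plComp_apply {m n l : ℕ} (h : m + n = l) (x : Q.obj m) (y : Q.obj n) :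
    Q.plComp h x y = ∑ i, Q.comp h i x y := by
  simp [plComp, LinearMap.sum_apply]

/-- Each `i` equals `σ⁻¹ 0` for m! permutations σ. The count is obtained by averaging over the point
that replaces 0, which explains the factor m + 1. -/
theorem sum_perm_inv_apply {m : ℕ} {Z : Type*} [AddCommGroup Z] [Module k Z]
    (F : Fin (m + 1) → Z) :
    ((m + 1 : ℕ) : k) • ∑ σ : Equiv.Perm (Fin (m + 1)), F (σ⁻¹ 0)
      = ((m + 1).factorial : k) • ∑ i, F i := by
  have h1 : ∀ i : Fin (m + 1), ∑ σ : Equiv.Perm (Fin (m + 1)), F (σ⁻¹ i)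
      = ∑ σ : Equiv.Perm (Fin (m + 1)), F (σ⁻¹ 0) := by
    intro i
    rw [← Equiv.sum_comp (Equiv.mulLeft (Equiv.swap 0 i)) fun σ => F (σ⁻¹ i)]
    refine Finset.sum_congr rfl fun σ _ => ?_
    simp
  have h2 : ∑ i, ∑ σ : Equiv.Perm (Fin (m + 1)), F (σ⁻¹ i)
      = ((m + 1 : ℕ) : k) • ∑ σ : Equiv.Perm (Fin (m + 1)), F (σ⁻¹ 0) := by
    rw [Finset.sum_congr rfl fun i _ => h1 i]
    rw [Finset.sum_const, Finset.card_univ, Fintype.card_fin, Nat.cast_smul_eq_nsmul]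
  rw [← h2, Finset.sum_comm, Finset.sum_congr rfl fun σ _ => Equiv.sum_comp σ⁻¹ F]
  rw [Finset.sum_const, Finset.card_univ, Fintype.card_perm, Fintype.card_fin,
    Nat.cast_smul_eq_nsmul]

/-- Carries the pre-Lie identity from the elementary product `plComp` to `insSum`. Both sides are
symmetric, so the right-hand side may be symmetrized once more, which makes all sets `S` and all
pairs of permutations contribute through the same elements `sym (x ∘_i y)`. The multiplicities then
agree up to factorials, which are invertible in characteristic zero. -/
theorem sym_plComp [CharZero k] {m n l : ℕ} (h : m + n = l) (x : Q.obj m) (y : Q.obj n) :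
    Q.sym (Q.plComp h x y) = Q.insSum h (Q.sym x) (Q.sym y) := by
  have hl : ((l + 1).factorial : k) ≠ 0 := Nat.cast_ne_zero.2 (Nat.factorial_ne_zero _)
  have hm : ((m + 1 : ℕ) : k) ≠ 0 := Nat.cast_ne_zero.2 (Nat.succ_ne_zero _)
  have e1 : ((l + 1).factorial : k) • Q.insSum h (Q.sym x) (Q.sym y)
      = ((l + 1).choose (n + 1) : k) • Q.sym (Q.comp h 0 (Q.sym x) (Q.sym y)) := by
    rw [← ((Q.isSymm_sym x).insSum h (Q.isSymm_sym y)).sym_eq, insSum_apply, map_sum]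
    simp only [sym_act, Finset.sum_const, Finset.card_powersetCard, Finset.card_univ,
      Fintype.card_fin, Nat.cast_smul_eq_nsmul]
  have e2 : Q.sym (Q.comp h 0 (Q.sym x) (Q.sym y))
      = ∑ τ : Equiv.Perm (Fin (n + 1)), ∑ σ : Equiv.Perm (Fin (m + 1)),
        Q.sym (Q.comp h (σ⁻¹ 0) x y) := by
    rw [Q.sym_apply x, Q.sym_apply y]
    simp only [map_sum, LinearMap.sum_apply]
    refine Finset.sum_congr rfl fun τ _ => ?_
    refine Finset.sum_congr rfl fun σ _ => ?_
    obtain ⟨ρ, hρ⟩ := Q.comp_act h (σ⁻¹ 0) σ τ x y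
    rw [← Equiv.Perm.mul_apply, mul_inv_cancel, Equiv.Perm.one_apply] at hρ
    rw [hρ, sym_act]
  have e3 : ((m + 1 : ℕ) : k) • Q.sym (Q.comp h 0 (Q.sym x) (Q.sym y))
      = ((n + 1).factorial : k) • ((m + 1).factorial : k) • Q.sym (Q.plComp h x y) := by
    rw [e2, Finset.sum_const, Finset.card_univ, Fintype.card_perm, Fintype.card_fin,
      ← Nat.cast_smul_eq_nsmul k, smul_comm,
      sum_perm_inv_apply (k := k) fun i => Q.sym (Q.comp h i x y), plComp_apply, map_sum]
  -- As (l + 1) - (n + 1) = m, this is the formula for the binomial coefficient multiplied by m + 1.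
  have e4 : ((m + 1 : ℕ) : k) * (l + 1).factorial
      = ((l + 1).choose (n + 1) : k) * ((n + 1).factorial * (m + 1).factorial) := by
    have := Nat.choose_mul_factorial_mul_factorial (n := l + 1) (k := n + 1) (by omega)
    rw [show l + 1 - (n + 1) = m by omega] at this
    rw [← this, Nat.factorial_succ m]
    push_cast
    ring
  have e5 := congrArg (fun z => ((m + 1 : ℕ) : k) • z) e1
  rw [smul_comm ((m + 1 : ℕ) : k) ((l + 1).choose (n + 1) : k), e3, smul_smul, smul_smul,
    smul_smul, mul_assoc, ← e4] at e5
  exact (smul_right_injective _ (mul_ne_zero hm hl) e5).symm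

/-! ### The pre-Lie product on families of operations -/

/-- Inserting `z` into an input of `y` cancels by associativity; what is left of the associator are
the insertions of `y` and `z` into two different inputs of `x`. -/
theorem plComp_assoc {m n r mn nr l : ℕ} (h₁ : m + n = mn) (h₂ : mn + r = l) (h₃ : n + r = nr)
    (h₄ : m + nr = l) (x : Q.obj m) (y : Q.obj n) (z : Q.obj r) :
    Q.plComp h₂ (Q.plComp h₁ x y) z - Q.plComp h₄ x (Q.plComp h₃ y z)
      = ∑ i, ∑ j, if j = i then 0 else Q.comp h₂ (outerPos h₁ i j) (Q.comp h₁ i x y) z := by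
  have e1 : Q.plComp h₂ (Q.plComp h₁ x y) z = ∑ i, ∑ c, Q.comp h₂ c (Q.comp h₁ i x y) z := by
    simp only [plComp_apply, map_sum, LinearMap.sum_apply]
  have e2 : Q.plComp h₄ x (Q.plComp h₃ y z) = ∑ i, ∑ a, Q.comp h₄ i x (Q.comp h₃ a y z) := by
    simp only [plComp_apply, map_sum]
    try exact Finset.sum_comm
  rw [e1, e2, ← Finset.sum_sub_distrib]
  refine Finset.sum_congr rfl fun i _ => ?_
  rw [sum_outer_inner h₁ i, add_sub_assoc, add_eq_left, sub_eq_zero]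
  exact Finset.sum_congr rfl fun a _ => Q.assoc h₁ h₂ h₃ h₄ i a x y z

/-- By `plComp_assoc` the associator is a sum over ordered pairs of distinct inputs, and the
parallel axiom exchanges the two inputs at the cost of the Koszul sign. -/
theorem plComp_preLie {m n r mn nr mr l : ℕ} (h₁ : m + n = mn) (h₂ : mn + r = l)
    (h₃ : n + r = nr) (h₄ : m + nr = l) (h₅ : m + r = mr) (h₆ : mr + n = l) (h₇ : r + n = nr)
    {p q : ZMod 2} (x : Q.obj m) {y : Q.obj n} {z : Q.obj r} (hy : HasParity Q.par p y)
    (hz : HasParity Q.par q z) :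
    Q.plComp h₂ (Q.plComp h₁ x y) z - Q.plComp h₄ x (Q.plComp h₃ y z)
      = sgn k (p * q) • (Q.plComp h₆ (Q.plComp h₅ x z) y - Q.plComp h₄ x (Q.plComp h₇ z y)) := by
  rw [plComp_assoc, plComp_assoc, Finset.sum_comm, Finset.smul_sum]
  refine Finset.sum_congr rfl fun j _ => ?_
  rw [Finset.smul_sum]
  refine Finset.sum_congr rfl fun i _ => ?_
  by_cases hij : i = j
  · simp [hij]
  · rw [if_neg (fun e => hij e.symm), if_neg hij]
    exact Q.parallel h₁ h₂ h₅ h₆ i j hij p q x y z hy hz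

/-- A family of operations, one of each arity. -/
abbrev Fam : Type w := ∀ n, Q.obj n

/-- The composition `insSum`, extended by zero to all arities. -/
def insExt (m n l : ℕ) : Q.obj m →ₗ[k] Q.obj n →ₗ[k] Q.obj l :=
  if h : m + n = l then Q.insSum h else 0

theorem insExt_eq {m n l : ℕ} (h : m + n = l) : Q.insExt m n l = Q.insSum h := dif_pos h

theorem insExt_eq_zero {m n l : ℕ} (h : m + n ≠ l) : Q.insExt m n l = 0 := dif_neg h

/-- The pre-Lie product of families of operations. -/
def star : Q.Fam →ₗ[k] Q.Fam →ₗ[k] Q.Fam :=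
  LinearMap.mk₂ k (fun x y n => ∑ a ∈ Finset.range (n + 1), ∑ b ∈ Finset.range (n + 1),
      Q.insExt a b n (x a) (y b))
    (fun x x' y => by ext n; simp [Finset.sum_add_distrib])
    (fun c x y => by ext n; simp [Finset.smul_sum])
    (fun x y y' => by ext n; simp [Finset.sum_add_distrib])
    (fun c x y => by ext n; simp [Finset.smul_sum])

/-- Terms of arity other than `n` vanish, so any larger cutoff may be used; iterated products can
then share one range of summation. -/
theorem star_apply (x y : Q.Fam) {n N : ℕ} (hN : n < N) :
    Q.star x y n = ∑ a ∈ Finset.range N, ∑ b ∈ Finset.range N, Q.insExt a b n (x a) (y b) := by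
  change ∑ a ∈ Finset.range (n + 1), ∑ b ∈ Finset.range (n + 1), Q.insExt a b n (x a) (y b) = _
  have h0 : ∀ a b, n < a ∨ n < b → Q.insExt a b n (x a) (y b) = 0 := fun a b hab => by
    rw [insExt_eq_zero _ (by omega)]; rfl
  have hs : Finset.range (n + 1) ⊆ Finset.range N := Finset.range_subset_range.2 hN
  rw [← Finset.sum_subset hs fun a _ ha => Finset.sum_eq_zero fun b _ => h0 a b (.inl (by
    simpa using ha))]
  refine Finset.sum_congr rfl fun a _ => Finset.sum_subset hs fun b _ hb => h0 a b (.inr (by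
    simpa using hb))

theorem star_eq_antidiagonal (x y : Q.Fam) (n : ℕ) : Q.star x y n
    = ∑ p : Fin (n + 1), Q.insSum (Nat.add_sub_of_le (Nat.lt_succ_iff.1 p.2)) (x p)
        (y (n - p)) := by
  rw [Q.star_apply x y (Nat.lt_succ_self n), ← Fin.sum_univ_eq_sum_range (fun a =>
    ∑ b ∈ Finset.range (n + 1), Q.insExt a b n (x a) (y b))]
  refine Finset.sum_congr rfl fun p _ => ?_
  rw [Finset.sum_eq_single (n - p), Q.insExt_eq (Nat.add_sub_of_le (Nat.lt_succ_iff.1 p.2))]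
  · intro b _ hb
    rw [insExt_eq_zero _ (by omega)]; rfl
  · intro hb
    exact absurd (Finset.mem_range.2 (by omega)) hb

/-- A family of operations is symmetric if each of its members is. -/
def FamSymm (x : Q.Fam) : Prop := ∀ n, Q.IsSymm (x n)

variable {Q}

theorem FamSymm.star {x y : Q.Fam} (hx : Q.FamSymm x) (hy : Q.FamSymm y) :
    Q.FamSymm (Q.star x y) := by
  intro n σ
  rw [star_eq_antidiagonal, map_sum]
  exact Finset.sum_congr rfl fun p _ => (hx p).insSum _ (hy (n - p)) σ

theorem IsSymm.exists_sym [CharZero k] {n : ℕ} {x : Q.obj n} (hx : Q.IsSymm x) :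
    x = Q.sym (((n + 1).factorial : k)⁻¹ • x) := by
  rw [map_smul, hx.sym_eq, smul_smul, inv_mul_cancel₀ (Nat.cast_ne_zero.2
    (Nat.factorial_ne_zero _)), one_smul]

/-- In characteristic zero a symmetric operation is a symmetrization, and `sym_plComp` makes
symmetrization a homomorphism from `plComp` to `insSum`. -/
theorem insSum_preLie [CharZero k] {m n r mn nr mr l : ℕ} (h₁ : m + n = mn) (h₂ : mn + r = l)
    (h₃ : n + r = nr) (h₄ : m + nr = l) (h₅ : m + r = mr) (h₆ : mr + n = l) (h₇ : r + n = nr)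
    {p q : ZMod 2} {x : Q.obj m} {y : Q.obj n} {z : Q.obj r} (sx : Q.IsSymm x) (sy : Q.IsSymm y)
    (sz : Q.IsSymm z) (hy : HasParity Q.par p y) (hz : HasParity Q.par q z) :
    Q.insSum h₂ (Q.insSum h₁ x y) z - Q.insSum h₄ x (Q.insSum h₃ y z)
      = sgn k (p * q) • (Q.insSum h₆ (Q.insSum h₅ x z) y - Q.insSum h₄ x (Q.insSum h₇ z y)) := by
  have ph : ∀ {n : ℕ} (c : k) {p : ZMod 2} {y : Q.obj n}, HasParity Q.par p y →
      HasParity Q.par p (c • y) := fun c p y hy => (parityPart Q.par p).smul_mem c hy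
  rw [sx.exists_sym, sy.exists_sym, sz.exists_sym]
  simp only [← sym_plComp]
  rw [← map_sub, plComp_preLie Q h₁ h₂ h₃ h₄ h₅ h₆ h₇ _ (ph _ hy) (ph _ hz), map_smul, map_sub]

theorem star_star_left (x y z : Q.Fam) (n : ℕ) : Q.star (Q.star x y) z n
    = ∑ a ∈ Finset.range (n + 1), ∑ b ∈ Finset.range (n + 1), ∑ c ∈ Finset.range (n + 1),
      Q.insExt (a + b) c n (Q.insExt a b (a + b) (x a) (y b)) (z c) := by
  rw [Q.star_apply _ _ (Nat.lt_succ_self n)]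
  have e : ∀ p ∈ Finset.range (n + 1), Q.star x y p = ∑ a ∈ Finset.range (n + 1),
      ∑ b ∈ Finset.range (n + 1), Q.insExt a b p (x a) (y b) := fun p hp =>
    Q.star_apply x y (Finset.mem_range.1 hp)
  rw [Finset.sum_congr rfl fun p hp => by rw [e p hp]]
  simp only [map_sum, LinearMap.sum_apply]
  rw [Finset.sum_congr rfl fun p _ => Finset.sum_comm, Finset.sum_comm]
  refine Finset.sum_congr rfl fun a _ => ?_
  rw [Finset.sum_congr rfl fun p _ => Finset.sum_comm, Finset.sum_comm]
  refine Finset.sum_congr rfl fun b _ => ?_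
  rw [Finset.sum_comm]
  refine Finset.sum_congr rfl fun c _ => ?_
  refine Finset.sum_eq_single (a + b) (fun p _ hp => ?_) fun hp => ?_
  · rw [Q.insExt_eq_zero (fun e => hp e.symm)]; simp
  -- When `a + b` falls outside the range it exceeds `n`, and then the outer composition vanishes
  -- too.
  · rw [Q.insExt_eq_zero (l := n)]
    · rfl
    · simp at hp; omega

theorem star_star_right (x y z : Q.Fam) (n : ℕ) : Q.star x (Q.star y z) n
    = ∑ a ∈ Finset.range (n + 1), ∑ b ∈ Finset.range (n + 1), ∑ c ∈ Finset.range (n + 1),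
      Q.insExt a (b + c) n (x a) (Q.insExt b c (b + c) (y b) (z c)) := by
  rw [Q.star_apply _ _ (Nat.lt_succ_self n)]
  refine Finset.sum_congr rfl fun a _ => ?_
  have e : ∀ p ∈ Finset.range (n + 1), Q.star y z p = ∑ b ∈ Finset.range (n + 1),
      ∑ c ∈ Finset.range (n + 1), Q.insExt b c p (y b) (z c) := fun p hp =>
    Q.star_apply y z (Finset.mem_range.1 hp)
  rw [Finset.sum_congr rfl fun p hp => by rw [e p hp]]
  simp only [map_sum]
  rw [Finset.sum_comm]
  refine Finset.sum_congr rfl fun b _ => ?_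
  rw [Finset.sum_comm]
  refine Finset.sum_congr rfl fun c _ => ?_
  refine Finset.sum_eq_single (b + c) (fun p _ hp => ?_) fun hp => ?_
  · rw [Q.insExt_eq_zero (fun e => hp e.symm)]; simp
  · rw [Q.insExt_eq_zero (l := n)]
    · rfl
    · simp at hp; omega

/-- The graded pre-Lie identity for symmetric families. -/
theorem star_preLie [CharZero k] {p q : ZMod 2} {x y z : Q.Fam} (sx : Q.FamSymm x)
    (sy : Q.FamSymm y) (sz : Q.FamSymm z) (hy : ∀ n, HasParity Q.par p (y n))
    (hz : ∀ n, HasParity Q.par q (z n)) :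
    Q.star (Q.star x y) z - Q.star x (Q.star y z)
      = sgn k (p * q) • (Q.star (Q.star x z) y - Q.star x (Q.star z y)) := by
  funext n
  simp only [Pi.sub_apply, Pi.smul_apply, star_star_left, star_star_right]
  simp only [← Finset.sum_sub_distrib, Finset.smul_sum]
  refine Finset.sum_congr rfl fun a _ => ?_
  rw [Finset.sum_comm]
  refine Finset.sum_congr rfl fun c _ => Finset.sum_congr rfl fun b _ => ?_
  by_cases h : a + b + c = n
  · rw [Q.insExt_eq h, Q.insExt_eq rfl, Q.insExt_eq (show a + (b + c) = n by omega),
      Q.insExt_eq rfl, Q.insExt_eq (show a + c + b = n by omega), Q.insExt_eq rfl,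
      Q.insExt_eq (show a + (c + b) = n by omega), Q.insExt_eq rfl]
    have := insSum_preLie (Q := Q) rfl h (Nat.add_comm b c) (show a + (c + b) = n by omega) rfl
      (show a + c + b = n by omega) rfl (sx a) (sy b) (sz c) (hy b) (hz c)
    rw [← this]
    congr 1
    -- The intermediate arities b + c and c + b are equal but not definitionally so.
    have key : ∀ {d e : ℕ} (hd : b + c = d) (he : b + c = e) (hd' : a + d = n) (he' : a + e = n),
        Q.insSum hd' (x a) (Q.insSum hd (y b) (z c))
          = Q.insSum he' (x a) (Q.insSum he (y b) (z c)) := by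
      rintro d e rfl rfl _ _; rfl
    exact key _ _ _ _
  · rw [Q.insExt_eq_zero h, Q.insExt_eq_zero (show a + (b + c) ≠ n by omega),
      Q.insExt_eq_zero (show a + c + b ≠ n by omega),
      Q.insExt_eq_zero (show a + (c + b) ≠ n by omega)]
    simp

end GrOperad

noncomputable section

/-! ### A differential equation in pre-Lie algebras -/

section
open Finset
open HasAntidiagonal (antidiagonal)
variable {k : Type u} [Field k] {V : Type v} [AddCommGroup V] [Module k V]
  (st : V →ₗ[k] V →ₗ[k] V) (S L P D : V →ₗ[k] V) (g : ℕ → V)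

theorem sum_antidiagonal_assoc {A : Type*} [AddCommMonoid A] (F : ℕ → ℕ → ℕ → A) (e : ℕ) :
    ∑ p ∈ antidiagonal e, ∑ q ∈ antidiagonal p.1, F q.1 q.2 p.2
      = ∑ p ∈ antidiagonal e, ∑ q ∈ antidiagonal p.2, F p.1 q.1 q.2 := by
  rw [sum_sigma', sum_sigma']
  refine sum_nbij' (fun x => ⟨(x.2.1, x.2.2 + x.1.2), (x.2.2, x.1.2)⟩)
    (fun x => ⟨(x.1.1 + x.2.1, x.2.2), (x.1.1, x.2.1)⟩) ?_ ?_ ?_ ?_ ?_ <;>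
  · rintro ⟨⟨a, b⟩, ⟨c, d⟩⟩ h
    simp only [mem_sigma, HasAntidiagonal.mem_antidiagonal] at h
    obtain ⟨h1, h2⟩ := h
    subst h2
    try subst h1
    simp [add_assoc]

/-- Write G = Σ τ^e g_e, so that `hrec` says G' = G ⋆ SG. The Leibniz rule and the pre-Lie identity
give (G ⋆ LG)' = (G ⋆ SG) ⋆ LG + G ⋆ L(G ⋆ SG) = (G ⋆ LG) ⋆ SG + G ⋆ S(G ⋆ LG). The statement is the
equality of the coefficients at τ^e: the product G ⋆ LG satisfies the linearization of the equation
for G. -/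
theorem sum_preLie_antidiagonal
    (hrec : ∀ e, ((e + 1 : ℕ) : k) • g (e + 1) = ∑ p ∈ antidiagonal e, st (g p.1) (S (g p.2)))
    (hpl : ∀ a b c, st (st (g a) (L (g b))) (S (g c)) - st (g a) (L (st (g b) (S (g c))))
      = st (st (g a) (S (g c))) (L (g b)) - st (g a) (S (st (g c) (L (g b))))) (e : ℕ) :
    ∑ p ∈ antidiagonal e,
        (st (∑ q ∈ antidiagonal p.1, st (g q.1) (L (g q.2))) (S (g p.2))
          + st (g p.1) (S (∑ q ∈ antidiagonal p.2, st (g q.1) (L (g q.2)))))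
      = ((e + 1 : ℕ) : k) • ∑ p ∈ antidiagonal (e + 1), st (g p.1) (L (g p.2)) := by
  have l1 : ∑ p ∈ antidiagonal e, st (∑ q ∈ antidiagonal p.1, st (g q.1) (L (g q.2))) (S (g p.2))
      = ∑ p ∈ antidiagonal e, ∑ q ∈ antidiagonal p.2,
        st (st (g p.1) (L (g q.1))) (S (g q.2)) := by
    rw [← sum_antidiagonal_assoc fun a b c => st (st (g a) (L (g b))) (S (g c))]
    simp only [map_sum, LinearMap.sum_apply]
  have l2 : ∑ p ∈ antidiagonal e, st (g p.1) (S (∑ q ∈ antidiagonal p.2, st (g q.1) (L (g q.2))))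
      = ∑ p ∈ antidiagonal e, ∑ q ∈ antidiagonal p.2,
        st (g p.1) (S (st (g q.2) (L (g q.1)))) := by
    simp only [map_sum]
    exact sum_congr rfl fun p _ =>
      Nat.sum_antidiagonal_swap (f := fun q => st (g p.1) (S (st (g q.2) (L (g q.1)))))
  -- The part of the derivative of G ⋆ LG in which the second factor is differentiated; `r2` is the
  -- part with the first factor.
  have r1 : ∑ p ∈ antidiagonal e, ∑ q ∈ antidiagonal p.2, st (g p.1) (L (st (g q.1) (S (g q.2))))
      = ∑ p ∈ antidiagonal (e + 1), (p.2 : k) • st (g p.1) (L (g p.2)) := by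
    rw [Nat.sum_antidiagonal_succ', Nat.cast_zero, zero_smul, zero_add]
    refine sum_congr rfl fun p _ => ?_
    rw [← map_smul, ← map_smul, hrec]
    simp only [map_sum]
  have r2 : ∑ p ∈ antidiagonal e, ∑ q ∈ antidiagonal p.2, st (st (g p.1) (S (g q.2))) (L (g q.1))
      = ∑ p ∈ antidiagonal (e + 1), (p.1 : k) • st (g p.1) (L (g p.2)) := by
    rw [Nat.sum_antidiagonal_succ, Nat.cast_zero, zero_smul, zero_add]
    trans ∑ p ∈ antidiagonal e, ∑ q ∈ antidiagonal p.2,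
      st (st (g p.1) (S (g q.1))) (L (g q.2))
    · exact sum_congr rfl fun p _ =>
        Nat.sum_antidiagonal_swap (f := fun q => st (st (g p.1) (S (g q.1))) (L (g q.2)))
    rw [← sum_antidiagonal_assoc fun a b c => st (st (g a) (S (g b))) (L (g c))]
    refine sum_congr rfl fun p _ => ?_
    rw [← LinearMap.map_smul₂, hrec]
    simp only [map_sum, LinearMap.sum_apply]
  rw [sum_add_distrib, l1, l2, ← sum_add_distrib]
  have step : ∀ p ∈ antidiagonal e,
      ∑ q ∈ antidiagonal p.2, st (st (g p.1) (L (g q.1))) (S (g q.2))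
        + ∑ q ∈ antidiagonal p.2, st (g p.1) (S (st (g q.2) (L (g q.1))))
      = ∑ q ∈ antidiagonal p.2, st (g p.1) (L (st (g q.1) (S (g q.2))))
        + ∑ q ∈ antidiagonal p.2, st (st (g p.1) (S (g q.2))) (L (g q.1)) := by
    intro p _
    rw [← sum_add_distrib, ← sum_add_distrib]
    refine sum_congr rfl fun q _ => ?_
    have := hpl p.1 q.1 q.2
    rw [sub_eq_sub_iff_add_eq_add] at this
    rw [this, add_comm]
  rw [sum_congr rfl step, sum_add_distrib, r1, r2, ← sum_add_distrib, smul_sum]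
  refine sum_congr rfl fun p hp => ?_
  rw [← add_smul, ← Nat.cast_add, add_comm, HasAntidiagonal.mem_antidiagonal.1 hp]

/-- In terms of G = Σ τ^e g_e the claim is DG = G ⋆ G - τ G ⋆ PG. By `hD` the left-hand side solves
X' = X ⋆ SG + G ⋆ SX - G ⋆ PG. The products T = G ⋆ G and R = G ⋆ PG solve the homogeneous equation
by `sum_preLie_antidiagonal`, and (τR)' = R + τR' supplies the inhomogeneous term, so T - τR solves
it too. The initial values agree by `h0`, and in characteristic zero the recursion determines all
coefficients. -/
theorem preLie_flow [CharZero k]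
    (h0 : D (g 0) = st (g 0) (g 0))
    (hrec : ∀ e, ((e + 1 : ℕ) : k) • g (e + 1) = ∑ p ∈ antidiagonal e, st (g p.1) (S (g p.2)))
    (hD : ∀ i j, D (st (g i) (S (g j)))
      = st (D (g i)) (S (g j)) - st (g i) (P (g j)) + st (g i) (S (D (g j))))
    (hpl : ∀ a b c, st (st (g a) (g b)) (S (g c)) - st (g a) (st (g b) (S (g c)))
      = st (st (g a) (S (g c))) (g b) - st (g a) (S (st (g c) (g b))))
    (hplP : ∀ a b c, st (st (g a) (P (g b))) (S (g c)) - st (g a) (P (st (g b) (S (g c))))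
      = st (st (g a) (S (g c))) (P (g b)) - st (g a) (S (st (g c) (P (g b)))))
    (e : ℕ) : D (g (e + 1)) = ∑ p ∈ antidiagonal (e + 1), st (g p.1) (g p.2)
      - ∑ p ∈ antidiagonal e, st (g p.1) (P (g p.2)) := by
  set T : ℕ → V := fun e => ∑ p ∈ antidiagonal e, st (g p.1) (g p.2) with hT
  set R : ℕ → V := fun e => ∑ p ∈ antidiagonal e, st (g p.1) (P (g p.2)) with hR
  -- The coefficients of τR.
  let R' : ℕ → V := fun e => Nat.casesOn e 0 R
  have hTs : ∀ e, ∑ p ∈ antidiagonal e, (st (T p.1) (S (g p.2)) + st (g p.1) (S (T p.2)))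
      = ((e + 1 : ℕ) : k) • T (e + 1) := sum_preLie_antidiagonal st S LinearMap.id g hrec hpl
  have hRs : ∀ e, ∑ p ∈ antidiagonal e, (st (R p.1) (S (g p.2)) + st (g p.1) (S (R p.2)))
      = ((e + 1 : ℕ) : k) • R (e + 1) := sum_preLie_antidiagonal st S P g hrec hplP
  have hRs' : ∀ e, ∑ p ∈ antidiagonal e, (st (R' p.1) (S (g p.2)) + st (g p.1) (S (R' p.2)))
      = (e : k) • R e := by
    intro e
    cases e with
    | zero => simp [R']
    | succ e =>
        rw [← hRs, sum_add_distrib, Nat.sum_antidiagonal_succ, Nat.sum_antidiagonal_succ',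
          sum_add_distrib]
        simp [R']
  have key : ∀ e, D (g e) = T e - R' e := by
    intro e
    induction e using Nat.strong_induction_on with
    | _ e ih =>
      cases e with
      | zero => simp [hT, h0, R']
      | succ e =>
          have hc : ((e + 1 : ℕ) : k) ≠ 0 := Nat.cast_ne_zero.2 (Nat.succ_ne_zero e)
          refine smul_right_injective V hc ?_
          change ((e + 1 : ℕ) : k) • D (g (e + 1)) = ((e + 1 : ℕ) : k) • (T (e + 1) - R e)
          rw [← map_smul, hrec, map_sum]
          have : ∀ p ∈ antidiagonal e, D (st (g p.1) (S (g p.2)))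
              = (st (T p.1) (S (g p.2)) + st (g p.1) (S (T p.2)))
                - (st (R' p.1) (S (g p.2)) + st (g p.1) (S (R' p.2)))
                - st (g p.1) (P (g p.2)) := by
            intro p hp
            rw [HasAntidiagonal.mem_antidiagonal] at hp
            rw [hD, ih p.1 (by omega), ih p.2 (by omega)]
            simp only [map_sub, LinearMap.sub_apply]
            abel
          rw [sum_congr rfl this, sum_sub_distrib, sum_sub_distrib, hTs, hRs', smul_sub]
          change _ - R e = _
          push_cast
          rw [add_smul (e : k) 1 (R e), one_smul]
          abel
  exact key (e + 1)

end

noncomputable section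

/-! ### Compositions along forests with a fixed decoration -/

section
variable {k : Type u} [Field k] (Q : GrOperad.{u, w} k)

theorem GrOperad.root_comp {m n l : ℕ} (h : m + n = l) (i : Fin (m + 1)) (e : Q.obj 0)
    (x : Q.obj m) (y : Q.obj n) : Q.comp (Nat.zero_add l) 0 e (Q.comp h i x y)
      = Q.comp h i (Q.comp (Nat.zero_add m) 0 e x) y := by
  have := Q.assoc (Nat.zero_add m) h h (Nat.zero_add l) 0 i e x y
  rwa [innerPos_zero, eq_comm] at this

theorem GrOperad.root_act {n : ℕ} (e : Q.obj 0) (σ : Equiv.Perm (Fin (n + 1))) (x : Q.obj n) :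
    Q.comp (Nat.zero_add n) 0 e (Q.act σ x) = Q.act σ (Q.comp (Nat.zero_add n) 0 e x) := by
  have := Q.equivariant (Nat.zero_add n) 0 1 σ σ
    (fun j hj => absurd (Subsingleton.elim (α := Fin 1) j 0) hj)
    (fun a => by rw [Equiv.Perm.one_apply, innerPos_zero, innerPos_zero]) e x
  rwa [Q.act_one] at this

variable (α : ∀ n, Q.obj n) (e l : Q.obj 0)

/-- Composition along a forest that is grafted on the inputs `pos, pos + 1, …`: a vertex with
`n + 1` inputs contributes `α n`, an internal edge contributes `e`, and a leaf contributes `l`. -/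
def Forest.glue : ∀ {r b : ℕ}, Forest r b → ∀ {m n : ℕ} (pos : ℕ),
    m + b = n → pos + r = m + 1 → (Q.obj m →ₗ[k] Q.obj n)
  | _, _, .nil, m, _, _, h, _ => h ▸ (LinearMap.id : Q.obj m →ₗ[k] Q.obj m)
  | _, _, .leaf F, m, _, pos, h, hp =>
      F.glue (pos + 1) h (by omega) ∘ₗ (Q.comp (Nat.add_zero m) ⟨pos, by omega⟩).flip l
  | _, _, .node (m := m') (a := a) h' C F, m, _, pos, h, hp =>
      F.glue (m := m + (m' + 1 + a)) (pos + (m' + 1 + a) + 1) (by omega) (by omega) ∘ₗ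
        (Q.comp (n := m' + 1 + a) rfl ⟨pos, by omega⟩).flip
          (Q.comp (Nat.zero_add _) 0 e
            (C.glue 0 rfl (Nat.zero_add _) (α (m' + 1))))

theorem Forest.glue_leaf {r b m n : ℕ} (F : Forest r b) (pos : ℕ) (h : m + b = n)
    (hp : pos + (r + 1) = m + 1) (x : Q.obj m) :
    F.leaf.glue Q α e l pos h hp x = F.glue Q α e l (pos + 1) h (by omega)
      (Q.comp (Nat.add_zero m) ⟨pos, by omega⟩ x l) := rfl

/-- The operation that a vertex with the forest `C` above it contributes, together with the edge
below it. -/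
def Forest.bush {m a : ℕ} (C : Forest (m + 2) a) : Q.obj (m + 1 + a) :=
  Q.comp (Nat.zero_add _) 0 e (C.glue Q α e l 0 rfl (Nat.zero_add _) (α (m + 1)))

theorem Forest.glue_node {r b m a c m' n' m'' : ℕ} (h' : m + 1 + a + b = c)
    (C : Forest (m + 2) a) (F : Forest r b) (pos : ℕ) (h : m' + c = n')
    (hp : pos + (r + 1) = m' + 1) (hm : m' + (m + 1 + a) = m'') (x : Q.obj m') :
    (Forest.node h' C F).glue Q α e l pos h hp x
      = F.glue Q α e l (pos + (m + 1 + a) + 1) (by omega) (by omega)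
        (Q.comp hm ⟨pos, by omega⟩ x (C.bush Q α e l)) := by
  subst hm; rfl

variable {Q α e l}

theorem GrOperad.par_root {n : ℕ} (he : Q.par e = -e) (x : Q.obj n) (hx : Q.par x = -x) :
    Q.par (Q.comp (Nat.zero_add n) 0 e x) = Q.comp (Nat.zero_add n) 0 e x := by
  rw [Q.par_comp, he, hx]; simp

theorem Forest.par_glue (hα : ∀ n, Q.par (α n) = -α n) (he : Q.par e = -e) (hl : Q.par l = l)
    {r b : ℕ} (F : Forest r b) : ∀ {m n : ℕ} (pos : ℕ) (h : m + b = n) (hp : pos + r = m + 1)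
      (x : Q.obj m), Q.par (F.glue Q α e l pos h hp x) = F.glue Q α e l pos h hp (Q.par x) := by
  induction F with
  | nil => rintro m n pos rfl hp x; rfl
  | leaf F ih =>
      intro m n pos h hp x
      rw [glue_leaf, ih, Q.par_comp, hl]; rfl
  | node h' C F ihC ihF =>
      intro m n pos h hp x
      rw [glue_node Q α e l h' C F pos h hp rfl, glue_node Q α e l h' C F pos h hp rfl, ihF,
        Q.par_comp, bush, Q.par_root he _ (by rw [ihC, hα, map_neg])]

/-- An odd vertex together with the odd edge below it is even, and so is everything grafted above
it. Hence parallel branches commute without signs. -/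
theorem Forest.par_bush (hα : ∀ n, Q.par (α n) = -α n) (he : Q.par e = -e) (hl : Q.par l = l)
    {m a : ℕ} (C : Forest (m + 2) a) : Q.par (C.bush Q α e l) = C.bush Q α e l := by
  rw [bush, Q.par_root he _ (by rw [par_glue hα he hl, hα, map_neg])]

/-- The parallel axiom for even operations with explicit positions: filling input `p` by an
operation with n + 1 inputs shifts the later position `q` by `n`. -/
theorem GrOperad.comp_comm_lt {m n r mn mr l : ℕ} (h₁ : m + n = mn) (h₂ : mn + r = l)
    (h₃ : m + r = mr) (h₄ : mr + n = l) {p q q' : ℕ} (hpq : p < q) (hq : q < m + 1)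
    (hq' : q' = q + n) (x : Q.obj m) {y : Q.obj n} {z : Q.obj r} (hy : Q.par y = y)
    (hz : Q.par z = z) :
    Q.comp h₂ ⟨q', by omega⟩ (Q.comp h₁ ⟨p, by omega⟩ x y) z
      = Q.comp h₄ ⟨p, by omega⟩ (Q.comp h₃ ⟨q, hq⟩ x z) y := by
  have := Q.parallel h₁ h₂ h₃ h₄ ⟨p, by omega⟩ ⟨q, hq⟩
    (fun e => by have := congrArg Fin.val e; simp at this; omega) 0 0 x y z
    (by simp [HasParity, hy]) (by simp [HasParity, hz])
  rw [mul_zero, sgn_zero, one_smul] at this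
  have e1 : (outerPos h₁ ⟨p, by omega⟩ ⟨q, hq⟩ : Fin (mn + 1)) = ⟨q', by omega⟩ := by
    ext; simp only [outerPos]; rw [if_neg (by omega)]; exact hq'.symm
  have e2 : (outerPos h₃ ⟨q, hq⟩ ⟨p, by omega⟩ : Fin (mr + 1)) = ⟨p, by omega⟩ := by
    ext; simp only [outerPos]; rw [if_pos hpq]
  rwa [e1, e2] at this

theorem GrOperad.comp_assoc_val {m n r mn nr l : ℕ} (h₁ : m + n = mn) (h₂ : mn + r = l)
    (h₃ : n + r = nr) (h₄ : m + nr = l) {p q pq : ℕ} (hp : p < m + 1) (hq : q < n + 1)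
    (hpq : pq = p + q) (x : Q.obj m) (y : Q.obj n) (z : Q.obj r) :
    Q.comp h₂ ⟨pq, by omega⟩ (Q.comp h₁ ⟨p, hp⟩ x y) z
      = Q.comp h₄ ⟨p, hp⟩ x (Q.comp h₃ ⟨q, hq⟩ y z) := by
  subst hpq
  exact Q.assoc h₁ h₂ h₃ h₄ ⟨p, hp⟩ ⟨q, hq⟩ x y z

/-- An even operation inserted to the left of the forest commutes with each even bush of the forest;
the only effect is a shift of positions. -/
theorem Forest.glue_comp_lt (hα : ∀ n, Q.par (α n) = -α n) (he : Q.par e = -e)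
    (hl : Q.par l = l) {r b : ℕ} (F : Forest r b) : ∀ {m n c m' n' : ℕ} (pos pos' q : ℕ)
      (_ : pos' = pos + c) (hq : q < pos) (h : m + b = n) (hp : pos + r = m + 1)
      (hm : m + c = m') (hn : n + c = n') (h' : m' + b = n') (hp' : pos' + r = m' + 1)
      (x : Q.obj m) {w : Q.obj c} (_ : Q.par w = w),
      F.glue Q α e l pos' h' hp' (Q.comp hm ⟨q, by omega⟩ x w)
        = Q.comp hn ⟨q, by omega⟩ (F.glue Q α e l pos h hp x) w := by
  induction F with
  | nil =>
      rintro m n c m' n' pos pos' q - hq rfl hp rfl hn rfl hp' x w hw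
      rfl
  | leaf F ih =>
      intro m n c m' n' pos pos' q hpos hq h hp hm hn h' hp' x w hw
      rw [glue_leaf, glue_leaf,
        Q.comp_comm_lt hm (Nat.add_zero m') (Nat.add_zero m) hm hq (by omega) hpos x hw hl,
        ih (pos + 1) (pos' + 1) q (by omega) (by omega) h (by omega) hm hn h' (by omega) _ hw]
  | node h0 C F ihC ihF =>
      rename_i m₀ a₀ r₀ b₀ c₀
      intro m n c m' n' pos pos' q hpos hq h hp hm hn h' hp' x w hw
      have hm2 : m + (m₀ + 1 + a₀) + c = m' + (m₀ + 1 + a₀) := by omega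
      rw [glue_node Q α e l h0 C F pos h hp rfl, glue_node Q α e l h0 C F pos' h' hp' rfl,
        Q.comp_comm_lt hm rfl rfl hm2 hq (by omega) hpos x hw (par_bush hα he hl C),
        ihF (pos + (m₀ + 1 + a₀) + 1) (pos' + (m₀ + 1 + a₀) + 1) q (by omega) (by omega) (by omega)
          (by omega) hm2 hn (by omega) (by omega) _ hw]

end

/-! ### Cutting a forest at a vertex -/

/-- `G.Cut F F' q`: the forest `F` is obtained from `F'` by replacing the leaf at position `q`
by a vertex with the forest `G` above it. -/
inductive Forest.Cut {M A : ℕ} (G : Forest (M + 2) A) :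
    ∀ {r b b' : ℕ}, Forest r b → Forest r b' → ℕ → Prop
  | here {r b c : ℕ} (h : M + 1 + A + b = c) (F : Forest r b) : Cut G (.node h G F) (.leaf F) 0
  | leaf {r b b' q : ℕ} {F : Forest r b} {F' : Forest r b'} (H : Cut G F F' q) :
      Cut G (.leaf F) (.leaf F') (q + 1)
  | child {m a a' r b c c' q : ℕ} {C : Forest (m + 2) a} {C' : Forest (m + 2) a'}
      (h : m + 1 + a + b = c) (h' : m + 1 + a' + b = c') (F : Forest r b) (H : Cut G C C' q) :
      Cut G (.node h C F) (.node h' C' F) q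
  | rest {m a r b b' c c' q : ℕ} {F : Forest r b} {F' : Forest r b'} (h : m + 1 + a + b = c)
      (h' : m + 1 + a + b' = c') (C : Forest (m + 2) a) (H : Cut G F F' q) :
      Cut G (.node h C F) (.node h' C F') (q + (m + 2 + a))

namespace Forest

theorem Cut.arity {M A : ℕ} {G : Forest (M + 2) A} {r b b' q : ℕ} {F : Forest r b}
    {F' : Forest r b'} (H : G.Cut F F' q) : b' + (M + 1 + A) = b ∧ q < r + b' := by
  induction H <;> omega

/-- Since leaves carry the unit, the leaf of `F'` that stands for the removed vertex contributes
nothing. The bush of `G` can therefore be composed last: it is moved out of the branch that contains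
it by associativity and past the trees to its right by `glue_comp_lt`. -/
theorem Cut.glue {k : Type u} [Field k] {Q : GrOperad.{u, w} k} {α : ∀ n, Q.obj n} {e : Q.obj 0}
    (hα : ∀ n, Q.par (α n) = -α n) (he : Q.par e = -e) {M A : ℕ} {G : Forest (M + 2) A}
    {r b b' q : ℕ} {F : Forest r b} {F' : Forest r b'} (H : G.Cut F F' q) :
    ∀ {m n n' : ℕ} (pos pq : ℕ) (h : m + b = n) (hp : pos + r = m + 1) (h' : m + b' = n')
      (hn : n' + (M + 1 + A) = n) (_ : pq = pos + q) (hq : pq < n' + 1) (x : Q.obj m),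
      F.glue Q α e Q.one pos h hp x
        = Q.comp hn ⟨pq, hq⟩ (F'.glue Q α e Q.one pos h' hp x) (G.bush Q α e Q.one) := by
  have h1 := Q.par_one
  induction H with
  | here h0 F =>
      intro m n n' pos pq h hp h' hn hpq hq x
      have hm : m + (M + 1 + A) = m + (M + 1 + A) := rfl
      rw [glue_node Q α e _ h0 G F pos h hp rfl, glue_leaf, Q.comp_one]
      obtain rfl : pq = pos := by omega
      exact glue_comp_lt hα he h1 F (pq + 1) _ pq (by omega) (by omega) _ (by omega) rfl hn _ _ x
        (par_bush hα he h1 G)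
  | leaf H ih =>
      intro m n n' pos pq h hp h' hn hpq hq x
      rw [glue_leaf, glue_leaf, Q.comp_one]
      exact ih (pos + 1) pq h (by omega) h' hn (by omega) hq x
  | @child m₀ a a' r b c c' q C C' h0 h0' F H ih =>
      intro m n n' pos pq h hp h' hn hpq hq x
      obtain ⟨ha, hqa⟩ := H.arity
      rw [glue_node Q α e _ h0 C F pos h hp rfl, glue_node Q α e _ h0' C' F pos h' hp rfl]
      have hC := ih (n := m₀ + 1 + a) (n' := m₀ + 1 + a') 0 q rfl (Nat.zero_add _) rfl (by omega)
        (Nat.zero_add _).symm (by omega) (α (m₀ + 1))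
      have hb : C.bush Q α e Q.one = Q.comp (by omega) ⟨q, by omega⟩ (C'.bush Q α e Q.one)
          (G.bush Q α e Q.one) := by
        conv_lhs => rw [bush, hC, Q.root_comp]
        rfl
      rw [hb, ← Q.comp_assoc_val rfl (by omega) _ _ _ _ hpq]
      exact glue_comp_lt hα he h1 F (pos + (m₀ + 1 + a') + 1) _ pq (by omega) (by omega) _
        (by omega) (by omega) hn _ _ _ (par_bush hα he h1 G)
  | @rest m₀ a r b b' c c' q F F' h0 h0' C H ih =>
      intro m n n' pos pq h hp h' hn hpq hq x
      rw [glue_node Q α e _ h0 C F pos h hp rfl, glue_node Q α e _ h0' C F' pos h' hp rfl]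
      exact ih _ pq _ _ _ hn (by omega) hq _

/-- The intervals of positions of the leaves above the vertices of a forest. -/
def ivs : ∀ {r b : ℕ}, Forest r b → ℕ → Finset (ℕ × ℕ)
  | _, _, .nil, _ => ∅
  | _, _, .leaf F, pos => F.ivs (pos + 1)
  | _, _, .node (m := m) (a := a) _ C F, pos =>
      insert (pos, m + 2 + a) (C.ivs pos ∪ F.ivs (pos + (m + 2 + a)))

/-- Separates the planar shape from the labelling, so that cutting can be studied on intervals of
positions. -/
theorem clusters_eq {N : ℕ} (label : Equiv.Perm (Fin N)) {r b : ℕ} (F : Forest r b) :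
    ∀ pos, F.clusters label pos = (F.ivs pos).image fun p => leafBlock label p.1 p.2 := by
  induction F with
  | nil => intro pos; rfl
  | leaf F ih => intro pos; exact ih _
  | node h C F ihC ihF =>
      intro pos
      simp only [clusters, ivs, Finset.image_insert, Finset.image_union, ihC, ihF]

theorem mem_ivs {r b : ℕ} (F : Forest r b) : ∀ {pos : ℕ} {x : ℕ × ℕ}, x ∈ F.ivs pos →
    pos ≤ x.1 ∧ x.1 + x.2 ≤ pos + (r + b) ∧ 2 ≤ x.2 := by
  induction F with
  | nil => intro pos x hx; simp [ivs] at hx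
  | leaf F ih => intro pos x hx; have := ih hx; omega
  | node h C F ihC ihF =>
      intro pos x hx
      simp only [ivs, Finset.mem_insert, Finset.mem_union] at hx
      rcases hx with rfl | hx | hx
      · simp only; omega
      · have := ihC hx; omega
      · have := ihF hx; omega

/-- The change of an interval when the position `q` is replaced by `c + 1` positions. -/
def expandIv (q c : ℕ) (x : ℕ × ℕ) : ℕ × ℕ :=
  (if q < x.1 then x.1 + c else x.1, if x.1 ≤ q ∧ q < x.1 + x.2 then x.2 + c else x.2)

theorem ivs_shift {r b : ℕ} (F : Forest r b) : ∀ (pos d : ℕ),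
    F.ivs (d + pos) = (F.ivs pos).image fun x => (d + x.1, x.2) := by
  induction F with
  | nil => intro pos d; rfl
  | leaf F ih => intro pos d; exact ih (pos + 1) d
  | @node m a r b c h C F ihC ihF =>
      intro pos d
      simp only [ivs, Finset.image_insert, Finset.image_union, ihC, ← ihF, add_assoc]

theorem ivs_expand_of_lt {r b : ℕ} (F : Forest r b) {pos q c : ℕ} (hq : q < pos) :
    (F.ivs pos).image (expandIv q c) = F.ivs (c + pos) := by
  rw [ivs_shift]
  refine Finset.image_congr fun x hx => ?_
  have := F.mem_ivs hx
  simp only [expandIv]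
  rw [if_pos (by omega), if_neg (by omega), add_comm]

theorem ivs_expand_of_le {r b : ℕ} (F : Forest r b) {pos q c : ℕ} (hq : pos + (r + b) ≤ q) :
    (F.ivs pos).image (expandIv q c) = F.ivs pos := by
  conv_rhs => rw [← Finset.image_id (s := F.ivs pos)]
  refine Finset.image_congr fun x hx => ?_
  have := F.mem_ivs hx
  simp only [expandIv, id]
  rw [if_neg (by omega), if_neg (by omega)]

/-- The vertices of `F` are the one at the cut, those of `G`, and those of `F'`. Above the last ones
the position `pq` has become a block of M + 2 + A positions, which stretches or shifts the
intervals. -/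
theorem Cut.ivs {M A : ℕ} {G : Forest (M + 2) A} {r b b' q : ℕ} {F : Forest r b}
    {F' : Forest r b'} (H : G.Cut F F' q) : ∀ (pos pq : ℕ) (_ : pq = pos + q),
    F.ivs pos = insert (pq, M + 2 + A)
      (G.ivs pq ∪ (F'.ivs pos).image (expandIv pq (M + 1 + A))) := by
  induction H with
  | here h F =>
      intro pos pq hpq
      obtain rfl : pq = pos := by omega
      simp only [Forest.ivs]
      rw [ivs_expand_of_lt F (by omega)]
      congr 3; omega
  | leaf H ih =>
      intro pos pq hpq
      exact ih (pos + 1) pq (by omega)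
  | @child m₀ a a' r b c c' q C C' h h' F H ih =>
      intro pos pq hpq
      obtain ⟨ha, hqa⟩ := H.arity
      simp only [Forest.ivs, Finset.image_insert, Finset.image_union]
      rw [ih pos pq hpq, ivs_expand_of_lt F (by omega)]
      have e1 : expandIv pq (M + 1 + A) (pos, m₀ + 2 + a') = (pos, m₀ + 2 + a) := by
        simp only [expandIv]; rw [if_neg (by omega), if_pos (by omega)]; congr 1; omega
      have e2 : M + 1 + A + (pos + (m₀ + 2 + a')) = pos + (m₀ + 2 + a) := by omega
      rw [e1, e2]
      ext x; simp only [Finset.mem_insert, Finset.mem_union]; tauto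
  | @rest m₀ a r b b' c c' q F F' h h' C H ih =>
      intro pos pq hpq
      simp only [Forest.ivs, Finset.image_insert, Finset.image_union]
      rw [ih (pos + (m₀ + 2 + a)) pq (by omega), ivs_expand_of_le C (by omega)]
      have e1 : expandIv pq (M + 1 + A) (pos, m₀ + 2 + a) = (pos, m₀ + 2 + a) := by
        simp only [expandIv]; rw [if_neg (by omega), if_neg (by omega)]
      rw [e1]
      ext x; simp only [Finset.mem_insert, Finset.mem_union]; tauto

/-- Each vertex of the forest is a place to cut, and the interval records where the cut is and how
many leaves lie above it. -/
theorem exists_cut_of_mem_ivs {r b : ℕ} (F : Forest r b) : ∀ {pos : ℕ} {x : ℕ × ℕ},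
    x ∈ F.ivs pos → ∃ (M A : ℕ) (G : Forest (M + 2) A) (b' : ℕ) (F' : Forest r b') (q : ℕ),
      G.Cut F F' q ∧ x = (pos + q, M + 2 + A) := by
  induction F with
  | nil => intro pos x hx; simp [Forest.ivs] at hx
  | leaf F ih =>
      intro pos x hx
      obtain ⟨M, A, G, b', F', q, H, rfl⟩ := ih hx
      exact ⟨M, A, G, b', _, q + 1, .leaf H, by congr 1; omega⟩
  | @node m a r b c h C F ihC ihF =>
      intro pos x hx
      simp only [Forest.ivs, Finset.mem_insert, Finset.mem_union] at hx
      rcases hx with rfl | hx | hx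
      · exact ⟨m, a, C, b, _, 0, .here h F, rfl⟩
      · obtain ⟨M, A, G, b', F', q, H, rfl⟩ := ihC hx
        exact ⟨M, A, G, _, _, q, .child h rfl F H, rfl⟩
      · obtain ⟨M, A, G, b', F', q, H, rfl⟩ := ihF hx
        exact ⟨M, A, G, _, _, _, .rest h rfl C H, by congr 1; omega⟩

/-- The inverse operation: a vertex with `G` above it can be grafted on any leaf. -/
theorem exists_cut {M A : ℕ} (G : Forest (M + 2) A) {r b' : ℕ} (F' : Forest r b') :
    ∀ {q : ℕ}, q < r + b' → ∃ (b : ℕ) (F : Forest r b), G.Cut F F' q := by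
  induction F' with
  | nil => intro q hq; omega
  | leaf F ih =>
      intro q hq
      cases q with
      | zero => exact ⟨_, _, .here rfl F⟩
      | succ q =>
          obtain ⟨b, F₁, H⟩ := ih (q := q) (by omega)
          exact ⟨b, _, .leaf H⟩
  | @node m a r b c h C F ihC ihF =>
      intro q hq
      rcases lt_or_ge q (m + 2 + a) with h1 | h1
      · obtain ⟨b, F₁, H⟩ := ihC h1
        exact ⟨_, _, .child rfl h F H⟩
      · obtain ⟨q, rfl⟩ := Nat.exists_eq_add_of_le' h1
        obtain ⟨b, F₁, H⟩ := ihF (q := q) (by omega)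
        exact ⟨_, _, .rest rfl h C H⟩

/-- A forest without vertices consists of leaves, so b = 0 and n = m; evaluating on a member of a
family `x` avoids a transport along this equality. -/
theorem glue_of_ivs_eq_empty {k : Type u} [Field k] {Q : GrOperad.{u, w} k} {α x : ∀ n, Q.obj n}
    {e : Q.obj 0} {r b : ℕ} (F : Forest r b) : ∀ {p : ℕ}, F.ivs p = ∅ → ∀ {m n : ℕ} (pos : ℕ)
      (h : m + b = n) (hp : pos + r = m + 1), F.glue Q α e Q.one pos h hp (x m) = x n := by
  induction F with
  | nil => rintro p - m n pos rfl hp; rfl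
  | leaf F ih =>
      intro p hF m n pos h hp
      rw [glue_leaf, Q.comp_one]
      exact ih hF _ _ _
  | node h C F ihC ihF => intro p hF; simp [Forest.ivs] at hF

theorem exists_ivs_eq_empty (r : ℕ) : ∃ F : Forest r 0, ∀ p, F.ivs p = ∅ := by
  induction r with
  | zero => exact ⟨.nil, fun _ => rfl⟩
  | succ r ih => obtain ⟨F, hF⟩ := ih; exact ⟨.leaf F, fun p => hF _⟩

end Forest

noncomputable section

/-! ### Cutting and grafting labelled trees -/

theorem mem_leafBlock {N : ℕ} {label : Equiv.Perm (Fin N)} {pos len : ℕ} {i : Fin N} :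
    i ∈ leafBlock label pos len ↔ pos ≤ (label.symm i : ℕ) ∧ (label.symm i : ℕ) < pos + len := by
  simp [leafBlock]

theorem card_leafBlock {N : ℕ} (label : Equiv.Perm (Fin N)) {pos len : ℕ} (h : pos + len ≤ N) :
    (leafBlock label pos len).card = len := by
  have : (Finset.range len).card = (leafBlock label pos len).card := by
    refine Finset.card_bij (fun i hi => label ⟨pos + i, by
      have := Finset.mem_range.1 hi; omega⟩) ?_ ?_ ?_
    · intro i hi
      have := Finset.mem_range.1 hi
      rw [mem_leafBlock]; simp [this]
    · intro i hi j hj e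
      have := congrArg Fin.val (label.injective e)
      simpa using this
    · intro c hc
      rw [mem_leafBlock] at hc
      refine ⟨(label.symm c : ℕ) - pos, Finset.mem_range.2 (by omega), ?_⟩
      refine ((label.eq_symm_apply).1 (Fin.ext ?_))
      simp only
      omega
  rw [← this, Finset.card_range]

namespace PlanarTree
variable {n : ℕ} (T : PlanarTree n)

theorem clusters_eq_image :
    T.clusters = insert Finset.univ ((T.children.ivs 0).image fun p => leafBlock T.label p.1 p.2) := by
  rw [clusters, Forest.clusters_eq]

theorem two_le_card_of_mem_clusters {D : Finset (Fin (n + 1))} (hD : D ∈ T.clusters) :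
    2 ≤ D.card := by
  rw [clusters_eq_image, Finset.mem_insert, Finset.mem_image] at hD
  have := T.h
  rcases hD with rfl | ⟨x, hx, rfl⟩
  · rw [Finset.card_univ, Fintype.card_fin]; omega
  · have h := T.children.mem_ivs hx
    rw [card_leafBlock _ (by omega)]; exact h.2.2

theorem univ_mem_clusters : Finset.univ ∈ T.clusters := Finset.mem_insert_self _ _

variable {k : Type u} [Field k] (Q : GrOperad.{u, w} k) (α : ∀ n, Q.obj n) (e : Q.obj 0)

/-- Composition along a labelled tree, without labels at the extremities. -/
def value : Q.obj n :=
  Q.act T.label (T.children.glue Q α e Q.one 0 T.h (Nat.zero_add _) (α (T.m + 1)))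

end PlanarTree

/-! ### Clusters of a grafted tree -/

section
variable {a b n : ℕ} (h : a + b = n)

/-- The map from the inputs of `x ∘_0 y` to the inputs of `x` that sends the inputs of `y`
to `0`. -/
def collapse (c : Fin (n + 1)) : Fin (a + 1) := ⟨(c : ℕ) - b, by omega⟩

/-- The set of inputs of `σ (x ∘_0 y)` that lie above a set of inputs of `x`. -/
def outBlock (σ : Equiv.Perm (Fin (n + 1))) (D : Finset (Fin (a + 1))) : Finset (Fin (n + 1)) :=
  Finset.univ.filter fun i => collapse h (σ.symm i) ∈ D

/-- A set of inputs of `y` as a set of inputs of `σ (x ∘_0 y)`. -/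
def inBlock (_ : a + b = n) (σ : Equiv.Perm (Fin (n + 1))) (D : Finset (Fin (b + 1))) :
    Finset (Fin (n + 1)) :=
  Finset.univ.filter fun i => ∃ c ∈ D, (c : ℕ) = σ.symm i

variable {h} {σ : Equiv.Perm (Fin (n + 1))}

theorem mem_outBlock {D : Finset (Fin (a + 1))} {i : Fin (n + 1)} :
    i ∈ outBlock h σ D ↔ collapse h (σ.symm i) ∈ D := by simp [outBlock]

theorem mem_inBlock {D : Finset (Fin (b + 1))} {i : Fin (n + 1)} :
    i ∈ inBlock h σ D ↔ ∃ c ∈ D, (c : ℕ) = σ.symm i := by simp [inBlock]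

theorem outBlock_injective : Function.Injective (outBlock h σ) := by
  intro D D' e
  ext j
  have := Finset.ext_iff.1 e (σ ⟨j + b, by omega⟩)
  rw [mem_outBlock, mem_outBlock, Equiv.symm_apply_apply] at this
  simpa [collapse] using this

theorem inBlock_injective : Function.Injective (inBlock h σ) := by
  intro D D' e
  ext j
  have := Finset.ext_iff.1 e (σ ⟨j, by omega⟩)
  rw [mem_inBlock, mem_inBlock, Equiv.symm_apply_apply] at this
  constructor
  · intro hj
    obtain ⟨c, hc, e⟩ := this.1 ⟨j, hj, rfl⟩
    rwa [← Fin.ext e]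
  · intro hj
    obtain ⟨c, hc, e⟩ := this.2 ⟨j, hj, rfl⟩
    rwa [← Fin.ext e]

/-- All inputs of `y` collapse to the input 0 of `x`, so equality would force `D` into {0}. Here
reducedness matters: a cluster has at least two elements. -/
theorem outBlock_ne_inBlock {D : Finset (Fin (a + 1))} {D' : Finset (Fin (b + 1))}
    (hD : 2 ≤ D.card) : outBlock h σ D ≠ inBlock h σ D' := by
  intro e
  have : D ⊆ {0} := by
    intro j hj
    have := Finset.ext_iff.1 e (σ ⟨j + b, by omega⟩)
    rw [mem_outBlock, mem_inBlock, Equiv.symm_apply_apply] at this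
    obtain ⟨c, -, hc⟩ := this.1 (by simpa [collapse] using hj)
    replace hc : (c : ℕ) = j + b := hc
    rw [Finset.mem_singleton]
    refine Fin.ext ?_
    rw [Fin.val_zero]; omega
  have := Finset.card_le_card this
  simp at this; omega

theorem outBlock_univ : outBlock h σ Finset.univ = Finset.univ := by
  ext i; simp [mem_outBlock]

theorem mem_inBlock_univ {i : Fin (n + 1)} :
    i ∈ inBlock h σ Finset.univ ↔ (σ.symm i : ℕ) < b + 1 := by
  rw [mem_inBlock]
  constructor
  · rintro ⟨c, -, hc⟩; omega
  · intro hi; exact ⟨⟨_, hi⟩, Finset.mem_univ _, rfl⟩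

theorem inBlock_univ_eq {S : Finset (Fin (n + 1))} (hS : ∀ i, σ i ∈ S ↔ (i : ℕ) < b + 1) :
    inBlock h σ Finset.univ = S := by
  ext i; rw [mem_inBlock_univ, ← hS, Equiv.apply_symm_apply]

variable (h σ)

/-- The clusters of the tree obtained from two trees by grafting. -/
def graftSets (H₁ : Finset (Finset (Fin (a + 1)))) (H₂ : Finset (Finset (Fin (b + 1)))) :
    Finset (Finset (Fin (n + 1))) :=
  H₁.image (outBlock h σ) ∪ H₂.image (inBlock h σ)

variable {h σ}

theorem card_graftSets {H₁ : Finset (Finset (Fin (a + 1)))} {H₂ : Finset (Finset (Fin (b + 1)))}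
    (h₁ : ∀ D ∈ H₁, 2 ≤ D.card) : (graftSets h σ H₁ H₂).card = H₁.card + H₂.card := by
  rw [graftSets, Finset.card_union_of_disjoint, Finset.card_image_of_injective _ outBlock_injective,
    Finset.card_image_of_injective _ inBlock_injective]
  rw [Finset.disjoint_left]
  intro D hD hD'
  obtain ⟨E, hE, rfl⟩ := Finset.mem_image.1 hD
  obtain ⟨E', hE', e⟩ := Finset.mem_image.1 hD'
  exact outBlock_ne_inBlock (h₁ E hE) e.symm

/-- Both maps on clusters are injective, and their images are disjoint by `outBlock_ne_inBlock`;
thus a tree and one of its internal edges determine the two parts up to isomorphism. -/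
theorem graftSets_injective {H₁ H₁' : Finset (Finset (Fin (a + 1)))}
    {H₂ H₂' : Finset (Finset (Fin (b + 1)))} (h₁ : ∀ D ∈ H₁, 2 ≤ D.card)
    (h₁' : ∀ D ∈ H₁', 2 ≤ D.card) (E : graftSets h σ H₁ H₂ = graftSets h σ H₁' H₂') :
    H₁ = H₁' ∧ H₂ = H₂' := by
  have key : ∀ {H₁ H₁' : Finset (Finset (Fin (a + 1)))} {H₂ H₂' : Finset (Finset (Fin (b + 1)))},
      (∀ D ∈ H₁, 2 ≤ D.card) → (∀ D ∈ H₁', 2 ≤ D.card) →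
      graftSets h σ H₁ H₂ = graftSets h σ H₁' H₂' → H₁ ⊆ H₁' ∧ H₂ ⊆ H₂' := by
    intro H₁ H₁' H₂ H₂' h₁ h₁' E
    constructor
    · intro D hD
      have : outBlock h σ D ∈ graftSets h σ H₁' H₂' :=
        E ▸ Finset.mem_union_left _ (Finset.mem_image_of_mem _ hD)
      rcases Finset.mem_union.1 this with h2 | h2 <;> obtain ⟨D', hD', e⟩ := Finset.mem_image.1 h2
      · rwa [← outBlock_injective e]
      · exact absurd e.symm (outBlock_ne_inBlock (h₁ D hD))
    · intro D hD
      have : inBlock h σ D ∈ graftSets h σ H₁' H₂' :=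
        E ▸ Finset.mem_union_right _ (Finset.mem_image_of_mem _ hD)
      rcases Finset.mem_union.1 this with h2 | h2 <;> obtain ⟨D', hD', e⟩ := Finset.mem_image.1 h2
      · exact absurd e (outBlock_ne_inBlock (h₁' D' hD'))
      · rwa [← inBlock_injective e]
  exact ⟨(key h₁ h₁' E).1.antisymm (key h₁' h₁ E.symm).1,
    (key h₁ h₁' E).2.antisymm (key h₁' h₁ E.symm).2⟩

end

/-! ### Cutting labelled trees, and independence of the planar representative -/

section
variable {k : Type u} [Field k] (Q : GrOperad.{u, w} k) (α : ∀ n, Q.obj n) (e : Q.obj 0)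

/-- `T` is obtained by grafting `T₂` on the leaf `0` of `T₁` and relabelling by `σ`. -/
structure IsGraft {a b n : ℕ} (h : a + b = n) (σ : Equiv.Perm (Fin (n + 1))) (T : PlanarTree n)
    (T₁ : PlanarTree a) (T₂ : PlanarTree b) : Prop where
  value_eq : T.value Q α e = Q.act σ (Q.comp h 0 (T₁.value Q α e)
    (Q.comp (Nat.zero_add b) 0 e (T₂.value Q α e)))
  clusters_eq : T.clusters = graftSets h σ T₁.clusters T₂.clusters

variable {Q α e}

/-- Translates a cut at position `q` of a planar forest into a grafting at the input 0, as in
`star`: `label₁` takes `q` to 0, and equivariance with the block permutation `ρ` moves the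
composition from `q` to 0. The clusters are then compared leaf by leaf through `Cut.ivs`. -/
theorem Forest.Cut.isGraft (hα : ∀ n, Q.par (α n) = -α n) (he : Q.par e = -e)
    {M A m a₁ a₂ a b n q : ℕ} {G : Forest (M + 2) A} {F : Forest (m + 2) a₂}
    {F' : Forest (m + 2) a₁} (H : G.Cut F F' q) (h₀ : m + 1 + a₂ = n) (h₁ : m + 1 + a₁ = a)
    (h₂ : M + 1 + A = b) (h : a + b = n) (hq : q < a + 1) (σ ρ : Equiv.Perm (Fin (n + 1)))
    (label₁ : Equiv.Perm (Fin (a + 1))) (label₂ : Equiv.Perm (Fin (b + 1)))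
    (h0 : label₁ ⟨q, hq⟩ = 0)
    (ho : ∀ j, j ≠ ⟨q, hq⟩ → ρ (outerPos h ⟨q, hq⟩ j) = outerPos h 0 (label₁ j))
    (hi : ∀ c, ρ (innerPos h ⟨q, hq⟩ c) = innerPos h 0 (label₂ c)) :
    IsGraft Q α e h σ ⟨m, a₂, h₀, F, σ * ρ⟩ ⟨m, a₁, h₁, F', label₁⟩ ⟨M, A, h₂, G, label₂⟩ := by
  constructor
  · have := Q.equivariant h ⟨q, hq⟩ label₁ label₂ ρ (by rwa [h0]) (by rwa [h0])
      (F'.glue Q α e Q.one 0 h₁ (Nat.zero_add _) (α (m + 1))) (Q.comp (Nat.zero_add b) 0 e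
        (G.glue Q α e Q.one 0 h₂ (Nat.zero_add _) (α (M + 1))))
    rw [h0] at this
    subst h₂
    simp only [PlanarTree.value]
    rw [Q.root_act, this, Q.act_mul]
    congr 2
    exact H.glue hα he 0 q h₀ (Nat.zero_add _) h₁ h (Nat.zero_add q).symm hq (α (m + 1))
  · rw [PlanarTree.clusters_eq_image, graftSets, PlanarTree.clusters_eq_image,
      PlanarTree.clusters_eq_image]
    simp only [Finset.image_insert, outBlock_univ]
    rw [H.ivs 0 q (Nat.zero_add q).symm, Finset.image_insert, Finset.image_union,
      Finset.image_image, Finset.image_image, Finset.image_image]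
    -- Every leaf of the whole tree is either a leaf of the lower tree other than the one at `q`, or
    -- a leaf of the upper tree; in both cases its position in the planar tree and its position
    -- before relabelling by `σ` are recorded.
    have cases : ∀ i : Fin (n + 1), (∃ j, j ≠ (⟨q, hq⟩ : Fin (a + 1)) ∧
        (((σ * ρ).symm i : Fin (n + 1)) : ℕ) = (if (j : ℕ) < q then (j : ℕ) else j + b) ∧
        collapse h (σ.symm i) = label₁ j ∧ b + 1 ≤ (σ.symm i : ℕ)) ∨
        ∃ c : Fin (b + 1), (((σ * ρ).symm i : Fin (n + 1)) : ℕ) = q + c ∧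
          (σ.symm i : ℕ) = label₂ c ∧ collapse h (σ.symm i) = 0 := by
      intro i
      obtain ⟨c, rfl⟩ := (σ * ρ).surjective i
      have e1 : σ.symm ((σ * ρ) c) = ρ c := by simp
      rw [Equiv.symm_apply_apply, e1]
      rcases outerPos_or_innerPos h ⟨q, hq⟩ c with ⟨j, hj, rfl⟩ | ⟨c, rfl⟩
      · left
        have hne : label₁ j ≠ 0 := fun e => hj (label₁.injective (e.trans h0.symm))
        have hne' : (label₁ j : ℕ) ≠ 0 := fun e => hne (Fin.ext e)
        refine ⟨j, hj, rfl, ?_, ?_⟩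
        · rw [ho j hj]; ext; simp [collapse, outerPos]
        · rw [ho j hj]
          simp only [outerPos, Fin.val_zero, Nat.not_lt_zero, if_false]; omega
      · right
        refine ⟨c, rfl, ?_, ?_⟩
        · rw [hi]; simp [innerPos]
        · rw [hi]; ext; simp [innerPos, collapse]; omega
    have k1 : (fun p : ℕ × ℕ => leafBlock (σ * ρ) p.1 p.2) ∘ Forest.expandIv q (M + 1 + A)
        = outBlock h σ ∘ fun p : ℕ × ℕ => leafBlock label₁ p.1 p.2 := by
      funext ⟨p, l⟩
      ext i
      simp only [Function.comp, Forest.expandIv, mem_leafBlock, mem_outBlock]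
      rcases cases i with ⟨j, hj, e1, e2, -⟩ | ⟨c, e1, -, e2⟩
      · rw [e1, e2, Equiv.symm_apply_apply]
        have hj' : (j : ℕ) ≠ q := fun e => hj (Fin.ext e)
        split_ifs <;> omega
      · rw [e1, e2, ← h0, Equiv.symm_apply_apply]
        have := c.2
        simp only
        split_ifs <;> omega
    have k2 : leafBlock (σ * ρ) q (M + 2 + A) = inBlock h σ Finset.univ := by
      ext i
      rw [mem_leafBlock, mem_inBlock_univ]
      rcases cases i with ⟨j, hj, e1, -, e2⟩ | ⟨c, e1, e2, -⟩
      · rw [e1]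
        have hj' : (j : ℕ) ≠ q := fun e => hj (Fin.ext e)
        split_ifs <;> omega
      · rw [e1, e2]
        have := c.2
        have := (label₂ c).2
        omega
    have k3 : (G.ivs q).image (fun p : ℕ × ℕ => leafBlock (σ * ρ) p.1 p.2)
        = (G.ivs 0).image (inBlock h σ ∘ fun p : ℕ × ℕ => leafBlock label₂ p.1 p.2) := by
      have := G.ivs_shift 0 q
      rw [add_zero] at this
      rw [this, Finset.image_image]
      refine Finset.image_congr fun x hx => ?_
      have hx := G.mem_ivs hx
      ext i
      simp only [Function.comp, mem_leafBlock, mem_inBlock]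
      rcases cases i with ⟨j, hj, e1, -, e2⟩ | ⟨c, e1, e2, -⟩
      · rw [e1]
        have hj' : (j : ℕ) ≠ q := fun e => hj (Fin.ext e)
        constructor
        · intro; exfalso; split_ifs at * <;> omega
        · rintro ⟨c, -, hc⟩; omega
      · rw [e1, e2]
        constructor
        · intro hc
          exact ⟨label₂ c, by rw [Equiv.symm_apply_apply]; omega, rfl⟩
        · rintro ⟨c', hc, e'⟩
          have := Fin.ext e'
          subst this
          rw [Equiv.symm_apply_apply] at hc
          omega
    rw [k1, k2, k3]
    ext D; simp only [Finset.mem_insert, Finset.mem_union]; tauto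

/-- A cluster other than the full set belongs to a non-root vertex, and the tree is cut there. As
`σ` takes the initial segment to this cluster, σ⁻¹ composed with the labelling takes a block to a
block, and `exists_perms_of_block` provides labellings of the two parts. -/
theorem exists_isGraft_of_mem (hα : ∀ n, Q.par (α n) = -α n) (he : Q.par e = -e) {a b n : ℕ}
    (h : a + b = n) (T : PlanarTree n) {C : Finset (Fin (n + 1))} (hC : C ∈ T.clusters)
    (hC' : C ≠ Finset.univ) {σ : Equiv.Perm (Fin (n + 1))}
    (hσ : ∀ i, σ i ∈ C ↔ (i : ℕ) < b + 1) (hb : C.card = b + 1) :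
    ∃ T₁ T₂, IsGraft Q α e h σ T T₁ T₂ := by
  obtain ⟨m, a₂, h₀, F, label⟩ := T
  rw [PlanarTree.clusters_eq_image, Finset.mem_insert] at hC
  obtain ⟨x, hx, rfl⟩ := Finset.mem_image.1 (hC.resolve_left hC')
  obtain ⟨M, A, G, a₁, F', q, H, rfl⟩ := F.exists_cut_of_mem_ivs hx
  have hm := F.mem_ivs hx
  have har := H.arity
  simp only [zero_add] at hb hσ hm h₀
  rw [card_leafBlock _ (by omega)] at hb
  have h₂ : M + 1 + A = b := by omega
  have h₁ : m + 1 + a₁ = a := by omega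
  have hq : q < a + 1 := by omega
  obtain ⟨label₁, label₂, h0, ho, hi⟩ := exists_perms_of_block h ⟨q, hq⟩ 0 (σ⁻¹ * label) fun c => by
    rw [innerPos_zero_iff, ← hσ, Equiv.Perm.mul_apply, ← Equiv.Perm.mul_apply σ,
      mul_inv_cancel, Equiv.Perm.one_apply, mem_leafBlock, Equiv.symm_apply_apply]
    simp only [innerPos]; omega
  have := H.isGraft hα he h₀ h₁ h₂ h hq σ _ label₁ label₂ h0 ho hi
  rw [mul_inv_cancel_left] at this
  exact ⟨_, _, this⟩

/-- The upper tree is attached at the position of the leaf of the lower tree labelled 0, and the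
labellings are combined by `exists_blockPerm`. -/
theorem exists_isGraft (hα : ∀ n, Q.par (α n) = -α n) (he : Q.par e = -e) {a b n : ℕ}
    (h : a + b = n) (σ : Equiv.Perm (Fin (n + 1))) (T₁ : PlanarTree a) (T₂ : PlanarTree b) :
    ∃ T, IsGraft Q α e h σ T T₁ T₂ := by
  obtain ⟨m, a₁, h₁, F', label₁⟩ := T₁
  obtain ⟨M, A, h₂, G, label₂⟩ := T₂
  obtain ⟨a₂, F, H⟩ := G.exists_cut F' (q := label₁.symm 0) (by omega)
  have har := H.arity
  obtain ⟨ρ, ho, hi⟩ := exists_blockPerm h (label₁.symm 0) label₁ label₂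
  rw [Equiv.apply_symm_apply] at ho hi
  exact ⟨_, H.isGraft hα he (show m + 1 + a₂ = n by omega) h₁ h₂ h (label₁.symm 0).2 σ ρ label₁ label₂
    (Equiv.apply_symm_apply _ _) ho hi⟩

/-- Above a non-root vertex there are fewer leaves than in the whole tree, so such a vertex would
give a second cluster. The tree is a corolla, and symmetry of `α` removes the labelling. -/
theorem PlanarTree.value_of_clusters_eq (hαs : ∀ n, Q.IsSymm (α n)) {n : ℕ} {T : PlanarTree n}
    (hT : T.clusters ⊆ {Finset.univ}) : T.value Q α e = α n := by
  have h0 : T.children.ivs 0 = ∅ := by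
    rw [Finset.eq_empty_iff_forall_notMem]
    intro x hx
    have h1 : leafBlock T.label x.1 x.2 ∈ T.clusters := by
      rw [clusters_eq_image]
      exact Finset.mem_insert_of_mem (Finset.mem_image_of_mem _ hx)
    have h2 := Finset.mem_singleton.1 (hT h1)
    obtain ⟨M, A, G, a₁, F', q, H, rfl⟩ := T.children.exists_cut_of_mem_ivs hx
    have h3 := T.children.mem_ivs hx
    have h4 := congrArg Finset.card h2
    have := H.arity
    have := T.h
    simp only at h3 h4
    rw [card_leafBlock _ (by omega), Finset.card_univ, Fintype.card_fin] at h4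
    omega
  rw [value, T.children.glue_of_ivs_eq_empty h0, hαs]

/-- The composition along a labelled tree depends only on the clusters of the tree. -/
theorem PlanarTree.value_eq_of_clusters_eq (hα : ∀ n, Q.par (α n) = -α n) (he : Q.par e = -e)
    (hαs : ∀ n, Q.IsSymm (α n)) {n : ℕ} (T T' : PlanarTree n) (hT : T.clusters = T'.clusters) :
    T.value Q α e = T'.value Q α e := by
  induction n using Nat.strong_induction_on with
  | _ n ih =>
    by_cases h0 : T.clusters ⊆ {Finset.univ}
    · rw [value_of_clusters_eq hαs h0, value_of_clusters_eq hαs (hT ▸ h0)]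
    · obtain ⟨C, hC, hC'⟩ := Finset.not_subset.1 h0
      rw [Finset.mem_singleton] at hC'
      have hc2 := T.two_le_card_of_mem_clusters hC
      have hcn : C.card < n + 1 := by
        have := Finset.card_lt_univ_of_notMem (s := C) (x := (Finset.univ \ C).min' (by
          rw [Finset.sdiff_nonempty]; exact fun h => hC' (Finset.univ_subset_iff.1 h)))
          (Finset.mem_sdiff.1 (Finset.min'_mem _ _)).2
        simpa using this
      -- Both trees are cut at the same proper cluster with the same relabelling; by
      -- `graftSets_injective` the parts have equal clusters, and they are smaller.
      have hs := permOf_spec (S := C) (j := C.card - 1 + 1) (by omega)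
      have hab : n - (C.card - 1) + (C.card - 1) = n := by omega
      obtain ⟨T₁, T₂, g⟩ := exists_isGraft_of_mem hα he hab T hC hC' hs (by omega)
      obtain ⟨T₁', T₂', g'⟩ := exists_isGraft_of_mem hα he hab T' (hT ▸ hC) hC' hs (by omega)
      have := graftSets_injective (fun D => T₁.two_le_card_of_mem_clusters)
        (fun D => T₁'.two_le_card_of_mem_clusters)
        (g.clusters_eq.symm.trans (hT.trans g'.clusters_eq))
      rw [g.value_eq, g'.value_eq, ih _ (by omega) T₁ T₁' this.1, ih _ (by omega) T₂ T₂' this.2]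

end

noncomputable section

/-! ### Sums over trees -/

section
variable {k : Type u} [Field k] (Q : GrOperad.{u, w} k) (α : ∀ n, Q.obj n) (e : Q.obj 0)

theorem RTree.clusters_planar {n : ℕ} (T : RTree n) : T.planar.clusters = T.1 := T.2.choose_spec

theorem RTree.pos {n : ℕ} (T : RTree n) : 0 < n := by have := T.planar.h; omega

theorem RTree.two_le_card {n : ℕ} (T : RTree n) : ∀ D ∈ T.1, 2 ≤ D.card := by
  rw [← T.clusters_planar]; exact fun D => T.planar.two_le_card_of_mem_clusters

theorem RTree.univ_mem {n : ℕ} (T : RTree n) : Finset.univ ∈ T.1 := by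
  rw [← T.clusters_planar]; exact T.planar.univ_mem_clusters

/-- The isomorphism class of a planar tree. -/
def PlanarTree.toRTree {n : ℕ} (T : PlanarTree n) : RTree n := ⟨T.clusters, T, rfl⟩

theorem PlanarTree.toRTree_val {n : ℕ} (T : PlanarTree n) : T.toRTree.1 = T.clusters := rfl

theorem RTree.ext {n : ℕ} {T T' : RTree n} (h : T.1 = T'.1) : T = T' := Subtype.ext h

/-- Composition of operations with a fixed operation of arity one at the output. -/
def GrOperad.root {n : ℕ} : Q.obj n →ₗ[k] Q.obj n := Q.comp (Nat.zero_add n) 0 e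

/-- The sum of the compositions along the trees with `j` internal edges. -/
def treeSum (j : ℕ) : Q.Fam := fun n =>
  ∑ T : RTree n, if T.1.card = j + 1 then T.planar.value Q α e else 0

variable {Q α e}

theorem sum_comm_four {M ι₁ ι₂ ι₃ ι₄ : Type*} [AddCommMonoid M] (s₁ : Finset ι₁)
    (s₂ : Finset ι₂) (s₃ : Finset ι₃) (s₄ : Finset ι₄) (f : ι₁ → ι₂ → ι₃ → ι₄ → M) :
    ∑ x ∈ s₁, ∑ y ∈ s₂, ∑ z ∈ s₃, ∑ t ∈ s₄, f x y z t
      = ∑ t ∈ s₄, ∑ z ∈ s₃, ∑ y ∈ s₂, ∑ x ∈ s₁, f x y z t := by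
  calc _ = ∑ t ∈ s₄, ∑ x ∈ s₁, ∑ y ∈ s₂, ∑ z ∈ s₃, f x y z t := by
        symm
        rw [Finset.sum_comm]
        refine Finset.sum_congr rfl fun x _ => ?_
        rw [Finset.sum_comm]
        exact Finset.sum_congr rfl fun y _ => Finset.sum_comm
    _ = _ := by
        refine Finset.sum_congr rfl fun t _ => ?_
        rw [Finset.sum_congr rfl fun x _ => Finset.sum_comm, Finset.sum_comm]
        exact Finset.sum_congr rfl fun y _ => Finset.sum_comm

/-- Counts internal edges: they correspond to the clusters other than the full set, and each is seen
for exactly one `p`, fixed by its cardinality. -/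
theorem sum_ite_card_eq (k : Type u) [Field k] {n : ℕ} (T : RTree n) :
    ∑ p : Fin (n + 1), ∑ C : Finset (Fin (n + 1)),
      (if C ∈ T.1 ∧ C ≠ Finset.univ ∧ C.card = n - p + 1 then (1 : k) else 0)
      = ((T.1.card - 1 : ℕ) : k) := by
  classical
  rw [Finset.sum_comm]
  have h1 : ∀ C : Finset (Fin (n + 1)), ∑ p : Fin (n + 1),
      (if C ∈ T.1 ∧ C ≠ Finset.univ ∧ C.card = n - p + 1 then (1 : k) else 0)
      = if C ∈ T.1.erase Finset.univ then 1 else 0 := by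
    intro C
    by_cases hC : C ∈ T.1.erase Finset.univ
    · obtain ⟨hC1, hC2⟩ := Finset.mem_erase.1 hC
      have h2 := T.two_le_card C hC2
      have h3 : C.card ≤ n + 1 := by simpa using Finset.card_le_univ C
      rw [if_pos hC, Finset.sum_eq_single ⟨n + 1 - C.card, by omega⟩]
      · rw [if_pos ⟨hC2, hC1, by simp only; omega⟩]
      · rintro ⟨p, hp⟩ _ hne
        rw [if_neg]
        rintro ⟨-, -, h4⟩
        refine hne (Fin.ext ?_)
        simp only at h4 ⊢
        omega
      · simp
    · rw [if_neg hC]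
      refine Finset.sum_eq_zero fun p _ => if_neg fun h => hC ?_
      exact Finset.mem_erase.2 ⟨h.2.1, h.1⟩
  rw [Finset.sum_congr rfl fun C _ => h1 C, Finset.sum_ite_mem, Finset.univ_inter]
  rw [Finset.sum_const, Finset.card_erase_of_mem T.univ_mem]
  simp

/-! ### The recursion over internal edges -/

section
variable (hα : ∀ n, Q.par (α n) = -α n) (he : Q.par e = -e) (hαs : ∀ n, Q.IsSymm (α n))
include hα he hαs

theorem RTree.value_planar {n : ℕ} {T : RTree n} {T' : PlanarTree n} (h : T'.clusters = T.1) :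
    T.planar.value Q α e = T'.value Q α e :=
  PlanarTree.value_eq_of_clusters_eq hα he hαs _ _ (T.clusters_planar.trans h.symm)

omit hα he in
-- A tree without internal edges is a corolla. There is no reduced tree with one leaf, which is why
-- `α 0` has to vanish.
theorem treeSum_zero (h0 : α 0 = 0) : treeSum Q α e 0 = α := by
  funext n
  cases n with
  | zero =>
      rw [h0]
      exact Finset.sum_eq_zero fun T _ => absurd T.pos (lt_irrefl 0)
  | succ n =>
      obtain ⟨F, hF⟩ := Forest.exists_ivs_eq_empty (n + 2)
      let T₀ : PlanarTree (n + 1) := ⟨n, 0, rfl, F, 1⟩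
      have hT₀ : T₀.clusters = {Finset.univ} := by
        rw [PlanarTree.clusters_eq_image]
        change insert _ (Finset.image _ (F.ivs 0)) = _
        rw [hF]; rfl
      have h1 : ∀ T : RTree (n + 1), T.1.card = 0 + 1 → T.1 = {Finset.univ} := by
        intro T hT
        obtain ⟨D, hD⟩ := Finset.card_eq_one.1 hT
        have := T.univ_mem
        rw [hD, Finset.mem_singleton] at this
        rw [hD, this]
      unfold treeSum
      rw [Finset.sum_eq_single T₀.toRTree]
      · rw [if_pos (by rw [T₀.toRTree_val, hT₀]; simp)]
        refine PlanarTree.value_of_clusters_eq hαs ?_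
        rw [RTree.clusters_planar, T₀.toRTree_val, hT₀]
      · intro T _ hT
        rw [if_neg]
        exact fun h => hT (RTree.ext ((h1 T h).trans hT₀.symm))
      · exact fun h => absurd (Finset.mem_univ _) h

/-- The bijection between trees with a marked internal edge and pairs of trees together with the set
`S` of leaves that go to the upper one. It is surjective by cutting, injective by
`graftSets_injective`, and compatible with the compositions by independence of the planar
representative. -/
theorem treeSum_isGraft {a b n : ℕ} (h : a + b = n) (j : ℕ) :
    ∑ T : RTree n, ∑ C : Finset (Fin (n + 1)),
      (if T.1.card = j + 2 ∧ C ∈ T.1 ∧ C ≠ Finset.univ ∧ C.card = b + 1 then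
        T.planar.value Q α e else 0)
    = ∑ S ∈ Finset.powersetCard (b + 1) (Finset.univ : Finset (Fin (n + 1))),
        ∑ T₁ : RTree a, ∑ T₂ : RTree b, if T₁.1.card + T₂.1.card = j + 2 then
          Q.act (permOf S (b + 1)) (Q.comp h 0 (T₁.planar.value Q α e)
            (Q.root e (T₂.planar.value Q α e))) else 0 := by
  classical
  simp only [← Finset.sum_product']
  rw [← Finset.sum_filter, ← Finset.sum_filter]
  symm
  have hg : ∀ (S : Finset (Fin (n + 1))) (T₁ : RTree a) (T₂ : RTree b), ∃ T : PlanarTree n,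
      IsGraft Q α e h (permOf S (b + 1)) T T₁.planar T₂.planar := fun S T₁ T₂ =>
    exists_isGraft hα he h _ _ _
  choose g hg using hg
  have hcl : ∀ S T₁ T₂, (g S T₁ T₂).clusters = graftSets h (permOf S (b + 1)) T₁.1 T₂.1 := by
    intro S T₁ T₂
    rw [(hg S T₁ T₂).clusters_eq, T₁.clusters_planar, T₂.clusters_planar]
  refine Finset.sum_bij (fun y _ => ((g y.1 y.2.1 y.2.2).toRTree, y.1)) ?_ ?_ ?_ ?_
  · rintro ⟨S, T₁, T₂⟩ hy
    simp only [Finset.mem_filter, Finset.mem_product, Finset.mem_powersetCard, Finset.mem_univ,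
      and_true, true_and, PlanarTree.toRTree_val] at hy ⊢
    obtain ⟨⟨-, hS⟩, hc⟩ := hy
    refine ⟨?_, ?_, ?_, hS⟩
    · rw [hcl, card_graftSets T₁.two_le_card, hc]
    · rw [hcl, graftSets]
      refine Finset.mem_union_right _ (Finset.mem_image.2 ⟨_, T₂.univ_mem, ?_⟩)
      exact inBlock_univ_eq (permOf_spec hS)
    · rintro rfl
      rw [Finset.card_univ, Fintype.card_fin] at hS
      have := T₁.pos
      omega
  · rintro ⟨S, T₁, T₂⟩ hy ⟨S', T₁', T₂'⟩ hy' E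
    obtain rfl : S = S' := congrArg Prod.snd E
    have E := congrArg Subtype.val (congrArg Prod.fst E)
    simp only [PlanarTree.toRTree_val] at E
    rw [hcl, hcl] at E
    have := graftSets_injective T₁.two_le_card T₁'.two_le_card E
    rw [RTree.ext this.1, RTree.ext this.2]
  · rintro ⟨T, C⟩ hy
    simp only [Finset.mem_filter, Finset.mem_product, Finset.mem_univ, and_true, true_and] at hy
    obtain ⟨hc, hC, hC', hb⟩ := hy
    obtain ⟨T₁, T₂, hT⟩ := exists_isGraft_of_mem hα he h T.planar (T.clusters_planar.symm ▸ hC) hC'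
      (permOf_spec hb) hb
    have hTc := hT.clusters_eq
    rw [T.clusters_planar] at hTc
    refine ⟨(C, T₁.toRTree, T₂.toRTree), ?_, ?_⟩
    · simp only [Finset.mem_filter, Finset.mem_product, Finset.mem_powersetCard, Finset.mem_univ,
        and_true]
      refine ⟨⟨Finset.subset_univ _, hb⟩, ?_⟩
      rw [← hc, hTc, card_graftSets fun D => T₁.two_le_card_of_mem_clusters]
      rfl
    · refine Prod.ext (RTree.ext ?_) rfl
      change (g C _ _).clusters = T.1
      rw [hcl, hTc]
      rfl
  · rintro ⟨S, T₁, T₂⟩ hy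
    have := RTree.value_planar hα he hαs (T := (g S T₁ T₂).toRTree) (T' := g S T₁ T₂) rfl
    simp only
    rw [this, (hg S T₁ T₂).value_eq]
    rfl

/-- Every internal edge cuts a tree in two. -/
theorem treeSum_succ (j : ℕ) : ((j + 1 : ℕ) : k) • treeSum Q α e (j + 1)
    = ∑ p ∈ Finset.HasAntidiagonal.antidiagonal j,
        Q.star (treeSum Q α e p.1) fun n => Q.root e (treeSum Q α e p.2 n) := by
  funext n
  rw [Finset.sum_apply, Finset.sum_congr rfl fun p _ => Q.star_eq_antidiagonal _ _ n,
    Finset.sum_comm]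
  have h1 : ∀ p : Fin (n + 1), ∑ q ∈ Finset.HasAntidiagonal.antidiagonal j,
      Q.insSum (Nat.add_sub_of_le (Nat.lt_succ_iff.1 p.2)) (treeSum Q α e q.1 p)
        (Q.root e (treeSum Q α e q.2 (n - p)))
      = ∑ T : RTree n, ∑ C : Finset (Fin (n + 1)),
      (if T.1.card = j + 2 ∧ C ∈ T.1 ∧ C ≠ Finset.univ ∧ C.card = n - p + 1 then
        T.planar.value Q α e else 0) := by
    intro p
    rw [treeSum_isGraft hα he hαs (Nat.add_sub_of_le (Nat.lt_succ_iff.1 p.2)) j]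
    simp only [Q.insSum_apply, treeSum, map_sum, LinearMap.sum_apply]
    rw [sum_comm_four]
    refine Finset.sum_congr rfl fun S _ => ?_
    refine Finset.sum_congr rfl fun T₁ _ => ?_
    refine Finset.sum_congr rfl fun T₂ _ => ?_
    have c1 : 1 ≤ T₁.1.card := Finset.card_pos.2 ⟨_, T₁.univ_mem⟩
    have c2 : 1 ≤ T₂.1.card := Finset.card_pos.2 ⟨_, T₂.univ_mem⟩
    by_cases hc : T₁.1.card + T₂.1.card = j + 2
    · rw [if_pos hc, Finset.sum_eq_single (T₁.1.card - 1, T₂.1.card - 1)]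
      · simp only
        rw [if_pos (by omega), if_pos (by omega)]
      · rintro ⟨q1, q2⟩ _ hq
        by_cases h3 : T₁.1.card = q1 + 1
        · by_cases h4 : T₂.1.card = q2 + 1
          · exact absurd (by rw [h3, h4]; rfl) hq
          · simp [h4]
        · simp [h3]
      · intro h; refine absurd (Finset.HasAntidiagonal.mem_antidiagonal.2 ?_) h
        simp only; omega
    · rw [if_neg hc]
      refine Finset.sum_eq_zero fun q hq => ?_
      have hq := Finset.HasAntidiagonal.mem_antidiagonal.1 hq
      by_cases h3 : T₁.1.card = q.1 + 1
      · have h4 : ¬ T₂.1.card = q.2 + 1 := by omega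
        simp [h4]
      · simp [h3]
  rw [Finset.sum_congr rfl fun p _ => h1 p, Finset.sum_comm]
  rw [Pi.smul_apply, treeSum]
  rw [Finset.smul_sum]
  refine Finset.sum_congr rfl fun T _ => ?_
  by_cases hc : T.1.card = j + 2
  · rw [if_pos hc]
    -- A tree with j + 2 clusters occurs once for each of its j + 1 internal edges.
    have := sum_ite_card_eq k T
    rw [hc] at this
    rw [show j + 1 = j + 2 - 1 by omega, ← this]
    simp only [hc, true_and, Finset.sum_smul, ite_smul, one_smul, zero_smul]
  · rw [if_neg hc]
    simp [hc]

/-- Symmetry passes through the recursion `treeSum_succ`, since `star` preserves it and j + 1 is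
invertible. -/
theorem famSymm_treeSum [CharZero k] (h0 : α 0 = 0) (j : ℕ) : Q.FamSymm (treeSum Q α e j) := by
  induction j using Nat.strong_induction_on with
  | _ j ih =>
    cases j with
    | zero => rw [treeSum_zero hαs h0]; exact hαs
    | succ j =>
        intro n σ
        have hc : ((j + 1 : ℕ) : k) ≠ 0 := Nat.cast_ne_zero.2 (Nat.succ_ne_zero j)
        refine smul_right_injective _ hc ?_
        have h := congrFun (treeSum_succ hα he hαs j) n
        simp only [Pi.smul_apply] at h
        simp only
        rw [← map_smul, h, Finset.sum_apply, map_sum]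
        refine Finset.sum_congr rfl fun p hp => ?_
        have hp := Finset.HasAntidiagonal.mem_antidiagonal.1 hp
        refine GrOperad.FamSymm.star (ih _ (by omega)) (fun n τ => ?_) n σ
        have := ih p.2 (by omega) n τ
        rw [GrOperad.root, ← Q.root_act, this]

omit hαs in
-- A tree has one more vertex than internal edges, and both kinds of factors are odd.
theorem par_treeSum (j n : ℕ) : Q.par (treeSum Q α e j n) = -treeSum Q α e j n := by
  rw [treeSum, map_sum, ← Finset.sum_neg_distrib]
  refine Finset.sum_congr rfl fun T _ => ?_
  split_ifs
  · rw [PlanarTree.value, Q.par_act, Forest.par_glue hα he Q.par_one, hα, map_neg, map_neg]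
  · simp

end
end

noncomputable section

/-! ### The Maurer-Cartan equation for the sum over all trees -/

section
variable {k : Type u} [Field k] (Q : GrOperad.{u, w} k)

/-- Composition with an operation of arity one at the output, on families of operations. -/
def GrOperad.rootFam (e : Q.obj 0) : Q.Fam →ₗ[k] Q.Fam :=
  LinearMap.pi fun n => Q.root e ∘ₗ LinearMap.proj n

variable {Q}

theorem GrOperad.rootFam_apply (e : Q.obj 0) (x : Q.Fam) (n : ℕ) :
    Q.rootFam e x n = Q.root e (x n) := rfl

theorem GrOperad.rootFam_star (e : Q.obj 0) (x y : Q.Fam) :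
    Q.rootFam e (Q.star x y) = Q.star (Q.rootFam e x) y := by
  funext n
  rw [rootFam_apply, star_eq_antidiagonal, star_eq_antidiagonal, map_sum]
  refine Finset.sum_congr rfl fun p _ => ?_
  rw [insSum_apply, insSum_apply, map_sum]
  refine Finset.sum_congr rfl fun S _ => ?_
  exact (Q.root_act e _ _).trans (congrArg _ (Q.root_comp _ 0 e _ _))

theorem GrOperad.FamSymm.rootFam {x : Q.Fam} (hx : Q.FamSymm x) (e : Q.obj 0) :
    Q.FamSymm (Q.rootFam e x) := fun n σ => by
  rw [rootFam_apply, root, ← Q.root_act, hx n σ]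

variable (Q) in
/-- The difference of a family of operations and its composition with `e` at the output. -/
def GrOperad.corootFam (e : Q.obj 0) : Q.Fam →ₗ[k] Q.Fam := LinearMap.id - Q.rootFam e

theorem GrOperad.corootFam_apply (e : Q.obj 0) (x : Q.Fam) :
    Q.corootFam e x = x - Q.rootFam e x := rfl

theorem GrOperad.corootFam_star (e : Q.obj 0) (x y : Q.Fam) :
    Q.corootFam e (Q.star x y) = Q.star (Q.corootFam e x) y := by
  rw [corootFam_apply, corootFam_apply, rootFam_star, map_sub, LinearMap.sub_apply]

theorem GrOperad.star_congr {x x' y y' : Q.Fam} {n : ℕ} (hx : ∀ m ≤ n, x m = x' m)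
    (hy : ∀ m ≤ n, y m = y' m) : Q.star x y n = Q.star x' y' n := by
  rw [star_eq_antidiagonal, star_eq_antidiagonal]
  refine Finset.sum_congr rfl fun p _ => ?_
  rw [hx _ (Nat.lt_succ_iff.1 p.2), hy _ (Nat.sub_le n p)]

/-- The square of side `N`, outside of which `F` vanishes, is covered by the antidiagonals below 2N;
this replaces the evaluation of a product of power series at τ = 1. -/
theorem sum_range_sum_antidiagonal {M : Type*} [AddCommMonoid M] (F : ℕ → ℕ → M) {N N' : ℕ}
    (hN : 2 * N ≤ N') (h : ∀ a b, N ≤ a ∨ N ≤ b → F a b = 0) :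
    ∑ j ∈ Finset.range N', ∑ p ∈ Finset.HasAntidiagonal.antidiagonal j, F p.1 p.2
      = ∑ a ∈ Finset.range N, ∑ b ∈ Finset.range N, F a b := by
  rw [← Finset.sum_product', ← Finset.sum_fiberwise_of_maps_to (t := Finset.range N')
    (g := fun p : ℕ × ℕ => p.1 + p.2)]
  · refine Finset.sum_congr rfl fun j _ => (Finset.sum_subset ?_ ?_).symm
    · intro p hp
      exact Finset.HasAntidiagonal.mem_antidiagonal.2 (Finset.mem_filter.1 hp).2
    · intro p hp hp'
      refine h _ _ ?_
      by_contra hc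
      refine hp' (Finset.mem_filter.2 ⟨Finset.mem_product.2 ⟨?_, ?_⟩,
        Finset.HasAntidiagonal.mem_antidiagonal.1 hp⟩) <;> rw [Finset.mem_range] <;> omega
  · intro p hp
    have := Finset.mem_product.1 hp
    rw [Finset.mem_range, Finset.mem_range] at this
    rw [Finset.mem_range]; omega

end

/-! ### The differential of the sum over all trees -/

section
variable {k : Type u} [Field k] (H : DiffOperad.{u, w} k)

/-- The differential on families of operations. -/
def DiffOperad.dFam : H.Fam →ₗ[k] H.Fam := LinearMap.pi fun n => H.d ∘ₗ LinearMap.proj n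

variable {H}

theorem DiffOperad.dFam_apply (x : H.Fam) (n : ℕ) : H.dFam x n = H.d (x n) := rfl

theorem DiffOperad.dFam_star {x : H.Fam} (hx : ∀ n, H.par (x n) = -x n) (y : H.Fam) :
    H.dFam (H.star x y) = H.star (H.dFam x) y - H.star x (H.dFam y) := by
  funext n
  rw [Pi.sub_apply, dFam_apply, H.star_eq_antidiagonal, H.star_eq_antidiagonal,
    H.star_eq_antidiagonal, map_sum, ← Finset.sum_sub_distrib]
  refine Finset.sum_congr rfl fun p _ => ?_
  rw [H.insSum_apply, H.insSum_apply, H.insSum_apply, map_sum, ← Finset.sum_sub_distrib]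
  refine Finset.sum_congr rfl fun S _ => ?_
  rw [H.d_act, H.d_comp, hx, map_neg, LinearMap.neg_apply, map_add, map_neg, sub_eq_add_neg]
  rfl

/-- The pair of an odd operation `s` and an even operation `t` of arity one that satisfies the
identities of a canonical Hodge decomposition. -/
structure DiffOperad.IsHodgePair (H : DiffOperad.{u, w} k) (s t : H.obj 0) : Prop where
  par_s : H.par s = -s
  par_t : H.par t = t
  t_t : H.comp (Nat.zero_add 0) 0 t t = t
  d_s : H.d s = H.one - t
  d_t : H.d t = 0

variable {s t : H.obj 0} (hst : H.IsHodgePair s t)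
include hst

theorem DiffOperad.IsHodgePair.dFam_rootFam (x : H.Fam) : H.dFam (H.rootFam s x)
    = (x - H.rootFam t x) - H.rootFam s (H.dFam x) := by
  funext n
  rw [Pi.sub_apply, Pi.sub_apply, dFam_apply, H.rootFam_apply, H.rootFam_apply, H.rootFam_apply,
    GrOperad.root, H.d_comp, hst.d_s, hst.par_s, map_sub, LinearMap.sub_apply, H.one_comp, map_neg,
    LinearMap.neg_apply, ← sub_eq_add_neg]
  rfl

variable {α : ∀ n, H.obj n} (hα : ∀ n, H.par (α n) = -α n) (hαs : ∀ n, H.IsSymm (α n))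
  (h0 : α 0 = 0) (hMC : ∀ n, H.d (α n) = H.star α α n)
include hα hαs h0 hMC

/-- The case of `preLie_flow` in which D is the differential, S puts `s` at the root and P is one
minus `t` at the root. The inserted family s g is even, so the graded pre-Lie identity has no sign,
and d(sx) = x - tx - s dx yields `hD`. -/
theorem d_treeSum [CharZero k] (e : ℕ) :
    H.dFam (treeSum H.toGrOperad α s (e + 1))
      = ∑ p ∈ Finset.HasAntidiagonal.antidiagonal (e + 1),
          H.star (treeSum H.toGrOperad α s p.1) (treeSum H.toGrOperad α s p.2)
        - ∑ p ∈ Finset.HasAntidiagonal.antidiagonal e,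
          H.star (treeSum H.toGrOperad α s p.1)
            (H.corootFam t (treeSum H.toGrOperad α s p.2)) := by
  have hsy := famSymm_treeSum hα hst.par_s hαs h0
  have hpar := par_treeSum hα hst.par_s
  have hodd : ∀ (x : H.Fam) n, H.par (x n) = -x n → HasParity H.par 1 (x n) := fun x n h => by
    rw [HasParity, h, sgn_one, neg_one_smul]
  have heven : ∀ j n, HasParity H.par 0 (H.rootFam s (treeSum H.toGrOperad α s j) n) := by
    intro j n
    rw [HasParity, sgn_zero, one_smul]
    exact H.par_root hst.par_s _ (hpar j n)
  have hpl : ∀ (a b c : ℕ) (y : H.Fam), H.FamSymm y → (∀ n, H.par (y n) = -y n) →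
      H.star (H.star (treeSum H.toGrOperad α s a) y) (H.rootFam s (treeSum H.toGrOperad α s c))
        - H.star (treeSum H.toGrOperad α s a)
          (H.star y (H.rootFam s (treeSum H.toGrOperad α s c)))
      = H.star (H.star (treeSum H.toGrOperad α s a) (H.rootFam s (treeSum H.toGrOperad α s c))) y
        - H.star (treeSum H.toGrOperad α s a)
          (H.rootFam s (H.star (treeSum H.toGrOperad α s c) y)) := by
    intro a b c y hy hy'
    have := H.star_preLie (hsy a) hy ((hsy c).rootFam s) (fun n => hodd y n (hy' n)) (heven c)
    rw [mul_zero, sgn_zero, one_smul] at this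
    rw [this, GrOperad.rootFam_star]
  refine preLie_flow (st := H.star) (S := H.rootFam s) (P := H.corootFam t)
    (D := H.dFam) (g := treeSum H.toGrOperad α s) ?_ ?_ ?_ ?_ ?_ e
  · rw [treeSum_zero hαs h0]
    exact funext hMC
  · exact treeSum_succ hα hst.par_s hαs
  · intro i j
    rw [DiffOperad.dFam_star (hpar i), hst.dFam_rootFam, map_sub, H.corootFam_apply]
    abel
  · exact fun a b c => hpl a b c _ (hsy b) (hpar b)
  · intro a b c
    rw [GrOperad.corootFam_star]
    refine hpl a b c _ (fun n σ => ?_) fun n => ?_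
    · have := (hsy b).rootFam t n σ
      rw [GrOperad.corootFam_apply, Pi.sub_apply, map_sub, hsy b n σ, this]
    · rw [GrOperad.corootFam_apply, Pi.sub_apply, map_sub, hpar, H.rootFam_apply,
        GrOperad.root, H.par_comp, hst.par_t, hpar, map_neg, neg_sub_neg, neg_sub]

omit hst hα hαs h0 hMC in
-- The clusters are distinct subsets of the leaves. This crude bound on the number of vertices is
-- enough to make all sums finite in each arity.
theorem treeSum_eq_zero {m n j : ℕ} (hm : m ≤ n) (hj : 2 ^ (n + 1) ≤ j) :
    treeSum H.toGrOperad α s j m = 0 := by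
  refine Finset.sum_eq_zero fun T _ => if_neg fun h => ?_
  have h1 : T.1.card ≤ 2 ^ (m + 1) := by
    simpa using Finset.card_le_univ T.1
  have h2 : 2 ^ (m + 1) ≤ 2 ^ (n + 1) := Nat.pow_le_pow_right (by norm_num) (by omega)
  omega

/-- The sum of the compositions along all trees. -/
def treeTotal (Q : GrOperad.{u, w} k) (α : ∀ n, Q.obj n) (e : Q.obj 0) : Q.Fam := fun n =>
  ∑ T : RTree n, T.planar.value Q α e

omit hst hα hαs h0 hMC in
theorem sum_treeSum {m n N : ℕ} (hm : m ≤ n) (hN : 2 ^ (n + 1) ≤ N) :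
    (∑ j ∈ Finset.range N, treeSum H.toGrOperad α s j) m = treeTotal H.toGrOperad α s m := by
  rw [Finset.sum_apply]
  simp only [treeSum]
  rw [Finset.sum_comm]
  refine Finset.sum_congr rfl fun T _ => ?_
  have h1 : T.1.card ≤ 2 ^ (m + 1) := by simpa using Finset.card_le_univ T.1
  have h2 : 2 ^ (m + 1) ≤ 2 ^ (n + 1) := Nat.pow_le_pow_right (by norm_num) (by omega)
  have h3 : 1 ≤ T.1.card := Finset.card_pos.2 ⟨_, T.univ_mem⟩
  rw [Finset.sum_eq_single (T.1.card - 1)]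
  · rw [if_pos (by omega)]
  · intro j _ hj
    rw [if_neg (by omega)]
  · intro h
    rw [Finset.mem_range] at h
    omega

omit hst hα hαs h0 hMC in
-- The coefficient sums of G ⋆ LG give the product of the totals. As `L` acts in each arity
-- separately, both factors may be replaced by finite partial sums.
theorem sum_star_treeSum (L : H.Fam →ₗ[k] H.Fam)
    (hL : ∀ (x y : H.Fam) n, x n = y n → L x n = L y n) {n N : ℕ}
    (hN : 2 * 2 ^ (n + 1) ≤ N) :
    (∑ j ∈ Finset.range N, ∑ p ∈ Finset.HasAntidiagonal.antidiagonal j,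
      H.star (treeSum H.toGrOperad α s p.1) (L (treeSum H.toGrOperad α s p.2))) n
    = H.star (treeTotal H.toGrOperad α s) (L (treeTotal H.toGrOperad α s)) n := by
  simp only [Finset.sum_apply]
  rw [sum_range_sum_antidiagonal (fun a b => H.star (treeSum H.toGrOperad α s a)
    (L (treeSum H.toGrOperad α s b)) n) hN]
  · rw [← GrOperad.star_congr
      (x := ∑ j ∈ Finset.range (2 ^ (n + 1)), treeSum H.toGrOperad α s j)
      (y := L (∑ j ∈ Finset.range (2 ^ (n + 1)), treeSum H.toGrOperad α s j))
      (fun m hm => sum_treeSum hm le_rfl)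
      (fun m hm => hL _ _ _ (sum_treeSum hm le_rfl))]
    simp only [map_sum, LinearMap.sum_apply, Finset.sum_apply]
    exact Finset.sum_comm
  · intro a b hab
    rcases hab with h | h
    · have := GrOperad.star_congr (Q := H.toGrOperad) (x := treeSum H.toGrOperad α s a) (x' := 0)
        (y := L (treeSum H.toGrOperad α s b)) (n := n)
        (fun m hm => treeSum_eq_zero hm h) (fun m hm => rfl)
      rw [this]; simp
    · have := GrOperad.star_congr (Q := H.toGrOperad) (x := treeSum H.toGrOperad α s a)
        (y := L (treeSum H.toGrOperad α s b)) (y' := L 0) (n := n)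
        (fun m hm => rfl) (fun m hm => hL _ _ _ (treeSum_eq_zero hm h))
      rw [this]; simp

/-- Summing `d_treeSum` over the number of internal edges gives G ⋆ G - G ⋆ (1-t)G, that is, only
the cuts labelled by `t` survive. -/
theorem d_treeTotal [CharZero k] :
    H.dFam (treeTotal H.toGrOperad α s)
      = H.star (treeTotal H.toGrOperad α s) (H.rootFam t (treeTotal H.toGrOperad α s)) := by
  funext n
  -- Each factor of a product vanishes from 2 ^ (n + 1) edges on, so twice this bound suffices. The
  -- sum of G ⋆ G runs up to N + 1 because the index in `d_treeSum` is shifted by one for that term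
  -- only.
  set N := 2 * 2 ^ (n + 1)
  have h1 : H.dFam (treeTotal H.toGrOperad α s) n
      = (H.dFam (∑ j ∈ Finset.range (N + 1), treeSum H.toGrOperad α s j)) n := by
    rw [DiffOperad.dFam_apply, DiffOperad.dFam_apply, sum_treeSum le_rfl (by omega)]
  have h2 := sum_star_treeSum (H := H) (α := α) (s := s) LinearMap.id (fun x y n h => h)
    (n := n) (N := N + 1) (Nat.le_succ N)
  have h3 := sum_star_treeSum (H := H) (α := α) (s := s) (H.corootFam t)
    (fun x y n h => by
      rw [H.corootFam_apply, H.corootFam_apply, Pi.sub_apply, Pi.sub_apply, H.rootFam_apply,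
        H.rootFam_apply, h]) (n := n) (N := N) le_rfl
  rw [Finset.sum_range_succ'] at h2
  rw [h1, map_sum, Finset.sum_range_succ',
    Finset.sum_congr rfl fun e _ => d_treeSum hst hα hαs h0 hMC e, Finset.sum_sub_distrib,
    Pi.add_apply, Pi.sub_apply, h3]
  simp only [LinearMap.id_apply, Pi.add_apply] at h2
  -- The initial term, given by the Maurer–Cartan equation of `α`, completes the sum for G ⋆ G.
  have h4 : H.dFam (treeSum H.toGrOperad α s 0) n
      = (∑ p ∈ Finset.HasAntidiagonal.antidiagonal 0,
          H.star (treeSum H.toGrOperad α s p.1) (treeSum H.toGrOperad α s p.2)) n := by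
    rw [Finset.Nat.antidiagonal_zero, Finset.sum_singleton, treeSum_zero hαs h0]
    exact hMC n
  rw [h4, sub_add_eq_add_sub, h2, H.corootFam_apply, map_sub, Pi.sub_apply, sub_sub_cancel]

omit hαs h0 hMC in
theorem par_treeTotal (n : ℕ) :
    H.par (treeTotal H.toGrOperad α s n) = -treeTotal H.toGrOperad α s n := by
  rw [← sum_treeSum le_rfl le_rfl, Finset.sum_apply, map_sum, ← Finset.sum_neg_distrib]
  exact Finset.sum_congr rfl fun j _ => par_treeSum hα hst.par_s j n

omit hMC in
theorem famSymm_treeTotal [CharZero k] : H.FamSymm (treeTotal H.toGrOperad α s) := by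
  intro n σ
  rw [← sum_treeSum le_rfl le_rfl, Finset.sum_apply, map_sum]
  exact Finset.sum_congr rfl fun j _ => famSymm_treeSum hα hst.par_s hαs h0 j n σ

end
end

noncomputable section

/-! ### Truncation by an idempotent -/

section
variable {k : Type u} [Field k] (Q : GrOperad.{u, w} k) (t : Q.obj 0)

/-- Composition with an operation of arity one at the input `i`. -/
def GrOperad.inp {n : ℕ} (i : ℕ) : Q.obj n →ₗ[k] Q.obj n :=
  if h : i < n + 1 then (Q.comp (Nat.add_zero n) ⟨i, h⟩).flip t else LinearMap.id

/-- Composition with an operation of arity one at the inputs `pos, …, pos + len - 1`. -/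
def GrOperad.inps {n : ℕ} : ℕ → ℕ → (Q.obj n →ₗ[k] Q.obj n)
  | _, 0 => LinearMap.id
  | pos, len + 1 => inps (pos + 1) len ∘ₗ Q.inp t pos

/-- Composition with an operation of arity one at the output and at all inputs. -/
def GrOperad.trunc {n : ℕ} : Q.obj n →ₗ[k] Q.obj n := Q.root t ∘ₗ Q.inps t 0 (n + 1)

/-- The operations that do not change when `t` is composed with the output or with an input. -/
def GrOperad.IsTrunc {n : ℕ} (x : Q.obj n) : Prop :=
  Q.comp (Nat.zero_add n) 0 t x = x ∧ ∀ i, Q.comp (Nat.add_zero n) i x t = x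

variable {Q t}

namespace GrOperad

theorem inp_val {n : ℕ} (i : Fin (n + 1)) (x : Q.obj n) :
    Q.inp t i x = Q.comp (Nat.add_zero n) i x t := by
  rw [inp, dif_pos i.2]; rfl

theorem inp_of_lt {n i : ℕ} (hi : i < n + 1) (x : Q.obj n) :
    Q.inp t i x = Q.comp (Nat.add_zero n) ⟨i, hi⟩ x t := inp_val ⟨i, hi⟩ x

theorem inp_of_le {n i : ℕ} (hi : n + 1 ≤ i) (x : Q.obj n) : Q.inp t i x = x := by
  rw [inp, dif_neg (by omega)]; rfl

theorem inps_succ {n : ℕ} (pos len : ℕ) (x : Q.obj n) :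
    Q.inps t pos (len + 1) x = Q.inps t (pos + 1) len (Q.inp t pos x) := rfl

theorem inps_add {n : ℕ} (len' : ℕ) : ∀ (pos len : ℕ) (x : Q.obj n),
    Q.inps t (pos + len) len' (Q.inps t pos len x) = Q.inps t pos (len + len') x := by
  intro pos len
  induction len generalizing pos with
  | zero => intro x; rw [Nat.zero_add]; rfl
  | succ len ih =>
      intro x
      rw [inps_succ, show pos + (len + 1) = pos + 1 + len by omega, ih,
        show len + 1 + len' = (len + len') + 1 by omega, inps_succ]

theorem map_inps {n : ℕ} {M : Type v} (f : Q.obj n → M) (hf : ∀ i x, f (Q.inp t i x) = f x)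
    (len : ℕ) : ∀ (pos : ℕ) (x : Q.obj n), f (Q.inps t pos len x) = f x := by
  induction len with
  | zero => intro pos x; rfl
  | succ len ih => intro pos x; rw [inps_succ, ih, hf]

theorem root_inp {n : ℕ} (e : Q.obj 0) (i : ℕ) (x : Q.obj n) :
    Q.root e (Q.inp t i x) = Q.inp t i (Q.root e x) := by
  by_cases hi : i < n + 1
  · rw [inp_of_lt hi, inp_of_lt hi]; exact Q.root_comp _ _ e x t
  · rw [inp_of_le (by omega), inp_of_le (by omega)]

theorem root_inps {n : ℕ} (e : Q.obj 0) (len : ℕ) : ∀ (pos : ℕ) (x : Q.obj n),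
    Q.root e (Q.inps t pos len x) = Q.inps t pos len (Q.root e x) := by
  induction len with
  | zero => intro pos x; rfl
  | succ len ih => intro pos x; rw [inps_succ, ih, root_inp, inps_succ]

section
variable (ht : Q.par t = t)
include ht

theorem inp_comm {n : ℕ} (i j : ℕ) (x : Q.obj n) :
    Q.inp t i (Q.inp t j x) = Q.inp t j (Q.inp t i x) := by
  have key : ∀ i j, i < j → Q.inp t j (Q.inp t i x) = Q.inp t i (Q.inp t j x) := by
    intro i j hij
    by_cases hj : j < n + 1
    · rw [inp_of_lt hj, inp_of_lt (hij.trans hj), inp_of_lt (hij.trans hj), inp_of_lt hj]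
      exact Q.comp_comm_lt _ _ _ _ hij hj rfl x ht ht
    · rw [inp_of_le (i := j) (by omega), inp_of_le (i := j) (by omega)]
  rcases lt_trichotomy i j with h | rfl | h
  · exact (key i j h).symm
  · rfl
  · exact key j i h

theorem inp_inps {n : ℕ} (j len : ℕ) : ∀ (pos : ℕ) (x : Q.obj n),
    Q.inp t j (Q.inps t pos len x) = Q.inps t pos len (Q.inp t j x) := by
  induction len with
  | zero => intro pos x; rfl
  | succ len ih => intro pos x; rw [inps_succ, ih, inp_comm ht, inps_succ]

variable (htt : Q.comp (Nat.zero_add 0) 0 t t = t)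
include htt

omit ht in
theorem root_root {n : ℕ} (x : Q.obj n) : Q.root t (Q.root t x) = Q.root t x := by
  have := Q.root_comp (Nat.zero_add n) 0 t t x
  rw [htt] at this
  exact this

omit ht in
theorem inp_inp {n : ℕ} (i : ℕ) (x : Q.obj n) : Q.inp t i (Q.inp t i x) = Q.inp t i x := by
  by_cases hi : i < n + 1
  · rw [inp_of_lt hi, inp_of_lt hi]
    exact (Q.comp_assoc_val (Nat.add_zero n) (Nat.add_zero n) (Nat.zero_add 0) (Nat.add_zero n) hi
      Nat.zero_lt_one rfl x t t).trans (congrArg _ htt)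
  · rw [inp_of_le (by omega)]

/-- The extra `t` is moved to the one already present at the same input and merged with it, as t² =
t. -/
theorem inp_inps_of_mem {n : ℕ} (j len : ℕ) : ∀ (pos : ℕ) (_ : pos ≤ j) (_ : j < pos + len)
    (x : Q.obj n), Q.inps t pos len (Q.inp t j x) = Q.inps t pos len x := by
  induction len with
  | zero => intro pos h1 h2; omega
  | succ len ih =>
      intro pos h1 h2 x
      rw [inps_succ, inps_succ]
      rcases Nat.eq_or_lt_of_le h1 with rfl | h3
      · rw [inp_inp htt]
      · rw [inp_comm ht, ih (pos + 1) h3 (by omega)]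

theorem trunc_inp {n : ℕ} (i : ℕ) (x : Q.obj n) : Q.trunc t (Q.inp t i x) = Q.trunc t x := by
  by_cases hi : i < n + 1
  · exact congrArg (Q.root t) (inp_inps_of_mem ht htt i (n + 1) 0 (by omega) (by omega) x)
  · rw [inp_of_le (by omega)]

omit ht in
theorem trunc_root {n : ℕ} (x : Q.obj n) : Q.trunc t (Q.root t x) = Q.trunc t x := by
  change Q.root t (Q.inps t 0 (n + 1) (Q.root t x)) = Q.root t (Q.inps t 0 (n + 1) x)
  rw [← root_inps, root_root htt]

theorem isTrunc_trunc {n : ℕ} (x : Q.obj n) : Q.IsTrunc t (Q.trunc t x) := by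
  refine ⟨root_root htt _, fun i => ?_⟩
  rw [← inp_val]
  change Q.inp t i (Q.root t _) = Q.root t _
  rw [← root_inp, inp_inps ht, inp_inps_of_mem ht htt _ _ _ (by omega) (by omega)]

omit ht htt in
theorem IsTrunc.trunc_eq {n : ℕ} {x : Q.obj n} (hx : Q.IsTrunc t x) : Q.trunc t x = x := by
  have h : ∀ i, Q.inp t i x = x := fun i => by
    by_cases hi : i < n + 1
    · rw [inp_of_lt hi, hx.2]
    · rw [inp_of_le (by omega)]
  have h2 : ∀ len pos, Q.inps t pos len x = x := by
    intro len
    induction len with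
    | zero => intro pos; rfl
    | succ len ih => intro pos; rw [inps_succ, h, ih]
  change Q.root t _ = x
  rw [h2]
  exact hx.1

omit ht htt in
/-- A map that does not see compositions with `t` does not see the truncation. -/
theorem map_trunc {n : ℕ} {M : Type v} (f : Q.obj n → M) (hr : ∀ x, f (Q.root t x) = f x)
    (hf : ∀ i x, f (Q.inp t i x) = f x) (x : Q.obj n) : f (Q.trunc t x) = f x := by
  change f (Q.root t _) = f x
  rw [hr, map_inps f hf]

omit ht htt in
theorem act_inp {n : ℕ} (σ : Equiv.Perm (Fin (n + 1))) (i : Fin (n + 1)) (x : Q.obj n) :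
    Q.act σ (Q.inp t i x) = Q.inp t (σ i) (Q.act σ x) := by
  rw [inp_val, inp_val]
  have := Q.equivariant (Nat.add_zero n) i σ 1 σ
    (fun j hj => by rw [outerPos_self, outerPos_self])
    (fun a => by rw [innerPos_self, innerPos_self]) x t
  rw [Q.act_one] at this
  exact this.symm

omit ht htt in
theorem IsTrunc.act {n : ℕ} (σ : Equiv.Perm (Fin (n + 1))) {x : Q.obj n} (hx : Q.IsTrunc t x) :
    Q.IsTrunc t (Q.act σ x) := by
  constructor
  · rw [Q.root_act, hx.1]
  · intro i
    rw [← inp_val, ← σ.apply_symm_apply i, ← act_inp, inp_val, hx.2]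

/-- Both sides are truncated, and the truncation inside is absorbed by the one outside because a
permutation takes inputs to inputs. -/
theorem trunc_act {n : ℕ} (σ : Equiv.Perm (Fin (n + 1))) (x : Q.obj n) :
    Q.trunc t (Q.act σ x) = Q.act σ (Q.trunc t x) := by
  rw [← ((isTrunc_trunc ht htt x).act σ).trunc_eq]
  refine (map_trunc (fun x => Q.trunc t (Q.act σ x)) (fun x => ?_) (fun i x => ?_) x).symm
  · rw [root, ← Q.root_act]
    exact trunc_root htt _
  · by_cases hi : i < n + 1
    · have := act_inp (t := t) σ ⟨i, hi⟩ x
      simp only at this ⊢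
      rw [this, trunc_inp ht htt]
    · rw [inp_of_le (by omega)]

omit htt in
theorem IsTrunc.comp [CharZero k] {m n l : ℕ} (h : m + n = l) (i : Fin (m + 1)) {x : Q.obj m}
    {y : Q.obj n} (hx : Q.IsTrunc t x) (hy : Q.IsTrunc t y) : Q.IsTrunc t (Q.comp h i x y) := by
  have hT : HasParity Q.par 0 t := by simp [HasParity, ht]
  constructor
  · rw [Q.root_comp, hx.1]
  · intro c
    rcases outerPos_or_innerPos h i c with ⟨j, hj, rfl⟩ | ⟨a, rfl⟩
    · refine parity_induction Q.par Q.par_par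
        (Q := fun y => Q.comp (Nat.add_zero l) (outerPos h i j) (Q.comp h i x y) t
          = Q.comp h i x y) (fun a b ha hb => by
            rw [map_add, map_add, LinearMap.add_apply, ha, hb]) (fun p y hy => ?_) y
      rw [Q.parallel h (Nat.add_zero l) (Nat.add_zero m) h i j hj.symm p 0 x y t hy hT,
        hx.2, mul_zero, sgn_zero, one_smul, outerPos_self]
    · rw [Q.assoc h (Nat.add_zero l) (Nat.add_zero n) h i a x y t, hy.2]

/-- Truncating a composition along an edge labelled by `t`. -/
theorem trunc_comp [CharZero k] {m n l : ℕ} (h : m + n = l) (i : Fin (m + 1)) (x : Q.obj m)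
    (y : Q.obj n) : Q.trunc t (Q.comp h i x (Q.root t y))
      = Q.comp h i (Q.trunc t x) (Q.trunc t y) := by
  have hT : HasParity Q.par 0 t := by simp [HasParity, ht]
  have h1 : ∀ (j : Fin (m + 1)) (x : Q.obj m) (y : Q.obj n), j ≠ i →
      Q.comp h i (Q.inp t j x) y = Q.inp t (outerPos h i j) (Q.comp h i x y) := by
    intro j x y hj
    refine parity_induction Q.par Q.par_par
      (Q := fun y => Q.comp h i (Q.inp t j x) y = Q.inp t (outerPos h i j) (Q.comp h i x y))
      (fun a b ha hb => by rw [map_add, map_add, map_add, ha, hb]) (fun p y hy => ?_) y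
    rw [inp_val, inp_val, Q.parallel h (Nat.add_zero l) (Nat.add_zero m) h i j hj.symm p 0 x y t
      hy hT, mul_zero, sgn_zero, one_smul, outerPos_self]
  have h2 : ∀ (a : Fin (n + 1)) (x : Q.obj m) (y : Q.obj n),
      Q.comp h i x (Q.inp t a y) = Q.inp t (innerPos h i a) (Q.comp h i x y) := by
    intro a x y
    rw [inp_val, inp_val, Q.assoc h (Nat.add_zero l) (Nat.add_zero n) h i a x y t]
  -- Truncating the lower factor changes nothing: a `t` at the input `i` merges with the one on the
  -- edge, and all others are absorbed by the outer truncation. The same holds for the upper factor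
  -- in `h4`.
  have h3 : ∀ (x : Q.obj m) (y : Q.obj n), Q.trunc t (Q.comp h i (Q.trunc t x) (Q.root t y))
      = Q.trunc t (Q.comp h i x (Q.root t y)) := by
    intro x y
    refine map_trunc (fun x => Q.trunc t (Q.comp h i x (Q.root t y))) (fun x => ?_)
      (fun j x => ?_) x
    · have := Q.root_comp h i t x (Q.root t y)
      exact (congrArg (Q.trunc t) this.symm).trans (trunc_root htt _)
    · by_cases hj : j < m + 1
      · by_cases hji : (⟨j, hj⟩ : Fin (m + 1)) = i
        · subst hji
          rw [inp_of_lt hj]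
          have := Q.comp_assoc_val (Nat.add_zero m) h (Nat.zero_add n) h hj Nat.zero_lt_one rfl x t
            (Q.root t y)
          refine congrArg (Q.trunc t) (this.trans ?_)
          exact congrArg (Q.comp h ⟨j, hj⟩ x) (root_root htt y)
        · have := h1 ⟨j, hj⟩ x (Q.root t y) hji
          simp only at this
          rw [this, trunc_inp ht htt]
      · rw [inp_of_le (by omega)]
  rw [← h3]
  have h4 : ∀ x : Q.obj m, Q.trunc t (Q.comp h i x (Q.root t (Q.trunc t y)))
      = Q.trunc t (Q.comp h i x (Q.root t y)) := by
    intro x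
    refine map_trunc (fun y => Q.trunc t (Q.comp h i x (Q.root t y))) (fun y => ?_)
      (fun a y => ?_) y
    · rw [root_root htt]
    · by_cases ha : a < n + 1
      · have := h2 ⟨a, ha⟩ x (Q.root t y)
        simp only at this
        rw [root_inp, this, trunc_inp ht htt]
      · rw [inp_of_le (by omega)]
  rw [← h4]
  -- With both factors truncated the edge label is superfluous, and the composition is already
  -- invariant under `t`.
  have hy := isTrunc_trunc ht htt y
  have e1 : Q.root t (Q.trunc t y) = Q.trunc t y := hy.1
  rw [e1]
  exact ((isTrunc_trunc ht htt x).comp ht h i hy).trunc_eq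

end

end GrOperad

end
end

noncomputable section

/-! ### Sums over trees with labelled extremities -/

section
variable {k : Type u} [Field k] {Q : GrOperad.{u, w} k} {t : Q.obj 0} {α : ∀ n, Q.obj n}
  {e : Q.obj 0}

theorem GrOperad.inps_add_of_eq {n pos pos' len len' : ℕ} (h : pos' = pos + len) (x : Q.obj n) :
    Q.inps t pos' len' (Q.inps t pos len x) = Q.inps t pos (len + len') x := by
  rw [h, GrOperad.inps_add]

theorem GrOperad.inps_comp {m n l p : ℕ} (h : m + n = l) (hp : p < m + 1) (x : Q.obj m)
    (len : ℕ) : ∀ (q : ℕ) (_ : q + len ≤ n + 1) (y : Q.obj n),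
      Q.comp h ⟨p, hp⟩ x (Q.inps t q len y) = Q.inps t (p + q) len (Q.comp h ⟨p, hp⟩ x y) := by
  induction len with
  | zero => intro q hq y; rfl
  | succ len ih =>
      intro q hq y
      rw [GrOperad.inps_succ, GrOperad.inps_succ, ih (q + 1) (by omega),
        GrOperad.inp_of_lt (show q < n + 1 by omega),
        GrOperad.inp_of_lt (show p + q < l + 1 by omega),
        Q.comp_assoc_val h (Nat.add_zero l) (Nat.add_zero n) h hp (by omega) rfl]
      rfl

section
variable (hα : ∀ n, Q.par (α n) = -α n) (he : Q.par e = -e) (ht : Q.par t = t)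
include hα he ht

theorem Forest.glue_one_inps {r b m n : ℕ} (F : Forest r b) (pos : ℕ) (h : m + b = n)
    (hp : pos + r = m + 1) (len : ℕ) : ∀ (q : ℕ) (_ : q + len ≤ pos) (x : Q.obj m),
      F.glue Q α e Q.one pos h hp (Q.inps t q len x)
        = Q.inps t q len (F.glue Q α e Q.one pos h hp x) := by
  induction len with
  | zero => intro q hq x; rfl
  | succ len ih =>
      intro q hq x
      rw [GrOperad.inps_succ, ih (q + 1) (by omega), GrOperad.inps_succ,
        GrOperad.inp_of_lt (show q < m + 1 by omega),
        GrOperad.inp_of_lt (show q < n + 1 by omega),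
        F.glue_comp_lt hα he Q.par_one pos pos q rfl (by omega) h hp (Nat.add_zero m)
          (Nat.add_zero n) h hp x ht]

/-- Labelling the leaves by `t`. -/
theorem Forest.glue_eq_inps {r b : ℕ} (F : Forest r b) : ∀ {m n : ℕ} (pos : ℕ) (h : m + b = n)
    (hp : pos + r = m + 1) (x : Q.obj m), F.glue Q α e t pos h hp x
      = Q.inps t pos (r + b) (F.glue Q α e Q.one pos h hp x) := by
  induction F with
  | nil => rintro m n pos rfl hp x; rfl
  | leaf F ih =>
      rename_i r b
      intro m n pos h hp x
      rw [glue_leaf, glue_leaf, ih, Q.comp_one, show r + 1 + b = (r + b) + 1 by omega,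
        GrOperad.inps_succ, GrOperad.inp_of_lt (show pos < n + 1 by omega),
        F.glue_comp_lt hα he Q.par_one (pos + 1) (pos + 1) pos rfl (by omega) h (by omega)
          (Nat.add_zero m) (Nat.add_zero n) h (by omega) x ht]
  | node h' C F ihC ihF =>
      rename_i m₀ a₀ r₀ b₀ c₀
      intro m n pos h hp x
      have h1 : C.bush Q α e t = Q.inps t 0 (m₀ + 2 + a₀) (C.bush Q α e Q.one) := by
        rw [bush, ihC]
        exact GrOperad.root_inps e _ _ _
      rw [glue_node Q α e t h' C F pos h hp rfl, glue_node Q α e Q.one h' C F pos h hp rfl, h1,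
        GrOperad.inps_comp _ _ _ _ _ (by omega), ihF,
        F.glue_one_inps hα he ht _ _ _ _ _ (by omega),
        GrOperad.inps_add_of_eq (show pos + (m₀ + 1 + a₀) + 1 = pos + 0 + (m₀ + 2 + a₀) by omega),
        Nat.add_zero, show m₀ + 2 + a₀ + (r₀ + b₀) = r₀ + 1 + c₀ by omega]

variable (Q t α e) in
omit hα he ht in
/-- The composition along a tree with the extremities labelled by `t`. -/
def PlanarTree.extValue {n : ℕ} (T : PlanarTree n) : Q.obj n :=
  Q.act T.label (Q.comp (Nat.zero_add n) 0 t
    (T.children.glue Q α e t 0 T.h (Nat.zero_add _) (α (T.m + 1))))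

/-- The recursion over cuts needs bare extremities, the maps ι_T need extremities labelled by `t`;
truncation leads from one to the other. -/
theorem PlanarTree.trunc_value (htt : Q.comp (Nat.zero_add 0) 0 t t = t) {n : ℕ}
    (T : PlanarTree n) : Q.trunc t (T.value Q α e) = T.extValue Q t α e := by
  rw [PlanarTree.value, GrOperad.trunc_act ht htt, extValue, T.children.glue_eq_inps hα he ht,
    show T.m + 2 + T.a = n + 1 by have := T.h; omega]
  rfl

end

variable (Q t) in
/-- Truncation of families of operations. -/
def GrOperad.truncFam (x : Q.Fam) : Q.Fam := fun n => Q.trunc t (x n)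

/-- This is where the label `t` on the cut edge in `d_treeTotal` is used: it is the common extremity
of the two truncated parts. -/
theorem GrOperad.truncFam_star [CharZero k] (ht : Q.par t = t)
    (htt : Q.comp (Nat.zero_add 0) 0 t t = t) (x y : Q.Fam) :
    Q.truncFam t (Q.star x (Q.rootFam t y)) = Q.star (Q.truncFam t x) (Q.truncFam t y) := by
  funext n
  rw [truncFam, star_eq_antidiagonal, star_eq_antidiagonal, map_sum]
  refine Finset.sum_congr rfl fun p _ => ?_
  rw [insSum_apply, insSum_apply, map_sum]
  refine Finset.sum_congr rfl fun S _ => ?_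
  rw [trunc_act ht htt]
  exact congrArg _ (trunc_comp ht htt _ _ _ _)

end

/-! ### The Maurer–Cartan equation for the truncated sum over trees -/

section
variable {k : Type u} [Field k]

/-- The sum of the compositions along all trees, with the extremities labelled by `t`. -/
def extTotal (H : DiffOperad.{u, w} k) (s t : H.obj 0) (α : ∀ n, H.obj n) : H.Fam := fun n =>
  ∑ T : RTree n, T.planar.extValue H.toGrOperad t α s

variable {H : DiffOperad.{u, w} k} {s t : H.obj 0}
  (hst : H.IsHodgePair s t)
include hst

theorem DiffOperad.IsHodgePair.d_trunc {n : ℕ} (x : H.obj n) :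
    H.d (H.trunc t x) = H.trunc t (H.d x) := by
  have h1 : ∀ (i : ℕ) (x : H.obj n), H.d (H.inp t i x) = H.inp t i (H.d x) := by
    intro i x
    by_cases hi : i < n + 1
    · rw [GrOperad.inp_of_lt hi, GrOperad.inp_of_lt hi, H.d_comp, hst.d_t, map_zero, add_zero]
    · rw [GrOperad.inp_of_le (by omega), GrOperad.inp_of_le (by omega)]
  have h2 : ∀ (len pos : ℕ) (x : H.obj n),
      H.d (H.inps t pos len x) = H.inps t pos len (H.d x) := by
    intro len
    induction len with
    | zero => intro pos x; rfl
    | succ len ih => intro pos x; rw [GrOperad.inps_succ, ih, h1, GrOperad.inps_succ]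
  change H.d (H.comp _ 0 t _) = H.comp _ 0 t _
  rw [H.d_comp, hst.d_t, hst.par_t, map_zero, LinearMap.zero_apply, zero_add, h2]

theorem DiffOperad.IsHodgePair.par_trunc {n : ℕ} (x : H.obj n) :
    H.par (H.trunc t x) = H.trunc t (H.par x) := by
  have h1 : ∀ (i : ℕ) (x : H.obj n), H.par (H.inp t i x) = H.inp t i (H.par x) := by
    intro i x
    by_cases hi : i < n + 1
    · rw [GrOperad.inp_of_lt hi, GrOperad.inp_of_lt hi, H.par_comp, hst.par_t]
    · rw [GrOperad.inp_of_le (by omega), GrOperad.inp_of_le (by omega)]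
  have h2 : ∀ (len pos : ℕ) (x : H.obj n),
      H.par (H.inps t pos len x) = H.inps t pos len (H.par x) := by
    intro len
    induction len with
    | zero => intro pos x; rfl
    | succ len ih => intro pos x; rw [GrOperad.inps_succ, ih, h1, GrOperad.inps_succ]
  change H.par (H.comp _ 0 t _) = H.comp _ 0 t _
  rw [H.par_comp, hst.par_t, h2]

variable {α : ∀ n, H.obj n} (hα : ∀ n, H.par (α n) = -α n)

include hα

theorem extTotal_eq : extTotal H s t α = H.truncFam t (treeTotal H.toGrOperad α s) := by
  funext n
  rw [GrOperad.truncFam, treeTotal, map_sum]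
  exact Finset.sum_congr rfl fun T _ =>
    (PlanarTree.trunc_value hα hst.par_s hst.par_t hst.t_t _).symm

theorem isTrunc_extTotal (n : ℕ) : H.IsTrunc t (extTotal H s t α n) := by
  rw [extTotal_eq hst hα]
  exact GrOperad.isTrunc_trunc hst.par_t hst.t_t _

theorem par_extTotal (n : ℕ) : H.par (extTotal H s t α n) = -extTotal H s t α n := by
  rw [extTotal_eq hst hα, GrOperad.truncFam, hst.par_trunc, par_treeTotal hst hα, map_neg]

theorem isSymm_extTotal [CharZero k] (hαs : ∀ n, H.IsSymm (α n)) (h0 : α 0 = 0) (n : ℕ) :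
    H.IsSymm (extTotal H s t α n) := by
  intro σ
  rw [extTotal_eq hst hα, GrOperad.truncFam, ← GrOperad.trunc_act hst.par_t hst.t_t,
    famSymm_treeTotal hst hα hαs h0 n σ]

/-- Truncation of `d_treeTotal`, which commutes with the differential because dt = 0. -/
theorem d_extTotal [CharZero k] (hαs : ∀ n, H.IsSymm (α n)) (h0 : α 0 = 0)
    (hMC : ∀ n, H.d (α n) = H.star α α n) (n : ℕ) :
    H.d (extTotal H s t α n) = H.star (extTotal H s t α) (extTotal H s t α) n := by
  rw [extTotal_eq hst hα, ← GrOperad.truncFam_star hst.par_t hst.t_t,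
    ← d_treeTotal hst hα hαs h0 hMC, GrOperad.truncFam, hst.d_trunc]
  rfl

omit hst hα in
theorem extTotal_zero : extTotal H s t α 0 = 0 :=
  Finset.sum_eq_zero fun T _ => absurd T.pos (lt_irrefl 0)

end
end

noncomputable section

/-! ### The Hadamard product of graded operads -/

section
open TensorProduct
variable {k : Type u} [Field k]

theorem HasParity.tmul {M : Type v} {N : Type w} [AddCommGroup M] [Module k M]
    [AddCommGroup N] [Module k N] {ε : M →ₗ[k] M} {η : N →ₗ[k] N} {q r : ZMod 2} {b : M} {p : N}
    (hb : HasParity ε q b) (hp : HasParity η r p) :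
    HasParity (TensorProduct.map ε η) (q + r) (b ⊗ₜ[k] p) := by
  unfold HasParity at *
  rw [TensorProduct.map_tmul, hb, hp, TensorProduct.smul_tmul_smul, sgn_add]

theorem HasParity.comp {Q : GrOperad.{u, w} k} {m n l : ℕ} (h : m + n = l) (i : Fin (m + 1))
    {p q : ZMod 2} {x : Q.obj m} {y : Q.obj n} (hx : HasParity Q.par p x)
    (hy : HasParity Q.par q y) : HasParity Q.par (p + q) (Q.comp h i x y) := by
  unfold HasParity at *
  rw [Q.par_comp, hx, hy, map_smul, map_smul, LinearMap.smul_apply, smul_smul, sgn_add, mul_comm]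

theorem HasParity.act {Q : GrOperad.{u, w} k} {n : ℕ} (σ : Equiv.Perm (Fin (n + 1)))
    {p : ZMod 2} {x : Q.obj n} (hx : HasParity Q.par p x) : HasParity Q.par p (Q.act σ x) := by
  unfold HasParity at *
  rw [Q.par_act, hx, map_smul]

theorem HasParity.d {Q : DiffOperad.{u, w} k} {n : ℕ} {p : ZMod 2} {x : Q.obj n}
    (hx : HasParity Q.par p x) : HasParity Q.par (p + 1) (Q.d x) := by
  unfold HasParity at *
  rw [Q.par_d, hx, map_smul, sgn_add, sgn_one, mul_neg_one, neg_smul]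

theorem HasParity.par {Q : GrOperad.{u, w} k} {n : ℕ} {p : ZMod 2} {x : Q.obj n}
    (hx : HasParity Q.par p x) : HasParity Q.par p (Q.par x) := by
  unfold HasParity at *
  rw [hx, map_smul, hx]

theorem HasParity.one (Q : GrOperad.{u, w} k) : HasParity Q.par 0 Q.one := by
  rw [HasParity, Q.par_one, sgn_zero, one_smul]

theorem sgn_smul_congr {M : Type v} [AddCommGroup M] [Module k M] {a b c d : ZMod 2} (x : M)
    (h : a + b = c + d) : sgn k a • sgn k b • x = sgn k c • sgn k d • x := by
  rw [smul_smul, smul_smul, ← sgn_add, ← sgn_add, h]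

variable [CharZero k]

@[elab_as_elim]
theorem tmul_parity_induction {M : Type v} {N : Type w} [AddCommGroup M] [Module k M]
    [AddCommGroup N] [Module k N] {ε : M →ₗ[k] M} {η : N →ₗ[k] N} (hε : ∀ x, ε (ε x) = x)
    (hη : ∀ x, η (η x) = x) {C : M ⊗[k] N → Prop} (h0 : C 0) (hadd : ∀ x y, C x → C y → C (x + y))
    (h : ∀ q r b p, HasParity ε q b → HasParity η r p → C (b ⊗ₜ p)) (x : M ⊗[k] N) : C x := by
  induction x using TensorProduct.induction_on with
  | zero => exact h0
  | add x y hx hy => exact hadd _ _ hx hy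
  | tmul b p =>
      refine parity_induction ε hε (Q := fun b => C (b ⊗ₜ p))
        (fun a b ha hb => by rw [TensorProduct.add_tmul]; exact hadd _ _ ha hb) (fun q b hb => ?_) b
      exact parity_induction η hη (Q := fun p => C (b ⊗ₜ p))
        (fun a b ha hb => by rw [TensorProduct.tmul_add]; exact hadd _ _ ha hb)
        (fun r p hp => h q r b p hb hp) p

-- Decomposes an arbitrary tensor into homogeneous pure tensors and projects to total parity `s`,
-- which keeps exactly the terms of that parity.
@[elab_as_elim]
theorem tmul_parity_induction_of_hasParity {M : Type v} {N : Type w} [AddCommGroup M] [Module k M]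
    [AddCommGroup N] [Module k N] {ε : M →ₗ[k] M} {η : N →ₗ[k] N} (hε : ∀ x, ε (ε x) = x)
    (hη : ∀ x, η (η x) = x) {s : ZMod 2} {C : M ⊗[k] N → Prop} (h0 : C 0)
    (hadd : ∀ x y, C x → C y → C (x + y))
    (h : ∀ q r b p, HasParity ε q b → HasParity η r p → q + r = s → C (b ⊗ₜ p)) (x : M ⊗[k] N)
    (hx : HasParity (TensorProduct.map ε η) s x) : C x := by
  have h1 := parityProj_of_hasParity _ hx s
  rw [if_pos rfl] at h1
  rw [← h1]
  refine tmul_parity_induction hε hη (C := fun x => C (parityProj (TensorProduct.map ε η) s x))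
    (by rwa [map_zero]) (fun x y hx hy => by rw [map_add]; exact hadd _ _ hx hy)
    (fun q r b p hb hp => ?_) x
  rw [parityProj_of_hasParity _ (hb.tmul hp)]
  split_ifs with hs
  · exact h q r b p hb hp hs.symm
  · exact h0

variable (B : GrOperad.{u, v} k) (P : GrOperad.{u, w} k)

/-- The power of the parity involution. -/
def GrOperad.parPow (q : ZMod 2) {n : ℕ} : P.obj n →ₗ[k] P.obj n :=
  if q = 0 then LinearMap.id else P.par

/-- The partial compositions in the Hadamard product. -/
def hadComp {m n l : ℕ} (h : m + n = l) (i : Fin (m + 1)) :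
    B.obj m ⊗[k] P.obj m →ₗ[k] B.obj n ⊗[k] P.obj n →ₗ[k] B.obj l ⊗[k] P.obj l :=
  ∑ q : ZMod 2, TensorProduct.map₂ ((B.comp h i).compl₂ (parityProj B.par q))
    ((P.comp h i) ∘ₗ P.parPow q)

variable {B P}

omit [CharZero k] in
theorem HasParity.parPow {n : ℕ} {r : ZMod 2} {p : P.obj n} (hp : HasParity P.par r p)
    (q : ZMod 2) : P.parPow q p = sgn k (r * q) • p := by
  rcases zmod2_cases q with rfl | rfl
  · simp [GrOperad.parPow]
  · rw [GrOperad.parPow, if_neg one_ne_zero, mul_one]; exact hp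

/-- The Koszul rule: in (b ⊗ p) ∘ (b' ⊗ p') the factors p and b' change places. All signs of the
theorem come from here. -/
theorem hadComp_tmul {m n l : ℕ} (h : m + n = l) (i : Fin (m + 1)) {q r : ZMod 2} (b : B.obj m)
    {p : P.obj m} {b' : B.obj n} (p' : P.obj n) (hp : HasParity P.par r p)
    (hb' : HasParity B.par q b') : hadComp B P h i (b ⊗ₜ p) (b' ⊗ₜ p')
      = sgn k (r * q) • (B.comp h i b b' ⊗ₜ[k] P.comp h i p p') := by
  rw [hadComp, LinearMap.sum_apply, LinearMap.sum_apply, Finset.sum_eq_single q]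
  · change B.comp h i b (parityProj B.par q b') ⊗ₜ P.comp h i (P.parPow q p) p' = _
    rw [parityProj_of_hasParity _ hb', if_pos rfl, hp.parPow, map_smul, LinearMap.smul_apply,
      TensorProduct.tmul_smul]
  · intro q' _ hq'
    change B.comp h i b (parityProj B.par q' b') ⊗ₜ P.comp h i (P.parPow q' p) p' = _
    rw [parityProj_of_hasParity _ hb', if_neg hq', map_zero, TensorProduct.zero_tmul]
  · exact fun hq => absurd (Finset.mem_univ q) hq

variable (B P)

/-- The Hadamard product of two graded operads. -/
abbrev hadamard : GrOperad.{u, max v w} k where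
  obj n := B.obj n ⊗[k] P.obj n
  par := TensorProduct.map B.par P.par
  act σ := TensorProduct.map (B.act σ) (P.act σ)
  comp := hadComp B P
  one := B.one ⊗ₜ P.one
  par_par x := by
    induction x using TensorProduct.induction_on with
    | zero => simp
    | tmul b p => simp [B.par_par, P.par_par]
    | add x y hx hy => rw [map_add, map_add, hx, hy]
  par_one := by rw [TensorProduct.map_tmul, B.par_one, P.par_one]
  par_act σ x := by
    induction x using TensorProduct.induction_on with
    | zero => simp
    | tmul b p => simp [B.par_act, P.par_act]
    | add x y hx hy => rw [map_add, map_add, map_add, map_add, hx, hy]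
  par_comp h i x y := by
    refine tmul_parity_induction B.par_par P.par_par (by simp)
      (fun x x' hx hx' => by simp only [map_add, LinearMap.add_apply, hx, hx'])
      (fun q r b p hb hp => ?_) x
    refine tmul_parity_induction B.par_par P.par_par (by simp)
      (fun x x' hx hx' => by simp only [map_add, hx, hx'])
      (fun q' r' b' p' hb' hp' => ?_) y
    rw [TensorProduct.map_tmul, TensorProduct.map_tmul, hadComp_tmul h i b p' hp hb',
      hadComp_tmul h i _ _ hp.par hb'.par, map_smul, TensorProduct.map_tmul, B.par_comp,
      P.par_comp]
  act_one x := by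
    induction x using TensorProduct.induction_on with
    | zero => simp
    | tmul b p => simp [B.act_one, P.act_one]
    | add x y hx hy => rw [map_add, hx, hy]
  act_mul σ τ x := by
    induction x using TensorProduct.induction_on with
    | zero => simp
    | tmul b p => simp [B.act_mul, P.act_mul]
    | add x y hx hy => rw [map_add, map_add, map_add, hx, hy]
  one_comp x := by
    refine tmul_parity_induction B.par_par P.par_par (by simp)
      (fun x x' hx hx' => by simp only [map_add, hx, hx'])
      (fun q r b p hb hp => ?_) x
    rw [hadComp_tmul _ _ _ _ (HasParity.one P) hb, zero_mul, sgn_zero, one_smul, B.one_comp,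
      P.one_comp]
  comp_one i x := by
    refine tmul_parity_induction B.par_par P.par_par (by simp)
      (fun x x' hx hx' => by simp only [map_add, LinearMap.add_apply, hx, hx'])
      (fun q r b p hb hp => ?_) x
    rw [hadComp_tmul _ _ _ _ hp (HasParity.one B), mul_zero, sgn_zero, one_smul, B.comp_one,
      P.comp_one]
  assoc h₁ h₂ h₃ h₄ i j x y z := by
    refine tmul_parity_induction B.par_par P.par_par (by simp)
      (fun x x' hx hx' => by simp only [map_add, LinearMap.add_apply, hx, hx'])
      (fun q r b p hb hp => ?_) x
    refine tmul_parity_induction B.par_par P.par_par (by simp)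
      (fun x x' hx hx' => by simp only [map_add, LinearMap.add_apply, hx, hx'])
      (fun q' r' b' p' hb' hp' => ?_) y
    refine tmul_parity_induction B.par_par P.par_par (by simp)
      (fun x x' hx hx' => by simp only [map_add, hx, hx'])
      (fun q'' r'' b'' p'' hb'' hp'' => ?_) z
    rw [hadComp_tmul _ _ _ _ hp hb', hadComp_tmul _ _ _ _ hp' hb'', map_smul, map_smul,
      LinearMap.smul_apply, hadComp_tmul _ _ _ _ (hp.comp h₁ i hp') hb'',
      hadComp_tmul _ _ _ _ hp (hb'.comp h₃ j hb''), B.assoc h₁ h₂ h₃ h₄ i j,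
      P.assoc h₁ h₂ h₃ h₄ i j]
    exact sgn_smul_congr _ (by ring)
  parallel h₁ h₂ h₃ h₄ i j hij s s' x y z hy hz := by
    refine tmul_parity_induction B.par_par P.par_par (by simp)
      (fun x x' hx hx' => by simp only [map_add, LinearMap.add_apply, smul_add, hx, hx'])
      (fun q r b p hb hp => ?_) x
    refine tmul_parity_induction_of_hasParity B.par_par P.par_par (by simp)
      (fun x x' hx hx' => by simp only [map_add, LinearMap.add_apply, smul_add, hx, hx'])
      (fun q' r' b' p' hb' hp' hs => ?_) y hy
    refine tmul_parity_induction_of_hasParity B.par_par P.par_par (by simp)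
      (fun x x' hx hx' => by simp only [map_add, LinearMap.add_apply, smul_add, hx, hx'])
      (fun q'' r'' b'' p'' hb'' hp'' hs' => ?_) z hz
    rw [hadComp_tmul _ _ _ _ hp hb', hadComp_tmul _ _ _ _ hp hb'', map_smul, map_smul,
      LinearMap.smul_apply, LinearMap.smul_apply, hadComp_tmul _ _ _ _ (hp.comp h₁ i hp') hb'',
      hadComp_tmul _ _ _ _ (hp.comp h₃ j hp'') hb',
      B.parallel h₁ h₂ h₃ h₄ i j hij _ _ _ _ _ hb' hb'',
      P.parallel h₁ h₂ h₃ h₄ i j hij _ _ _ _ _ hp' hp'', TensorProduct.smul_tmul_smul]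
    simp only [smul_smul, ← sgn_add]
    -- The exponents agree by an identity in five elements of `ZMod 2`, which is checked on all
    -- values.
    congr 2
    subst hs hs'
    clear * -
    revert q' q'' r r' r''
    decide
  equivariant h i σ τ ρ h₁ h₂ x y := by
    refine tmul_parity_induction B.par_par P.par_par (by simp)
      (fun x x' hx hx' => by simp only [map_add, LinearMap.add_apply, hx, hx'])
      (fun q r b p hb hp => ?_) x
    refine tmul_parity_induction B.par_par P.par_par (by simp)
      (fun x x' hx hx' => by simp only [map_add, hx, hx'])
      (fun q' r' b' p' hb' hp' => ?_) y
    rw [TensorProduct.map_tmul, TensorProduct.map_tmul, hadComp_tmul _ _ _ _ hp hb',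
      hadComp_tmul _ _ _ _ (hp.act σ) (hb'.act τ), map_smul, TensorProduct.map_tmul,
      B.equivariant h i σ τ ρ h₁ h₂, P.equivariant h i σ τ ρ h₁ h₂]

end

/-! ### The differential on the Hadamard product -/

section
open TensorProduct
variable {k : Type u} [Field k] [CharZero k] (B : DiffOperad.{u, v} k) (P : DiffOperad.{u, w} k)

/-- The differential on the Hadamard product. -/
def hadD {n : ℕ} : B.obj n ⊗[k] P.obj n →ₗ[k] B.obj n ⊗[k] P.obj n :=
  TensorProduct.map B.d LinearMap.id + TensorProduct.map B.par P.d

variable {B P} in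
omit [CharZero k] in
theorem hadD_tmul {n : ℕ} (b : B.obj n) (p : P.obj n) :
    hadD B P (b ⊗ₜ p) = B.d b ⊗ₜ p + B.par b ⊗ₜ P.d p := rfl

theorem hadD_comp {m n l : ℕ} (h : m + n = l) (i : Fin (m + 1)) (x : B.obj m ⊗[k] P.obj m)
    (y : B.obj n ⊗[k] P.obj n) : hadD B P (hadComp B.toGrOperad P.toGrOperad h i x y)
      = hadComp B.toGrOperad P.toGrOperad h i (hadD B P x) y
        + hadComp B.toGrOperad P.toGrOperad h i (TensorProduct.map B.par P.par x) (hadD B P y) := by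
  refine tmul_parity_induction B.par_par P.par_par (by simp)
    (fun x x' hx hx' => by simp only [map_add, LinearMap.add_apply, hx, hx']; abel)
    (fun q r b p hb hp => ?_) x
  refine tmul_parity_induction B.par_par P.par_par (by simp)
    (fun x x' hx hx' => by simp only [map_add, hx, hx']; abel)
    (fun q' r' b' p' hb' hp' => ?_) y
  rw [hadComp_tmul _ _ _ _ hp hb', map_smul, hadD_tmul, hadD_tmul, hadD_tmul, map_add, map_add,
    LinearMap.add_apply, TensorProduct.map_tmul, hadComp_tmul _ _ _ _ hp hb',
    hadComp_tmul _ _ _ _ hp.d hb', hadComp_tmul _ _ _ _ hp.par hb'.d,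
    hadComp_tmul _ _ _ _ hp.par hb'.par, B.d_comp, P.d_comp, B.par_comp, hp.eps, hb'.eps]
  simp only [map_smul, LinearMap.smul_apply, TensorProduct.add_tmul, TensorProduct.tmul_add,
    TensorProduct.smul_tmul', TensorProduct.tmul_smul, smul_add, smul_smul]
  simp only [← sgn_add]
  have e1 : (r + 1) * q' = r * q' + q' := by ring
  have e2 : r * (q' + 1) + r = r * q' := by
    rw [mul_add, mul_one, add_assoc, zmod2_add_self, add_zero]
  rw [e1, e2]
  abel


/-- The Hadamard product of two graded operads with derivations. -/
abbrev hadamardD : DiffOperad.{u, max v w} k where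
  toGrOperad := hadamard B.toGrOperad P.toGrOperad
  d := hadD B P
  par_d x := by
    change TensorProduct.map B.par P.par (hadD B P x) = -hadD B P (TensorProduct.map B.par P.par x)
    induction x using TensorProduct.induction_on with
    | zero => simp
    | tmul b p =>
        simp only [hadD_tmul, map_add, TensorProduct.map_tmul, B.par_d, P.par_d,
          TensorProduct.neg_tmul, TensorProduct.tmul_neg, neg_add]
    | add x y hx hy => rw [map_add, map_add, map_add, map_add, hx, hy, neg_add]
  d_act σ x := by
    change hadD B P (TensorProduct.map (B.act σ) (P.act σ) x)
      = TensorProduct.map (B.act σ) (P.act σ) (hadD B P x)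
    induction x using TensorProduct.induction_on with
    | zero => simp
    | tmul b p =>
        simp only [hadD_tmul, map_add, TensorProduct.map_tmul, B.d_act, P.d_act, B.par_act]
    | add x y hx hy => rw [map_add, map_add, map_add, map_add, hx, hy]
  d_comp := hadD_comp B P

end
end

noncomputable section

/-! ### Twisting families in the Hadamard product with an admissible operad -/

section
variable {k : Type u} [Field k] {Q : GrOperad.{u, w} k}

theorem GrOperad.star_zero_of_zero {x : Q.Fam} (hx : x 0 = 0) : Q.star x x 0 = 0 := by
  rw [star_eq_antidiagonal]
  refine Finset.sum_eq_zero fun p _ => ?_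
  rw [Subsingleton.elim (α := Fin 1) p 0]
  change Q.insSum _ (x 0) _ = 0
  rw [hx, map_zero, LinearMap.zero_apply]

/-- Without a member of arity one the two extreme terms drop out, and the remaining indices are
those of the trees with two vertices in `cobarD`. -/
theorem GrOperad.star_succ_of_zero {x : Q.Fam} (hx : x 0 = 0) (n : ℕ) :
    Q.star x x (n + 1) = ∑ a : Fin n, Q.insSum
      (show (a : ℕ) + 1 + (n - 1 - a + 1) = n + 1 by omega) (x (a + 1)) (x (n - 1 - a + 1)) := by
  have e : ∀ a b, a = 0 ∨ b = 0 → Q.insExt a b (n + 1) (x a) (x b) = 0 := by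
    rintro a b (rfl | rfl)
    · rw [hx, map_zero, LinearMap.zero_apply]
    · rw [hx, map_zero]
  rw [star_eq_antidiagonal]
  simp only [← insExt_eq]
  rw [Fin.sum_univ_succ, Fin.sum_univ_castSucc,
    e ((0 : Fin (n + 2)) : ℕ) _ (.inl (by simp)), zero_add,
    e ((Fin.last n).succ : Fin (n + 2)) _ (.inr (by simp)), add_zero]
  refine Finset.sum_congr rfl fun a _ => ?_
  have h1 : ((a.castSucc.succ : Fin (n + 2)) : ℕ) = a + 1 := by simp
  have h2 : n + 1 - (a + 1) = n - 1 - a + 1 := by omega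
  rw [h1, h2]

end

/-! ### Contraction of a tensor with a functional -/

section
open TensorProduct
variable {k : Type u} [Field k]

/-- Contraction of the second tensor factor with a functional. -/
def contr {M : Type v} {N : Type w} [AddCommGroup M] [Module k M] [AddCommGroup N] [Module k N]
    (x : Module.Dual k N) : M ⊗[k] N →ₗ[k] M :=
  (TensorProduct.rid k M).toLinearMap ∘ₗ TensorProduct.map LinearMap.id x

variable {M : Type v} {N : Type w} [AddCommGroup M] [Module k M] [AddCommGroup N] [Module k N]

theorem contr_tmul (x : Module.Dual k N) (b : M) (p : N) : contr x (b ⊗ₜ[k] p) = x p • b := by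
  simp [contr]

theorem contr_add (x y : Module.Dual k N) (z : M ⊗[k] N) :
    contr (x + y) z = contr x z + contr y z := by
  rw [contr, TensorProduct.map_add_right]; simp [contr]

theorem contr_smul (c : k) (x : Module.Dual k N) (z : M ⊗[k] N) :
    contr (c • x) z = c • contr x z := by
  rw [contr, TensorProduct.map_smul_right]; simp [contr]

theorem contr_map (x : Module.Dual k N) (f : M →ₗ[k] M) (g : N →ₗ[k] N) (z : M ⊗[k] N) :
    contr x (TensorProduct.map f g z) = f (contr (x ∘ₗ g) z) := by
  induction z using TensorProduct.induction_on with
  | zero => simp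
  | tmul b p => simp [contr_tmul]
  | add z z' hz hz' => simp only [map_add, hz, hz']

end

/-! ### Maurer–Cartan families and linear maps from the dual of P -/

section
open TensorProduct
variable {k : Type u} [Field k] [CharZero k] {P : DiffOperad.{u, w} k} (hP : P.Admissible)
  {B : DiffOperad.{u, v} k}

omit [CharZero k] in
theorem contr_hadD {n : ℕ} (x : Module.Dual k (P.obj n)) (z : B.obj n ⊗[k] P.obj n) :
    contr x (hadD B P z) = B.d (contr x z) + B.par (contr (x ∘ₗ P.d) z) := by
  rw [hadD, LinearMap.add_apply, map_add, contr_map, contr_map]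
  rfl

theorem sum_basisCov {n : ℕ} (p : P.obj n) :
    ∑ c : P.Idx n, basisCov hP c p • basisVec hP c = p := by
  have := hP.finite n
  refine (Fintype.sum_sigma _).trans ?_
  have h : ∀ q, ∑ i, basisCov hP (⟨q, i⟩ : P.Idx n) p • basisVec hP ⟨q, i⟩
      = parityProj P.par q p := fun q => sum_hCov_smul_hVec P.par P.par_par q p
  rw [Finset.sum_congr rfl fun q _ => h q]
  exact (Fin.sum_univ_two _).trans (parityProj_add P.par p)

theorem sum_basisVec {n : ℕ} (x : Module.Dual k (P.obj n)) :
    ∑ c : P.Idx n, x (basisVec hP c) • basisCov hP c = x := by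
  ext p
  conv_rhs => rw [← sum_basisCov hP p]
  simp only [LinearMap.sum_apply, LinearMap.smul_apply, map_sum, map_smul, smul_eq_mul]
  exact Finset.sum_congr rfl fun c _ => mul_comm _ _

theorem sum_contr_tmul {n : ℕ} (z : B.obj n ⊗[k] P.obj n) :
    ∑ c : P.Idx n, contr (basisCov hP c) z ⊗ₜ[k] basisVec hP c = z := by
  induction z using TensorProduct.induction_on with
  | zero => simp
  | tmul b p =>
      conv_rhs => rw [← sum_basisCov hP p, TensorProduct.tmul_sum]
      refine Finset.sum_congr rfl fun c _ => ?_
      rw [contr_tmul, TensorProduct.smul_tmul]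
  | add z z' hz hz' =>
      simp only [map_add, TensorProduct.add_tmul, Finset.sum_add_distrib, hz, hz']

include hP in
-- Finite-dimensionality of P(n) enters here: a tensor is recovered from its contractions with a
-- dual basis. Equations in the Hadamard product can thus be tested on functionals.
theorem contr_ext {n : ℕ} {z z' : B.obj n ⊗[k] P.obj n}
    (h : ∀ x : Module.Dual k (P.obj n), contr x z = contr x z') : z = z' := by
  rw [← sum_contr_tmul hP z, ← sum_contr_tmul hP z']
  simp only [h]

/-- The family of elements of the Hadamard product that corresponds to a family of linear maps
from the dual of `P`. -/
def famOf (ζ : ∀ n, Module.Dual k (P.obj n) →ₗ[k] B.obj n) : (hadamardD B P).Fam := fun n =>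
  ∑ c : P.Idx n, ζ n (basisCov hP c) ⊗ₜ[k] basisVec hP c

variable {ζ : ∀ n, Module.Dual k (P.obj n) →ₗ[k] B.obj n}

theorem contr_famOf {n : ℕ} (x : Module.Dual k (P.obj n)) :
    contr x (famOf hP ζ n) = ζ n x := by
  rw [famOf, map_sum]
  simp only [contr_tmul, ← map_smul]
  rw [← map_sum, sum_basisVec]

theorem famOf_zero (h0 : ζ 0 = 0) : famOf hP ζ 0 = 0 := by
  refine contr_ext hP fun x => ?_
  rw [contr_famOf, h0]
  exact (map_zero _).symm

section
variable (hζ : ∀ n x, B.par (ζ n x) = -ζ n (x ∘ₗ P.par))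
include hζ

/-- A map that reverses parity corresponds to an odd element of the tensor product. -/
theorem par_famOf (n : ℕ) : (hadamardD B P).par (famOf hP ζ n) = -famOf hP ζ n := by
  refine contr_ext hP fun x => ?_
  refine (contr_map x _ _ _).trans ?_
  rw [contr_famOf, hζ, map_neg, contr_famOf, LinearMap.comp_assoc]
  congr 2
  ext p
  simp [P.par_par]

theorem hasParity_basisCov {n : ℕ} (c : P.Idx n) :
    HasParity B.par (1 + c.1) (ζ n (basisCov hP c)) := by
  rw [HasParity, hζ, basisCov_par, map_smul, sgn_add, sgn_one, neg_one_mul, neg_smul]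

/-- The sign (-1)^{|c|(1+|c'|)} of the cobar differential is the Koszul sign of moving e_c past
ζ(e_{c'}^*), which has parity 1 + |c'|. -/
theorem contr_insSum {m n l : ℕ} (h : m + n = l) (x : Module.Dual k (P.obj l)) :
    contr x ((hadamardD B P).insSum h (famOf hP ζ m) (famOf hP ζ n))
      = ∑ S ∈ Finset.powersetCard (n + 1) Finset.univ, ∑ c : P.Idx m, ∑ c' : P.Idx n,
        (sgn k (c.1 * (1 + c'.1))
          * x (P.act (permOf S (n + 1)) (P.comp h 0 (basisVec hP c) (basisVec hP c')))) •
        B.act (permOf S (n + 1)) (B.comp h 0 (ζ m (basisCov hP c)) (ζ n (basisCov hP c'))) := by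
  rw [GrOperad.insSum_apply, map_sum]
  refine Finset.sum_congr rfl fun S _ => ?_
  refine (contr_map x (B.act (permOf S (n + 1))) (P.act (permOf S (n + 1)))
    (hadComp B.toGrOperad P.toGrOperad h 0 (famOf hP ζ m) (famOf hP ζ n))).trans ?_
  simp only [famOf, map_sum, LinearMap.sum_apply]
  rw [Finset.sum_comm]
  refine Finset.sum_congr rfl fun c _ => Finset.sum_congr rfl fun c' _ => ?_
  rw [hadComp_tmul h 0 _ _ (par_basisVec hP c) (hasParity_basisCov hP hζ c'), map_smul, map_smul,
    contr_tmul, map_smul, smul_smul]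
  rfl

/-- The value at `x` of the equation `d ζ = ζ * ζ`. -/
theorem contr_star (h0 : ζ 0 = 0) {n : ℕ} (x : Module.Dual k (P.obj (n + 1))) :
    contr x ((hadamardD B P).star (famOf hP ζ) (famOf hP ζ) (n + 1))
      = ∑ a : Fin n, ∑ S ∈ Finset.powersetCard (n - 1 - a + 1 + 1) Finset.univ,
        ∑ c : P.Idx (a + 1), ∑ c' : P.Idx (n - 1 - a + 1),
        (sgn k (c.1 * (1 + c'.1)) * x (P.act (permOf S (n - 1 - a + 1 + 1))
          (P.comp (show (a : ℕ) + 1 + (n - 1 - a + 1) = n + 1 by omega) 0 (basisVec hP c)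
            (basisVec hP c')))) •
        B.act (permOf S (n - 1 - a + 1 + 1))
          (B.comp (show (a : ℕ) + 1 + (n - 1 - a + 1) = n + 1 by omega) 0
            (ζ (a + 1) (basisCov hP c)) (ζ (n - 1 - a + 1) (basisCov hP c'))) := by
  rw [GrOperad.star_succ_of_zero (famOf_zero hP h0), map_sum]
  exact Finset.sum_congr rfl fun a _ => contr_insSum hP hζ _ x

/-- The Maurer-Cartan equation for a family of linear maps. -/
theorem d_famOf_iff (h0 : ζ 0 = 0) : (∀ n, (hadamardD B P).d (famOf hP ζ n)
      = (hadamardD B P).star (famOf hP ζ) (famOf hP ζ) n)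
    ↔ ∀ (n : ℕ) (x : Module.Dual k (P.obj (n + 1))), B.d (ζ (n + 1) x)
      = ζ (n + 1) (x ∘ₗ P.d ∘ₗ P.par)
        + ∑ a : Fin n, ∑ S ∈ Finset.powersetCard (n - 1 - a + 1 + 1) Finset.univ,
        ∑ c : P.Idx (a + 1), ∑ c' : P.Idx (n - 1 - a + 1),
        (sgn k (c.1 * (1 + c'.1)) * x (P.act (permOf S (n - 1 - a + 1 + 1))
          (P.comp (show (a : ℕ) + 1 + (n - 1 - a + 1) = n + 1 by omega) 0 (basisVec hP c)
            (basisVec hP c')))) •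
        B.act (permOf S (n - 1 - a + 1 + 1))
          (B.comp (show (a : ℕ) + 1 + (n - 1 - a + 1) = n + 1 by omega) 0
            (ζ (a + 1) (basisCov hP c)) (ζ (n - 1 - a + 1) (basisCov hP c'))) := by
  -- The parity involution in front of the differential of P is moved to the functional by `hζ`;
  -- this is the source of the minus sign and of the factor `P.par`.
  have h1 : ∀ n (x : Module.Dual k (P.obj (n + 1))),
      contr x ((hadamardD B P).d (famOf hP ζ (n + 1)))
        = B.d (ζ (n + 1) x) - ζ (n + 1) (x ∘ₗ P.d ∘ₗ P.par) := by
    intro n x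
    refine (contr_hadD x _).trans ?_
    rw [contr_famOf, contr_famOf, hζ, sub_eq_add_neg]
    rfl
  constructor
  · intro h n x
    have := congrArg (contr x) (h (n + 1))
    rw [h1, contr_star hP hζ h0, sub_eq_iff_eq_add'] at this
    exact this
  · intro h n
    cases n with
    | zero =>
        rw [GrOperad.star_zero_of_zero (famOf_zero hP h0), famOf_zero hP h0, map_zero]
    | succ n =>
        refine contr_ext hP fun x => ?_
        rw [h1, contr_star hP hζ h0, sub_eq_iff_eq_add', h]

end

/-- Equivariance of `ζ` is invariance of its canonical element: permutations act on both tensor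
factors and cancel after contraction. -/
theorem isSymm_famOf (hs : ∀ n (σ : Equiv.Perm (Fin (n + 1))) x,
    B.act σ (ζ n x) = ζ n (x ∘ₗ P.act σ⁻¹)) (n : ℕ) :
    (hadamardD B P).IsSymm (famOf hP ζ n) := by
  intro σ
  refine contr_ext hP fun x => ?_
  refine (contr_map x _ _ _).trans ?_
  rw [contr_famOf, contr_famOf, hs]
  congr 1
  ext p
  simp only [LinearMap.comp_apply]
  rw [← P.act_mul, mul_inv_cancel, P.act_one]

end
end

noncomputable section

/-! ### Expansion of compositions along trees in the Hadamard product -/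

section
variable {ι : ℕ → Type}

instance Forest.fintypeDec [∀ m, Fintype (ι m)] {r b : ℕ} (F : Forest r b) : Fintype (F.Dec ι) :=
  F.decFintype ι

theorem Forest.sum_dec_nil [∀ m, Fintype (ι m)] {Z : Type*} [AddCommMonoid Z]
    (G : Forest.nil.Dec ι → Z) : ∑ D, G D = G () :=
  Fintype.sum_unique (ι := Unit) G

theorem Forest.sum_dec_node [∀ m, Fintype (ι m)] {Z : Type*} [AddCommMonoid Z]
    {m a r b c : ℕ} (h : m + 1 + a + b = c) (C : Forest (m + 2) a) (F : Forest r b)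
    (G : (Forest.node h C F).Dec ι → Z) :
    ∑ D, G D = ∑ c : ι (m + 1), ∑ D₁ : C.Dec ι, ∑ D₂ : F.Dec ι, G (c, D₁, D₂) := by
  refine (Fintype.sum_prod_type (α₁ := ι (m + 1)) (α₂ := C.Dec ι × F.Dec ι) G).trans ?_
  exact Finset.sum_congr rfl fun c _ => Fintype.sum_prod_type _

theorem PlanarTree.sum_dec [∀ m, Fintype (ι m)] {Z : Type*} [AddCommMonoid Z] {n : ℕ}
    (T : PlanarTree n) (G : T.Dec ι → Z) :
    ∑ D, G D = ∑ c : ι (T.m + 1), ∑ D : T.children.Dec ι, G (c, D) :=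
  Fintype.sum_prod_type (α₁ := ι (T.m + 1)) (α₂ := T.children.Dec ι) G

variable {k : Type u} [Field k] (Q : GrOperad.{u, w} k) (φ : ∀ m, ι m → Q.obj m) (e l : Q.obj 0)

theorem Forest.contract_leaf {r b m n : ℕ} (F : Forest r b) (D : F.leaf.Dec ι) (pos : ℕ)
    (h : m + b = n) (hp : pos + (r + 1) = m + 1) (x : Q.obj m) :
    F.leaf.contract Q φ e l D pos h hp x = F.contract Q φ e l D (pos + 1) h (by omega)
      (Q.comp (Nat.add_zero m) ⟨pos, by omega⟩ x l) := rfl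

theorem Forest.contract_node {m' a r b c m n : ℕ} (h' : m' + 1 + a + b = c)
    (C : Forest (m' + 2) a) (F : Forest r b) (d : ι (m' + 1)) (D₁ : C.Dec ι) (D₂ : F.Dec ι)
    (pos : ℕ) (h : m + c = n) (hp : pos + (r + 1) = m + 1) (x : Q.obj m) :
    (Forest.node h' C F).contract Q φ e l (d, D₁, D₂) pos h hp x
      = F.contract Q φ e l D₂ (m := m + (m' + 1 + a)) (pos + (m' + 1 + a) + 1) (by omega)
        (by omega) (Q.comp (n := m' + 1 + a) rfl ⟨pos, by omega⟩ x
          (Q.comp (Nat.zero_add _) 0 e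
            (C.contract Q φ e l D₁ 0 rfl (Nat.zero_add _) (φ (m' + 1) d)))) := rfl

end

/-! ### The Koszul sign of a tree -/

section
open TensorProduct
variable {k : Type u} [Field k] [CharZero k] {P : DiffOperad.{u, w} k}

/-- The number of vertices with an odd decoration. -/
abbrev Forest.oddCount {r b : ℕ} (F : Forest r b) (D : F.Dec P.Idx) : ℕ :=
  F.count (fun _ b => ZMod.val b.1) D

omit [CharZero k] in
theorem Forest.oddCount_node {m a r b c : ℕ} (h : m + 1 + a + b = c) (C : Forest (m + 2) a)
    (F : Forest r b) (d : P.Idx (m + 1)) (D₁ : C.Dec P.Idx) (D₂ : F.Dec P.Idx) :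
    (Forest.node h C F).oddCount (d, D₁, D₂) = d.1.val + C.oddCount D₁ + F.oddCount D₂ := rfl

omit [CharZero k] in
-- The exponent q(q-1)/2 of a tree in terms of those of its parts: a vertex of parity p, `a` odd
-- vertices above it and `b` odd vertices in the rest. The products are the Koszul signs collected
-- when these are put in order.
theorem cast_choose_two (p : ZMod 2) (a b : ℕ) :
    ((p.val + a + b).choose 2 : ZMod 2)
      = (a.choose 2 : ZMod 2) + p * a + (b.choose 2 : ZMod 2) + (p + a) * b := by
  have key : ∀ a b : ℕ, (a + b).choose 2 = a.choose 2 + b.choose 2 + a * b := by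
    intro a b
    rw [Nat.add_choose_eq]
    simp [Finset.Nat.antidiagonal_succ]
    ring
  rw [key, key]
  -- A single vertex counts 0 or 1, so it contributes nothing by itself.
  have hp : p.val.choose 2 = 0 := Nat.choose_eq_zero_of_lt (ZMod.val_lt p)
  rw [hp]
  push_cast
  rw [ZMod.natCast_zmod_val]
  ring

section
variable {Q : GrOperad.{u, v} k} {φ : ∀ m, P.Idx m → Q.obj m} {e l : Q.obj 0} {π : ZMod 2}
  (hφ : ∀ m (c : P.Idx m), HasParity Q.par (π + c.1) (φ m c)) (he : HasParity Q.par π e)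
  (hl : HasParity Q.par 0 l)
include hφ he hl

omit [CharZero k] in
-- Every vertex of the forest comes with the edge below it; their shifts π cancel and the parities
-- of the decorations remain. The case π = 1 serves the factor B, the case π = 0 the factor P.
theorem HasParity.contract {r b : ℕ} (F : Forest r b) : ∀ (D : F.Dec P.Idx) {m n : ℕ} (pos : ℕ)
    (h : m + b = n) (hp : pos + r = m + 1) {q : ZMod 2} {x : Q.obj m} (_ : HasParity Q.par q x),
    HasParity Q.par (q + F.oddCount D) (F.contract Q φ e l D pos h hp x) := by
  induction F with
  | nil =>
      rintro D m n pos rfl hp q x hx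
      change HasParity Q.par (q + ((0 : ℕ) : ZMod 2)) x
      rw [Nat.cast_zero, add_zero]
      exact hx
  | leaf F ih =>
      intro D m n pos h hp q x hx
      have := ih D (pos + 1) h (by omega) (hx.comp (Nat.add_zero m) ⟨pos, by omega⟩ hl)
      rw [add_zero] at this
      exact this
  | node h' C F ihC ihF =>
      rename_i m' a r b c
      rintro ⟨d, D₁, D₂⟩ m n pos h hp q x hx
      rw [Forest.contract_node, Forest.oddCount_node]
      have h1 := he.comp (Nat.zero_add _) 0 (ihC D₁ 0 rfl (Nat.zero_add _) (hφ _ d))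
      have h2 := ihF D₂ (n := n) (pos + (m' + 1 + a) + 1) (by omega) (by omega) (hx.comp rfl ⟨pos, by omega⟩ h1)
      convert h2 using 1
      push_cast
      rw [ZMod.natCast_zmod_val, show π + (π + d.1 + (C.oddCount D₁ : ZMod 2))
        = (π + π) + d.1 + C.oddCount D₁ by ring, zmod2_add_self]
      ring

end

variable (hP : P.Admissible) {B : DiffOperad.{u, v} k} {ψ : ∀ m, P.Idx m → B.obj m}
  {e l : B.obj 0}

variable (ψ) in
/-- The family of the elements of the Hadamard product with the components `ψ`. -/
def decFam : (hadamardD B P).Fam := fun n => ∑ c : P.Idx n, ψ n c ⊗ₜ[k] basisVec hP c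

section
variable (hψ : ∀ m (c : P.Idx m), HasParity B.par (1 + c.1) (ψ m c)) (he : HasParity B.par 1 e)
  (hl : HasParity B.par 0 l)
include hψ he hl

/-- When a bush is grafted, the P-part collected so far, of parity `q`, passes the B-part of the
bush, whose parity is its number of odd decorations modulo 2; afterwards it has absorbed the P-part
of the bush. This explains the term `q * oddCount`, needed for the induction, and `cast_choose_two`
sums the signs to the binomial coefficient. -/
theorem Forest.glue_hadamard {r b : ℕ} (F : Forest r b) : ∀ {m n : ℕ} (pos : ℕ)
    (h : m + b = n) (hp : pos + r = m + 1) {q : ZMod 2} (x : B.obj m) {p : P.obj m}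
    (_ : HasParity P.par q p),
    F.glue (hadamardD B P).toGrOperad (decFam hP ψ) (e ⊗ₜ[k] P.one) (l ⊗ₜ[k] P.one) pos h hp
        (x ⊗ₜ[k] p)
      = ∑ D : F.Dec P.Idx, sgn k ((F.oddCount D).choose 2 + q * F.oddCount D) •
        (F.contract B.toGrOperad ψ e l D pos h hp x
          ⊗ₜ[k] F.contract P.toGrOperad (fun _ => basisVec hP) P.one P.one D pos h hp p) := by
  have hb : ∀ m (c : P.Idx m), HasParity P.par (0 + c.1) (basisVec hP c) := fun m c => by
    rw [zero_add]; exact par_basisVec hP c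
  have h1 := HasParity.one P.toGrOperad
  induction F with
  | nil =>
      rintro m n pos rfl hp q x p hpar
      rw [Forest.sum_dec_nil]
      change x ⊗ₜ[k] p = sgn k (((Nat.choose 0 2 : ℕ) : ZMod 2) + q * ((0 : ℕ) : ZMod 2)) • (x ⊗ₜ[k] p)
      simp
  | leaf F ih =>
      intro m n pos h hp q x p hpar
      rw [Forest.glue_leaf]
      have e1 : (hadamardD B P).comp (Nat.add_zero m) ⟨pos, by omega⟩ (x ⊗ₜ[k] p) (l ⊗ₜ[k] P.one)
          = B.comp (Nat.add_zero m) ⟨pos, by omega⟩ x l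
            ⊗ₜ[k] P.comp (Nat.add_zero m) ⟨pos, by omega⟩ p P.one := by
        refine (hadComp_tmul _ _ _ _ hpar hl).trans ?_
        rw [mul_zero, sgn_zero, one_smul]
      rw [e1]
      have := hpar.comp (Nat.add_zero m) ⟨pos, by omega⟩ h1
      rw [add_zero] at this
      exact ih (pos + 1) h (by omega) _ this
  | node h' C F ihC ihF =>
      rename_i m' a r b c
      intro m n pos h hp q x p hpar
      rw [Forest.glue_node _ _ _ _ h' C F pos h hp rfl, Forest.sum_dec_node]
      have e1 : C.bush (hadamardD B P).toGrOperad (decFam hP ψ) (e ⊗ₜ[k] P.one) (l ⊗ₜ[k] P.one)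
          = ∑ d : P.Idx (m' + 1), ∑ D₁ : C.Dec P.Idx,
            sgn k ((C.oddCount D₁).choose 2 + d.1 * C.oddCount D₁) •
            (B.comp (Nat.zero_add _) 0 e (C.contract B.toGrOperad ψ e l D₁ 0 rfl
                (Nat.zero_add _) (ψ _ d))
              ⊗ₜ[k] P.comp (Nat.zero_add _) 0 P.one (C.contract P.toGrOperad
                (fun _ => basisVec hP) P.one P.one D₁ 0 rfl (Nat.zero_add _)
                (basisVec hP d))) := by
        rw [Forest.bush, decFam, map_sum, map_sum]
        refine Finset.sum_congr rfl fun d _ => ?_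
        rw [ihC 0 rfl (Nat.zero_add _) _ (par_basisVec hP d), map_sum]
        refine Finset.sum_congr rfl fun D₁ _ => ?_
        rw [map_smul]
        congr 1
        refine (hadComp_tmul _ _ _ _ h1 (HasParity.contract hψ he hl C D₁ 0 rfl
          (Nat.zero_add _) (hψ _ d))).trans ?_
        rw [zero_mul, sgn_zero, one_smul]
      rw [e1, map_sum, map_sum]
      refine Finset.sum_congr rfl fun d _ => ?_
      rw [map_sum, map_sum]
      refine Finset.sum_congr rfl fun D₁ _ => ?_
      have p1 := he.comp (Nat.zero_add _) 0 (HasParity.contract hψ he hl C D₁ 0 rfl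
          (Nat.zero_add _) (hψ _ d))
      have p2 := h1.comp (Nat.zero_add _) 0 (HasParity.contract hb h1 h1 C D₁ 0 rfl
          (Nat.zero_add _) (hb _ d))
      have e2 := hadComp_tmul (B := B.toGrOperad) (P := P.toGrOperad)
        (rfl : m + (m' + 1 + a) = m + (m' + 1 + a)) ⟨pos, by omega⟩ x
        (P.comp (Nat.zero_add _) 0 P.one (C.contract P.toGrOperad
                (fun _ => basisVec hP) P.one P.one D₁ 0 rfl (Nat.zero_add _)
                (basisVec hP d))) hpar p1
      have e3 := ihF (pos + (m' + 1 + a) + 1) (n := n) (by omega) (by omega)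
        (B.comp rfl ⟨pos, by omega⟩ x (B.comp (Nat.zero_add _) 0 e
          (C.contract B.toGrOperad ψ e l D₁ 0 rfl (Nat.zero_add _) (ψ _ d)))) (hpar.comp rfl ⟨pos, by omega⟩ p2)
      rw [map_smul, map_smul]
      refine (congrArg _ (congrArg _ e2)).trans ?_
      rw [map_smul]
      refine (congrArg _ (congrArg _ e3)).trans ?_
      rw [Finset.smul_sum, Finset.smul_sum]
      refine Finset.sum_congr rfl fun D₂ _ => ?_
      rw [Forest.contract_node, Forest.contract_node, smul_smul, smul_smul, ← sgn_add, ← sgn_add]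
      congr 2
      rw [Forest.oddCount_node, cast_choose_two]
      push_cast
      rw [ZMod.natCast_zmod_val]
      have e4 : (1 : ZMod 2) + 1 = 0 := zmod2_add_self 1
      linear_combination (q * e4)

/-- Contraction of the composition along a tree in the Hadamard product. -/
theorem PlanarTree.contr_extValue {n : ℕ} (T : PlanarTree n) (x : Module.Dual k (P.obj n)) :
    contr x (T.extValue (hadamardD B P).toGrOperad (l ⊗ₜ[k] P.one) (decFam hP ψ)
        (e ⊗ₜ[k] P.one))
      = ∑ D : T.Dec P.Idx,
        x (T.contract P.toGrOperad (fun _ => basisVec hP) P.one P.one D) •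
          sgn k ((T.count (fun _ b => ZMod.val b.1) D).choose 2 : ℕ) •
          T.contract B.toGrOperad ψ e l D := by
  have h1 := HasParity.one P.toGrOperad
  refine (contr_map x (B.act T.label) (P.act T.label) _).trans ?_
  rw [decFam, map_sum, map_sum, map_sum, map_sum, PlanarTree.sum_dec]
  refine Finset.sum_congr rfl fun d _ => ?_
  rw [T.children.glue_hadamard hP hψ he hl 0 T.h (Nat.zero_add _) _ (par_basisVec hP d),
    map_sum, map_sum, map_sum]
  refine Finset.sum_congr rfl fun D _ => ?_
  have e1 := hadComp_tmul (B := B.toGrOperad) (P := P.toGrOperad) (Nat.zero_add n) 0 l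
    (T.children.contract P.toGrOperad (fun _ => basisVec hP) P.one P.one D 0 T.h
      (Nat.zero_add _) (basisVec hP d)) h1
    (HasParity.contract hψ he hl T.children D 0 T.h (Nat.zero_add _) (hψ _ d))
  rw [zero_mul, sgn_zero, one_smul] at e1
  rw [map_smul, map_smul, map_smul]
  refine (congrArg _ (congrArg _ (congrArg _ e1))).trans ?_
  rw [contr_tmul, map_smul, smul_comm]
  have e2 : T.count (fun _ b => ZMod.val b.1) ((d, D) : T.Dec P.Idx)
      = d.1.val + T.children.oddCount D + 0 := rfl
  rw [e2, cast_choose_two]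
  simp only [Nat.choose_zero_succ, Nat.cast_zero, mul_zero, add_zero]
  rfl

end
end
end

noncomputable section

/-! ### The splitting of the projection to the cobar construction -/

section
open TensorProduct
variable {k : Type u} [Field k]

/-- The inclusion of an operad in its BV-resolution. -/
def bvHom (O : DiffOperad.{u, w} k) : OperadHom O (BV O) where
  app :=
    { toFun := bvOp O
      map_add' x y := Presented.sound (.of (.op_add x y))
      map_smul' c x := Presented.sound (.of (.op_smul c x)) }
  map_par x := Presented.sound (.of (.op_par x))
  map_act σ x := Presented.sound (.of (.op_act σ x))
  map_comp h i x y := Presented.sound (.of (.op_comp h i x y))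
  map_one := Presented.sound (.of .op_one)
  map_d _ := rfl

theorem isHodgePair_bv (O : DiffOperad.{u, w} k) : (BV O).IsHodgePair (bvS O) (bvT O) where
  par_s := by
    have h : (BV O).par (bvS O) = (-1 : k) • bvS O := Presented.sound (.of .par_s)
    rw [h, neg_one_smul]
  par_t := par_bvT O
  t_t := bvT_bvT O
  d_s := rfl
  d_t := d_bvT O

/-- The image of (s, t) under the augmentation of the BV-resolution. -/
theorem DiffOperad.isHodgePair_zero_one (H : DiffOperad.{u, w} k) : H.IsHodgePair 0 H.one where
  par_s := by rw [map_zero, neg_zero]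
  par_t := H.par_one
  t_t := H.one_comp H.one
  d_s := by rw [map_zero, sub_self]
  d_t := H.d_one

/-- With s = 0 the recursion `treeSum_succ` kills every tree with an internal edge, and truncation
by the unit does nothing; only the corollas are left. -/
theorem extTotal_zero_one [CharZero k] {H : DiffOperad.{u, w} k} {α : ∀ n, H.obj n}
    (hα : ∀ n, H.par (α n) = -α n) (hαs : ∀ n, H.IsSymm (α n)) (h0 : α 0 = 0) :
    extTotal H 0 H.one α = α := by
  have hz : H.par (0 : H.obj 0) = -0 := by rw [map_zero, neg_zero]
  have h1 : ∀ j, treeSum H.toGrOperad α 0 (j + 1) = 0 := by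
    intro j
    have hc : ((j + 1 : ℕ) : k) ≠ 0 := Nat.cast_ne_zero.2 (Nat.succ_ne_zero j)
    refine smul_right_injective _ hc ?_
    simp only
    rw [treeSum_succ hα hz hαs, smul_zero]
    refine Finset.sum_eq_zero fun p _ => ?_
    have : (fun n => H.root 0 (treeSum H.toGrOperad α 0 p.2 n)) = (0 : H.Fam) := by
      funext n
      rw [GrOperad.root, map_zero]; rfl
    rw [this, map_zero]
  rw [extTotal_eq H.isHodgePair_zero_one hα]
  funext n
  rw [GrOperad.truncFam, GrOperad.IsTrunc.trunc_eq ⟨H.one_comp _, fun i => H.comp_one i _⟩,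
    ← sum_treeSum le_rfl (Nat.le_succ _), Finset.sum_range_succ',
    Finset.sum_eq_zero fun j _ => h1 j, zero_add, treeSum_zero hαs h0]

theorem OperadHom.map_contract {A : DiffOperad.{u, v} k} {B : DiffOperad.{u, w} k}
    (f : OperadHom A B) {ι : ℕ → Type} (φ : ∀ m, ι m → A.obj m) (e l : A.obj 0) {r b : ℕ}
    (F : Forest r b) : ∀ (D : F.Dec ι) {m n : ℕ} (pos : ℕ) (h : m + b = n) (hp : pos + r = m + 1)
      (x : A.obj m), f.app (F.contract A.toGrOperad φ e l D pos h hp x)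
        = F.contract B.toGrOperad (fun m c => f.app (φ m c)) (f.app e) (f.app l) D pos h hp
          (f.app x) := by
  induction F with
  | nil => rintro D m n pos rfl hp x; rfl
  | leaf F ih =>
      intro D m n pos h hp x
      rw [Forest.contract_leaf, Forest.contract_leaf, ← f.map_comp]
      exact ih D _ _ _ _
  | node h' C F ihC ihF =>
      rintro ⟨d, D₁, D₂⟩ m n pos h hp x
      rw [Forest.contract_node, Forest.contract_node, ihF, f.map_comp, f.map_comp, ihC]

theorem OperadHom.map_treeContract {A : DiffOperad.{u, v} k} {B : DiffOperad.{u, w} k}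
    (f : OperadHom A B) {ι : ℕ → Type} (φ : ∀ m, ι m → A.obj m) (e l : A.obj 0) {n : ℕ}
    (T : PlanarTree n) (D : T.Dec ι) : f.app (T.contract A.toGrOperad φ e l D)
      = T.contract B.toGrOperad (fun m c => f.app (φ m c)) (f.app e) (f.app l) D := by
  rw [PlanarTree.contract, PlanarTree.contract, f.map_act, f.map_comp, f.map_contract]

variable [CharZero k]

/-! ### Hodge pairs in the Hadamard product -/

section
variable {P : DiffOperad.{u, w} k} {B : DiffOperad.{u, v} k}

theorem contr_root {n : ℕ} (t : B.obj 0) (x : Module.Dual k (P.obj n))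
    (z : B.obj n ⊗[k] P.obj n) :
    contr x (hadComp B.toGrOperad P.toGrOperad (Nat.zero_add n) 0 (t ⊗ₜ P.one) z)
      = B.comp (Nat.zero_add n) 0 t (contr x z) := by
  refine tmul_parity_induction B.par_par P.par_par (by simp)
    (fun y y' hy hy' => by simp only [map_add, hy, hy']) (fun q r b p hb hp => ?_) z
  rw [hadComp_tmul _ _ _ _ (HasParity.one P.toGrOperad) hb, zero_mul, sgn_zero, one_smul,
    P.one_comp, contr_tmul, contr_tmul, map_smul]

theorem contr_inp {n : ℕ} (i : Fin (n + 1)) {t : B.obj 0} (ht : B.par t = t)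
    (x : Module.Dual k (P.obj n)) (z : B.obj n ⊗[k] P.obj n) :
    contr x (hadComp B.toGrOperad P.toGrOperad (Nat.add_zero n) i z (t ⊗ₜ P.one))
      = B.comp (Nat.add_zero n) i (contr x z) t := by
  have ht' : HasParity B.par 0 t := by rw [HasParity, ht, sgn_zero, one_smul]
  refine tmul_parity_induction B.par_par P.par_par (by simp)
    (fun y y' hy hy' => by simp only [map_add, LinearMap.add_apply, hy, hy'])
    (fun q r b p hb hp => ?_) z
  rw [hadComp_tmul _ _ _ _ hp ht', mul_zero, sgn_zero, one_smul,
    P.comp_one, contr_tmul, contr_tmul, map_smul, LinearMap.smul_apply]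

/-- The unit of P is even and closed, so tensoring with it neither creates signs nor changes the
identities. -/
theorem DiffOperad.IsHodgePair.hadamard (P : DiffOperad.{u, w} k) {s t : B.obj 0}
    (h : B.IsHodgePair s t) :
    (hadamardD B P).IsHodgePair (s ⊗ₜ[k] P.one) (t ⊗ₜ[k] P.one) where
  par_s := by
    refine (TensorProduct.map_tmul _ _ _ _).trans ?_
    rw [h.par_s, P.par_one, TensorProduct.neg_tmul]
  par_t := by
    refine (TensorProduct.map_tmul _ _ _ _).trans ?_
    rw [h.par_t, P.par_one]
  t_t := by
    refine (hadComp_tmul _ _ _ _ (HasParity.one P.toGrOperad)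
      (show HasParity B.par 0 t by rw [HasParity, h.par_t, sgn_zero, one_smul])).trans ?_
    rw [mul_zero, sgn_zero, one_smul, h.t_t, P.one_comp]
  d_s := by
    refine (hadD_tmul _ _).trans ?_
    rw [h.d_s, P.d_one, TensorProduct.tmul_zero, add_zero, TensorProduct.sub_tmul]
  d_t := by
    refine (hadD_tmul _ _).trans ?_
    rw [h.d_t, P.d_one, TensorProduct.tmul_zero, add_zero, TensorProduct.zero_tmul]

end

variable {P : DiffOperad.{u, w} k} (hP : P.Admissible)

/-! ### Tree sums attached to a map out of the cobar construction -/

section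
variable {B : DiffOperad.{u, v} k} (f : OperadHom (Cobar hP) B)

/-- The values of a map out of the cobar construction on the generators. -/
def genMap : ∀ n, Module.Dual k (P.obj n) →ₗ[k] B.obj n
  | 0 => 0
  | _ + 1 => f.app ∘ₗ Cobar.xi hP

theorem par_genMap (n : ℕ) (x : Module.Dual k (P.obj n)) :
    B.par (genMap hP f n x) = -genMap hP f n (x ∘ₗ P.par) := by
  cases n with
  | zero => exact (map_zero _).trans neg_zero.symm
  | succ n =>
      refine (f.map_par _).symm.trans ?_
      refine (congrArg _ (par_cobarXi P x)).trans ?_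
      exact map_neg _ _

theorem act_genMap (n : ℕ) (σ : Equiv.Perm (Fin (n + 1))) (x : Module.Dual k (P.obj n)) :
    B.act σ (genMap hP f n x) = genMap hP f n (x ∘ₗ P.act σ⁻¹) := by
  cases n with
  | zero => exact map_zero _
  | succ n =>
      refine (f.map_act _ _).symm.trans ?_
      exact congrArg _ (act_cobarXi P σ x)

/-- The definition `cobarD` of the differential on generators, transported by `f`, is the
Maurer–Cartan equation in the form of `d_famOf_iff`. -/
theorem d_famOf_genMap (n : ℕ) : (hadamardD B P).d (famOf hP (genMap hP f) n)
    = (hadamardD B P).star (famOf hP (genMap hP f)) (famOf hP (genMap hP f)) n := by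
  refine (d_famOf_iff hP (par_genMap hP f) rfl).2 (fun n x => ?_) n
  refine (f.map_d _).symm.trans ?_
  refine (congrArg f.app (show (Cobar hP).d (Cobar.xi hP x) = cobarD hP x from rfl)).trans ?_
  rw [cobarD]
  refine (map_add f.app _ _).trans (congrArg₂ (· + ·) rfl ?_)
  refine (map_sum f.app _ _).trans (Finset.sum_congr rfl fun a _ => ?_)
  refine (map_sum f.app _ _).trans (Finset.sum_congr rfl fun S _ => ?_)
  refine (map_sum f.app _ _).trans (Finset.sum_congr rfl fun c _ => ?_)
  refine (map_sum f.app _ _).trans (Finset.sum_congr rfl fun c' _ => ?_)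
  refine (map_smul f.app _ _).trans (congrArg _ ?_)
  refine (f.map_act _ _).trans (congrArg _ ?_)
  exact f.map_comp _ _ _ _

theorem genMap_basisCov : (fun n (c : P.Idx n) => genMap hP f n (basisCov hP c))
    = fun n c => f.app (vertexXi hP n c) := by
  funext n c
  cases n with
  | zero => exact (map_zero f.app).symm
  | succ n => rfl

/-- The sum over all trees of the compositions of generators along the tree with internal edges
labelled by `s` and extremities labelled by `t`, as an element of the Hadamard product. -/
def treeElement (s t : B.obj 0) : (hadamardD B P).Fam :=
  extTotal (hadamardD B P) (s ⊗ₜ[k] P.one) (t ⊗ₜ[k] P.one) (famOf hP (genMap hP f))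

/-- The contraction of the sum over all trees with a functional. -/
def treeMap (s t : B.obj 0) (n : ℕ) : Module.Dual k (P.obj n) →ₗ[k] B.obj n where
  toFun x := contr x (treeElement hP f s t n)
  map_add' x y := contr_add x y _
  map_smul' c x := contr_smul c x _

/-- The tree element is recovered from its contractions, so `d_famOf_iff` can be applied backwards
to it. -/
theorem famOf_treeMap (s t : B.obj 0) : famOf hP (treeMap hP f s t) = treeElement hP f s t :=
  funext fun n => sum_contr_tmul hP (treeElement hP f s t n)

theorem treeMap_zero (s t : B.obj 0) : treeMap hP f s t 0 = 0 := by
  ext x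
  change contr x (treeElement hP f s t 0) = 0
  rw [treeElement, extTotal_zero]
  exact map_zero _

variable {s t : B.obj 0} (hst : B.IsHodgePair s t)
include hst

theorem par_treeElement (n : ℕ) :
    (hadamardD B P).par (treeElement hP f s t n) = -treeElement hP f s t n :=
  par_extTotal (hst.hadamard P) (par_famOf hP (par_genMap hP f)) n

theorem par_treeMap (n : ℕ) (x : Module.Dual k (P.obj n)) :
    B.par (treeMap hP f s t n x) = -treeMap hP f s t n (x ∘ₗ P.par) := by
  have h1 := congrArg (contr (x ∘ₗ P.par)) (par_treeElement hP f hst n)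
  have h2 := (contr_map (x ∘ₗ P.par) B.par P.par (treeElement hP f s t n)).symm.trans h1
  have h3 : (x ∘ₗ P.par) ∘ₗ P.par = x := by
    ext p
    simp only [LinearMap.comp_apply, P.par_par]
  rw [h3, map_neg] at h2
  exact h2

theorem act_treeMap (n : ℕ) (σ : Equiv.Perm (Fin (n + 1))) (x : Module.Dual k (P.obj n)) :
    B.act σ (treeMap hP f s t n x) = treeMap hP f s t n (x ∘ₗ P.act σ⁻¹) := by
  have h0 := isSymm_extTotal (hst.hadamard P) (par_famOf hP (par_genMap hP f))
    (isSymm_famOf hP (act_genMap hP f)) (famOf_zero hP rfl) n σ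
  have h1 := congrArg (contr (x ∘ₗ P.act σ⁻¹)) h0
  have h2 := (contr_map (x ∘ₗ P.act σ⁻¹) (B.act σ) (P.act σ)
    (treeElement hP f s t n)).symm.trans h1
  have h3 : (x ∘ₗ P.act σ⁻¹) ∘ₗ P.act σ = x := by
    ext p
    simp only [LinearMap.comp_apply]
    rw [← P.act_mul, inv_mul_cancel, P.act_one]
  rw [h3] at h2
  exact h2

/-- Contraction commutes with composition with `t ⊗ 1` at the root and at the inputs, so invariance
passes from the Hadamard product to B. -/
theorem isTrunc_treeMap (n : ℕ) (x : Module.Dual k (P.obj n)) :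
    B.IsTrunc t (treeMap hP f s t n x) := by
  have h := isTrunc_extTotal (hst.hadamard P) (par_famOf hP (par_genMap hP f)) n
  exact ⟨(contr_root _ x (treeElement hP f s t n)).symm.trans (congrArg (contr x) h.1), fun i =>
    (contr_inp i hst.par_t x (treeElement hP f s t n)).symm.trans (congrArg (contr x) (h.2 i))⟩

/-- The Maurer–Cartan equation of the tree element, read on functionals: the new values on
generators satisfy the relation that the cobar differential demands. -/
theorem d_treeMap (n : ℕ) (x : Module.Dual k (P.obj (n + 1))) :
    B.d (treeMap hP f s t (n + 1) x)
      = treeMap hP f s t (n + 1) (x ∘ₗ P.d ∘ₗ P.par)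
        + ∑ a : Fin n, ∑ S ∈ Finset.powersetCard (n - 1 - a + 1 + 1) Finset.univ,
        ∑ c : P.Idx (a + 1), ∑ c' : P.Idx (n - 1 - a + 1),
        (sgn k (c.1 * (1 + c'.1)) * x (P.act (permOf S (n - 1 - a + 1 + 1))
          (P.comp (show (a : ℕ) + 1 + (n - 1 - a + 1) = n + 1 by omega) 0 (basisVec hP c)
            (basisVec hP c')))) •
        B.act (permOf S (n - 1 - a + 1 + 1))
          (B.comp (show (a : ℕ) + 1 + (n - 1 - a + 1) = n + 1 by omega) 0
            (treeMap hP f s t (a + 1) (basisCov hP c))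
            (treeMap hP f s t (n - 1 - a + 1) (basisCov hP c'))) := by
  refine (d_famOf_iff hP (par_treeMap hP f hst) (treeMap_zero hP f s t)).1 (fun n => ?_) n x
  rw [famOf_treeMap]
  exact d_extTotal (hst.hadamard P) (par_famOf hP (par_genMap hP f))
    (isSymm_famOf hP (act_genMap hP f)) (famOf_zero hP rfl) (d_famOf_genMap hP f) n

/-- Turns the abstract construction into the sum of the maps ι_T ∘ μ_T^*, by expanding each tree
over the basis decorations of its vertices. -/
theorem treeMap_eq_sum (n : ℕ) (x : Module.Dual k (P.obj n)) :
    treeMap hP f s t n x = ∑ T : RTree n, ∑ D : T.planar.Dec P.Idx,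
      muDual hP T.planar x D •
        sgn k ((T.planar.count (fun _ b => ZMod.val b.1) D).choose 2 : ℕ) •
        T.planar.contract B.toGrOperad (fun m c => f.app (vertexXi hP m c)) s t D := by
  change contr x (treeElement hP f s t n) = _
  rw [treeElement, extTotal, map_sum]
  refine Finset.sum_congr rfl fun T _ => ?_
  have := T.planar.contr_extValue hP (e := s) (l := t)
    (fun m c => hasParity_basisCov hP (par_genMap hP f) c)
    (by rw [HasParity, hst.par_s, sgn_one, neg_one_smul])
    (by rw [HasParity, hst.par_t, sgn_zero, one_smul]) x
  refine this.trans ?_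
  rw [genMap_basisCov]
  rfl

omit hst in
theorem treeMap_zero_one (n : ℕ) (x : Module.Dual k (P.obj n)) :
    treeMap hP f 0 B.one n x = genMap hP f n x := by
  change contr x (treeElement hP f 0 B.one n) = _
  rw [treeElement, TensorProduct.zero_tmul]
  refine (congrArg (contr x) (congrFun (extTotal_zero_one (H := hadamardD B P)
    (par_famOf hP (par_genMap hP f)) (isSymm_famOf hP (act_genMap hP f)) (famOf_zero hP rfl))
    n)).trans (contr_famOf hP x)

omit hst in
-- Naturality in B is visible on the explicit sum, since maps of operads preserve compositions along
-- decorated trees.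
theorem OperadHom.map_treeMap {C : DiffOperad.{u, u'} k} (g : OperadHom B C)
    (f' : OperadHom (Cobar hP) C) (hf : ∀ n (x : (Cobar hP).obj n), g.app (f.app x) = f'.app x)
    {s t : B.obj 0} (hst : B.IsHodgePair s t) (hst' : C.IsHodgePair (g.app s) (g.app t)) (n : ℕ)
    (x : Module.Dual k (P.obj n)) :
    g.app (treeMap hP f s t n x) = treeMap hP f' (g.app s) (g.app t) n x := by
  rw [treeMap_eq_sum hP f hst, treeMap_eq_sum hP f' hst']
  simp only [map_sum, map_smul, OperadHom.map_treeContract, hf]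

end

/-- The values of the splitting on the generators. -/
def kappaGen : ∀ n, CobarGen P n → (bv (Cobar hP)).obj n
  | _, .xi x => ⟨treeMap hP (bvHom _) (bvS _) (bvT _) _ x,
      isTrunc_treeMap hP (bvHom _) (isHodgePair_bv _) _ x⟩

theorem bvIncl_kappaGen {n : ℕ} (x : Module.Dual k (P.obj (n + 1))) :
    bvIncl (Cobar hP) (kappaGen hP _ (.xi x))
      = treeMap hP (bvHom (Cobar hP)) (bvS (Cobar hP)) (bvT (Cobar hP)) (n + 1) x := rfl

theorem bvIncl_ext (O : DiffOperad.{u, w} k) {n : ℕ} {x y : (bv O).obj n}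
    (h : bvIncl O x = bvIncl O y) : x = y := Subtype.ext h

theorem bvIncl_par (O : DiffOperad.{u, w} k) {n : ℕ} (x : (bv O).obj n) :
    bvIncl O ((bv O).par x) = (BV O).par (bvIncl O x) := rfl

theorem bvIncl_act (O : DiffOperad.{u, w} k) {n : ℕ} (σ : Equiv.Perm (Fin (n + 1)))
    (x : (bv O).obj n) : bvIncl O ((bv O).act σ x) = (BV O).act σ (bvIncl O x) := rfl

theorem bvIncl_comp (O : DiffOperad.{u, w} k) {m n l : ℕ} (h : m + n = l) (i : Fin (m + 1))
    (x : (bv O).obj m) (y : (bv O).obj n) :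
    bvIncl O ((bv O).comp h i x y) = (BV O).comp h i (bvIncl O x) (bvIncl O y) := rfl

theorem bvIncl_d (O : DiffOperad.{u, w} k) {n : ℕ} (x : (bv O).obj n) :
    bvIncl O ((bv O).d x) = (BV O).d (bvIncl O x) := rfl

theorem kappaGen_rel {n : ℕ} {a b : OpTerm k (CobarGen P) n} (h : CobarRel P n a b) :
    a.eval (bv (Cobar hP)).toGrOperad (kappaGen hP)
      = b.eval (bv (Cobar hP)).toGrOperad (kappaGen hP) := by
  refine bvIncl_ext _ ?_
  cases h with
  | add x y =>
      simp only [OpTerm.eval]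
      rw [map_add, bvIncl_kappaGen, bvIncl_kappaGen, bvIncl_kappaGen, map_add]
  | smul c x =>
      simp only [OpTerm.eval]
      rw [map_smul, bvIncl_kappaGen, bvIncl_kappaGen, map_smul]
  | par x =>
      simp only [OpTerm.eval]
      rw [bvIncl_par, map_smul, bvIncl_kappaGen, bvIncl_kappaGen,
        par_treeMap hP _ (isHodgePair_bv _), neg_one_smul]
  | act σ x =>
      simp only [OpTerm.eval]
      rw [bvIncl_act, bvIncl_kappaGen, bvIncl_kappaGen, act_treeMap hP _ (isHodgePair_bv _)]

omit [CharZero k] in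
theorem lift_act_comp_xi (T : GrOperad.{u, v} k) (φ : ∀ n : ℕ, CobarGen P n → T.obj n)
    (hR : ∀ {n : ℕ} {a b : OpTerm k (CobarGen P) n}, CobarRel P n a b → a.eval T φ = b.eval T φ)
    {m n l : ℕ} (h : m + 1 + (n + 1) = l) (i : Fin (m + 1 + 1)) (σ : Equiv.Perm (Fin (l + 1)))
    (x : Module.Dual k (P.obj (m + 1))) (y : Module.Dual k (P.obj (n + 1))) :
    Presented.lift T φ hR (Presented.act σ (Presented.comp h i (cobarXi P x) (cobarXi P y)))
      = T.act σ (T.comp h i (φ _ (.xi x)) (φ _ (.xi y))) := rfl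

omit [CharZero k] in
theorem lift_cobarXi (T : GrOperad.{u, v} k) (φ : ∀ n : ℕ, CobarGen P n → T.obj n)
    (hR : ∀ {n : ℕ} {a b : OpTerm k (CobarGen P) n}, CobarRel P n a b → a.eval T φ = b.eval T φ)
    {n : ℕ} (x : Module.Dual k (P.obj (n + 1))) :
    Presented.lift T φ hR (cobarXi P x) = φ _ (.xi x) := rfl

/-- Compatibility with the differential has to be checked on generators only, where it is
`d_treeMap`. -/
theorem kappaGen_d {n : ℕ} (g : CobarGen P n) :
    Presented.lift (bv (Cobar hP)).toGrOperad (kappaGen hP) (kappaGen_rel hP) (cobarDelta hP n g)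
      = (bv (Cobar hP)).d (kappaGen hP n g) := by
  refine bvIncl_ext _ ?_
  cases g with
  | xi x =>
      rw [bvIncl_d, bvIncl_kappaGen, d_treeMap hP _ (isHodgePair_bv _), cobarDelta, cobarD]
      simp only [map_add, map_sum, cobarQuad, map_smul, lift_cobarXi, lift_act_comp_xi,
        bvIncl_act, bvIncl_comp, bvIncl_kappaGen]

/-- The splitting of the projection of the truncated BV-resolution to the cobar construction. -/
def kappa : OperadHom (Cobar hP) (bv (Cobar hP)) :=
  Presented.liftHom (cobarDelta hP) (cobarDelta_rel hP) (bv (Cobar hP)) (kappaGen hP)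
    (kappaGen_rel hP) (kappaGen_d hP)

theorem kappa_xi {n : ℕ} (x : Module.Dual k (P.obj (n + 1))) :
    bvIncl _ ((kappa hP).app (Cobar.xi hP x))
      = ∑ T : RTree (n + 1), iotaTree hP T.planar (muDual hP T.planar x) :=
  (bvIncl_kappaGen hP x).trans (treeMap_eq_sum hP (bvHom (Cobar hP)) (isHodgePair_bv _) _ x)

/-- By naturality the augmentation yields the tree sum for the pair (0, 1), that is the contribution
ξ(x) of the corolla. -/
theorem bvAug_kappaGen {n : ℕ} (x : Module.Dual k (P.obj (n + 1))) :
    (bvAug (Cobar hP)).app (bvIncl _ (kappaGen hP _ (.xi x))) = Cobar.xi hP x := by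
  let f : OperadHom (Cobar hP) (Cobar hP) :=
    ⟨LinearMap.id, fun _ => rfl, fun _ _ => rfl, fun _ _ _ _ => rfl, rfl, fun _ => rfl⟩
  rw [bvIncl_kappaGen]
  have h := OperadHom.map_treeMap hP (bvHom (Cobar hP)) (bvAug (Cobar hP)) f (fun n x => rfl)
    (isHodgePair_bv (Cobar hP)) (Cobar hP).isHodgePair_zero_one _ x
  exact h.trans (treeMap_zero_one hP f _ x)

/-- Extends `bvAug_kappaGen` to all formal expressions. The unit of the truncated operad is `t`,
which the augmentation takes to the unit. -/
theorem bvAug_eval {n : ℕ} (a : OpTerm k (CobarGen P) n) :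
    (bvAug (Cobar hP)).app (bvIncl _ (a.eval (bv (Cobar hP)).toGrOperad (kappaGen hP)))
      = Presented.mk a := by
  induction a with
  | gen g =>
      cases g with
      | xi y => exact bvAug_kappaGen hP y
  | one => rfl
  | zero => rfl
  | add a b iha ihb =>
      rw [OpTerm.eval, map_add, map_add, iha, ihb]
      rfl
  | smul c a ih =>
      rw [OpTerm.eval, map_smul, map_smul, ih]
      rfl
  | par a ih => exact ((bvAug (Cobar hP)).map_par _).trans (congrArg _ ih)
  | act σ a ih => exact ((bvAug (Cobar hP)).map_act _ _).trans (congrArg _ ih)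
  | comp h i a b iha ihb =>
      exact ((bvAug (Cobar hP)).map_comp _ _ _ _).trans
        (congrArg₂ (fun x y => (Cobar hP).comp h i x y) iha ihb)

theorem bvProj_kappa {n : ℕ} (x : (Cobar hP).obj n) :
    bvProj (Cobar hP) ((kappa hP).app x) = x :=
  Presented.ind (Q := fun x => bvProj (Cobar hP) ((kappa hP).app x) = x)
    (fun a => bvAug_eval hP a) x

end
end

noncomputable section

/-! ### Minimal models -/

section
variable {k : Type u} [Field k]

theorem map_insVec {M : Type v} {N : Type w} {l m n : ℕ} (h : m + n = l) (i : Fin (m + 1))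
    (f : M → N) (v : Fin (l + 1) → M) (x : M) (j : Fin (m + 1)) :
    f (insVec h i v x j) = insVec h i (fun a => f (v a)) (f x) j := by
  unfold insVec; split_ifs <;> rfl

variable {M : Type v} [AddCommGroup M] [Module k M]

theorem insertMap_zero_right {l m n : ℕ} (h : m + n = l) (i : Fin (m + 1))
    (f : MultilinearMap k (fun _ : Fin (m + 1) => M) M) :
    insertMap h i f (0 : MultilinearMap k (fun _ : Fin (n + 1) => M) M) = 0 := by
  ext v
  rw [insertMap_apply]
  exact f.map_coord_zero i (by simp [insVec])

theorem insVec_add_zero {M : Type v} {n : ℕ} (i : Fin (n + 1)) (v : Fin (n + 1) → M) (x : M) :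
    insVec (Nat.add_zero n) i v x = Function.update v i x := by
  funext j
  by_cases hj : j = i
  · subst hj; simp [insVec]
  · rw [Function.update_of_ne hj]
    simp only [insVec, hj, if_false]
    congr 1
    ext
    simp [outerPos]

theorem innerPos_add_zero {n : ℕ} (i : Fin (n + 1)) (a : Fin 1) :
    innerPos (Nat.add_zero n) i a = i := by
  ext; simp [innerPos]

theorem parityProj_endLin [CharZero k] {ε t : M →ₗ[k] M} (hε : ∀ x, ε (ε x) = x)
    (ht : ∀ x, ε (t x) = t (ε x)) :
    parityProj (endPar ε 1) 0 (endLin t) = endLin t ∧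
      parityProj (endPar ε 1) 1 (endLin t) = 0 := by
  have h : HasParity (endPar ε 1) 0 (endLin t) := by
    refine MultilinearMap.ext fun v => ?_
    simp [endPar_apply, endLin_apply, ht, hε]
  exact ⟨by rw [parityProj_of_hasParity _ h]; simp, by rw [parityProj_of_hasParity _ h]; simp⟩

/-- The only input of `a` has nothing to its left, so neither parity part of `g` acquires a sign. -/
theorem endComp_endLin_left [CharZero k] (ε a : M →ₗ[k] M) {n : ℕ}
    (g : MultilinearMap k (fun _ : Fin (n + 1) => M) M) (v : Fin (n + 1) → M) :
    endComp (Nat.zero_add n) 0 ε (endLin a) g v = a (g v) := by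
  have e : (endLin a).compLinearMap (fun j : Fin 1 => if j < 0 then ε else LinearMap.id)
      = endLin a := by
    ext v; simp [endLin_apply]
  have hv : (fun a => v (innerPos (Nat.zero_add n) 0 a)) = v :=
    funext fun a => congrArg v (innerPos_zero a)
  simp only [endComp, LinearMap.mk₂_apply, add_apply]
  erw [e]
  simp only [insertMap_apply, hv]
  refine (map_add a _ _).symm.trans (congrArg a ?_)
  exact congrArg (fun G : MultilinearMap k (fun _ : Fin (n + 1) => M) M => G v)
    (parityProj_add (endPar ε (n + 1)) g)

theorem endComp_endLin_right [CharZero k] {ε t : M →ₗ[k] M} (hε : ∀ x, ε (ε x) = x)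
    (ht : ∀ x, ε (t x) = t (ε x)) {n : ℕ} (i : Fin (n + 1))
    (f : MultilinearMap k (fun _ : Fin (n + 1) => M) M) (v : Fin (n + 1) → M) :
    endComp (Nat.add_zero n) i ε f (endLin t) v = f (Function.update v i (t (v i))) := by
  simp only [endComp, LinearMap.mk₂_apply, add_apply]
  erw [(parityProj_endLin hε ht).1, (parityProj_endLin hε ht).2, insertMap_zero_right]
  simp only [insertMap_apply, insVec_add_zero, innerPos_add_zero, zero_apply, add_zero]
  rfl

end

/-! ### Operations on the homology as operations on V -/

section
variable {k : Type u} [Field k] [CharZero k] {V : DGSpace.{u, v} k} (H : Hodge V)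
  (hc : H.IsCanonical)

namespace Hodge

omit [CharZero k] in
theorem toHomology_par (x : V.carrier) :
    H.toHomology hc (V.par x) = (homology V).par (H.toHomology hc x) := by
  refine congrArg (Submodule.mkQ _) (Subtype.ext ?_)
  exact (H.par_t x).symm

omit [CharZero k] in
theorem ofHomology_par (x : (homology V).carrier) :
    H.ofHomology hc ((homology V).par x) = V.par (H.ofHomology hc x) := by
  obtain ⟨x, rfl⟩ := Submodule.Quotient.mk_surjective _ x
  exact (H.par_t x.1).symm

omit [CharZero k] in
theorem d_ofHomology (x : (homology V).carrier) : V.d (H.ofHomology hc x) = 0 := by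
  obtain ⟨x, rfl⟩ := Submodule.Quotient.mk_surjective _ x
  exact hc x.1

omit [CharZero k] in
theorem toHomology_d (x : V.carrier) : H.toHomology hc (V.d x) = 0 := by
  have h : LinearMap.codRestrict (LinearMap.ker V.d) H.t hc (V.d x) = 0 :=
    Subtype.ext ((H.d_t x).symm.trans (hc x))
  exact (congrArg (Submodule.mkQ _) h).trans (map_zero _)

/-- The restriction of operations on `V` to `H(V)`. -/
def restrEnd {n : ℕ} : (endOperad V).obj n →ₗ[k] (endOperad (homology V)).obj n where
  toFun φ := ((H.toHomology hc).compMultilinearMap φ).compLinearMap fun _ => H.ofHomology hc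
  map_add' f g := by
    refine MultilinearMap.ext fun v => ?_
    exact map_add (H.toHomology hc) _ _
  map_smul' c f := by
    refine MultilinearMap.ext fun v => ?_
    exact map_smul (H.toHomology hc) _ _

theorem restrEnd_inclEnd {n : ℕ} (φ : (endOperad (homology V)).obj n) :
    H.restrEnd hc (H.inclEnd hc φ) = φ := by
  refine MultilinearMap.ext fun v => ?_
  refine (H.toHomology_ofHomology hc _).trans ?_
  exact congrArg (DFunLike.coe (F := MultilinearMap k (fun _ : Fin (n + 1) => _) _) φ)
    (funext fun j => H.toHomology_ofHomology hc (v j))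

theorem inclEnd_injective {n : ℕ} : Function.Injective (H.inclEnd hc (n := n)) :=
  Function.LeftInverse.injective (H.restrEnd_inclEnd hc)

theorem inclEnd_par {n : ℕ} (φ : (endOperad (homology V)).obj n) :
    H.inclEnd hc ((endOperad (homology V)).par φ) = (endOperad V).par (H.inclEnd hc φ) := by
  refine MultilinearMap.ext fun v => ?_
  refine (H.ofHomology_par hc _).trans (congrArg V.par (congrArg (H.ofHomology hc) ?_))
  exact congrArg (DFunLike.coe (F := MultilinearMap k (fun _ : Fin (n + 1) => _) _) φ)
    (funext fun j => (H.toHomology_par hc (v j)).symm)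

theorem inclEnd_act {n : ℕ} (σ : Equiv.Perm (Fin (n + 1))) (φ : (endOperad (homology V)).obj n) :
    H.inclEnd hc ((endOperad (homology V)).act σ φ) = (endOperad V).act σ (H.inclEnd hc φ) := by
  refine multilinear_ext_parity V.par V.par_par fun p v hv => ?_
  have hw : ∀ j, HasParity (homology V).par (p j) (H.toHomology hc (v j)) := fun j => by
    have := hv j
    unfold HasParity at this ⊢
    rw [← H.toHomology_par, this, map_smul]
  refine (congrArg (H.ofHomology hc) (endAct_apply (homology V).par σ φ hw)).trans ?_
  rw [map_smul]
  exact (endAct_apply V.par σ (H.inclEnd hc φ) hv).symm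

/-- Along the edge H(V) → V → H(V) is the identity. The Koszul signs agree because V → H(V)
preserves parity. -/
theorem inclEnd_comp {m n l : ℕ} (h : m + n = l) (i : Fin (m + 1))
    (φ : (endOperad (homology V)).obj m) (ψ : (endOperad (homology V)).obj n) :
    H.inclEnd hc ((endOperad (homology V)).comp h i φ ψ)
      = (endOperad V).comp h i (H.inclEnd hc φ) (H.inclEnd hc ψ) := by
  refine parity_induction (endPar (homology V).par (n + 1))
    (endPar_endPar (homology V).par (homology V).par_par)
    (Q := fun ψ => H.inclEnd hc ((endOperad (homology V)).comp h i φ ψ)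
      = (endOperad V).comp h i (H.inclEnd hc φ) (H.inclEnd hc ψ))
    (fun x y hx hy => ?_) (fun q ψ hψ => ?_) ψ
  · refine (congrArg (H.inclEnd hc) (map_add ((endOperad (homology V)).comp h i φ) x y)).trans ?_
    refine (map_add (H.inclEnd hc) _ _).trans ((congrArg₂ (· + ·) hx hy).trans ?_)
    refine (map_add ((endOperad V).comp h i (H.inclEnd hc φ)) _ _).symm.trans ?_
    exact congrArg _ (map_add (H.inclEnd hc) x y).symm
  · refine multilinear_ext_parity V.par V.par_par fun p v hv => ?_
    have hw : ∀ j, HasParity (homology V).par (p j) (H.toHomology hc (v j)) := fun j => by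
      have := hv j
      unfold HasParity at this ⊢
      rw [← H.toHomology_par, this, map_smul]
    have hψ' : HasParity (endPar V.par (n + 1)) q (H.inclEnd hc ψ) := by
      refine (H.inclEnd_par hc ψ).symm.trans ?_
      exact (congrArg (H.inclEnd hc) hψ).trans (map_smul _ _ _)
    refine (congrArg (H.ofHomology hc) (endComp_apply h i (homology V).par φ hψ hw)).trans ?_
    rw [map_smul]
    refine Eq.trans ?_ (endComp_apply h i V.par (H.inclEnd hc φ) hψ' hv).symm
    refine congrArg (sgn k _ • ·) ?_
    refine congrArg (H.ofHomology hc) ?_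
    refine congrArg (DFunLike.coe (F := MultilinearMap k (fun _ : Fin (m + 1) => _) _) φ) ?_
    funext j
    rw [map_insVec h i (H.toHomology hc)]
    refine congrArg (fun x => insVec h i _ x j) ?_
    exact (H.toHomology_ofHomology hc _).symm

/-- The inclusion is not unital; its image of the unit is the image of the unit `t` of the truncated
BV-resolution. -/
theorem inclEnd_one : H.inclEnd hc (endOperad (homology V)).one = endLin H.t :=
  MultilinearMap.ext fun v => H.ofHomology_toHomology hc (v 0)

/-- Operations that do not change under composition with `t` come from `H(V)`. -/
theorem inclEnd_restrEnd {n : ℕ} {φ : (endOperad V).obj n}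
    (h₀ : (endOperad V).comp (Nat.zero_add n) 0 (endLin H.t) φ = φ)
    (h₁ : ∀ i, (endOperad V).comp (Nat.add_zero n) i φ (endLin H.t) = φ) :
    H.inclEnd hc (H.restrEnd hc φ) = φ := by
  let F : MultilinearMap k (fun _ : Fin (n + 1) => V.carrier) V.carrier := φ
  have h0 : ∀ v, H.t (F v) = F v := fun v =>
    (endComp_endLin_left V.par H.t F v).symm.trans (congrArg (fun G :
      MultilinearMap k (fun _ : Fin (n + 1) => V.carrier) V.carrier => G v) h₀)
  have h1 : ∀ i v, F (Function.update v i (H.t (v i))) = F v := fun i v =>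
    (endComp_endLin_right V.par_par H.par_t i F v).symm.trans (congrArg (fun G :
      MultilinearMap k (fun _ : Fin (n + 1) => V.carrier) V.carrier => G v) (h₁ i))
  -- Invariance at single inputs is extended to all inputs at once by adding them one at a time.
  have h2 : ∀ (s : Finset (Fin (n + 1))) v, F (fun j => if j ∈ s then H.t (v j) else v j) = F v := by
    intro s
    induction s using Finset.induction_on with
    | empty => intro v; simp
    | insert i s hi ih =>
      intro v
      rw [← ih v, ← h1 i (fun j => if j ∈ s then H.t (v j) else v j)]
      congr 1
      funext j
      by_cases hj : j = i
      · subst hj; simp [hi]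
      · simp [hj]
  refine MultilinearMap.ext fun v => ?_
  refine (H.ofHomology_toHomology hc _).trans ?_
  have e : (fun j => H.ofHomology hc (H.toHomology hc (v j))) = fun j => H.t (v j) :=
    funext fun j => H.ofHomology_toHomology hc (v j)
  refine (congrArg (fun w => H.t (F w)) e).trans ((h0 _).trans ?_)
  simpa using h2 Finset.univ v

/-- H(V) → V has values in the cycles and V → H(V) kills the boundaries, so every term of the
bracket with d vanishes. -/
theorem d_inclEnd {n : ℕ} (φ : (endOperad (homology V)).obj n) :
    (endOperad V).d (H.inclEnd hc φ) = 0 := by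
  refine ((endGr V).bracket_apply (endLin V.d) (H.inclEnd hc φ)).trans ?_
  have h0 : (endGr V).comp (Nat.zero_add n) 0 (endLin V.d) (H.inclEnd hc φ) = 0 := by
    refine MultilinearMap.ext fun v => ?_
    exact (endComp_endLin_left V.par V.d _ v).trans (H.d_ofHomology hc _)
  have h1 : ∀ i : Fin (n + 1),
      (endGr V).comp (Nat.add_zero n) i ((endGr V).par (H.inclEnd hc φ)) (endLin V.d) = 0 := by
    intro i
    refine multilinear_ext_parity V.par V.par_par fun p v hv => ?_
    have hd : HasParity (endPar V.par 1) 1 (endLin V.d) := by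
      rw [HasParity, par_endLin_d, sgn_one, neg_one_smul]
    refine (endComp_apply (Nat.add_zero n) i V.par _ hd hv).trans ?_
    refine (congrArg (sgn k _ • ·) ?_).trans (smul_zero _)
    have e := H.inclEnd_par hc φ
    refine (congrArg (fun G : MultilinearMap k (fun _ : Fin (n + 1) => V.carrier) V.carrier =>
      G _) e.symm).trans ?_
    refine (congrArg (H.ofHomology hc) ?_).trans (map_zero _)
    refine MultilinearMap.map_coord_zero _ i ?_
    rw [insVec, if_pos rfl]
    exact H.toHomology_d hc _
  exact (congrArg₂ (· - ·) h0 (Finset.sum_eq_zero fun i _ => h1 i)).trans (sub_zero _)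

end Hodge

omit [CharZero k] in
theorem GrOperad.bracket_zero (T : GrOperad.{u, w} k) (n : ℕ) :
    T.bracket (0 : T.obj 0) (n := n) = 0 := by
  ext x
  simp [GrOperad.bracket]

theorem d_endOperad_homology {n : ℕ} (φ : (endOperad (homology V)).obj n) :
    (endOperad (homology V)).d φ = 0 := by
  have e : endLin (homology V).d = 0 := map_zero endLin
  refine (congrArg (fun δ => (endGr (homology V)).bracket δ φ) e).trans ?_
  exact congrArg (· φ) ((endGr (homology V)).bracket_zero n)

/-! ### Existence and uniqueness of the minimal model -/

variable {O : DiffOperad.{u, w} k} (f : OperadHom O (endOperad V))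

theorem hodgeMap_bvT : (hodgeMap f H).app (bvT O) = endLin H.t := rfl

theorem inclEnd_restrEnd_hodgeMap {n : ℕ} (x : (bv O).obj n) :
    H.inclEnd hc (H.restrEnd hc ((hodgeMap f H).app (bvIncl O x)))
      = (hodgeMap f H).app (bvIncl O x) := by
  obtain ⟨x, h₀, h₁⟩ := x
  refine H.inclEnd_restrEnd hc ?_ fun i => ?_
  · rw [← hodgeMap_bvT H f, ← OperadHom.map_comp]
    exact congrArg _ h₀
  · rw [← hodgeMap_bvT H f, ← OperadHom.map_comp]
    exact congrArg _ (h₁ i)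

/-- The minimal model of an algebra with a canonical Hodge decomposition. -/
def minimalModel (κ : OperadHom O (bv O)) : OperadHom O (endOperad (homology V)) where
  app := H.restrEnd hc ∘ₗ (hodgeMap f H).app ∘ₗ bvIncl O ∘ₗ κ.app
  map_par x := by
    refine H.inclEnd_injective hc ?_
    simp only [LinearMap.comp_apply]
    rw [H.inclEnd_par, inclEnd_restrEnd_hodgeMap, inclEnd_restrEnd_hodgeMap, κ.map_par,
      bvIncl_par, OperadHom.map_par]
  map_act σ x := by
    refine H.inclEnd_injective hc ?_
    simp only [LinearMap.comp_apply]
    rw [H.inclEnd_act, inclEnd_restrEnd_hodgeMap, inclEnd_restrEnd_hodgeMap, κ.map_act,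
      bvIncl_act, OperadHom.map_act]
  map_comp h i x y := by
    refine H.inclEnd_injective hc ?_
    simp only [LinearMap.comp_apply]
    rw [H.inclEnd_comp, inclEnd_restrEnd_hodgeMap, inclEnd_restrEnd_hodgeMap,
      inclEnd_restrEnd_hodgeMap, κ.map_comp, bvIncl_comp, OperadHom.map_comp]
  -- κ takes the unit to `t`, which is the image of the unit of the endomorphism operad of H(V).
  map_one := by
    refine H.inclEnd_injective hc ?_
    simp only [LinearMap.comp_apply]
    rw [H.inclEnd_one, inclEnd_restrEnd_hodgeMap, κ.map_one]
    rfl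
  map_d x := by
    refine H.inclEnd_injective hc ?_
    simp only [LinearMap.comp_apply]
    -- Operations on H(V) have zero differential, and operations on V that come from H(V) are
    -- closed.
    rw [d_endOperad_homology, map_zero, inclEnd_restrEnd_hodgeMap, κ.map_d, bvIncl_d,
      OperadHom.map_d, ← inclEnd_restrEnd_hodgeMap H hc f, H.d_inclEnd]

theorem isMinimalModel_minimalModel (κ : OperadHom O (bv O)) :
    IsMinimalModel κ f H hc (minimalModel H hc f κ) :=
  fun _ x => inclEnd_restrEnd_hodgeMap H hc f (κ.app x)

omit [CharZero k] in
theorem OperadHom.ext_app {A : DiffOperad.{u, v} k} {B : DiffOperad.{u, w} k} {f g : OperadHom A B}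
    (h : ∀ (n : ℕ) (x : A.obj n), f.app x = g.app x) : f = g := by
  obtain ⟨f, _⟩ := f
  obtain ⟨g, _⟩ := g
  have : @f = @g := funext fun n => LinearMap.ext (h n)
  subst this
  rfl

/-- Injectivity of `Hodge.inclEnd` gives uniqueness from the minimal model property alone. -/
theorem IsMinimalModel.eq {κ : OperadHom O (bv O)} {f : OperadHom O (endOperad V)} {H : Hodge V}
    {hc : H.IsCanonical} {g g' : OperadHom O (endOperad (homology V))}
    (h : IsMinimalModel κ f H hc g) (h' : IsMinimalModel κ f H hc g') : g = g' :=
  OperadHom.ext_app fun n x => H.inclEnd_injective hc ((h n x).trans (h' n x).symm)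

end

end

theorem theorem3p1 {k : Type u} [Field k] [CharZero k] (P : DiffOperad.{u, w} k)
    (hP : P.Admissible) :
    ∃ κ : OperadHom (Cobar hP) (bv (Cobar hP)),
      (∀ (n : ℕ) (x : (Cobar hP).obj n), bvProj (Cobar hP) (κ.app x) = x) ∧
      ∀ (V : DGSpace.{u, v} k) (f : OperadHom (Cobar hP) (endOperad V)) (H : Hodge V)
        (hc : H.IsCanonical),
        ∃! g : OperadHom (Cobar hP) (endOperad (homology V)),
          IsMinimalModel κ f H hc g ∧
          ∀ (n : ℕ) (x : Module.Dual k (P.obj (n + 1))),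
            H.inclEnd hc (g.app (Cobar.xi hP x))
              = ∑ T : RTree (n + 1),
                  (hodgeMap f H).app (iotaTree hP T.planar (muDual hP T.planar x)) := by
  refine ⟨kappa hP, fun n x => bvProj_kappa hP x, fun V f H hc => ?_⟩
  refine ⟨minimalModel H hc f (kappa hP), ⟨isMinimalModel_minimalModel H hc f _, fun n x => ?_⟩,
    fun g hg => hg.1.eq (isMinimalModel_minimalModel H hc f _)⟩
  rw [isMinimalModel_minimalModel H hc f (kappa hP), kappa_xi, map_sum]
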